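/- \textbf{Setting.} The disk is the closed upper half plane together with the point at infinity. A \emph{PBDTP network} $\mathcal N$ is a finite plane graph in the disk with straight edges and without components isolated from the boundary. It has boundary vertices $b_1,\dots,b_n$ on the real axis, labelled clockwise (that is, from right to left), each of degree one and joined to an internal bivalent white vertex; its internal vertices lie strictly inside the disk, are bivalent or trivalent, and are colored black or white; each internal face (one not adjacent to the boundary of the disk) has trivalent vertices of both colors. Edges carry positive weights $w_e$; reversing an edge replaces its weight by the reciprocal. A \emph{perfect orientation} $\mathcal O$ directs the edges so that each white internal vertex has exactly one incoming edge and each black internal vertex exactly one outgoing edge; its \emph{base} $I\subset[n]$ is the set of labels of the boundary sources, $\bar I=[n]\setminus I$ that of the boundary sinks. A \emph{gauge ray direction} $\mathfrak l$ is a direction pointing into the disk, not parallel to any internal edge, such that no ray $\mathfrak l_i$ in direction $\mathfrak l$ from a boundary vertex $b_i$ contains an internal vertex. For vectors $a,b$ let $s(a,b)\in\{1,0,-1\}$ be the sign of $\det(a,b)$. For consecutive edges $e,f$ put $\mathrm{wind}(e,f)=\pm1$ if $s(e,f)=s(e,\mathfrak l)=s(\mathfrak l,f)=\pm1$ and $\mathrm{wind}(e,f)=0$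 otherwise. Let $\mathrm{int}_{\mathcal O}(e)$ be the number of rays $\mathfrak l_i$, $i\in I$, that meet $e$. Given vectors $F_j\in\mathbb R^n$, $j\in\bar I$, a \emph{system of edge vectors} on $(\mathcal N,\mathcal O,\mathfrak l)$ with boundary vectors $F_j$ is a family $(E_e)_e$ in $\mathbb R^n$ with $$E_e=\sum_{f}(-1)^{\mathrm{int}_{\mathcal O}(e)+\mathrm{wind}(e,f)}\,w_e\,E_f$$ for every edge $e$ ending at an internal vertex $V$, where $f$ runs over the edges starting at $V$, and with $E_e=(-1)^{\mathrm{int}_{\mathcal O}(e)}w_eF_j$ for the edge $e$ ending at a boundary sink $b_j$. It is \emph{standard} if $F_j=E[j]$, the $j$-th vector of the canonical basis, for all $j\in\bar I$. A \emph{conservative flow} is a set of edges, none incident to a boundary vertex, such that at each internal vertex as many of its edges arrive as leave; a \emph{flow} from $b_i$ to $b_j$ is a set of edges with the same balance at internal vertices whose only edges at boundary vertices are those at $b_i$ and $b_j$; the weight of a set of edges is the product of their weights. For $i\in I$ the \emph{boundary measurement row} $A_{\mathcal O}[i]\in\mathbb R^n$ has entry $\delta_{ij}$ at $j\in I$ and,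 at $j\in\bar I$, the entry $$(-1)^{\#\{l\in I:\ l\text{ strictly between } i \text{ and } j\}}\ \frac{\sum_{F:\,b_i\to b_j}w(F)}{\sum_{C}w(C)},$$ with sums over flows $F$ from $b_i$ to $b_j$ and over conservative flows $C$. The rows in increasing order of $i\in I$ form the boundary measurement matrix. The \emph{point represented by} $\mathcal N$ is its class modulo left multiplication by $GL_k^+$, $k=|I|$; a matrix in this class is a \emph{representative matrix}. \textbf{Theorem.} Let $\mathcal N$ be a PBDTP network, $\mathfrak l$ a gauge ray direction, $\mathcal O$ a perfect orientation with base $I$, $|I|=k$, and $A$ a representative matrix, with rows $A[r]$, $r\in[k]$, of the point represented by $(\mathcal N,\mathcal O)$. \textbf{(0)} For every perfect orientation and every choice of boundary vectors there is exactly one system of edge vectors. \textbf{(1)} Let $\hat{\mathcal O}$ be a perfect orientation of $\mathcal N$, with base $I'$, and let $E_e$, $\hat E_e$ be the standard systems of edge vectors on $(\mathcal N,\mathcal O,\mathfrak l)$ and $(\mathcal N,\hat{\mathcal O},\mathfrak l)$. For every edge $e$ there are real constants $\alpha_e\neq0$ and $c^r_e$, $r\in[k]$, with $$\hat E_e=\alpha_eE_e+\sum_{r=1}^kc_e^rA[r].$$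 \textbf{(2)} Let $\mathcal P_0$ be a non-self-intersecting directed path in $\mathcal O$ from a boundary source $b_{i_0}$ to a boundary sink $b_{j_0}$. Then reversing $\mathcal P_0$ gives a perfect orientation $\hat{\mathcal O}$, and the $j_0$-th entry $A^{i_0}_{j_0}$ of $A_{\mathcal O}[i_0]$ is non-zero. Let $E_e$ be the standard system on $(\mathcal N,\mathcal O,\mathfrak l)$ and $\tilde E_e$ the system on $(\mathcal N,\mathcal O,\mathfrak l)$ with boundary vectors $E[j]$ for $j\ne j_0$ and $E[j_0]-\frac1{A^{i_0}_{j_0}}A_{\mathcal O}[i_0]$ for $j=j_0$. Then each $\tilde E_e-E_e$ is a multiple of $A_{\mathcal O}[i_0]$, and the standard system on $(\mathcal N,\hat{\mathcal O},\mathfrak l)$ is $$\hat E_e=(-1)^{\epsilon(e)}\tilde E_e\quad(e\notin\mathcal P_0),\qquad \hat E_e=\frac{(-1)^{\epsilon(e)}}{w_e}\tilde E_e\quad(e\in\mathcal P_0).$$ Here $w_e$ and $\epsilon(e)$ refer to the initial orientation $\mathcal O$, and $\epsilon$ is defined as follows. The interior of the disk is divided into regions by $\mathcal P_0$, the ray $\mathfrak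 l_{i_0}$ oriented upwards and the ray $\mathfrak l_{j_0}$ oriented downwards, the two arcs of the boundary of the disk being oriented from $b_{j_0}$ to $b_{i_0}$. A region is marked $+$ if its boundary is oriented, i.e. the region lies on the same side of all curves bounding it, and $-$ otherwise. If $e\notin\mathcal P_0$, then $\epsilon(e)$ is $0$ or $1$ according as the starting vertex of $e$, shifted infinitesimally in the direction of $e$, lies in a $+$ or a $-$ region. If $e\in\mathcal P_0$, then $\epsilon(e)=\epsilon_1(e)+\epsilon_2(e)+\epsilon_3(e)$, where $\epsilon_1(e)$ is $0$ or $1$ according as the region to the left of $e$ near its end point is marked $+$ or $-$, $\epsilon_2(e)=\frac{1-s(e,\mathfrak l)}2$, and $\epsilon_3(e)=\mathrm{int}_{\mathcal O}(e)$. \textbf{(3)} Let $\mathcal Q_0$ be a simple directed cycle in $\mathcal O$. Then reversing $\mathcal Q_0$ gives a perfect orientation $\hat{\mathcal O}$, and if $E_e$ is the standard system on $(\mathcal N,\mathcal O,\mathfrak l)$, then the standard system on $(\mathcal N,\hat{\mathcal O},\mathfrak l)$ is $\hat E_e=(-1)^{\epsilon(e)}E_e$ for $e\notin\mathcal Q_0$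 and $\hat E_e=\frac{(-1)^{\epsilon(e)}}{w_e}E_e$ for $e\in\mathcal Q_0$, with $\epsilon$ as in (2), where now the region external to $\mathcal Q_0$ is marked $+$ and the internal one $-$. -/

import Mathlib

open scoped Topology

/-- The plane cross product (determinant) of two vectors. -/
def planeCross (a b : ℝ × ℝ) : ℝ := a.1 * b.2 - a.2 * b.1

/-- Counterclockwise rotation by a right angle: `rotLeft d` points to the left of `d`. -/
def rotLeft (d : ℝ × ℝ) : ℝ × ℝ := (-d.2, d.1)

/-- The open ray with origin `p` and direction `d`. -/
def openRay (p d : ℝ × ℝ) : Set (ℝ × ℝ) := {z | ∃ t : ℝ, 0 < t ∧ z = p + t • d}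

/-- `s(a, b)`: `1` if the ordered pair is positively oriented (counterclockwise), `-1` if it is
negatively oriented, `0` if the vectors are parallel. -/
noncomputable def orientSign (a b : ℝ × ℝ) : ℤ := ((SignType.sign (planeCross a b) : SignType) : ℤ)

open Classical in
/-- Local winding number of the ordered pair of vectors `(a, b)` with respect to the direction `ℓ`.
(Consecutive edges of a straight-line plane graph are never antiparallel.) -/
noncomputable def localWind (ℓ a b : ℝ × ℝ) : ℤ :=
  if orientSign a b = 1 ∧ orientSign a ℓ = 1 ∧ orientSign ℓ b = 1 then 1
  else if orientSign a b = -1 ∧ orientSign a ℓ = -1 ∧ orientSign ℓ b = -1 then -1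
  else 0

/-- The orientation obtained from `O` by reversing exactly the edges in `S`.
`O u v` means that the edge between `u` and `v` is directed from `u` to `v`. -/
def reorient {V : Type*} (O : V → V → Prop) (S : Set (Sym2 V)) (u v : V) : Prop :=
  (s(u, v) ∈ S ∧ O v u) ∨ (s(u, v) ∉ S ∧ O u v)

/-- A planar bicolored trivalent perfect graph in the disk with `n` boundary vertices and positive
edge weights.  The disk is the closed upper half plane (with its point at infinity), so that the
interval containing the boundary vertices lies on the real axis; going clockwise along the boundary
means going left on the real axis.  Edges are straight segments.  The graph is recorded without an
orientation; `weight u v` is the weight which the edge has when it is directed from `u` to `v`. -/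
structure PBDTPNetwork (V : Type*) (n : ℕ) where
  graph : SimpleGraph V
  pos : V → ℝ × ℝ
  bdry : Fin n → V
  white : V → Prop
  weight : V → V → ℝ
  pos_injective : Function.Injective pos
  bdry_on_axis : ∀ i, (pos (bdry i)).2 = 0
  bdry_clockwise : ∀ i j, i < j → (pos (bdry j)).1 < (pos (bdry i)).1
  internal_inside : ∀ v, v ∉ Set.range bdry → 0 < (pos v).2
  -- distinct edges meet at most in common end points
  planar : ∀ u v x y, graph.Adj u v → graph.Adj x y → s(u, v) ≠ s(x, y) →
    ∀ z ∈ segment ℝ (pos u) (pos v) ∩ segment ℝ (pos x) (pos y),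
      ∃ w, w ∈ s(u, v) ∧ w ∈ s(x, y) ∧ z = pos w
  -- no component is isolated from the boundary
  connected : ∀ v, ∃ i, graph.Reachable v (bdry i)
  -- internal vertices are bivalent or trivalent
  valency : ∀ v, v ∉ Set.range bdry →
    (graph.neighborSet v).ncard = 2 ∨ (graph.neighborSet v).ncard = 3
  -- a boundary vertex has one edge, and it leads to an internal bivalent white vertex
  bdry_edge : ∀ i, ∃ v, graph.neighborSet (bdry i) = {v} ∧ v ∉ Set.range bdry ∧
    (graph.neighborSet v).ncard = 2 ∧ white v
  -- an internal face (one whose closure avoids the boundary of the disk) has trivalent vertices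
  -- of both colors on its boundary
  faces : ∀ z ∈ {z : ℝ × ℝ | 0 < z.2} \
        {z | ∃ u v, graph.Adj u v ∧ z ∈ segment ℝ (pos u) (pos v)},
    ∀ C : Set (ℝ × ℝ), C = connectedComponentIn ({z : ℝ × ℝ | 0 < z.2} \
        {z | ∃ u v, graph.Adj u v ∧ z ∈ segment ℝ (pos u) (pos v)}) z →
      Disjoint (closure C) {z : ℝ × ℝ | z.2 = 0} →
        (∃ v, v ∉ Set.range bdry ∧ (graph.neighborSet v).ncard = 3 ∧ white v ∧
          pos v ∈ closure C) ∧
        (∃ v, v ∉ Set.range bdry ∧ (graph.neighborSet v).ncard = 3 ∧ ¬ white v ∧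
          pos v ∈ closure C)
  weight_pos : ∀ u v, graph.Adj u v → 0 < weight u v
  weight_symm : ∀ u v, graph.Adj u v → weight v u = (weight u v)⁻¹

namespace PBDTPNetwork

variable {V : Type*} {n : ℕ}

/-- `v` is an internal vertex. -/
def IsInternal (N : PBDTPNetwork V n) (v : V) : Prop := v ∉ Set.range N.bdry

/-- The vector of the edge directed from `u` to `v`. -/
def edgeDir (N : PBDTPNetwork V n) (u v : V) : ℝ × ℝ := N.pos v - N.pos u

/-- `O` is a perfect orientation compatible with the coloring: every edge gets exactly one
direction, a white internal vertex has exactly one incoming edge and a black internal vertex has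
exactly one outgoing edge. -/
structure IsPerfect (N : PBDTPNetwork V n) (O : V → V → Prop) : Prop where
  adj : ∀ u v, O u v → N.graph.Adj u v
  total : ∀ u v, N.graph.Adj u v → O u v ∨ O v u
  asymm : ∀ u v, O u v → ¬ O v u
  white : ∀ v, N.IsInternal v → N.white v → ∃! u, O u v
  black : ∀ v, N.IsInternal v → ¬ N.white v → ∃! u, O v u

/-- `ℓ` is a gauge ray direction. -/
structure IsGaugeDirection (N : PBDTPNetwork V n) (ℓ : ℝ × ℝ) : Prop where
  inside : 0 < ℓ.2
  not_parallel : ∀ u v, N.IsInternal u → N.IsInternal v → N.graph.Adj u v →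
    planeCross (N.edgeDir u v) ℓ ≠ 0
  avoids : ∀ i v, N.IsInternal v → N.pos v ∉ openRay (N.pos (N.bdry i)) ℓ

open Classical in
/-- The base of the orientation `O`: the labels of its boundary sources. -/
noncomputable def sources (N : PBDTPNetwork V n) (O : V → V → Prop) : Finset (Fin n) :=
  {i | ∃ v, O (N.bdry i) v}

open Classical in
/-- `int(e)`: the number of gauge rays starting at boundary sources of `O` which meet the edge
between `u` and `v`. -/
noncomputable def crossings (N : PBDTPNetwork V n) (ℓ : ℝ × ℝ) (O : V → V → Prop) (u v : V) : ℤ :=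
  (((N.sources O).filter fun i =>
    (openRay (N.pos (N.bdry i)) ℓ ∩ segment ℝ (N.pos u) (N.pos v)).Nonempty).card : ℤ)

/-- `wind(e, f)` for the consecutive edges `e = (u, v)` and `f = (v, x)`. -/
noncomputable def wind (N : PBDTPNetwork V n) (ℓ : ℝ × ℝ) (u v x : V) : ℤ :=
  localWind ℓ (N.edgeDir u v) (N.edgeDir v x)

open Classical in
/-- `E` is the system of edge vectors on `(N, O, ℓ)` with the vectors `F j` assigned to the boundary
sinks: it solves the linear relation at each internal vertex, and
`E_e = (-1)^{int(e)} w_e F_j` for the edge `e` at the boundary sink `j`. -/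
structure IsEdgeSystem [Fintype V] (N : PBDTPNetwork V n) (ℓ : ℝ × ℝ) (O : V → V → Prop)
    (F : Fin n → Fin n → ℝ) (E : Sym2 V → Fin n → ℝ) : Prop where
  internal : ∀ u v, O u v → N.IsInternal v →
    E s(u, v) = ∑ x : V, if O v x then
      ((-1 : ℝ) ^ (N.crossings ℓ O u v + N.wind ℓ u v x) * N.weight u v) • E s(v, x) else 0
  sink : ∀ u j, O u (N.bdry j) →
    E s(u, N.bdry j) = ((-1 : ℝ) ^ N.crossings ℓ O u (N.bdry j) * N.weight u (N.bdry j)) • F j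

/-- The vectors of the canonical basis, as boundary conditions. -/
def stdVec (n : ℕ) (j : Fin n) : Fin n → ℝ := Pi.single j 1

open Classical in
/-- At each internal vertex as many edges of `F` arrive as leave. -/
def Balanced (N : PBDTPNetwork V n) (F : Finset (V × V)) : Prop :=
  ∀ v, N.IsInternal v → (F.filter fun e => e.2 = v).card = (F.filter fun e => e.1 = v).card

/-- Conservative flows: balanced sets of directed edges without edges at the boundary. -/
def IsConservativeFlow (N : PBDTPNetwork V n) (O : V → V → Prop) (F : Finset (V × V)) : Prop :=
  (∀ e ∈ F, O e.1 e.2) ∧ N.Balanced F ∧ ∀ e ∈ F, N.IsInternal e.1 ∧ N.IsInternal e.2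

/-- Flows from the boundary source `i` to the boundary sink `j`: balanced sets of directed edges
whose edges at the boundary are the edge at `i` and the edge at `j`. -/
def IsFlow (N : PBDTPNetwork V n) (O : V → V → Prop) (i j : Fin n) (F : Finset (V × V)) : Prop :=
  (∀ e ∈ F, O e.1 e.2) ∧ N.Balanced F ∧
    (∃ e ∈ F, e.1 = N.bdry i) ∧ (∃ e ∈ F, e.2 = N.bdry j) ∧
    ∀ e ∈ F, ∀ l, (e.1 = N.bdry l → l = i) ∧ (e.2 = N.bdry l → l = j)

/-- The weight of a set of directed edges. -/
noncomputable def flowWeight (N : PBDTPNetwork V n) (F : Finset (V × V)) : ℝ :=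
  ∏ e ∈ F, N.weight e.1 e.2

open Classical in
/-- The row, labelled by the boundary source `i`, of the boundary measurement matrix of `(N, O)`
(the identity in the columns of the base; elsewhere the signed boundary measurements, which are
quotients of sums over flows by the sum over conservative flows). -/
noncomputable def measRow [Fintype V] (N : PBDTPNetwork V n) (O : V → V → Prop) (i j : Fin n) : ℝ :=
  if j ∈ N.sources O then (if j = i then 1 else 0)
  else (-1 : ℝ) ^ ((N.sources O).filter fun l => min i j < l ∧ l < max i j).card *
    ((∑ F : Finset (V × V) with N.IsFlow O i j F, N.flowWeight F) /
      ∑ C : Finset (V × V) with N.IsConservativeFlow O C, N.flowWeight C)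

/-- `A` is a representative matrix of the point of the Grassmannian represented by the network:
`A` is the boundary measurement matrix up to left multiplication by `GL_k^+`. -/
def Represents [Fintype V] {k : ℕ} (N : PBDTPNetwork V n) (O : V → V → Prop)
    (A : Matrix (Fin k) (Fin n) ℝ) : Prop :=
  ∃ (hk : (N.sources O).card = k) (g : Matrix (Fin k) (Fin k) ℝ), 0 < g.det ∧
    A = g * Matrix.of fun r j => N.measRow O ((N.sources O).orderEmbOfFin hk r) j

/-- The union of the edges of a walk. -/
def walkSet (N : PBDTPNetwork V n) {u v : V} (P : N.graph.Walk u v) : Set (ℝ × ℝ) :=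
  {z | ∃ d ∈ P.darts, z ∈ segment ℝ (N.pos d.fst) (N.pos d.snd)}

/-- The region containing `z` among those into which the interior of the disk is divided by the
path `P` from `b_{i₀}` to `b_{j₀}` and the gauge rays starting at `b_{i₀}` and `b_{j₀}`. -/
def pathRegion (N : PBDTPNetwork V n) (ℓ : ℝ × ℝ) {i₀ j₀ : Fin n}
    (P : N.graph.Walk (N.bdry i₀) (N.bdry j₀)) (z : ℝ × ℝ) : Set (ℝ × ℝ) :=
  connectedComponentIn ({z : ℝ × ℝ | 0 < z.2} \
    (openRay (N.pos (N.bdry i₀)) ℓ ∪ openRay (N.pos (N.bdry j₀)) ℓ ∪ N.walkSet P)) z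

/-- The oriented curves bounding the regions, cut into straight pieces with their directions: the
ray at `b_{i₀}` oriented upwards, the ray at `b_{j₀}` oriented downwards, the edges of `P`, and the
two arcs of the boundary of the disk from `b_{j₀}` to `b_{i₀}` (one is a segment of the real axis,
the other one passes through the point at infinity). -/
def pathPieces (N : PBDTPNetwork V n) (ℓ : ℝ × ℝ) {i₀ j₀ : Fin n}
    (P : N.graph.Walk (N.bdry i₀) (N.bdry j₀)) : Set (Set (ℝ × ℝ) × (ℝ × ℝ)) :=
  {(openRay (N.pos (N.bdry i₀)) ℓ, ℓ),
   (openRay (N.pos (N.bdry j₀)) ℓ, -ℓ),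
   (openSegment ℝ (N.pos (N.bdry j₀)) (N.pos (N.bdry i₀)), N.edgeDir (N.bdry j₀) (N.bdry i₀)),
   (openRay (N.pos (N.bdry j₀)) (N.edgeDir (N.bdry i₀) (N.bdry j₀)),
      N.edgeDir (N.bdry i₀) (N.bdry j₀)),
   (openRay (N.pos (N.bdry i₀)) (N.edgeDir (N.bdry j₀) (N.bdry i₀)),
      N.edgeDir (N.bdry i₀) (N.bdry j₀))} ∪
  {p | ∃ d ∈ P.darts,
      p = (openSegment ℝ (N.pos d.fst) (N.pos d.snd), N.edgeDir d.fst d.snd)}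

/-- The point `z` lies in a region marked `+` by the path `P`: the boundary of its region is
oriented, that is, the region lies on the same side of all the pieces bounding it. -/
def PathPlus (N : PBDTPNetwork V n) (ℓ : ℝ × ℝ) {i₀ j₀ : Fin n}
    (P : N.graph.Walk (N.bdry i₀) (N.bdry j₀)) (z : ℝ × ℝ) : Prop :=
  (∀ p ∈ N.pathPieces ℓ P, ¬ ∃ q ∈ p.1,
      ∀ᶠ t in 𝓝[>] (0 : ℝ), q + t • rotLeft p.2 ∈ N.pathRegion ℓ P z) ∨
  (∀ p ∈ N.pathPieces ℓ P, ¬ ∃ q ∈ p.1,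
      ∀ᶠ t in 𝓝[>] (0 : ℝ), q - t • rotLeft p.2 ∈ N.pathRegion ℓ P z)

/-- The point `z` lies in the region marked `+` by the closed walk `Q`: the region external
to `Q`, which is the unbounded one. -/
def CyclePlus (N : PBDTPNetwork V n) {v : V} (Q : N.graph.Walk v v) (z : ℝ × ℝ) : Prop :=
  ¬ Bornology.IsBounded (connectedComponentIn ({z : ℝ × ℝ | 0 < z.2} \ N.walkSet Q) z)

open Classical in
/-- The index `ε(e)` of an edge `e = (u, v)` that does not change its direction: `0` if its starting
vertex, infinitesimally shifted in the direction of `e`, lies in a `+` region, and `1` otherwise. -/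
noncomputable def indexOff (N : PBDTPNetwork V n) (Plus : ℝ × ℝ → Prop) (u v : V) : ℤ :=
  if ∀ᶠ t in 𝓝[>] (0 : ℝ), Plus (N.pos u + t • N.edgeDir u v) then 0 else 1

open Classical in
/-- The index `ε(e) = ε₁(e) + ε₂(e) + ε₃(e)` of an edge `e = (u, v)` that changes its direction:
`ε₁` is `0` or `1` according to the mark of the region to the left of `e` near its end point `v`,
`ε₂ = (1 - s(e, ℓ)) / 2`, and `ε₃ = int(e)`, all in the initial orientation `O`. -/
noncomputable def indexOn (N : PBDTPNetwork V n) (ℓ : ℝ × ℝ) (O : V → V → Prop)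
    (Plus : ℝ × ℝ → Prop) (u v : V) : ℤ :=
  (if ∀ᶠ a in 𝓝[>] (0 : ℝ), ∀ᶠ t in 𝓝[>] (0 : ℝ),
      Plus (N.pos v - a • N.edgeDir u v + t • rotLeft (N.edgeDir u v)) then 0 else 1) +
    (1 - orientSign (N.edgeDir u v) ℓ) / 2 + N.crossings ℓ O u v

open Classical in
/-- The factor of the edge `(u, v)` of `O` in the elementary change of orientation along `S`. -/
noncomputable def changeFactor (N : PBDTPNetwork V n) (ℓ : ℝ × ℝ) (O : V → V → Prop)
    (S : Set (Sym2 V)) (Plus : ℝ × ℝ → Prop) (u v : V) : ℝ :=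
  if s(u, v) ∈ S then (-1 : ℝ) ^ N.indexOn ℓ O Plus u v / N.weight u v
  else (-1 : ℝ) ^ N.indexOff Plus u v

end PBDTPNetwork

open scoped Topology

/-! ### The turning number of a simple polygon modulo two -/

open Classical in
/-- The truth value of a proposition as an element of `ZMod 2`. -/
noncomputable def parity (p : Prop) : ZMod 2 := if p then 1 else 0

theorem parity_true {p : Prop} (h : p) : parity p = 1 := if_pos h

theorem parity_false {p : Prop} (h : ¬ p) : parity p = 0 := if_neg h

theorem parity_congr {p q : Prop} (h : p ↔ q) : parity p = parity q := by rw [propext h]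

theorem add_self_zmod_two (a : ZMod 2) : a + a = 0 := CharTwo.add_self_eq_zero a

theorem parity_not (p : Prop) : parity (¬ p) = 1 + parity p := by
  by_cases h : p
  · rw [parity_true h, parity_false (not_not.2 h)]; rfl
  · rw [parity_true h, parity_false h]; rfl

/-- The abscissa of `P` lies strictly between those of `C` and `D`. -/
def Spans (P C D : ℝ × ℝ) : Prop := (P.1 - C.1) * (P.1 - D.1) < 0

/-- `P` lies below the line through `C` and `D`. -/
def IsBelow (P C D : ℝ × ℝ) : Prop := (D.1 - C.1) * planeCross (D - C) (P - C) < 0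

theorem spans_comm {P C D : ℝ × ℝ} : Spans P C D ↔ Spans P D C := by
  unfold Spans; rw [mul_comm]

theorem isBelow_comm {P C D : ℝ × ℝ} : IsBelow P C D ↔ IsBelow P D C := by
  unfold IsBelow planeCross
  simp only [Prod.fst_sub, Prod.snd_sub]
  constructor <;> intro h <;> nlinarith

/-- The number, modulo two, of ends of the common abscissa interval of the segments `AB` and `CD`,
counted if `CD` lies above `AB`. -/
noncomputable def pairCount (A B C D : ℝ × ℝ) : ZMod 2 :=
  parity (Spans A C D ∧ IsBelow A C D) + parity (Spans B C D ∧ IsBelow B C D) +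
    (parity (Spans C A B ∧ ¬ IsBelow C A B) + parity (Spans D A B ∧ ¬ IsBelow D A B))

theorem pairCount_swap_left (A B C D : ℝ × ℝ) : pairCount A B C D = pairCount B A C D := by
  unfold pairCount
  simp only [spans_comm (C := A) (D := B), isBelow_comm (C := A) (D := B)]
  ring

theorem pairCount_swap_right (A B C D : ℝ × ℝ) : pairCount A B C D = pairCount A B D C := by
  unfold pairCount
  simp only [spans_comm (C := C) (D := D), isBelow_comm (C := C) (D := D)]
  ring

theorem segments_meet {A B C D : ℝ × ℝ} (hAB : A.1 < B.1)
    (hC : A.1 ≤ C.1) (hC' : C.1 ≤ B.1) (hD : A.1 ≤ D.1) (hD' : D.1 ≤ B.1)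
    (h1 : 0 ≤ planeCross (B - A) (C - A)) (h2 : planeCross (B - A) (D - A) ≤ 0) :
    ∃ z, z ∈ segment ℝ A B ∧ z ∈ segment ℝ C D := by
  obtain ⟨s, hs0, hs1, hs⟩ : ∃ s : ℝ, 0 ≤ s ∧ s ≤ 1 ∧
      (1 - s) * planeCross (B - A) (C - A) + s * planeCross (B - A) (D - A) = 0 := by
    set a := planeCross (B - A) (C - A)
    set b := planeCross (B - A) (D - A)
    by_cases hab : a - b = 0
    · exact ⟨0, le_rfl, zero_le_one, by nlinarith⟩
    · have : 0 < a - b := lt_of_le_of_ne (by linarith) (Ne.symm hab)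
      refine ⟨a / (a - b), by positivity, by rw [div_le_one this]; linarith, ?_⟩
      field_simp; ring
  have hB : B.1 - A.1 ≠ 0 := by linarith
  set z : ℝ × ℝ := (1 - s) • C + s • D with hz
  have z1 : z.1 = (1 - s) * C.1 + s * D.1 := by simp [hz]
  have z2 : z.2 = (1 - s) * C.2 + s * D.2 := by simp [hz]
  refine ⟨z, ?_, ⟨1 - s, s, by linarith, hs0, by ring, rfl⟩⟩
  set r := (z.1 - A.1) / (B.1 - A.1) with hr
  have hr' : r * (B.1 - A.1) = z.1 - A.1 := by rw [hr]; field_simp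
  have hr0 : 0 ≤ r := div_nonneg (by rw [z1]; nlinarith) (by linarith)
  have hr1 : r ≤ 1 := by rw [hr, div_le_one (by linarith)]; rw [z1]; nlinarith
  refine ⟨1 - r, r, by linarith, hr0, by ring, ?_⟩
  unfold planeCross at hs
  simp only [Prod.fst_sub, Prod.snd_sub] at hs
  ext
  · simp; linarith
  · simp
    have : (B.1 - A.1) * ((1 - r) * A.2 + r * B.2) = (B.1 - A.1) * z.2 := by
      have e : (B.1 - A.1) * ((1 - r) * A.2 + r * B.2) =
        (B.1 - A.1) * A.2 + (r * (B.1 - A.1)) * (B.2 - A.2) := by ring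
      rw [e, hr', z1, z2]; linarith
    exact mul_left_cancel₀ hB this

theorem isBelow_iff {P C D : ℝ × ℝ} (h : C.1 < D.1) :
    IsBelow P C D ↔ planeCross (D - C) (P - C) < 0 := by
  unfold IsBelow
  constructor
  · intro h'; by_contra! hc; nlinarith
  · intro h'; nlinarith

/-- In the situation `A < C < D < B` of the abscissas. -/
theorem isBelow_iff_of_inner {A B C D : ℝ × ℝ} (hAB : A.1 < B.1)
    (hC : A.1 < C.1) (hC' : C.1 < B.1) (hD : A.1 < D.1) (hD' : D.1 < B.1)
    (hd : Disjoint (segment ℝ A B) (segment ℝ C D)) : IsBelow C A B ↔ IsBelow D A B := by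
  rw [isBelow_iff hAB, isBelow_iff hAB]
  constructor
  · intro h; by_contra! hc
    obtain ⟨z, h1, h2⟩ := segments_meet hAB hD.le hD'.le hC.le hC'.le hc h.le
    rw [segment_symm] at h2
    exact Set.disjoint_left.1 hd h1 h2
  · intro h; by_contra! hc
    obtain ⟨z, h1, h2⟩ := segments_meet hAB hC.le hC'.le hD.le hD'.le hc h.le
    exact Set.disjoint_left.1 hd h1 h2

/-- In the situation `A < C < B < D` of the abscissas. -/
theorem isBelow_iff_of_overlap {A B C D : ℝ × ℝ} (hC : A.1 < C.1) (hC' : C.1 < B.1)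
    (hD : B.1 < D.1) (hd : Disjoint (segment ℝ A B) (segment ℝ C D)) :
    IsBelow B C D ↔ ¬ IsBelow C A B := by
  have hAB : A.1 < B.1 := hC.trans hC'
  have hCD : C.1 < D.1 := hC'.trans hD
  set s := (B.1 - C.1) / (D.1 - C.1) with hs
  have hD0 : D.1 - C.1 ≠ 0 := by linarith
  have hs' : s * (D.1 - C.1) = B.1 - C.1 := by rw [hs]; field_simp
  have hs0 : 0 ≤ s := div_nonneg (by linarith) (by linarith)
  have hs1 : s ≤ 1 := by rw [hs, div_le_one (by linarith)]; linarith
  set Z : ℝ × ℝ := C + s • (D - C) with hZ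
  have hZ1 : Z.1 = B.1 := by simp [hZ]; linarith
  have hZ2 : Z.2 = C.2 + s * (D.2 - C.2) := by simp [hZ]
  have hsub : segment ℝ C Z ⊆ segment ℝ C D := by
    apply (convex_segment C D).segment_subset (left_mem_segment ℝ C D)
    exact ⟨1 - s, s, by linarith, hs0, by ring, by rw [hZ]; module⟩
  have hd' := hd.mono_right hsub
  have key : planeCross (B - A) (Z - A) = (B.1 - A.1) * (Z.2 - B.2) := by
    unfold planeCross; simp only [Prod.fst_sub, Prod.snd_sub]; rw [hZ1]; ring
  have key2 : planeCross (D - C) (B - C) = (D.1 - C.1) * (B.2 - Z.2) := by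
    unfold planeCross; simp only [Prod.fst_sub, Prod.snd_sub]; rw [hZ2, ← hs']; ring
  rw [isBelow_iff hAB, isBelow_iff hCD, key2]
  constructor
  · intro h hc
    obtain ⟨z, h1, h2⟩ := segments_meet (C := Z) (D := C) hAB (by linarith) (by linarith) hC.le hC'.le
      (by rw [key]; nlinarith) hc.le
    rw [segment_symm] at h2
    exact Set.disjoint_left.1 hd' h1 h2
  · intro h; by_contra! hc
    obtain ⟨z, h1, h2⟩ := segments_meet (C := C) (D := Z) hAB hC.le hC'.le (by linarith) (by linarith)
      (not_lt.1 h) (by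
        rw [key]
        have : 0 ≤ B.2 - Z.2 := by by_contra! h3; nlinarith
        nlinarith)
    exact Set.disjoint_left.1 hd' h1 h2

theorem spans_iff {P C D : ℝ × ℝ} (h : C.1 < D.1) : Spans P C D ↔ C.1 < P.1 ∧ P.1 < D.1 := by
  unfold Spans
  constructor
  · intro h'; constructor <;> by_contra! hc <;> nlinarith
  · rintro ⟨h1, h2⟩; nlinarith

theorem pairCount_of_disjoint {A B C D : ℝ × ℝ} (hAB : A.1 ≠ B.1) (hCD : C.1 ≠ D.1)
    (hAC : A.1 ≠ C.1) (hAD : A.1 ≠ D.1) (hBC : B.1 ≠ C.1) (hBD : B.1 ≠ D.1)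
    (hd : Disjoint (segment ℝ A B) (segment ℝ C D)) : pairCount A B C D = 0 := by
  wlog h1 : A.1 < B.1 generalizing A B
  · rw [pairCount_swap_left]
    exact this hAB.symm hBC hBD hAC hAD (by rwa [segment_symm]) (lt_of_le_of_ne (not_lt.1 h1) hAB.symm)
  wlog h2 : C.1 < D.1 generalizing C D
  · rw [pairCount_swap_right]
    exact this hCD.symm hAD hAC hBD hBC (by rwa [segment_symm ℝ D C])
      (lt_of_le_of_ne (not_lt.1 h2) hCD.symm)
  unfold pairCount
  simp only [spans_iff h1, spans_iff h2]
  rcases lt_or_gt_of_ne hAC with hAC | hAC <;> rcases lt_or_gt_of_ne hBD with hBD | hBD <;>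
    rcases lt_or_gt_of_ne hAD with hAD | hAD <;> rcases lt_or_gt_of_ne hBC with hBC | hBC <;>
    (try (exfalso; linarith)) <;>
    simp only [hAC, hAC.not_gt, hBD, hBD.not_gt, hAD, hAD.not_gt, hBC, hBC.not_gt, true_and,
      and_true, and_false, false_and, parity_false, not_false_iff, zero_add, add_zero]
  · have := isBelow_iff_of_overlap hAC hBC hBD hd
    rw [parity_congr this, add_self_zmod_two]
  · rw [parity_congr (not_congr (isBelow_iff_of_inner h1 hAC hBC hAD hBD hd)), add_self_zmod_two]
  · rw [parity_congr (isBelow_iff_of_inner h2 hAC hAD hBC hBD hd.symm), add_self_zmod_two]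
  · have := isBelow_iff_of_overlap hAC hAD hBD hd.symm
    rw [parity_congr (not_congr this), not_not, add_self_zmod_two]

/-- The polygonal line `A, B, D` turns back at `B` through the upward direction. -/
def TurnsUp (A B D : ℝ × ℝ) : Prop :=
  (B.1 - A.1) * (D.1 - B.1) < 0 ∧ 0 < (B.1 - A.1) * planeCross (B - A) (D - B)

theorem pairCount_adjacent {A B D : ℝ × ℝ} (hAB : A.1 ≠ B.1) (hBD : B.1 ≠ D.1) (hAD : A.1 ≠ D.1)
    (hne : (B.1 - A.1) * (D.1 - B.1) < 0 → planeCross (B - A) (D - B) ≠ 0) :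
    pairCount A B B D = parity (TurnsUp A B D) := by
  have e1 : planeCross (D - B) (A - B) = planeCross (B - A) (D - B) := by
    unfold planeCross; simp only [Prod.fst_sub, Prod.snd_sub]; ring
  have e2 : planeCross (B - A) (D - A) = planeCross (B - A) (D - B) := by
    unfold planeCross; simp only [Prod.fst_sub, Prod.snd_sub]; ring
  have s1 : ¬ Spans B B D := by simp [Spans]
  have s2 : ¬ Spans B A B := by simp [Spans]
  have sA : ∀ q : Prop, parity (Spans B B D ∧ q) = 0 := fun q => parity_false fun h => s1 h.1
  have sB : ∀ q : Prop, parity (Spans B A B ∧ q) = 0 := fun q => parity_false fun h => s2 h.1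
  unfold pairCount
  rw [sA, sB]
  unfold IsBelow TurnsUp
  rw [e1, e2, add_zero, zero_add]
  set c := planeCross (B - A) (D - B)
  have hx : (B.1 - A.1) ≠ 0 := sub_ne_zero.2 hAB.symm
  by_cases hex : (B.1 - A.1) * (D.1 - B.1) < 0
  · have hc := hne hex
    by_cases hA : Spans A B D
    · have hD : ¬ Spans D A B := by
        unfold Spans at *
        intro h; rcases lt_or_gt_of_ne hAB with h' | h' <;> rcases lt_or_gt_of_ne hBD with h'' | h'' <;>
          nlinarith
      rw [parity_false (p := Spans D A B ∧ _) (fun h => hD h.1), add_zero]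
      apply parity_congr
      simp only [hA, hex, true_and]
      rcases lt_or_gt_of_ne hAB with h' | h'
      · have : D.1 - B.1 < 0 := by by_contra! hh; nlinarith
        constructor
        · intro h; have : 0 < c := by by_contra! hh; nlinarith
          nlinarith
        · intro h; have : 0 < c := by by_contra! hh; nlinarith
          nlinarith
      · have : 0 < D.1 - B.1 := by by_contra! hh; nlinarith
        constructor
        · intro h; have : c < 0 := by by_contra! hh; nlinarith
          nlinarith
        · intro h; have : c < 0 := by by_contra! hh; nlinarith
          nlinarith
    · have hD : Spans D A B := by
        unfold Spans at *
        rcases lt_or_gt_of_ne hAB with h' | h' <;> rcases lt_or_gt_of_ne hBD with h'' | h'' <;>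
          rcases lt_or_gt_of_ne hAD with h3 | h3 <;> nlinarith
      rw [parity_false (p := Spans A B D ∧ _) (fun h => hA h.1), zero_add]
      apply parity_congr
      simp only [hD, hex, true_and, not_lt]
      exact ⟨fun h => lt_of_le_of_ne h (mul_ne_zero hx hc).symm, le_of_lt⟩
  · have hA : ¬ Spans A B D := by
      unfold Spans
      intro h; apply hex; rcases lt_or_gt_of_ne hAB with h' | h' <;>
        rcases lt_or_gt_of_ne hBD with h'' | h'' <;> nlinarith
    have hD : ¬ Spans D A B := by
      unfold Spans
      intro h; apply hex; rcases lt_or_gt_of_ne hAB with h' | h' <;>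
        rcases lt_or_gt_of_ne hBD with h'' | h'' <;> nlinarith
    rw [parity_false (fun h => hA h.1), parity_false (fun h => hD h.1),
      parity_false (fun h => hex h.1), add_zero]

theorem pairCount_adjacent_rev {A B D : ℝ × ℝ} (hAB : A.1 ≠ B.1) (hBD : B.1 ≠ D.1)
    (hAD : A.1 ≠ D.1) :
    pairCount B D A B = pairCount A B B D + parity ((B.1 - A.1) * (D.1 - B.1) < 0) := by
  have s1 : ∀ q : Prop, parity (Spans B B D ∧ q) = 0 :=
    fun q => parity_false fun h => by simp [Spans] at h
  have s2 : ∀ q : Prop, parity (Spans B A B ∧ q) = 0 :=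
    fun q => parity_false fun h => by simp [Spans] at h
  unfold pairCount
  simp only [s1, s2, zero_add, add_zero]
  have split : ∀ p q : Prop, parity (p ∧ q) = parity (p ∧ ¬ q) + parity p := by
    intro p q
    by_cases hp : p <;> by_cases hq : q <;> simp [parity, hp, hq]; decide
  rw [split (Spans D A B), add_comm (parity (Spans A B D ∧ _)), split (Spans A B D) (IsBelow _ _ _)]
  have : parity ((B.1 - A.1) * (D.1 - B.1) < 0) = parity (Spans D A B) + parity (Spans A B D) := by
    unfold Spans
    rcases lt_or_gt_of_ne hAB with h' | h' <;> rcases lt_or_gt_of_ne hBD with h'' | h'' <;>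
      rcases lt_or_gt_of_ne hAD with h3 | h3 <;> (try (exfalso; linarith))
    all_goals
      unfold parity
      split_ifs <;> first | rfl | (exfalso; nlinarith)
  rw [this]
  generalize parity (Spans D A B ∧ ¬ IsBelow D A B) = a
  generalize parity (Spans A B D ∧ ¬ IsBelow A B D) = b
  generalize parity (Spans D A B) = c
  generalize parity (Spans A B D) = d
  revert a b c d; decide

theorem sum_range_add_succ (f : ℕ → ZMod 2) (n : ℕ) :
    ∑ a ∈ Finset.range n, (f a + f (a + 1)) = f 0 + f n := by
  induction n with
  | zero => simp [add_self_zmod_two]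
  | succ n ih =>
    rw [Finset.sum_range_succ, ih]
    generalize f 0 = a; generalize f n = b; generalize f (n + 1) = c
    revert a b c; decide

theorem sum_Ico_add_succ (f : ℕ → ZMod 2) {k n : ℕ} (h : k ≤ n) :
    ∑ a ∈ Finset.Ico k n, (f a + f (a + 1)) = f k + f n := by
  induction n, h using Nat.le_induction with
  | base => simp [add_self_zmod_two]
  | succ n hkn ih =>
    rw [Finset.sum_Ico_succ_top hkn, ih]
    generalize f k = a; generalize f n = b; generalize f (n + 1) = c
    revert a b c; decide

theorem sum_triangle_comm {M : Type*} [AddCommMonoid M] (f : ℕ → ℕ → M) (m : ℕ) :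
    ∑ b ∈ Finset.range m, ∑ a ∈ Finset.range b, f a b =
      ∑ a ∈ Finset.range m, ∑ b ∈ Finset.Ico (a + 1) m, f a b := by
  apply Finset.sum_comm'
  intro x y
  simp only [Finset.mem_range, Finset.mem_Ico]
  omega

/-- The number of edges of a closed polygon above or below its base point. -/
theorem sum_spans_base {n : ℕ} (hn : 1 ≤ n) (p : ℕ → ℝ × ℝ) (h0 : p (n + 2) = p 0)
    (hx : ∀ i < n + 2, ∀ j < n + 2, i ≠ j → (p i).1 ≠ (p j).1) :
    ∑ g ∈ Finset.range (n + 2), parity (Spans (p 0) (p g) (p (g + 1))) +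
      parity (((p 0).1 - (p (n + 1)).1) * ((p 1).1 - (p 0).1) < 0) = 1 := by
  set H : ℕ → ZMod 2 := fun i => parity ((p i).1 ≤ (p 0).1) with hH
  have htot := sum_range_add_succ (fun i => H (i + 1)) n
  have hmid : ∀ g ∈ Finset.range n, parity (Spans (p 0) (p (g + 1)) (p (g + 1 + 1))) =
      H (g + 1) + H (g + 1 + 1) := by
    intro g hg
    rw [Finset.mem_range] at hg
    have a1 := hx 0 (by omega) (g + 1) (by omega) (by omega)
    have a2 := hx 0 (by omega) (g + 1 + 1) (by omega) (by omega)
    simp only [hH]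
    unfold Spans
    rcases lt_or_gt_of_ne a1 with h1 | h1 <;> rcases lt_or_gt_of_ne a2 with h2 | h2
    · rw [parity_false (by nlinarith), parity_false (by linarith), parity_false (by linarith)]; rfl
    · rw [parity_true (by nlinarith), parity_false (by linarith), parity_true (by linarith)]; rfl
    · rw [parity_true (by nlinarith), parity_true (by linarith), parity_false (by linarith)]; rfl
    · rw [parity_false (by nlinarith), parity_true (by linarith), parity_true (by linarith)]; rfl
  rw [Finset.sum_range_succ, Finset.sum_range_succ', Finset.sum_congr rfl hmid, htot, h0]
  rw [parity_false (p := Spans (p 0) (p 0) _) (by simp [Spans]),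
    parity_false (p := Spans (p 0) _ (p 0)) (by simp [Spans])]
  have a1 := hx 0 (by omega) 1 (by omega) (by omega)
  have a2 := hx 0 (by omega) (n + 1) (by omega) (by omega)
  simp only [hH, add_zero, zero_add]
  rcases lt_or_gt_of_ne a1 with h1 | h1 <;> rcases lt_or_gt_of_ne a2 with h2 | h2
  · rw [parity_false (by linarith), parity_false (by linarith), parity_true (by nlinarith)]; rfl
  · rw [parity_false (by linarith), parity_true (by linarith), parity_false (by nlinarith)]; rfl
  · rw [parity_true (by linarith), parity_false (by linarith), parity_false (by nlinarith)]; rfl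
  · rw [parity_true (by linarith), parity_true (by linarith), parity_true (by nlinarith)]; rfl

/-- Hopf's Umlaufsatz modulo two for a simple polygon in general position. -/
theorem sum_turnsUp_of_generic {n : ℕ} (hn : 1 ≤ n) (p : ℕ → ℝ × ℝ) (h0 : p (n + 2) = p 0)
    (h1 : p (n + 3) = p 1)
    (hx : ∀ i < n + 2, ∀ j < n + 2, i ≠ j → (p i).1 ≠ (p j).1)
    (hd : ∀ i j, i + 1 < j → j < n + 2 → (i ≠ 0 ∨ j ≠ n + 1) →
      Disjoint (segment ℝ (p i) (p (i + 1))) (segment ℝ (p j) (p (j + 1))))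
    (hne : ∀ i < n + 2, ((p (i + 1)).1 - (p i).1) * ((p (i + 2)).1 - (p (i + 1)).1) < 0 →
      planeCross (p (i + 1) - p i) (p (i + 2) - p (i + 1)) ≠ 0) :
    ∑ i ∈ Finset.range (n + 2), parity (TurnsUp (p i) (p (i + 1)) (p (i + 2))) = 1 := by
  have hx' : ∀ i ≤ n + 2, ∀ j ≤ n + 2, i < j → (i ≠ 0 ∨ j ≠ n + 2) → (p i).1 ≠ (p j).1 := by
    intro i hi j hj hij h
    rcases Nat.lt_or_ge j (n + 2) with hj' | hj'
    · exact hx i (by omega) j hj' (by omega)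
    · obtain rfl : j = n + 2 := by omega
      rw [h0]; exact hx i (by omega) 0 (by omega) (by omega)
  set ext := parity (((p 0).1 - (p (n + 1)).1) * ((p 1).1 - (p 0).1) < 0)
  set w : ℕ → ZMod 2 := fun i => parity (TurnsUp (p i) (p (i + 1)) (p (i + 2)))
  have hpair : ∀ b ∈ Finset.range (n + 2), ∀ a ∈ Finset.range b,
      pairCount (p a) (p (a + 1)) (p b) (p (b + 1)) =
        (if a + 1 = b then w a else 0) + (if a = 0 then (if b = n + 1 then w (n + 1) + ext else 0)
          else 0) := by
    intro b hb a ha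
    rw [Finset.mem_range] at ha hb
    by_cases h : a + 1 = b
    · subst h
      have : ¬ (a = 0 ∧ a + 1 = n + 1) := by omega
      rw [if_pos rfl]
      have e : (if a = 0 then (if a + 1 = n + 1 then w (n + 1) + ext else 0) else 0) = 0 := by
        split_ifs <;> first | rfl | (exfalso; omega)
      rw [e, add_zero]
      exact pairCount_adjacent (hx' _ (by omega) _ (by omega) (by omega) (by omega))
        (hx' _ (by omega) _ (by omega) (by omega) (by omega))
        (hx' _ (by omega) _ (by omega) (by omega) (by omega)) (hne a (by omega))
    · rw [if_neg h, zero_add]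
      by_cases h' : a = 0 ∧ b = n + 1
      · obtain ⟨rfl, rfl⟩ := h'
        rw [if_pos rfl, if_pos rfl]
        have hA : (p (n + 1)).1 ≠ (p (n + 2)).1 :=
          hx' _ (by omega) _ (by omega) (by omega) (by omega)
        have hB : (p (n + 2)).1 ≠ (p (n + 3)).1 := by
          rw [h0, h1]; exact hx' _ (by omega) _ (by omega) (by omega) (by omega)
        have hC : (p (n + 1)).1 ≠ (p (n + 3)).1 := by
          rw [h1]; exact (hx' _ (by omega) _ (by omega) (by omega) (by omega)).symm
        have e1 := pairCount_adjacent hA hB hC (hne (n + 1) (by omega))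
        have e2 := pairCount_adjacent_rev hA hB hC
        rw [e1] at e2
        simp only [h0, h1] at e2
        show pairCount (p 0) (p (0 + 1)) (p (n + 1)) (p (n + 2)) = _
        rw [h0, zero_add, e2]
        simp only [w, ext]
        rw [show n + 1 + 1 = n + 2 from rfl, show n + 1 + 2 = n + 3 from rfl, h0, h1]
      · have e : (if a = 0 then (if b = n + 1 then w (n + 1) + ext else 0) else 0) = 0 := by
          split_ifs <;> first | rfl | (exfalso; omega)
        rw [e]
        exact pairCount_of_disjoint (hx' _ (by omega) _ (by omega) (by omega) (by omega))
          (hx' _ (by omega) _ (by omega) (by omega) (by omega))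
          (hx' _ (by omega) _ (by omega) (by omega) (by omega))
          (hx' _ (by omega) _ (by omega) (by omega) (by omega))
          (hx' _ (by omega) _ (by omega) (by omega) (by omega))
          (hx' _ (by omega) _ (by omega) (by omega) (by omega))
          (hd a b (by omega) hb (by omega))
  have way1 : ∑ b ∈ Finset.range (n + 2), ∑ a ∈ Finset.range b,
      pairCount (p a) (p (a + 1)) (p b) (p (b + 1)) =
        ∑ i ∈ Finset.range (n + 2), w i + ext := by
    rw [Finset.sum_congr rfl fun b hb => Finset.sum_congr rfl (hpair b hb)]
    simp only [Finset.sum_add_distrib]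
    have e1 : ∑ b ∈ Finset.range (n + 2), ∑ a ∈ Finset.range b, (if a + 1 = b then w a else 0) =
        ∑ i ∈ Finset.range (n + 1), w i := by
      rw [Finset.sum_range_succ' (n := n + 1), Finset.sum_range_zero, add_zero]
      refine Finset.sum_congr rfl fun b _ => ?_
      simp only [Nat.add_right_cancel_iff, Finset.sum_ite_eq', Finset.mem_range]
      rw [if_pos (by omega)]
    have e2 : ∑ b ∈ Finset.range (n + 2), ∑ a ∈ Finset.range b,
        (if a = 0 then (if b = n + 1 then w (n + 1) + ext else 0) else 0) = w (n + 1) + ext := by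
      rw [Finset.sum_range_succ (n := n + 1), Finset.sum_eq_zero, zero_add]
      · rw [Finset.sum_ite_eq', if_pos (by simp), if_pos rfl]
      · intro b hb
        rw [Finset.mem_range] at hb
        rw [if_neg (by omega : ¬ b = n + 1)]
        simp
    rw [e1, e2, Finset.sum_range_succ w (n + 1), add_assoc]
  set J : ℕ → ℕ → ZMod 2 :=
    fun i g => parity (Spans (p i) (p g) (p (g + 1)) ∧ IsBelow (p i) (p g) (p (g + 1))) with hJ
  set K : ℕ → ℕ → ZMod 2 :=
    fun i g => parity (Spans (p i) (p g) (p (g + 1)) ∧ ¬ IsBelow (p i) (p g) (p (g + 1))) with hK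
  have way2 : ∑ b ∈ Finset.range (n + 2), ∑ a ∈ Finset.range b,
      pairCount (p a) (p (a + 1)) (p b) (p (b + 1)) =
        ∑ g ∈ Finset.range (n + 2), parity (Spans (p 0) (p g) (p (g + 1))) := by
    have e : ∀ a b, pairCount (p a) (p (a + 1)) (p b) (p (b + 1)) =
        (J a b + J (a + 1) b) + (K b a + K (b + 1) a) := fun a b => rfl
    simp only [e]
    rw [Finset.sum_congr rfl fun b _ => Finset.sum_add_distrib, Finset.sum_add_distrib,
      sum_triangle_comm (fun a b => K b a + K (b + 1) a), ← Finset.sum_add_distrib]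
    refine Finset.sum_congr rfl fun g hg => ?_
    rw [Finset.mem_range] at hg
    rw [sum_range_add_succ (fun a => J a g), sum_Ico_add_succ (fun b => K b g) (by omega)]
    have j0 : J g g = 0 := parity_false (fun h => by have := h.1; simp [Spans] at this)
    have k0 : K (g + 1) g = 0 := parity_false (fun h => by have := h.1; simp [Spans] at this)
    have k1 : K (n + 2) g = K 0 g := by simp only [hK, h0]
    rw [j0, k0, k1]
    simp only [hJ, hK]
    by_cases hs : Spans (p 0) (p g) (p (g + 1)) <;>
      by_cases hb : IsBelow (p 0) (p g) (p (g + 1)) <;> simp [parity, hs, hb]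
  have hb := sum_spans_base hn p h0 hx
  rw [← way2, way1, add_assoc, add_self_zmod_two, add_zero] at hb
  exact hb

theorem orientSign_eq_one {a b : ℝ × ℝ} : orientSign a b = 1 ↔ 0 < planeCross a b := by
  unfold orientSign
  rcases lt_trichotomy (planeCross a b) 0 with h | h | h
  · simp [sign_neg h, h.le]
  · simp [h]
  · simp [sign_pos h, h]

theorem orientSign_eq_neg_one {a b : ℝ × ℝ} : orientSign a b = -1 ↔ planeCross a b < 0 := by
  unfold orientSign
  rcases lt_trichotomy (planeCross a b) 0 with h | h | h
  · simp [sign_neg h, h]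
  · simp [h]
  · simp [sign_pos h, h.le]

theorem planeCross_swap (a b : ℝ × ℝ) : planeCross b a = -planeCross a b := by
  unfold planeCross; ring

open Classical in
/-- The sign of the turn from `a` to `b`: `-1` if it passes through the direction `ℓ`. -/
noncomputable def turnSign (ℓ a b : ℝ × ℝ) : ℝ :=
  if planeCross a ℓ * planeCross b ℓ < 0 ∧ 0 < planeCross a ℓ * planeCross a b then -1 else 1

theorem neg_one_zpow_localWind {ℓ a b : ℝ × ℝ} (ha : planeCross a ℓ ≠ 0) :
    (-1 : ℝ) ^ localWind ℓ a b = turnSign ℓ a b := by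
  unfold localWind turnSign
  simp only [orientSign_eq_one, orientSign_eq_neg_one, planeCross_swap b ℓ]
  set x := planeCross a ℓ
  set y := planeCross b ℓ
  set z := planeCross a b
  rcases lt_or_gt_of_ne ha with h | h
  · rw [if_neg (fun h' => absurd h'.2.1 h.not_gt)]
    by_cases hh : z < 0 ∧ x < 0 ∧ -y < 0
    · rw [if_pos hh, if_pos ⟨by nlinarith [hh.2.2], by nlinarith [hh.1]⟩]; norm_num
    · rw [if_neg hh, if_neg]; · norm_num
      rintro ⟨h1, h2⟩
      exact hh ⟨by nlinarith, h, by nlinarith⟩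
  · have hneg : ¬ (z < 0 ∧ x < 0 ∧ -y < 0) := fun h' => absurd h'.2.1 h.not_gt
    by_cases hh : 0 < z ∧ 0 < x ∧ 0 < -y
    · rw [if_pos hh, if_pos ⟨by nlinarith [hh.2.2], by nlinarith [hh.1]⟩]; norm_num
    · rw [if_neg hh, if_neg hneg, if_neg]; · norm_num
      rintro ⟨h1, h2⟩
      exact hh ⟨by nlinarith, h, by nlinarith⟩

/-- The linear map taking the direction `ℓ` to the vertical direction. -/
noncomputable def straighten (ℓ : ℝ × ℝ) : (ℝ × ℝ) →ₗ[ℝ] ℝ × ℝ where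
  toFun z := (planeCross z ℓ, z.2)
  map_add' a b := by unfold planeCross; ext <;> simp; ring
  map_smul' c a := by unfold planeCross; ext <;> simp; ring

theorem straighten_apply (ℓ z : ℝ × ℝ) : straighten ℓ z = (planeCross z ℓ, z.2) := rfl

theorem straighten_injective {ℓ : ℝ × ℝ} (hℓ : 0 < ℓ.2) : Function.Injective (straighten ℓ) := by
  intro a b h
  simp only [straighten_apply, planeCross, Prod.mk.injEq] at h
  obtain ⟨h1, h2⟩ := h
  ext
  · rw [h2] at h1
    exact mul_right_cancel₀ hℓ.ne' (by linarith)
  · exact h2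

theorem planeCross_straighten (ℓ a b : ℝ × ℝ) :
    planeCross (straighten ℓ a) (straighten ℓ b) = ℓ.2 * planeCross a b := by
  simp only [straighten_apply, planeCross]; ring

theorem turnSign_eq_of_turnsUp {ℓ A B D : ℝ × ℝ} (hℓ : 0 < ℓ.2) :
    turnSign ℓ (B - A) (D - B) =
      if parity (TurnsUp (straighten ℓ A) (straighten ℓ B) (straighten ℓ D)) = 1 then -1 else 1 := by
  have : TurnsUp (straighten ℓ A) (straighten ℓ B) (straighten ℓ D) ↔
      planeCross (B - A) ℓ * planeCross (D - B) ℓ < 0 ∧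
        0 < planeCross (B - A) ℓ * planeCross (B - A) (D - B) := by
    unfold TurnsUp
    rw [← map_sub, ← map_sub, planeCross_straighten]
    have e : ∀ P Q : ℝ × ℝ, (straighten ℓ P).1 - (straighten ℓ Q).1 = planeCross (P - Q) ℓ := by
      intro P Q; simp only [straighten_apply, planeCross, Prod.fst_sub, Prod.snd_sub]; ring
    rw [e, e]
    apply and_congr_right
    intro _
    rw [mul_left_comm]
    exact mul_pos_iff_of_pos_left hℓ
  unfold turnSign
  rw [parity_congr this]
  by_cases h : planeCross (B - A) ℓ * planeCross (D - B) ℓ < 0 ∧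
        0 < planeCross (B - A) ℓ * planeCross (B - A) (D - B)
  · rw [parity_true h, if_pos h, if_pos rfl]
  · rw [parity_false h, if_neg h, if_neg (by decide)]

theorem prod_sign_of_sum {ι : Type*} (s : Finset ι) (f : ι → ZMod 2) :
    ∏ i ∈ s, (if f i = 1 then (-1 : ℝ) else 1) = if ∑ i ∈ s, f i = 1 then -1 else 1 := by
  classical
  induction s using Finset.induction_on with
  | empty => simp
  | insert a s ha ih =>
    rw [Finset.prod_insert ha, Finset.sum_insert ha, ih]
    generalize f a = x
    generalize ∑ i ∈ s, f i = y
    have h2 : ∀ c : ZMod 2, c = 0 ∨ c = 1 := by decide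
    have h01 : (0 : ZMod 2) ≠ 1 := by decide
    rcases h2 x with rfl | rfl <;> rcases h2 y with rfl | rfl <;> simp [h01, add_self_zmod_two]

theorem turnSign_congr {ℓ ℓ' a b : ℝ × ℝ} (ha : 0 < planeCross a ℓ * planeCross a ℓ')
    (hb : 0 < planeCross b ℓ * planeCross b ℓ') : turnSign ℓ a b = turnSign ℓ' a b := by
  unfold turnSign
  congr 1
  apply propext
  rcases pos_and_pos_or_neg_and_neg_of_mul_pos ha with ⟨h1, h2⟩ | ⟨h1, h2⟩ <;>
  rcases pos_and_pos_or_neg_and_neg_of_mul_pos hb with ⟨h3, h4⟩ | ⟨h3, h4⟩ <;>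
  · simp only [mul_neg_iff, mul_pos_iff, h1, h1.not_gt, h2, h2.not_gt, h3, h3.not_gt, h4, h4.not_gt,
      true_and, and_true, false_and, and_false]

open Filter in
theorem exists_generic_direction {ℓ : ℝ × ℝ} (hℓ : 0 < ℓ.2) (S : Finset (ℝ × ℝ))
    (hS : ∀ v ∈ S, v ≠ 0) :
    ∃ ℓ' : ℝ × ℝ, 0 < ℓ'.2 ∧ (∀ v ∈ S, planeCross v ℓ' ≠ 0) ∧
      ∀ v ∈ S, planeCross v ℓ ≠ 0 → 0 < planeCross v ℓ * planeCross v ℓ' := by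
  have key : ∀ v ∈ S, ∀ᶠ t in 𝓝[>] (0 : ℝ), planeCross v (ℓ + (t, 0)) ≠ 0 ∧
      (planeCross v ℓ ≠ 0 → 0 < planeCross v ℓ * planeCross v (ℓ + (t, 0))) := by
    intro v hv
    by_cases h : planeCross v ℓ = 0
    · filter_upwards [self_mem_nhdsWithin] with t ht
      refine ⟨?_, fun h' => absurd h h'⟩
      intro h'
      unfold planeCross at h h'
      simp only [Prod.fst_add, Prod.snd_add, add_zero] at h'
      have h2 : v.2 * t = 0 := by linarith
      have hv2 : v.2 = 0 := (mul_eq_zero.1 h2).resolve_right (ne_of_gt ht)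
      have hv1 : v.1 = 0 := by
        rw [hv2] at h
        exact (mul_eq_zero.1 (by linarith : v.1 * ℓ.2 = 0)).resolve_right hℓ.ne'
      exact hS v hv (Prod.ext hv1 hv2)
    · have hc : Continuous fun t : ℝ => planeCross v ℓ * planeCross v (ℓ + (t, 0)) := by
        unfold planeCross; fun_prop
      have h0 : 0 < planeCross v ℓ * planeCross v (ℓ + ((0 : ℝ), 0)) := by
        have : ℓ + ((0 : ℝ), (0 : ℝ)) = ℓ := by ext <;> simp
        rw [this]; exact mul_self_pos.2 h
      have := (hc.continuousAt (x := 0)).eventually (lt_mem_nhds h0)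
      filter_upwards [nhdsWithin_le_nhds this] with t ht
      exact ⟨fun h' => by rw [h'] at ht; simp at ht, fun _ => ht⟩
  obtain ⟨t, ht⟩ := ((eventually_all_finset S).2 key).exists
  exact ⟨ℓ + (t, 0), by simpa using hℓ, fun v hv => (ht v hv).1, fun v hv => (ht v hv).2⟩

/-- The turning signs along a simple closed polygon multiply to `-1`. -/
theorem prod_turnSign_of_simple {n : ℕ} (hn : 1 ≤ n) {ℓ : ℝ × ℝ} (hℓ : 0 < ℓ.2) (p : ℕ → ℝ × ℝ)
    (h0 : p (n + 2) = p 0) (h1 : p (n + 3) = p 1)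
    (hinj : ∀ i < n + 2, ∀ j < n + 2, i ≠ j → p i ≠ p j)
    (hpar : ∀ i < n + 2, planeCross (p (i + 1) - p i) ℓ ≠ 0)
    (hd : ∀ i j, i + 1 < j → j < n + 2 → (i ≠ 0 ∨ j ≠ n + 1) →
      Disjoint (segment ℝ (p i) (p (i + 1))) (segment ℝ (p j) (p (j + 1))))
    (hne : ∀ i < n + 2,
      planeCross (p (i + 1) - p i) ℓ * planeCross (p (i + 2) - p (i + 1)) ℓ < 0 →
      planeCross (p (i + 1) - p i) (p (i + 2) - p (i + 1)) ≠ 0) :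
    ∏ i ∈ Finset.range (n + 2), turnSign ℓ (p (i + 1) - p i) (p (i + 2) - p (i + 1)) = -1 := by
  classical
  set S : Finset (ℝ × ℝ) := ((Finset.range (n + 2) ×ˢ Finset.range (n + 2)).filter
    fun q => q.1 ≠ q.2).image fun q => p q.1 - p q.2 with hS
  have memS : ∀ i < n + 2, ∀ j < n + 2, i ≠ j → p i - p j ∈ S := fun i hi j hj hij =>
    Finset.mem_image.2 ⟨(i, j), by simp [hi, hj, hij], rfl⟩
  obtain ⟨ℓ', hℓ', hS0, hS1⟩ := exists_generic_direction hℓ S (by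
    intro v hv
    obtain ⟨⟨i, j⟩, hq, rfl⟩ := Finset.mem_image.1 hv
    simp only [Finset.mem_filter, Finset.mem_product, Finset.mem_range] at hq
    exact sub_ne_zero.2 (hinj i hq.1.1 j hq.1.2 hq.2))
  have memS' : ∀ i < n + 2, p (i + 1) - p i ∈ S := by
    intro i hi
    rcases Nat.lt_or_ge (i + 1) (n + 2) with h | h
    · exact memS _ h _ hi (by omega)
    · obtain rfl : i = n + 1 := by omega
      rw [h0]; exact memS _ (by omega) _ hi (by omega)
  have hpos : ∀ i < n + 2,
      0 < planeCross (p (i + 1) - p i) ℓ * planeCross (p (i + 1) - p i) ℓ' :=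
    fun i hi => hS1 _ (memS' i hi) (hpar i hi)
  have hpos' : ∀ i < n + 2,
      0 < planeCross (p (i + 2) - p (i + 1)) ℓ * planeCross (p (i + 2) - p (i + 1)) ℓ' := by
    intro i hi
    rcases Nat.lt_or_ge (i + 1) (n + 2) with h | h
    · exact hpos (i + 1) h
    · obtain rfl : i = n + 1 := by omega
      have := hpos 0 (by omega)
      rwa [show n + 1 + 2 = n + 3 from rfl, show n + 1 + 1 = n + 2 from rfl, h0, h1]
  have hfst : ∀ i j, (straighten ℓ' (p i)).1 - (straighten ℓ' (p j)).1 =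
      planeCross (p i - p j) ℓ' := by
    intro i j; simp only [straighten_apply, planeCross, Prod.fst_sub, Prod.snd_sub]; ring
  have main := sum_turnsUp_of_generic hn (fun i => straighten ℓ' (p i)) (by simp only [h0])
    (by simp only [h1])
    (fun i hi j hj hij h => hS0 _ (memS i hi j hj hij) (by rw [← hfst]; exact sub_eq_zero.2 h))
    (by
      intro i j hij hj h
      have e : ∀ a b, segment ℝ (straighten ℓ' a) (straighten ℓ' b) =
          straighten ℓ' '' segment ℝ a b :=
        fun a b => (image_segment ℝ (straighten ℓ').toAffineMap a b).symm
      simp only [e]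
      exact (Set.disjoint_image_iff (straighten_injective hℓ')).2 (hd i j hij hj h))
    (by
      intro i hi h
      rw [hfst, hfst] at h
      rw [← map_sub, ← map_sub, planeCross_straighten]
      refine mul_ne_zero hℓ'.ne' (hne i hi ?_)
      have a := hpos i hi
      have b := hpos' i hi
      rcases pos_and_pos_or_neg_and_neg_of_mul_pos a with ⟨h1, h2⟩ | ⟨h1, h2⟩ <;>
      rcases pos_and_pos_or_neg_and_neg_of_mul_pos b with ⟨h3, h4⟩ | ⟨h3, h4⟩ <;> nlinarith)
  rw [Finset.prod_congr rfl fun i hi => (turnSign_congr (hpos i (Finset.mem_range.1 hi))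
    (hpos' i (Finset.mem_range.1 hi))).trans (turnSign_eq_of_turnsUp hℓ'), prod_sign_of_sum, main,
    if_pos rfl]

/-- The sign of a real number, with value `1` at zero. -/
noncomputable def sgn (x : ℝ) : ℝ := if x < 0 then -1 else 1

theorem sgn_of_neg {x : ℝ} (h : x < 0) : sgn x = -1 := if_pos h

theorem sgn_of_nonneg {x : ℝ} (h : 0 ≤ x) : sgn x = 1 := if_neg h.not_gt

theorem sgn_mul_self (x : ℝ) : sgn x * sgn x = 1 := by unfold sgn; split_ifs <;> norm_num

theorem abs_sgn (x : ℝ) : |sgn x| = 1 := by unfold sgn; split_ifs <;> norm_num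

theorem sgn_mul {x y : ℝ} (hx : x ≠ 0) (hy : y ≠ 0) : sgn (x * y) = sgn x * sgn y := by
  rcases lt_or_gt_of_ne hx with h | h <;> rcases lt_or_gt_of_ne hy with h' | h'
  · rw [sgn_of_neg h, sgn_of_neg h', sgn_of_nonneg (by nlinarith)]; norm_num
  · rw [sgn_of_neg h, sgn_of_nonneg h'.le, sgn_of_neg (by nlinarith)]; norm_num
  · rw [sgn_of_nonneg h.le, sgn_of_neg h', sgn_of_neg (by nlinarith)]; norm_num
  · rw [sgn_of_nonneg h.le, sgn_of_nonneg h'.le, sgn_of_nonneg (by positivity)]; norm_num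

theorem sgn_neg {x : ℝ} (hx : x ≠ 0) : sgn (-x) = -sgn x := by
  rcases lt_or_gt_of_ne hx with h | h
  · rw [sgn_of_neg h, sgn_of_nonneg (by linarith)]; norm_num
  · rw [sgn_of_nonneg h.le, sgn_of_neg (by linarith)]

theorem sgn_mul_pos {x y : ℝ} (hx : 0 < x) : sgn (x * y) = sgn y := by
  unfold sgn
  simp only [mul_neg_iff, hx, hx.not_gt, true_and, false_and, or_false]

theorem turnSign_mul_self (ℓ a b : ℝ × ℝ) : turnSign ℓ a b * turnSign ℓ a b = 1 := by
  unfold turnSign; split_ifs <;> norm_num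

theorem planeCross_sub_left (a b c : ℝ × ℝ) :
    planeCross (a - b) c = planeCross a c - planeCross b c := by
  unfold planeCross; simp only [Prod.fst_sub, Prod.snd_sub]; ring

theorem planeCross_add_left (a b c : ℝ × ℝ) :
    planeCross (a + b) c = planeCross a c + planeCross b c := by
  unfold planeCross; simp only [Prod.fst_add, Prod.snd_add]; ring

theorem planeCross_add_right (a b c : ℝ × ℝ) :
    planeCross a (b + c) = planeCross a b + planeCross a c := by
  unfold planeCross; simp only [Prod.fst_add, Prod.snd_add]; ring

theorem planeCross_sub_right (a b c : ℝ × ℝ) :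
    planeCross a (b - c) = planeCross a b - planeCross a c := by
  unfold planeCross; simp only [Prod.fst_sub, Prod.snd_sub]; ring

theorem planeCross_smul_left (t : ℝ) (a b : ℝ × ℝ) :
    planeCross (t • a) b = t * planeCross a b := by
  unfold planeCross; simp only [Prod.smul_fst, Prod.smul_snd, smul_eq_mul]; ring

theorem planeCross_smul_right (t : ℝ) (a b : ℝ × ℝ) :
    planeCross a (t • b) = t * planeCross a b := by
  unfold planeCross; simp only [Prod.smul_fst, Prod.smul_snd, smul_eq_mul]; ring

theorem planeCross_self (a : ℝ × ℝ) : planeCross a a = 0 := by unfold planeCross; ring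

theorem planeCross_neg_left (a b : ℝ × ℝ) : planeCross (-a) b = -planeCross a b := by
  unfold planeCross; simp only [Prod.fst_neg, Prod.snd_neg]; ring

theorem planeCross_neg_right (a b : ℝ × ℝ) : planeCross a (-b) = -planeCross a b := by
  unfold planeCross; simp only [Prod.fst_neg, Prod.snd_neg]; ring

theorem exists_mem_segment_iff {z a b : ℝ × ℝ} :
    z ∈ segment ℝ a b ↔ ∃ t : ℝ, 0 ≤ t ∧ t ≤ 1 ∧ z = a + t • (b - a) := by
  rw [segment_eq_image']
  constructor
  · rintro ⟨t, ⟨h0, h1⟩, rfl⟩; exact ⟨t, h0, h1, rfl⟩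
  · rintro ⟨t, h0, h1, rfl⟩; exact ⟨t, ⟨h0, h1⟩, rfl⟩

namespace PBDTPNetwork

variable {V : Type*} {n : ℕ} (N : PBDTPNetwork V n) {ℓ : ℝ × ℝ}

theorem isInternal_or (v : V) : N.IsInternal v ∨ ∃ i, v = N.bdry i := by
  by_cases h : v ∈ Set.range N.bdry
  · obtain ⟨i, rfl⟩ := h; exact Or.inr ⟨i, rfl⟩
  · exact Or.inl h

theorem not_isInternal_bdry (i : Fin n) : ¬ N.IsInternal (N.bdry i) := fun h => h ⟨i, rfl⟩

theorem bdry_fst_ne {i j : Fin n} (h : i ≠ j) : (N.pos (N.bdry i)).1 ≠ (N.pos (N.bdry j)).1 := by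
  rcases lt_or_gt_of_ne h with h | h
  · exact (N.bdry_clockwise _ _ h).ne'
  · exact (N.bdry_clockwise _ _ h).ne

theorem bdry_injective : Function.Injective N.bdry := by
  intro i j h
  by_contra hne
  exact N.bdry_fst_ne hne (by rw [h])

theorem pos_snd_nonneg (v : V) : 0 ≤ (N.pos v).2 := by
  rcases N.isInternal_or v with h | ⟨i, rfl⟩
  · exact (N.internal_inside v h).le
  · exact (N.bdry_on_axis i).ge

theorem isInternal_of_adj_bdry {i : Fin n} {v : V} (h : N.graph.Adj (N.bdry i) v) :
    N.IsInternal v := by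
  obtain ⟨w, hw, hw', -⟩ := N.bdry_edge i
  have : v ∈ N.graph.neighborSet (N.bdry i) := h
  rw [hw, Set.mem_singleton_iff] at this
  exact this ▸ hw'

theorem eq_of_adj_bdry {i : Fin n} {v w : V} (h : N.graph.Adj (N.bdry i) v)
    (h' : N.graph.Adj (N.bdry i) w) : v = w := by
  obtain ⟨u, hu, -⟩ := N.bdry_edge i
  have a : v ∈ N.graph.neighborSet (N.bdry i) := h
  have b : w ∈ N.graph.neighborSet (N.bdry i) := h'
  rw [hu, Set.mem_singleton_iff] at a b
  rw [a, b]

theorem edgeDir_swap (u v : V) : N.edgeDir v u = -N.edgeDir u v := by unfold edgeDir; abel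

/-- The signed distance of `v` from the line of the gauge ray at the boundary vertex `b_l`. -/
noncomputable def side (ℓ : ℝ × ℝ) (l : Fin n) (v : V) : ℝ :=
  planeCross (N.pos v - N.pos (N.bdry l)) ℓ

theorem side_bdry (l j : Fin n) :
    N.side ℓ l (N.bdry j) = ((N.pos (N.bdry j)).1 - (N.pos (N.bdry l)).1) * ℓ.2 := by
  unfold side planeCross
  simp only [Prod.fst_sub, Prod.snd_sub, N.bdry_on_axis]; ring

theorem side_self (l : Fin n) : N.side ℓ l (N.bdry l) = 0 := by rw [side_bdry]; ring

theorem side_sub_side (l : Fin n) (u v : V) :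
    N.side ℓ l v - N.side ℓ l u = planeCross (N.edgeDir u v) ℓ := by
  unfold side edgeDir; rw [← planeCross_sub_left]; congr 1; abel

variable {N}

namespace IsGaugeDirection

theorem mem_openRay_of_planeCross_eq_zero (hℓ : N.IsGaugeDirection ℓ) {z : ℝ × ℝ} {l : Fin n}
    (hz : 0 < z.2) (h : planeCross (z - N.pos (N.bdry l)) ℓ = 0) :
    z ∈ openRay (N.pos (N.bdry l)) ℓ := by
  have h2 := hℓ.inside
  refine ⟨z.2 / ℓ.2, div_pos hz h2, ?_⟩
  unfold planeCross at h
  simp only [Prod.fst_sub, Prod.snd_sub, N.bdry_on_axis] at h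
  ext
  · simp; field_simp; linarith
  · simp [N.bdry_on_axis]; field_simp

theorem planeCross_of_mem_openRay {z p : ℝ × ℝ} (h : z ∈ openRay p ℓ) :
    planeCross (z - p) ℓ = 0 := by
  obtain ⟨t, -, rfl⟩ := h
  unfold planeCross; simp; ring

theorem snd_pos_of_mem_openRay (hℓ : N.IsGaugeDirection ℓ) {z : ℝ × ℝ} {l : Fin n}
    (h : z ∈ openRay (N.pos (N.bdry l)) ℓ) : 0 < z.2 := by
  obtain ⟨t, ht, rfl⟩ := h
  have := hℓ.inside
  simp [N.bdry_on_axis]; positivity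

theorem side_ne_zero (hℓ : N.IsGaugeDirection ℓ) {l : Fin n} {v : V} (h : v ≠ N.bdry l) :
    N.side ℓ l v ≠ 0 := by
  rcases N.isInternal_or v with hv | ⟨j, rfl⟩
  · intro h0
    exact hℓ.avoids l v hv (hℓ.mem_openRay_of_planeCross_eq_zero (N.internal_inside v hv) h0)
  · rw [side_bdry]
    refine mul_ne_zero (sub_ne_zero.2 (N.bdry_fst_ne ?_)) hℓ.inside.ne'
    rintro rfl; exact h rfl

theorem not_parallel_of_adj (hℓ : N.IsGaugeDirection ℓ) {u v : V} (h : N.graph.Adj u v) :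
    planeCross (N.edgeDir u v) ℓ ≠ 0 := by
  rcases N.isInternal_or u with hu | ⟨i, rfl⟩
  · rcases N.isInternal_or v with hv | ⟨i, rfl⟩
    · exact hℓ.not_parallel u v hu hv h
    · rw [← N.side_sub_side i, side_self, zero_sub]
      exact neg_ne_zero.2 (hℓ.side_ne_zero h.ne)
  · rw [← N.side_sub_side i, side_self, sub_zero]
    exact hℓ.side_ne_zero h.ne'

theorem ray_meets_iff (hℓ : N.IsGaugeDirection ℓ) {u v : V} (h : N.graph.Adj u v) (l : Fin n) :
    (openRay (N.pos (N.bdry l)) ℓ ∩ segment ℝ (N.pos u) (N.pos v)).Nonempty ↔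
      N.side ℓ l u * N.side ℓ l v < 0 := by
  have hside : ∀ t : ℝ, planeCross (N.pos u + t • (N.pos v - N.pos u) - N.pos (N.bdry l)) ℓ =
      (1 - t) * N.side ℓ l u + t * N.side ℓ l v := by
    intro t; unfold side planeCross; simp; ring
  constructor
  · rintro ⟨z, hz, hz'⟩
    obtain ⟨t, h0, h1, rfl⟩ := exists_mem_segment_iff.1 hz'
    have e := planeCross_of_mem_openRay hz
    have hpos := hℓ.snd_pos_of_mem_openRay hz
    rw [hside] at e
    by_cases hu : u = N.bdry l
    · subst hu
      have hv := hℓ.side_ne_zero (l := l) h.ne'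
      rw [side_self, mul_zero, zero_add] at e
      have ht := (mul_eq_zero.1 e).resolve_right hv
      rw [ht] at hpos; simp [N.bdry_on_axis] at hpos
    · by_cases hv : v = N.bdry l
      · subst hv
        have hu' := hℓ.side_ne_zero (l := l) hu
        rw [side_self, mul_zero, add_zero] at e
        have ht : t = 1 := by have := (mul_eq_zero.1 e).resolve_right hu'; linarith
        rw [ht] at hpos; simp [N.bdry_on_axis] at hpos
      · have hu' := hℓ.side_ne_zero (l := l) hu
        have hv' := hℓ.side_ne_zero (l := l) hv
        rcases lt_or_gt_of_ne hu' with a | a <;> rcases lt_or_gt_of_ne hv' with b | b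
        · exfalso; rcases eq_or_lt_of_le h0 with rfl | h0
          · linarith
          · nlinarith
        · nlinarith
        · nlinarith
        · exfalso; rcases eq_or_lt_of_le h0 with rfl | h0
          · linarith
          · nlinarith
  · intro hneg
    set a := N.side ℓ l u
    set b := N.side ℓ l v
    have hab : a - b ≠ 0 := by intro h'; have : a = b := by linarith
                               rw [this] at hneg; nlinarith
    obtain ⟨t, ht0, ht1, ht⟩ : ∃ t : ℝ, 0 < t ∧ t < 1 ∧ (1 - t) * a + t * b = 0 := by
      refine ⟨a / (a - b), ?_, ?_, by field_simp; ring⟩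
      · rcases mul_neg_iff.1 hneg with ⟨h1, h2⟩ | ⟨h1, h2⟩
        · exact div_pos h1 (by linarith)
        · exact div_pos_of_neg_of_neg h1 (by linarith)
      · rcases mul_neg_iff.1 hneg with ⟨h1, h2⟩ | ⟨h1, h2⟩
        · rw [div_lt_one (by linarith)]; linarith
        · rw [div_lt_one_of_neg (by linarith)]; linarith
    refine ⟨N.pos u + t • (N.pos v - N.pos u), hℓ.mem_openRay_of_planeCross_eq_zero ?_
      (by rw [hside, ht]), exists_mem_segment_iff.2 ⟨t, ht0.le, ht1.le, rfl⟩⟩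
    have e : (N.pos u + t • (N.pos v - N.pos u)).2 = (1 - t) * (N.pos u).2 + t * (N.pos v).2 := by
      simp; ring
    rw [e]
    have hu := N.pos_snd_nonneg u
    have hv := N.pos_snd_nonneg v
    rcases N.isInternal_or u with hu' | ⟨i, rfl⟩
    · have := N.internal_inside u hu'; nlinarith [mul_nonneg ht0.le hv, mul_pos (sub_pos.2 ht1) this]
    · have := N.internal_inside v (N.isInternal_of_adj_bdry h)
      nlinarith [mul_pos ht0 this, mul_nonneg (sub_pos.2 ht1).le hu]

theorem neg_one_zpow_crossings (hℓ : N.IsGaugeDirection ℓ) (O : V → V → Prop) {u v : V}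
    (h : N.graph.Adj u v) : (-1 : ℝ) ^ N.crossings ℓ O u v =
      ∏ l ∈ N.sources O, sgn (N.side ℓ l u * N.side ℓ l v) := by
  unfold crossings sgn
  simp only [hℓ.ray_meets_iff h]
  rw [zpow_natCast, Finset.prod_ite]
  simp

end IsGaugeDirection

theorem eq_of_mem_segments {u v x y w : V} (huv : N.graph.Adj u v) (hxy : N.graph.Adj x y)
    {z : ℝ × ℝ} (hne : s(u, v) ≠ s(x, y)) (h1 : z ∈ segment ℝ (N.pos u) (N.pos v))
    (h2 : z ∈ segment ℝ (N.pos x) (N.pos y)) (hw : w ∈ s(u, v)) (hw' : w ∈ s(x, y)) :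
    z = N.pos w := by
  obtain ⟨w', hw1, hw2, rfl⟩ := N.planar u v x y huv hxy hne z ⟨h1, h2⟩
  by_contra hc
  have hww : w' ≠ w := fun h => hc (by rw [h])
  exact hne (((Sym2.mem_and_mem_iff hww).1 ⟨hw1, hw⟩).trans
    ((Sym2.mem_and_mem_iff hww).1 ⟨hw2, hw'⟩).symm)

theorem disjoint_segments {u v x y : V} (huv : N.graph.Adj u v) (hxy : N.graph.Adj x y)
    (h1 : u ≠ x) (h2 : u ≠ y) (h3 : v ≠ x) (h4 : v ≠ y) :
    Disjoint (segment ℝ (N.pos u) (N.pos v)) (segment ℝ (N.pos x) (N.pos y)) := by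
  rw [Set.disjoint_left]
  intro z hz hz'
  have hne : s(u, v) ≠ s(x, y) := by
    rw [Ne, Sym2.eq_iff]; tauto
  obtain ⟨w, hw, hw', -⟩ := N.planar u v x y huv hxy hne z ⟨hz, hz'⟩
  rw [Sym2.mem_iff] at hw hw'
  rcases hw with rfl | rfl <;> rcases hw' with rfl | rfl <;> contradiction

theorem planeCross_ne_zero_of_turn {u v x : V} (huv : N.graph.Adj u v) (hvx : N.graph.Adj v x)
    (hux : u ≠ x)
    (hneg : planeCross (N.edgeDir u v) ℓ * planeCross (N.edgeDir v x) ℓ < 0) :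
    planeCross (N.edgeDir u v) (N.edgeDir v x) ≠ 0 := by
  intro h0
  set e := N.edgeDir u v with he
  set f := N.edgeDir v x with hf
  set a := planeCross e ℓ with ha
  set b := planeCross f ℓ with hb
  have ha0 : a ≠ 0 := fun h => by rw [h] at hneg; simp at hneg
  have hb0 : b ≠ 0 := fun h => by rw [h] at hneg; simp at hneg
  have hrel : a • f = b • e := by
    rw [ha, hb]; unfold planeCross at h0 ⊢
    ext <;> simp
    · linear_combination ℓ.1 * h0
    · linear_combination ℓ.2 * h0
  -- a point at distance `|a| / (|a| + |b|)` along `f`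
  set s := |a| / (|a| + |b|) with hs
  have hA := abs_pos.2 ha0
  have hB := abs_pos.2 hb0
  have hs0 : 0 < s := by positivity
  have hs1 : s ≤ 1 := by rw [hs, div_le_one (by positivity)]; linarith
  set r := |b| / (|a| + |b|) with hr
  have hr0 : 0 < r := by positivity
  have hr1 : r ≤ 1 := by rw [hr, div_le_one (by positivity)]; linarith
  have hfe : s • f = -(r • e) := by
    have h1 : |a| • f = -(|b| • e) := by
      rcases mul_neg_iff.1 hneg with ⟨h1, h2⟩ | ⟨h1, h2⟩
      · rw [abs_of_pos h1, abs_of_neg h2, hrel]; simp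
      · rw [abs_of_neg h1, abs_of_pos h2, neg_smul, hrel]
    have h2 : s • f = (1 / (|a| + |b|)) • (|a| • f) := by rw [smul_smul, hs]; congr 1; ring
    rw [h2, h1, smul_neg, smul_smul, hr]; congr 2; ring
  have hz1 : N.pos v + s • f ∈ segment ℝ (N.pos v) (N.pos x) :=
    exists_mem_segment_iff.2 ⟨s, hs0.le, hs1, rfl⟩
  have hz2 : N.pos v + s • f ∈ segment ℝ (N.pos u) (N.pos v) := by
    refine exists_mem_segment_iff.2 ⟨1 - r, by linarith, by linarith, ?_⟩
    rw [hfe, he, edgeDir]; module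
  have := N.eq_of_mem_segments huv hvx (by rw [Ne, Sym2.eq_iff]; have := huv.ne; tauto) hz2 hz1
    (Sym2.mem_mk_right u v) (Sym2.mem_mk_left v x)
  have h3 : s • f = 0 := by simpa using this
  rcases smul_eq_zero.1 h3 with h | h
  · exact hs0.ne' h
  · rw [h] at hb; apply hb0; rw [hb]; simp [planeCross]

end PBDTPNetwork

theorem prod_range_sgn_mul (f : ℕ → ℝ) (m : ℕ) (h : ∀ i ≤ m, f i ≠ 0) :
    ∏ i ∈ Finset.range m, sgn (f i * f (i + 1)) = sgn (f 0) * sgn (f m) := by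
  induction m with
  | zero => simp [sgn_mul_self]
  | succ m ih =>
    rw [Finset.prod_range_succ, ih fun i hi => h i (by omega), sgn_mul (h m (by omega)) (h _ le_rfl),
      mul_assoc, ← mul_assoc (sgn (f m)), sgn_mul_self, one_mul]

namespace PBDTPNetwork

variable {V : Type*} {n : ℕ} {N : PBDTPNetwork V n} {ℓ : ℝ × ℝ}

/-- The sign with which the edge `(v, x)` enters the linear relation for the edge `(u, v)`. -/
noncomputable def stepSign (N : PBDTPNetwork V n) (ℓ : ℝ × ℝ) (O : V → V → Prop) (u v x : V) : ℝ :=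
  (-1 : ℝ) ^ (N.crossings ℓ O u v + N.wind ℓ u v x)

/-- The sign `(-1)^{int(e)}`. -/
noncomputable def crossSign (N : PBDTPNetwork V n) (ℓ : ℝ × ℝ) (O : V → V → Prop) (u v : V) : ℝ :=
  ∏ l ∈ N.sources O, sgn (N.side ℓ l u * N.side ℓ l v)

theorem crossSign_comm (O : V → V → Prop) (u v : V) :
    N.crossSign ℓ O u v = N.crossSign ℓ O v u := by
  unfold crossSign; simp only [mul_comm (N.side ℓ _ u)]

theorem crossSign_mul_self (O : V → V → Prop) (u v : V) :
    N.crossSign ℓ O u v * N.crossSign ℓ O u v = 1 := by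
  unfold crossSign; rw [← Finset.prod_mul_distrib]; simp [sgn_mul_self]

theorem abs_crossSign (O : V → V → Prop) (u v : V) : |N.crossSign ℓ O u v| = 1 := by
  unfold crossSign; rw [Finset.abs_prod]; simp [abs_sgn]

theorem stepSign_eq (hℓ : N.IsGaugeDirection ℓ) (O : V → V → Prop) {u v x : V}
    (h : N.graph.Adj u v) :
    N.stepSign ℓ O u v x = N.crossSign ℓ O u v * turnSign ℓ (N.edgeDir u v) (N.edgeDir v x) := by
  unfold stepSign crossSign wind
  rw [zpow_add₀ (by norm_num), hℓ.neg_one_zpow_crossings O h,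
    neg_one_zpow_localWind (hℓ.not_parallel_of_adj h)]

/-- The vertices `q 0, …, q (m + 1)` span disjoint edges, if they are not consecutive. -/
theorem disjoint_edges_of_injOn {m : ℕ} {q : ℕ → V}
    (hinj : ∀ i < m + 2, ∀ j < m + 2, i ≠ j → q i ≠ q j) {i j : ℕ}
    (hij : i + 1 < j) (hj : j + 1 < m + 2) (hi : N.graph.Adj (q i) (q (i + 1)))
    (hj' : N.graph.Adj (q j) (q (j + 1))) :
    Disjoint (segment ℝ (N.pos (q i)) (N.pos (q (i + 1))))
      (segment ℝ (N.pos (q j)) (N.pos (q (j + 1)))) :=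
  disjoint_segments hi hj' (hinj _ (by omega) _ (by omega) (by omega))
    (hinj _ (by omega) _ (by omega) (by omega)) (hinj _ (by omega) _ (by omega) (by omega))
    (hinj _ (by omega) _ (by omega) (by omega))

theorem prod_stepSign_cycle (hℓ : N.IsGaugeDirection ℓ) (O : V → V → Prop) {m : ℕ} (hm : 1 ≤ m)
    (q : ℕ → V) (h0 : q (m + 2) = q 0) (h1 : q (m + 3) = q 1)
    (hinj : ∀ i < m + 2, ∀ j < m + 2, i ≠ j → q i ≠ q j)
    (hadj : ∀ i < m + 2, N.graph.Adj (q i) (q (i + 1))) (hint : ∀ i, N.IsInternal (q i)) :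
    ∏ i ∈ Finset.range (m + 2), N.stepSign ℓ O (q i) (q (i + 1)) (q (i + 2)) = -1 := by
  have hadj' : ∀ i < m + 2, N.graph.Adj (q (i + 1)) (q (i + 2)) := by
    intro i hi
    rcases Nat.lt_or_ge (i + 1) (m + 2) with h | h
    · exact hadj _ h
    · obtain rfl : i = m + 1 := by omega
      show N.graph.Adj (q (m + 2)) (q (m + 3))
      rw [h0, h1]; exact hadj 0 (by omega)
  have hne2 : ∀ i < m + 2, q i ≠ q (i + 2) := by
    intro i hi
    rcases Nat.lt_or_ge (i + 2) (m + 2) with h | h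
    · exact hinj _ hi _ h (by omega)
    · rcases Nat.lt_or_ge (i + 1) (m + 2) with h' | h'
      · obtain rfl : i = m := by omega
        rw [h0]; exact hinj _ (by omega) _ (by omega) (by omega)
      · obtain rfl : i = m + 1 := by omega
        rw [show m + 1 + 2 = m + 3 from rfl, h1]; exact hinj _ (by omega) _ (by omega) (by omega)
  rw [Finset.prod_congr rfl fun i hi => stepSign_eq hℓ O (hadj i (Finset.mem_range.1 hi)),
    Finset.prod_mul_distrib]
  have hturn := prod_turnSign_of_simple hm hℓ.inside (fun i => N.pos (q i)) (by simp only [h0])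
    (by simp only [h1]) (fun i hi j hj hij h => hinj i hi j hj hij (N.pos_injective h))
    (fun i hi => hℓ.not_parallel_of_adj (hadj i hi))
    (by
      intro i j hij hj h
      rcases Nat.lt_or_ge (j + 1) (m + 2) with h' | h'
      · exact disjoint_edges_of_injOn hinj hij h' (hadj _ (by omega)) (hadj _ hj)
      · obtain rfl : j = m + 1 := by omega
        refine disjoint_segments (hadj _ (by omega)) (hadj _ hj) (hinj _ (by omega) _ hj (by omega))
          ?_ (hinj _ (by omega) _ hj (by omega)) ?_
        · rw [show m + 1 + 1 = m + 2 from rfl, h0]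
          exact hinj _ (by omega) _ (by omega) (by omega)
        · rw [show m + 1 + 1 = m + 2 from rfl, h0]
          exact hinj _ (by omega) _ (by omega) (by omega))
    (fun i hi h => planeCross_ne_zero_of_turn (hadj i hi) (hadj' i hi) (hne2 i hi) h)
  unfold edgeDir
  rw [hturn]
  unfold crossSign
  rw [Finset.prod_comm, Finset.prod_eq_one, one_mul]
  intro l _
  rw [prod_range_sgn_mul (fun i => N.side ℓ l (q i)) _ fun i _ => hℓ.side_ne_zero fun h =>
    N.not_isInternal_bdry l (h ▸ hint i), h0, sgn_mul_self]

theorem prod_sgn_between (hℓ : N.IsGaugeDirection ℓ) (S : Finset (Fin n)) {i j : Fin n}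
    (hi : i ∈ S) (hj : j ∉ S) :
    ∏ l ∈ S.erase i, sgn (N.side ℓ l (N.bdry i)) * sgn (N.side ℓ l (N.bdry j)) =
      (-1 : ℝ) ^ (S.filter fun l => min i j < l ∧ l < max i j).card := by
  have hℓ2 := hℓ.inside
  have key : ∀ l ∈ S.erase i, sgn (N.side ℓ l (N.bdry i)) * sgn (N.side ℓ l (N.bdry j)) =
      if min i j < l ∧ l < max i j then -1 else 1 := by
    intro l hl
    obtain ⟨hli, hlS⟩ := Finset.mem_erase.1 hl
    have hlj : l ≠ j := fun h => hj (h ▸ hlS)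
    have hneg : ∀ a, l < a → sgn (N.side ℓ l (N.bdry a)) = -1 := by
      intro a ha
      have := N.bdry_clockwise _ _ ha
      exact sgn_of_neg (by rw [side_bdry]; nlinarith)
    have hpos : ∀ a, a < l → sgn (N.side ℓ l (N.bdry a)) = 1 := by
      intro a ha
      have := N.bdry_clockwise _ _ ha
      exact sgn_of_nonneg (by rw [side_bdry]; nlinarith)
    rcases lt_or_gt_of_ne hli with h1 | h1 <;> rcases lt_or_gt_of_ne hlj with h2 | h2
    · rw [hneg _ h1, hneg _ h2, if_neg (by simp [h1.not_gt, h2.not_gt])]; norm_num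
    · rw [hneg _ h1, hpos _ h2, if_pos (by simp [h1, h2])]; norm_num
    · rw [hpos _ h1, hneg _ h2, if_pos (by simp [h1, h2])]; norm_num
    · rw [hpos _ h1, hpos _ h2, if_neg (by simp [h1.not_gt, h2.not_gt])]; norm_num
  rw [Finset.prod_congr rfl key, Finset.prod_ite]
  simp only [Finset.prod_const, one_pow, mul_one]
  congr 2
  ext l
  simp only [Finset.mem_filter, Finset.mem_erase]
  constructor
  · rintro ⟨⟨-, h⟩, h'⟩; exact ⟨h, h'⟩
  · rintro ⟨h, h'⟩
    refine ⟨⟨?_, h⟩, h'⟩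
    rintro rfl
    rcases le_total l j with h2 | h2 <;> simp [h2] at h'

theorem turnSign_axis {e a : ℝ × ℝ} (hℓ : 0 < ℓ.2) (he : e.2 < 0) (ha : a.2 = 0) :
    turnSign ℓ e a = 1 := by
  apply if_neg
  rintro ⟨h1, h2⟩
  unfold planeCross at *
  rw [ha] at h1 h2
  have e1 : (e.1 * ℓ.2 - e.2 * ℓ.1) * (a.1 * ℓ.2 - 0 * ℓ.1) =
    ((e.1 * ℓ.2 - e.2 * ℓ.1) * a.1) * ℓ.2 := by ring
  have e2 : (e.1 * ℓ.2 - e.2 * ℓ.1) * (e.1 * 0 - e.2 * a.1) =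
    ((e.1 * ℓ.2 - e.2 * ℓ.1) * a.1) * (-e.2) := by ring
  rw [e1] at h1; rw [e2] at h2
  nlinarith

theorem axis_turnSign {e a : ℝ × ℝ} (hℓ : 0 < ℓ.2) (he : 0 < e.2) (ha : a.2 = 0)
    (ha1 : a.1 ≠ 0) (hpar : planeCross e ℓ ≠ 0) :
    turnSign ℓ a e = sgn (a.1) * sgn (planeCross e ℓ) := by
  have haℓ : planeCross a ℓ = a.1 * ℓ.2 := by unfold planeCross; rw [ha]; ring
  have hae : planeCross a e = a.1 * e.2 := by unfold planeCross; rw [ha]; ring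
  unfold turnSign
  rw [haℓ, hae]
  have h2 : 0 < a.1 * ℓ.2 * (a.1 * e.2) := by
    have := mul_self_pos.2 ha1
    have e1 : a.1 * ℓ.2 * (a.1 * e.2) = (a.1 * a.1) * (ℓ.2 * e.2) := by ring
    rw [e1]; positivity
  simp only [h2, and_true]
  have e3 : a.1 * ℓ.2 * planeCross e ℓ = ℓ.2 * (a.1 * planeCross e ℓ) := by ring
  rw [← sgn_mul ha1 hpar, e3, ← sgn_mul_pos (x := ℓ.2) (y := a.1 * planeCross e ℓ) hℓ]
  rfl

/-- The sign of a simple path from a boundary source `b_i` to a boundary sink `b_j`. -/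
theorem prod_sign_path (hℓ : N.IsGaugeDirection ℓ) (O : V → V → Prop) {m : ℕ} (hm : 1 ≤ m)
    (q : ℕ → V) {i j : Fin n} (hi : i ∈ N.sources O) (hj : j ∉ N.sources O)
    (h0 : q 0 = N.bdry i) (h1 : q (m + 1) = N.bdry j)
    (hinj : ∀ a < m + 2, ∀ b < m + 2, a ≠ b → q a ≠ q b)
    (hadj : ∀ a < m + 1, N.graph.Adj (q a) (q (a + 1)))
    (hint : ∀ a, 0 < a → a < m + 1 → N.IsInternal (q a)) :
    (∏ a ∈ Finset.range m, N.stepSign ℓ O (q a) (q (a + 1)) (q (a + 2))) *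
      N.crossSign ℓ O (q m) (q (m + 1)) =
        (-1 : ℝ) ^ ((N.sources O).filter fun l => min i j < l ∧ l < max i j).card := by
  have hij : i ≠ j := fun h => hj (h ▸ hi)
  have hℓ2 := hℓ.inside
  rw [Finset.prod_congr rfl fun a ha => stepSign_eq hℓ O (hadj a (by
    have := Finset.mem_range.1 ha; omega)), Finset.prod_mul_distrib, mul_right_comm,
    ← Finset.prod_range_succ (fun a => N.crossSign ℓ O (q a) (q (a + 1)))]
  set p : ℕ → ℝ × ℝ := fun a => if a < m + 2 then N.pos (q a) else N.pos (q (a - (m + 2))) with hp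
  have hp1 : ∀ a < m + 2, p a = N.pos (q a) := fun a ha => if_pos ha
  have hp2 : p (m + 2) = N.pos (N.bdry i) := by simp only [hp]; rw [if_neg (by omega)]; simp [h0]
  have hp3 : p (m + 3) = N.pos (q 1) := by
    simp only [hp]; rw [if_neg (by omega)]; congr 2; omega
  have hpj : p (m + 1) = N.pos (N.bdry j) := by rw [hp1 _ (by omega), h1]
  have hpi : p 0 = N.pos (N.bdry i) := by rw [hp1 _ (by omega), h0]
  have hedge : ∀ a < m + 1, p (a + 1) - p a = N.edgeDir (q a) (q (a + 1)) := by
    intro a ha; rw [hp1 _ (by omega), hp1 _ (by omega)]; rfl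
  have hadj0 : N.graph.Adj (N.bdry i) (q 1) := by have := hadj 0 (by omega); rwa [h0] at this
  have haxis2 : (p (m + 2) - p (m + 1)).2 = 0 := by
    rw [hp2, hpj]; simp [N.bdry_on_axis]
  have haxis1 : (p (m + 2) - p (m + 1)).1 ≠ 0 := by
    rw [hp2, hpj]; simp only [Prod.fst_sub]; exact sub_ne_zero.2 (N.bdry_fst_ne hij)
  have hlast : (p (m + 1) - p m).2 < 0 := by
    rw [hpj, hp1 m (by omega)]
    have := N.internal_inside _ (hint m (by omega) (by omega))
    simp [N.bdry_on_axis, this]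
  have hfirst : p (m + 3) - p (m + 2) = N.edgeDir (q 0) (q 1) := by
    rw [hp3, hp2, h0]; rfl
  have hfirst2 : 0 < (N.edgeDir (q 0) (q 1)).2 := by
    unfold edgeDir; rw [h0]; simp [N.bdry_on_axis, N.internal_inside _ (N.isInternal_of_adj_bdry hadj0)]
  have hpar0 := hℓ.not_parallel_of_adj (hadj 0 (by omega))
  have hturn := prod_turnSign_of_simple hm hℓ2 p (by rw [hp2, hpi]) (by rw [hp3, hp1 _ (by omega)])
    (fun a ha b hb hab h => by
      rw [hp1 _ ha, hp1 _ hb] at h; exact hinj a ha b hb hab (N.pos_injective h))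
    (fun a ha => by
      rcases Nat.lt_or_ge a (m + 1) with h | h
      · rw [hedge a h]; exact hℓ.not_parallel_of_adj (hadj a h)
      · obtain rfl : a = m + 1 := by omega
        show planeCross (p (m + 2) - p (m + 1)) ℓ ≠ 0
        unfold planeCross; rw [haxis2, zero_mul, sub_zero]; exact mul_ne_zero haxis1 hℓ2.ne')
    (by
      intro a b hab hb h
      rcases Nat.lt_or_ge (b + 1) (m + 2) with h' | h'
      · rw [hp1 a (by omega), hp1 _ (by omega), hp1 b (by omega), hp1 _ (by omega)]
        exact disjoint_edges_of_injOn hinj hab h' (hadj _ (by omega)) (hadj _ (by omega))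
      · obtain rfl : b = m + 1 := by omega
        show Disjoint _ (segment ℝ (p (m + 1)) (p (m + 2)))
        rw [Set.disjoint_left]
        intro z hz hz'
        obtain ⟨t, ht0, ht1, hzt⟩ := exists_mem_segment_iff.1 hz
        obtain ⟨s, hs0, hs1, hzs⟩ := exists_mem_segment_iff.1 hz'
        have hz2 : z.2 = 0 := by
          rw [hzs]; simp only [Prod.snd_add, Prod.smul_snd]; rw [haxis2, hpj]; simp [N.bdry_on_axis]
        rw [hp1 a (by omega), hp1 _ (by omega)] at hzt
        have ha := N.internal_inside _ (hint a (by omega) (by omega))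
        have ha' := N.internal_inside _ (hint (a + 1) (by omega) (by omega))
        have e : z.2 = (1 - t) * (N.pos (q a)).2 + t * (N.pos (q (a + 1))).2 := by
          rw [hzt]; simp; ring
        rw [hz2] at e
        rcases eq_or_lt_of_le ht0 with rfl | ht0
        · linarith
        · nlinarith)
    (by
      intro a ha hneg
      rcases Nat.lt_or_ge a m with h | h
      · rw [hedge a (by omega), hedge (a + 1) (by omega)] at hneg ⊢
        exact planeCross_ne_zero_of_turn (hadj _ (by omega)) (hadj _ (by omega))
          (hinj _ (by omega) _ (by omega) (by omega)) hneg
      · rcases Nat.lt_or_ge a (m + 1) with h' | h'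
        · obtain rfl : a = m := by omega
          show planeCross _ (p (a + 2) - p (a + 1)) ≠ 0
          unfold planeCross; rw [haxis2, mul_zero, zero_sub]
          exact neg_ne_zero.2 (mul_ne_zero hlast.ne haxis1)
        · obtain rfl : a = m + 1 := by omega
          show planeCross (p (m + 2) - p (m + 1)) (p (m + 3) - p (m + 2)) ≠ 0
          rw [hfirst]
          unfold planeCross; rw [haxis2, zero_mul, sub_zero]
          exact mul_ne_zero haxis1 hfirst2.ne')
  rw [Finset.prod_range_succ, Finset.prod_range_succ] at hturn
  have t1 : turnSign ℓ (p (m + 1) - p m) (p (m + 2) - p (m + 1)) = 1 :=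
    turnSign_axis hℓ2 hlast haxis2
  have t2 : turnSign ℓ (p (m + 1 + 1) - p (m + 1)) (p (m + 1 + 2) - p (m + 1 + 1)) =
      sgn ((p (m + 2) - p (m + 1)).1) * sgn (planeCross (N.edgeDir (q 0) (q 1)) ℓ) := by
    show turnSign ℓ (p (m + 2) - p (m + 1)) (p (m + 3) - p (m + 2)) = _
    rw [hfirst]; exact axis_turnSign hℓ2 hfirst2 haxis2 haxis1 hpar0
  rw [t1, t2, mul_one] at hturn
  have hT : ∏ a ∈ Finset.range m,
      turnSign ℓ (N.edgeDir (q a) (q (a + 1))) (N.edgeDir (q (a + 1)) (q (a + 2))) =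
        ∏ a ∈ Finset.range m, turnSign ℓ (p (a + 1) - p a) (p (a + 2) - p (a + 1)) := by
    refine Finset.prod_congr rfl fun a ha => ?_
    have := Finset.mem_range.1 ha
    rw [← hedge a (by omega), ← hedge (a + 1) (by omega)]
  rw [hT]
  have hcross : ∏ a ∈ Finset.range (m + 1), N.crossSign ℓ O (q a) (q (a + 1)) =
      (sgn (N.side ℓ i (q 1)) * sgn (N.side ℓ i (N.bdry j))) *
        (-1 : ℝ) ^ ((N.sources O).filter fun l => min i j < l ∧ l < max i j).card := by
    unfold crossSign
    rw [Finset.prod_comm, ← Finset.mul_prod_erase _ _ hi, ← prod_sgn_between hℓ _ hi hj]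
    congr 1
    · rw [Finset.prod_range_succ', h0, side_self, zero_mul, sgn_of_nonneg le_rfl, mul_one]
      rw [prod_range_sgn_mul (fun a => N.side ℓ i (q (a + 1))) m, h1]
      intro a ha
      refine hℓ.side_ne_zero ?_
      rw [← h0]; exact hinj _ (by omega) _ (by omega) (by omega)
    · refine Finset.prod_congr rfl fun l hl => ?_
      obtain ⟨hli, hlS⟩ := Finset.mem_erase.1 hl
      rw [prod_range_sgn_mul (fun a => N.side ℓ l (q a)) (m + 1), h0, h1]
      intro a ha
      refine hℓ.side_ne_zero ?_
      rcases Nat.eq_zero_or_pos a with rfl | ha0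
      · rw [h0]; exact fun h => hli (N.bdry_injective h).symm
      · rcases Nat.lt_or_ge a (m + 1) with h | h
        · exact fun h' => N.not_isInternal_bdry l (h' ▸ hint a ha0 h)
        · obtain rfl : a = m + 1 := by omega
          rw [h1]; exact fun h' => hj ((N.bdry_injective h') ▸ hlS)
  rw [hcross]
  have s1 : N.side ℓ i (q 1) = planeCross (N.edgeDir (q 0) (q 1)) ℓ := by
    rw [h0]; rfl
  have s2 : sgn (N.side ℓ i (N.bdry j)) = -sgn ((p (m + 2) - p (m + 1)).1) := by
    rw [side_bdry, hp2, hpj, mul_comm, sgn_mul_pos hℓ2, ← sgn_neg]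
    · simp
    · simpa using sub_ne_zero.2 (N.bdry_fst_ne hij)
  rw [s1, s2]
  set A := sgn ((p (m + 2) - p (m + 1)).1)
  set B := sgn (planeCross (N.edgeDir (q 0) (q 1)) ℓ)
  linear_combination (-(-1 : ℝ) ^ ((N.sources O).filter fun l => min i j < l ∧ l < max i j).card) *
    hturn

end PBDTPNetwork

section CyclicProducts

variable {D : Type*} [Fintype D] [DecidableEq D]

/-- Along every cyclic permutation the entries of `K` have a nonpositive product. -/
def NegativeCycles (K : Matrix D D ℝ) : Prop :=
  ∀ c : Equiv.Perm D, c.IsCycle → (∀ e ∈ c.support, K e (c e) ≠ 0) →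
    ∏ e ∈ c.support, K e (c e) = -∏ e ∈ c.support, |K e (c e)|

theorem sign_mul_prod_support {K : Matrix D D ℝ} (hK : NegativeCycles K) (σ : Equiv.Perm D) :
    ((Equiv.Perm.sign σ : ℤ) : ℝ) * ∏ e ∈ σ.support, -K e (σ e) =
      ∏ e ∈ σ.support, |K e (σ e)| := by
  induction σ using Equiv.Perm.cycle_induction_on with
  | base_one => simp
  | base_cycles c hc =>
    by_cases h : ∀ e ∈ c.support, K e (c e) ≠ 0
    · rw [Finset.prod_neg, hK c hc h, hc.sign]
      push_cast
      have : ((-1 : ℝ) ^ c.support.card) * (-1) ^ c.support.card = 1 := by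
        rw [← mul_pow]; simp
      linear_combination (∏ e ∈ c.support, |K e (c e)|) * this
    · push Not at h
      obtain ⟨e, he, h0⟩ := h
      rw [Finset.prod_eq_zero he (by rw [h0, neg_zero]), Finset.prod_eq_zero he (by rw [h0, abs_zero]),
        mul_zero]
  | induction_disjoint σ τ hd _ h1 h2 =>
    have eσ : ∀ e ∈ σ.support, (σ * τ) e = σ e := by
      intro e he
      have : τ e = e := (hd e).resolve_left (Equiv.Perm.mem_support.1 he)
      rw [Equiv.Perm.mul_apply, this]
    have eτ : ∀ e ∈ τ.support, (σ * τ) e = τ e := by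
      intro e he
      rw [hd.commute.eq]
      have : σ e = e := (hd e).resolve_right (Equiv.Perm.mem_support.1 he)
      rw [Equiv.Perm.mul_apply, this]
    have split : ∀ g : D → D → ℝ, ∏ e ∈ (σ * τ).support, g e ((σ * τ) e) =
        (∏ e ∈ σ.support, g e (σ e)) * ∏ e ∈ τ.support, g e (τ e) := by
      intro g
      rw [hd.support_mul, Finset.prod_union hd.disjoint_support]
      exact congrArg₂ _ (Finset.prod_congr rfl fun e he => by rw [eσ e he])
        (Finset.prod_congr rfl fun e he => by rw [eτ e he])
    rw [split fun a b => -K a b, split fun a b => |K a b|, ← h1, ← h2, Equiv.Perm.sign_mul]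
    push_cast; ring

theorem det_one_sub_eq_sum {K : Matrix D D ℝ} (hK : NegativeCycles K) (h0 : ∀ e, K e e = 0) :
    (1 - K).det = ∑ σ : Equiv.Perm D, ∏ e ∈ σ.support, |K e (σ e)| := by
  rw [← Matrix.det_transpose, Matrix.det_apply']
  refine Finset.sum_congr rfl fun σ _ => ?_
  rw [← sign_mul_prod_support hK]
  congr 1
  rw [← Finset.prod_subset (Finset.subset_univ σ.support)]
  · refine Finset.prod_congr rfl fun e he => ?_
    have : e ≠ σ e := (Equiv.Perm.mem_support.1 he).symm
    simp [Matrix.one_apply_ne this]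
  · intro e _ he
    rw [Equiv.Perm.notMem_support] at he
    simp [he, h0]

theorem det_one_sub_pos {K : Matrix D D ℝ} (hK : NegativeCycles K) (h0 : ∀ e, K e e = 0) :
    0 < (1 - K).det := by
  rw [det_one_sub_eq_sum hK h0]
  refine Finset.sum_pos' (fun σ _ => Finset.prod_nonneg fun e _ => abs_nonneg _)
    ⟨1, Finset.mem_univ _, ?_⟩
  simp

/-- The support of a cycle is enumerated by its powers. -/
theorem prod_support_cycle {c : Equiv.Perm D} (hc : c.IsCycle) {e : D} (he : e ∈ c.support)
    (f : D → ℝ) : ∏ x ∈ c.support, f x = ∏ k ∈ Finset.range c.support.card, f ((c ^ k) e) ∧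
      (c ^ c.support.card) e = e ∧
      ∀ a < c.support.card, ∀ b < c.support.card, (c ^ a) e = (c ^ b) e → a = b := by
  have himg : c.support = (Finset.range c.support.card).image fun k => (c ^ k) e := by
    ext x
    simp only [Finset.mem_image, Finset.mem_range]
    constructor
    · intro hx
      have hs : c.SameCycle e x := hc.sameCycle (Equiv.Perm.mem_support.1 he)
        (Equiv.Perm.mem_support.1 hx)
      obtain ⟨i, hi, hix⟩ := hs.exists_pow_eq'
      rw [hc.orderOf] at hi
      exact ⟨i, hi, hix⟩
    · rintro ⟨i, -, rfl⟩
      exact Equiv.Perm.pow_apply_mem_support.2 he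
  have hinj : Set.InjOn (fun k => (c ^ k) e) (Finset.range c.support.card : Set ℕ) := by
    apply Finset.card_image_iff.1
    rw [← himg, Finset.card_range]
  refine ⟨?_, ?_, ?_⟩
  · conv_lhs => rw [himg]
    exact Finset.prod_image hinj
  · rw [← hc.orderOf, pow_orderOf_eq_one]; rfl
  · intro a ha b hb h
    exact hinj (by simpa using ha) (by simpa using hb) h

theorem one_sub_mulVec_unique {K : Matrix D D ℝ} (hK : NegativeCycles K) (h0 : ∀ e, K e e = 0)
    {x y : D → ℝ} (h : (1 - K).mulVec x = (1 - K).mulVec y) : x = y :=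
  Matrix.mulVec_injective_of_isUnit ((Matrix.isUnit_iff_isUnit_det _).2
    (isUnit_iff_ne_zero.2 (det_one_sub_pos hK h0).ne')) h

/-- Cramer's rule for a right-hand side supported at one place: if the column `i` of `K` vanishes,
the numerator is obtained by adding the entry `s` to `K` at `(j, i)`. -/
theorem solution_at_eq {K : Matrix D D ℝ} {i j : D} (hcol : ∀ e, K e i = 0) (hK : NegativeCycles K)
    (h0 : ∀ e, K e e = 0) {β s : ℝ} {x : D → ℝ}
    (hx : (1 - K).mulVec x = Pi.single j β) :
    s * (1 - K).det * x i = β * ((1 - K).det -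
      (1 - (K + Matrix.single j i s)).det) := by
  have hdet := (det_one_sub_pos hK h0).ne'
  have hcr : (1 - K).det * x i = ((1 - K).updateCol i (Pi.single j β)).det := by
    rw [← Matrix.cramer_apply]
    have h1 : (1 - K).mulVec (Matrix.cramer (1 - K) (Pi.single j β)) =
        (1 - K).mulVec ((1 - K).det • x) := by
      rw [Matrix.mulVec_cramer, Matrix.mulVec_smul, hx]
    have := one_sub_mulVec_unique hK h0 h1
    rw [this]; simp
  have hup : (1 - (K + Matrix.single j i s)) =
      (1 - K).updateCol i ((fun e => (1 - K) e i) + (-s) • Pi.single j 1) := by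
    ext a b
    by_cases hb : b = i
    · subst hb
      by_cases ha : a = j
      · subst ha; simp; ring
      · have ha' : j ≠ a := fun h => ha h.symm
        simp [Matrix.updateCol_self, ha, ha']
    · have hb' : i ≠ b := fun h => hb h.symm
      simp [hb, hb']
  have hβ : (Pi.single j β : D → ℝ) = β • Pi.single j 1 := by
    ext a; by_cases ha : a = j
    · subst ha; simp
    · simp [ha]
  rw [hup, Matrix.det_updateCol_add, Matrix.det_updateCol_smul, Matrix.updateCol_eq_self, mul_assoc,
    hcr, hβ, Matrix.det_updateCol_smul]
  ring

end CyclicProducts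

namespace PBDTPNetwork

variable {V : Type*} {n : ℕ} {N : PBDTPNetwork V n} {ℓ : ℝ × ℝ} {O : V → V → Prop}

/-- The directed edges of an orientation. -/
abbrev DirEdge (O : V → V → Prop) : Type _ := {e : V × V // O e.1 e.2}

theorem mem_sources {i : Fin n} : i ∈ N.sources O ↔ ∃ v, O (N.bdry i) v := by
  simp [sources]

namespace IsPerfect

theorem isInternal_of_in_out (hO : N.IsPerfect O) {u v x : V} (h : O u v) (h' : O v x) :
    N.IsInternal v := by
  rcases N.isInternal_or v with hv | ⟨i, rfl⟩
  · exact hv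
  · have : u = x := N.eq_of_adj_bdry (hO.adj _ _ h).symm (hO.adj _ _ h')
    subst this
    exact absurd h' (hO.asymm _ _ h)

theorem in_or_out_unique (hO : N.IsPerfect O) {v u u' x x' : V} (hu : O u v) (hu' : O u' v)
    (hx : O v x) (hx' : O v x') : u = u' ∨ x = x' := by
  have hv := hO.isInternal_of_in_out hu hx
  by_cases hw : N.white v
  · exact Or.inl ((hO.white v hv hw).unique hu hu')
  · exact Or.inr ((hO.black v hv hw).unique hx hx')

theorem exists_sink_edge (hO : N.IsPerfect O) {j : Fin n} (hj : j ∉ N.sources O) :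
    ∃ u, O u (N.bdry j) := by
  obtain ⟨v, hv, -⟩ := N.bdry_edge j
  have hadj : N.graph.Adj (N.bdry j) v := by
    have : v ∈ N.graph.neighborSet (N.bdry j) := by rw [hv]; rfl
    exact this
  rcases hO.total _ _ hadj with h | h
  · exact absurd (mem_sources.2 ⟨v, h⟩) hj
  · exact ⟨v, h⟩

theorem notMem_sources_of_edge (hO : N.IsPerfect O) {j : Fin n} {u : V} (h : O u (N.bdry j)) :
    j ∉ N.sources O := by
  intro hj
  obtain ⟨v, hv⟩ := mem_sources.1 hj
  exact N.not_isInternal_bdry j (hO.isInternal_of_in_out h hv)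

theorem eq_of_start_eq (hO : N.IsPerfect O) [Fintype (DirEdge O)] [DecidableEq (DirEdge O)]
    {c : Equiv.Perm (DirEdge O)}
    (hc : ∀ x ∈ c.support, x.1.2 = (c x).1.1 ∨ ¬ N.IsInternal (c x).1.1)
    {x y : DirEdge O} (hx : x ∈ c.support) (hy : y ∈ c.support) (h : x.1.1 = y.1.1) : x = y := by
  have pre : ∀ z ∈ c.support, ∃ p ∈ c.support, c p = z := fun z hz =>
    ⟨c⁻¹ z, Equiv.Perm.apply_mem_support.1 (by simpa using hz), by simp⟩
  obtain ⟨⟨x1, x2⟩, hxO⟩ := x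
  obtain ⟨⟨y1, y2⟩, hyO⟩ := y
  simp only at h
  subst h
  simp only at hxO hyO
  rcases N.isInternal_or x1 with hv | ⟨i, rfl⟩
  · obtain ⟨⟨⟨p1, p2⟩, hpO⟩, hp, hpx⟩ := pre _ hx
    obtain ⟨⟨⟨r1, r2⟩, hrO⟩, hr, hry⟩ := pre _ hy
    have e1 := (hc _ hp).resolve_right (by rw [hpx]; exact not_not.2 hv)
    have e2 := (hc _ hr).resolve_right (by rw [hry]; exact not_not.2 hv)
    rw [hpx] at e1; rw [hry] at e2
    simp only at e1 e2
    subst e1; subst e2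
    rcases hO.in_or_out_unique hpO hrO hxO hyO with rfl | rfl
    · rw [← hpx, ← hry]
    · rfl
  · have : x2 = y2 := N.eq_of_adj_bdry (hO.adj _ _ hxO) (hO.adj _ _ hyO)
    subst this; rfl

end IsPerfect

open Classical in
/-- The matrix of the linear relations of an orientation. -/
noncomputable def transfer (N : PBDTPNetwork V n) (ℓ : ℝ × ℝ) (O : V → V → Prop) :
    Matrix (DirEdge O) (DirEdge O) ℝ := fun e f =>
  if e.1.2 = f.1.1 then N.stepSign ℓ O e.1.1 e.1.2 f.1.2 * N.weight e.1.1 e.1.2 else 0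

theorem transfer_of_follows {e f : DirEdge O} (h : e.1.2 = f.1.1) :
    N.transfer ℓ O e f = N.stepSign ℓ O e.1.1 e.1.2 f.1.2 * N.weight e.1.1 e.1.2 := if_pos h

theorem transfer_of_not_follows {e f : DirEdge O} (h : e.1.2 ≠ f.1.1) :
    N.transfer ℓ O e f = 0 := if_neg h

theorem abs_stepSign (u v x : V) : |N.stepSign ℓ O u v x| = 1 := by
  unfold stepSign; rw [abs_zpow]; simp

theorem IsPerfect.weight_pos (hO : N.IsPerfect O) (e : DirEdge O) : 0 < N.weight e.1.1 e.1.2 :=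
  N.weight_pos _ _ (hO.adj _ _ e.2)

theorem abs_transfer (hO : N.IsPerfect O) {e f : DirEdge O} (h : e.1.2 = f.1.1) :
    |N.transfer ℓ O e f| = N.weight e.1.1 e.1.2 := by
  rw [transfer_of_follows h, abs_mul, abs_stepSign, one_mul, abs_of_pos (hO.weight_pos e)]

theorem transfer_self (hO : N.IsPerfect O) (e : DirEdge O) : N.transfer ℓ O e e = 0 :=
  transfer_of_not_follows (hO.adj _ _ e.2).ne'

theorem negativeCycles_transfer [Fintype (DirEdge O)] [DecidableEq (DirEdge O)]
    (hℓ : N.IsGaugeDirection ℓ) (hO : N.IsPerfect O) : NegativeCycles (N.transfer ℓ O) := by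
  intro c hc hne
  have hfol : ∀ x ∈ c.support, x.1.2 = (c x).1.1 := by
    intro x hx; by_contra h; exact hne x hx (transfer_of_not_follows h)
  obtain ⟨e, he, -⟩ := id hc
  have he' : e ∈ c.support := Equiv.Perm.mem_support.2 he
  have hmem : ∀ k, (c ^ k) e ∈ c.support := fun k => Equiv.Perm.pow_apply_mem_support.2 he'
  obtain ⟨-, hper, hinj⟩ := prod_support_cycle hc he' fun _ => 0
  rw [(prod_support_cycle hc he' _).1, (prod_support_cycle hc he' _).1]
  have h2 := hc.two_le_card_support
  set m := c.support.card
  set q : ℕ → V := fun k => ((c ^ k) e).1.1 with hq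
  have hsucc : ∀ k, c ((c ^ k) e) = (c ^ (k + 1)) e := fun k => by rw [pow_succ']; rfl
  have hend : ∀ k, ((c ^ k) e).1.2 = q (k + 1) := fun k => by rw [hfol _ (hmem k), hsucc]
  have hqO : ∀ k, O (q k) (q (k + 1)) := fun k => by rw [← hend]; exact ((c ^ k) e).2
  have hqm : q m = q 0 := by simp only [hq, hper]; rfl
  have hqm1 : q (m + 1) = q 1 := by
    simp only [hq]; rw [add_comm, pow_add, Equiv.Perm.mul_apply, hper]
  have hqinj : ∀ i < m, ∀ j < m, i ≠ j → q i ≠ q j := fun i hi j hj hij h =>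
    hij (hinj i hi j hj (hO.eq_of_start_eq (fun x hx => Or.inl (hfol x hx)) (hmem i) (hmem j) h))
  have hm2 : m ≠ 2 := by
    intro h
    have a := hqO 0
    have b : O (q 1) (q 2) := hqO 1
    rw [show q 2 = q 0 by rw [← hqm, h]] at b
    exact hO.asymm _ _ a b
  obtain ⟨m', hm'⟩ : ∃ m', m = m' + 2 := ⟨m - 2, by omega⟩
  have hval : ∀ k, N.transfer ℓ O ((c ^ k) e) (c ((c ^ k) e)) =
      N.stepSign ℓ O (q k) (q (k + 1)) (q (k + 2)) *
        N.weight ((c ^ k) e).1.1 ((c ^ k) e).1.2 := by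
    intro k
    rw [transfer_of_follows (hfol _ (hmem k)), hend k]
    congr 2
    rw [hsucc, hend]
  have habs : ∀ k, |N.transfer ℓ O ((c ^ k) e) (c ((c ^ k) e))| =
      N.weight ((c ^ k) e).1.1 ((c ^ k) e).1.2 := fun k => abs_transfer hO (hfol _ (hmem k))
  simp only [habs]
  simp only [hval]
  rw [Finset.prod_mul_distrib, hm', prod_stepSign_cycle hℓ O (m := m') (by omega) q
    (by rw [← hm', hqm]) (by rw [show m' + 3 = m + 1 by omega, hqm1]) (by rwa [← hm'])
    (fun i _ => hO.adj _ _ (hqO i)) ?_, neg_one_mul]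
  intro k
  rcases k with _ | k
  · rw [← hqm, hm']; exact hO.isInternal_of_in_out (hqO (m' + 1)) (hqO (m' + 2))
  · exact hO.isInternal_of_in_out (hqO k) (hqO (k + 1))

/-- The sign `(-1)^{#{l ∈ I : l strictly between i and j}}`. -/
noncomputable def betweenSign (N : PBDTPNetwork V n) (O : V → V → Prop) (i j : Fin n) : ℝ :=
  (-1 : ℝ) ^ ((N.sources O).filter fun l => min i j < l ∧ l < max i j).card

theorem abs_betweenSign (i j : Fin n) : |N.betweenSign O i j| = 1 := by
  unfold betweenSign; rw [abs_pow]; simp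

theorem betweenSign_mul_self (i j : Fin n) : N.betweenSign O i j * N.betweenSign O i j = 1 := by
  unfold betweenSign; rw [← mul_pow]; simp

/-- The entry that closes up the paths from the edge `e` at a source to the edge `f` at a sink. -/
noncomputable def closingEntry (N : PBDTPNetwork V n) (ℓ : ℝ × ℝ) (O : V → V → Prop) (i j : Fin n)
    (f : DirEdge O) : ℝ :=
  -(N.betweenSign O i j * N.crossSign ℓ O f.1.1 f.1.2 * N.weight f.1.1 f.1.2)

theorem abs_closingEntry (hO : N.IsPerfect O) (i j : Fin n) (f : DirEdge O) :
    |N.closingEntry ℓ O i j f| = N.weight f.1.1 f.1.2 := by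
  unfold closingEntry
  rw [abs_neg, abs_mul, abs_mul, abs_betweenSign, abs_crossSign, one_mul, one_mul,
    abs_of_pos (hO.weight_pos f)]

theorem negativeCycles_transfer_closed [Fintype (DirEdge O)] [DecidableEq (DirEdge O)]
    (hℓ : N.IsGaugeDirection ℓ) (hO : N.IsPerfect O) {i j : Fin n} {e f : DirEdge O}
    (he : e.1.1 = N.bdry i) (hf : f.1.2 = N.bdry j) :
    NegativeCycles (N.transfer ℓ O + Matrix.single f e (N.closingEntry ℓ O i j f)) := by
  intro c hc hne
  have hi : i ∈ N.sources O := mem_sources.2 ⟨e.1.2, he ▸ e.2⟩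
  have hj : j ∉ N.sources O := hO.notMem_sources_of_edge (hf ▸ f.2)
  have hij : i ≠ j := fun h => hj (h ▸ hi)
  have hentry : ∀ x, ¬ (x = f ∧ c x = e) → (N.transfer ℓ O +
      Matrix.single f e (N.closingEntry ℓ O i j f)) x (c x) = N.transfer ℓ O x (c x) := by
    intro x hx
    rw [Matrix.add_apply, Matrix.single_apply, if_neg fun h => hx ⟨h.1.symm, h.2.symm⟩, add_zero]
  by_cases hcf : f ∈ c.support ∧ c f = e
  swap
  · have hentry' : ∀ x ∈ c.support, (N.transfer ℓ O +
        Matrix.single f e (N.closingEntry ℓ O i j f)) x (c x) = N.transfer ℓ O x (c x) :=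
      fun x hx => hentry x fun h => hcf ⟨h.1 ▸ hx, h.1 ▸ h.2⟩
    have habs : ∏ x ∈ c.support, |(N.transfer ℓ O +
        Matrix.single f e (N.closingEntry ℓ O i j f)) x (c x)| =
          ∏ x ∈ c.support, |N.transfer ℓ O x (c x)| :=
      Finset.prod_congr rfl fun x hx => by rw [hentry' x hx]
    rw [Finset.prod_congr rfl hentry', habs]
    exact negativeCycles_transfer hℓ hO c hc fun x hx => hentry' x hx ▸ hne x hx
  obtain ⟨hfc, hcf⟩ := hcf
  have he' : e ∈ c.support := hcf ▸ Equiv.Perm.apply_mem_support.2 hfc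
  have hfol : ∀ x ∈ c.support, x ≠ f → x.1.2 = (c x).1.1 := by
    intro x hx hxf; by_contra h
    exact hne x hx (by rw [hentry x fun h => hxf h.1]; exact transfer_of_not_follows h)
  have hfol' : ∀ x ∈ c.support, x.1.2 = (c x).1.1 ∨ ¬ N.IsInternal (c x).1.1 := by
    intro x hx
    by_cases hxf : x = f
    · right; rw [hxf, hcf, he]; exact N.not_isInternal_bdry i
    · exact Or.inl (hfol x hx hxf)
  have hmem : ∀ k, (c ^ k) e ∈ c.support := fun k => Equiv.Perm.pow_apply_mem_support.2 he'
  obtain ⟨-, hper, hinj⟩ := prod_support_cycle hc he' fun _ => 0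
  rw [(prod_support_cycle hc he' _).1, (prod_support_cycle hc he' _).1]
  have h2 := hc.two_le_card_support
  obtain ⟨m, hm⟩ : ∃ m, c.support.card = m + 1 := ⟨c.support.card - 1, by omega⟩
  rw [hm] at hper hinj h2 ⊢
  have hsucc : ∀ k, c ((c ^ k) e) = (c ^ (k + 1)) e := fun k => by rw [pow_succ']; rfl
  have hlast : (c ^ m) e = f := c.injective (by rw [hsucc, hper, hcf])
  have hnotlast : ∀ k < m, (c ^ k) e ≠ f := by
    intro k hk h
    have := hinj k (by omega) m (by omega) (by rw [h, hlast])
    omega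
  set q : ℕ → V := fun k => if k < m + 1 then ((c ^ k) e).1.1 else N.bdry j with hq
  have hq1 : ∀ k < m + 1, q k = ((c ^ k) e).1.1 := fun k hk => if_pos hk
  have hq2 : q (m + 1) = N.bdry j := if_neg (by omega)
  have hend : ∀ k < m + 1, ((c ^ k) e).1.2 = q (k + 1) := by
    intro k hk
    rcases Nat.lt_or_ge k m with h | h
    · rw [hfol _ (hmem k) (hnotlast k h), hsucc, hq1 _ (by omega)]
    · obtain rfl : k = m := by omega
      rw [hlast, hf, hq2]
  have hqO : ∀ k < m + 1, O (q k) (q (k + 1)) := fun k hk => by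
    rw [← hend k hk, hq1 k hk]; exact ((c ^ k) e).2
  have hq0 : q 0 = N.bdry i := by rw [hq1 0 (by omega)]; exact he
  have hqint : ∀ a, 0 < a → a < m + 1 → N.IsInternal (q a) := by
    intro a ha ha'
    obtain ⟨b, rfl⟩ : ∃ b, a = b + 1 := ⟨a - 1, by omega⟩
    exact hO.isInternal_of_in_out (hqO b (by omega)) (hqO (b + 1) ha')
  have hqj : ∀ a < m + 1, q a ≠ N.bdry j := by
    intro a ha h
    rcases Nat.eq_zero_or_pos a with rfl | ha0
    · rw [hq0] at h; exact hij (N.bdry_injective h)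
    · exact N.not_isInternal_bdry j (h ▸ hqint a ha0 ha)
  have hqinj : ∀ a < m + 2, ∀ b < m + 2, a ≠ b → q a ≠ q b := by
    intro a ha b hb hab h
    rcases Nat.lt_or_ge a (m + 1) with ha' | ha' <;> rcases Nat.lt_or_ge b (m + 1) with hb' | hb'
    · rw [hq1 a ha', hq1 b hb'] at h
      exact hab (hinj a ha' b hb' (hO.eq_of_start_eq hfol' (hmem a) (hmem b) h))
    · obtain rfl : b = m + 1 := by omega
      exact hqj a ha' (h.trans hq2)
    · obtain rfl : a = m + 1 := by omega
      exact hqj b hb' (h.symm.trans hq2)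
    · omega
  have hpath := prod_sign_path hℓ O (m := m) (by omega) q hi hj hq0 hq2 hqinj
    (fun a ha => hO.adj _ _ (hqO a ha)) hqint
  have hval : ∀ k ∈ Finset.range m, (N.transfer ℓ O +
      Matrix.single f e (N.closingEntry ℓ O i j f)) ((c ^ k) e) (c ((c ^ k) e)) =
      N.stepSign ℓ O (q k) (q (k + 1)) (q (k + 2)) *
        N.weight ((c ^ k) e).1.1 ((c ^ k) e).1.2 := by
    intro k hk
    rw [Finset.mem_range] at hk
    rw [hentry _ fun h => hnotlast k hk h.1, transfer_of_follows (hfol _ (hmem k) (hnotlast k hk)),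
      hend k (by omega), hq1 k (by omega)]
    congr 2
    rw [hsucc, hend _ (by omega)]
  have hval' : (N.transfer ℓ O + Matrix.single f e (N.closingEntry ℓ O i j f)) ((c ^ m) e)
      (c ((c ^ m) e)) = N.closingEntry ℓ O i j f := by
    rw [hlast, hcf, Matrix.add_apply, transfer_of_not_follows, Matrix.single_apply_same, zero_add]
    rw [he, hf]; exact fun h => hij (N.bdry_injective h).symm
  rw [Finset.prod_range_succ, Finset.prod_range_succ, Finset.prod_congr rfl hval, hval',
    Finset.prod_congr (g := fun k => N.weight ((c ^ k) e).1.1 ((c ^ k) e).1.2) (s₁ := Finset.range m)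
    (f := fun k => |_|) rfl, Finset.prod_mul_distrib, abs_closingEntry hO]
  · have hε := betweenSign_mul_self (N := N) (O := O) i j
    have hcr := crossSign_mul_self (N := N) (ℓ := ℓ) O f.1.1 f.1.2
    rw [← hlast, ← hq1 m (by omega), hend m (by omega)] at hcr
    change _ = N.betweenSign O i j at hpath
    unfold closingEntry
    rw [← hlast, ← hq1 m (by omega), hend m (by omega)]
    set T := ∏ k ∈ Finset.range m, N.stepSign ℓ O (q k) (q (k + 1)) (q (k + 2))
    set W := ∏ k ∈ Finset.range m, N.weight ((c ^ k) e).1.1 ((c ^ k) e).1.2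
    set w := N.weight (q m) (q (m + 1))
    linear_combination (-(N.betweenSign O i j) * W * w) * hpath - W * w * hε
  · intro k hk
    rw [hval k hk, abs_mul, abs_stepSign, one_mul, abs_of_pos (hO.weight_pos _)]

end PBDTPNetwork

namespace PBDTPNetwork

variable {V : Type*} {n : ℕ} {N : PBDTPNetwork V n} {ℓ : ℝ × ℝ} {O : V → V → Prop}

/-- The directed edge `y` may follow `x`, where the sink edge `f` may be followed by the source edge
`e`. -/
def Follows (e f x y : DirEdge O) : Prop := x.1.2 = y.1.1 ∨ (x = f ∧ y = e)

theorem not_follows_bdry (hO : N.IsPerfect O) {i : Fin n} {e x : DirEdge O}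
    (he : e.1.1 = N.bdry i) : x.1.2 ≠ e.1.1 := by
  intro h
  have := hO.isInternal_of_in_out x.2 (h ▸ e.2)
  rw [h, he] at this
  exact N.not_isInternal_bdry i this

theorem not_bdry_follows (hO : N.IsPerfect O) {j : Fin n} {f x : DirEdge O}
    (hf : f.1.2 = N.bdry j) : f.1.2 ≠ x.1.1 := by
  intro h
  have := hO.isInternal_of_in_out f.2 (h ▸ x.2)
  rw [hf] at this
  exact N.not_isInternal_bdry j this

section Flows

variable [Fintype (DirEdge O)] [DecidableEq (DirEdge O)]

/-- The permutations of the edges that move every edge to one that may follow it. -/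
def IsGood (e f : DirEdge O) (σ : Equiv.Perm (DirEdge O)) : Prop :=
  ∀ x ∈ σ.support, Follows e f x (σ x)

theorem IsGood.start_or {e f : DirEdge O} {i : Fin n} (he : e.1.1 = N.bdry i)
    {σ : Equiv.Perm (DirEdge O)} (hσ : IsGood e f σ) :
    ∀ x ∈ σ.support, x.1.2 = (σ x).1.1 ∨ ¬ N.IsInternal (σ x).1.1 := by
  intro x hx
  rcases hσ x hx with h | ⟨-, h⟩
  · exact Or.inl h
  · right; rw [h, he]; exact N.not_isInternal_bdry i

theorem exists_isGood (hO : N.IsPerfect O) {i j : Fin n} {e f : DirEdge O}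
    (he : e.1.1 = N.bdry i) (hf : f.1.2 = N.bdry j) {F : Finset (V × V)}
    (hF : N.Balanced F) (hFO : ∀ p ∈ F, O p.1 p.2) (hef : e ≠ f)
    (hend : ∀ x : DirEdge O, x.1 ∈ F → N.IsInternal x.1.2 ∨ (x = f ∧ e.1 ∈ F)) :
    ∃ σ : Equiv.Perm (DirEdge O), IsGood e f σ ∧ ∀ x, x ∈ σ.support ↔ x.1 ∈ F := by
  classical
  have hnext : ∀ x : DirEdge O, ∃ y : DirEdge O, (x.1 ∈ F → y.1 ∈ F ∧ Follows e f x y) ∧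
      (x.1 ∉ F → y = x) := by
    intro x
    by_cases hx : x.1 ∈ F
    · rcases hend x hx with hint | ⟨rfl, h⟩
      · have hpos : 0 < (F.filter fun p => p.1 = x.1.2).card := by
          rw [← hF _ hint]
          exact Finset.card_pos.2 ⟨x.1, Finset.mem_filter.2 ⟨hx, rfl⟩⟩
        obtain ⟨p, hp⟩ := Finset.card_pos.1 hpos
        obtain ⟨hp1, hp2⟩ := Finset.mem_filter.1 hp
        exact ⟨⟨p, hFO p hp1⟩, fun _ => ⟨hp1, Or.inl hp2.symm⟩, fun h => absurd hx h⟩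
      · exact ⟨e, fun _ => ⟨h, Or.inr ⟨rfl, rfl⟩⟩, fun h => absurd hx h⟩
    · exact ⟨x, fun h => absurd h hx, fun _ => rfl⟩
  choose g hg1 hg2 using hnext
  have hinj : Function.Injective g := by
    intro x x' h
    by_cases hx : x.1 ∈ F <;> by_cases hx' : x'.1 ∈ F
    · obtain ⟨hy, hxy⟩ := hg1 x hx
      obtain ⟨-, hxy'⟩ := hg1 x' hx'
      rw [← h] at hxy'
      generalize g x = y at hy hxy hxy'
      rcases hxy with hxy | ⟨rfl, rfl⟩
      · rcases hxy' with hxy' | ⟨rfl, rfl⟩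
        · by_contra hne
          have hint : N.IsInternal y.1.1 :=
            hO.isInternal_of_in_out (u := x.1.1) (by rw [← hxy]; exact x.2) y.2
          have h1 : 1 < (F.filter fun p => p.2 = y.1.1).card := by
            rw [Finset.one_lt_card]
            exact ⟨x.1, Finset.mem_filter.2 ⟨hx, hxy⟩, x'.1, Finset.mem_filter.2 ⟨hx', hxy'⟩,
              fun h => hne (Subtype.ext h)⟩
          rw [hF _ hint, Finset.one_lt_card] at h1
          obtain ⟨a, ha, b, hb, hab⟩ := h1
          obtain ⟨haF, ha1⟩ := Finset.mem_filter.1 ha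
          obtain ⟨hbF, hb1⟩ := Finset.mem_filter.1 hb
          have haO := hFO a haF
          have hbO := hFO b hbF
          have hxO := x.2
          have hxO' := x'.2
          rw [hxy] at hxO; rw [hxy'] at hxO'; rw [ha1] at haO; rw [hb1] at hbO
          rcases hO.in_or_out_unique hxO hxO' haO hbO with h | h
          · exact hne (Subtype.ext (Prod.ext h (hxy.trans hxy'.symm)))
          · exact hab (Prod.ext (ha1.trans hb1.symm) h)
        · exact absurd hxy (not_follows_bdry hO he)
      · rcases hxy' with hxy' | ⟨rfl, -⟩
        · exact absurd hxy' (not_follows_bdry hO he)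
        · rfl
    · rw [hg2 x' hx'] at h
      exact absurd (h ▸ (hg1 x hx).1) hx'
    · rw [hg2 x hx] at h
      exact absurd (h ▸ (hg1 x' hx').1) hx
    · rwa [hg2 x hx, hg2 x' hx'] at h
  set σ : Equiv.Perm (DirEdge O) := Equiv.ofBijective g (Finite.injective_iff_bijective.1 hinj)
  have hσ : ∀ x, σ x = g x := fun x => rfl
  have hsupp : ∀ x, x ∈ σ.support ↔ x.1 ∈ F := by
    intro x
    rw [Equiv.Perm.mem_support, hσ]
    constructor
    · intro h; by_contra hx; exact h (hg2 x hx)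
    · intro hx h
      have := (hg1 x hx).2
      rw [h] at this
      rcases this with h' | ⟨rfl, h'⟩
      · exact (hO.adj _ _ x.2).ne' h'
      · exact hef h'.symm
  exact ⟨σ, fun x hx => (hg1 x ((hsupp x).1 hx)).2, hsupp⟩

/-- The set of edges moved by a permutation. -/
noncomputable def movedEdges (σ : Equiv.Perm (DirEdge O)) : Finset (V × V) :=
  σ.support.map (Function.Embedding.subtype _)

theorem mem_movedEdges {σ : Equiv.Perm (DirEdge O)} {p : V × V} :
    p ∈ movedEdges σ ↔ ∃ h : O p.1 p.2, (⟨p, h⟩ : DirEdge O) ∈ σ.support := by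
  simp [movedEdges]

theorem flowWeight_movedEdges (σ : Equiv.Perm (DirEdge O)) :
    N.flowWeight (movedEdges σ) = ∏ x ∈ σ.support, N.weight x.1.1 x.1.2 := by
  unfold flowWeight movedEdges; rw [Finset.prod_map]; rfl

theorem movedEdges_injOn (hO : N.IsPerfect O) {i j : Fin n} {e f : DirEdge O}
    (he : e.1.1 = N.bdry i) (hf : f.1.2 = N.bdry j) {σ τ : Equiv.Perm (DirEdge O)}
    (hσ : IsGood e f σ) (hτ : IsGood e f τ) (h : movedEdges σ = movedEdges τ) : σ = τ := by
  have hs : σ.support = τ.support := Finset.map_injective _ h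
  ext1 x
  by_cases hx : x ∈ σ.support
  · have hx' := hs ▸ hx
    rcases hσ x hx with h1 | ⟨rfl, h1⟩
    · rcases hτ x hx' with h2 | ⟨rfl, h2⟩
      · exact hO.eq_of_start_eq (hσ.start_or he) (Equiv.Perm.apply_mem_support.2 hx)
          (hs ▸ Equiv.Perm.apply_mem_support.2 hx') (h1.symm.trans h2)
      · exact absurd h1 (not_bdry_follows hO hf)
    · rcases hτ x hx' with h2 | ⟨-, h2⟩
      · exact absurd h2 (not_bdry_follows hO hf)
      · rw [h1, h2]
  · have hx' := hs ▸ hx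
    rw [Equiv.Perm.notMem_support] at hx hx'
    rw [hx, hx']

theorem balanced_movedEdges {i : Fin n} {e f : DirEdge O}
    (he : e.1.1 = N.bdry i) {j : Fin n} (hf : f.1.2 = N.bdry j) {σ : Equiv.Perm (DirEdge O)}
    (hσ : IsGood e f σ) : N.Balanced (movedEdges σ) := by
  classical
  intro v hv
  have e1 : ((movedEdges σ).filter fun p => p.2 = v).card =
      (σ.support.filter fun x => x.1.2 = v).card := by
    unfold movedEdges; rw [Finset.filter_map, Finset.card_map]; rfl
  have e2 : ((movedEdges σ).filter fun p => p.1 = v).card =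
      (σ.support.filter fun x => x.1.1 = v).card := by
    unfold movedEdges; rw [Finset.filter_map, Finset.card_map]; rfl
  refine Eq.trans ?_ (Eq.trans (e1.trans ?_) (e2.symm.trans ?_))
  · congr
  · refine Finset.card_bij (fun x _ => σ x) ?_ (fun _ _ _ _ h => σ.injective h) ?_
    · intro x hx
      obtain ⟨hx, hxv⟩ := Finset.mem_filter.1 hx
      refine Finset.mem_filter.2 ⟨Equiv.Perm.apply_mem_support.2 hx, ?_⟩
      rcases hσ x hx with h | ⟨rfl, h⟩
      · rw [← h, hxv]
      · exact absurd (hxv ▸ hv) (hf ▸ N.not_isInternal_bdry j)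
    · intro y hy
      obtain ⟨hy, hyv⟩ := Finset.mem_filter.1 hy
      have hx : σ⁻¹ y ∈ σ.support := Equiv.Perm.apply_mem_support.1 (by simpa using hy)
      refine ⟨σ⁻¹ y, Finset.mem_filter.2 ⟨hx, ?_⟩, by simp⟩
      rcases hσ _ hx with h | ⟨-, h⟩
      · rw [h, ← hyv]; simp
      · have hye : y = e := by simpa using h
        exact absurd (hyv ▸ hv) (hye ▸ he ▸ N.not_isInternal_bdry i)
  · congr

theorem isConservativeFlow_iff (hO : N.IsPerfect O) {i j : Fin n} {e f : DirEdge O}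
    (he : e.1.1 = N.bdry i) (hf : f.1.2 = N.bdry j) (hef : e ≠ f) (F : Finset (V × V)) :
    N.IsConservativeFlow O F ↔ ∃ σ : Equiv.Perm (DirEdge O),
      (IsGood e f σ ∧ ¬ f ∈ σ.support) ∧ movedEdges σ = F := by
  constructor
  · rintro ⟨h1, h2, h3⟩
    obtain ⟨σ, hσ, hs⟩ := exists_isGood hO he hf h2 h1 hef fun x hx => Or.inl (h3 _ hx).2
    refine ⟨σ, ⟨hσ, fun h => ?_⟩, ?_⟩
    · have := (h3 _ ((hs f).1 h)).2
      rw [hf] at this; exact N.not_isInternal_bdry j this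
    · ext p
      rw [mem_movedEdges]
      exact ⟨fun ⟨h, h'⟩ => (hs _).1 h', fun h => ⟨h1 p h, (hs _).2 h⟩⟩
  · rintro ⟨σ, ⟨hσ, hfσ⟩, rfl⟩
    have hfol : ∀ x ∈ σ.support, x.1.2 = (σ x).1.1 := by
      intro x hx
      rcases hσ x hx with h | ⟨rfl, -⟩
      · exact h
      · exact absurd hx hfσ
    refine ⟨fun p hp => (mem_movedEdges.1 hp).1, balanced_movedEdges he hf hσ, ?_⟩
    intro p hp
    obtain ⟨hpO, hp⟩ := mem_movedEdges.1 hp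
    set x : DirEdge O := ⟨p, hpO⟩
    have hy : σ⁻¹ x ∈ σ.support := Equiv.Perm.apply_mem_support.1 (by simpa using hp)
    have h1 := hfol _ hy
    have h2 := hfol _ hp
    rw [show σ (σ⁻¹ x) = x by simp] at h1
    exact ⟨hO.isInternal_of_in_out (u := (σ⁻¹ x).1.1) (h1 ▸ (σ⁻¹ x).2) hpO,
      hO.isInternal_of_in_out hpO (x := (σ x).1.2) (by rw [show p.2 = x.1.2 from rfl, h2]; exact (σ x).2)⟩

theorem isFlow_iff (hO : N.IsPerfect O) {i j : Fin n} {e f : DirEdge O}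
    (he : e.1.1 = N.bdry i) (hf : f.1.2 = N.bdry j) (hef : e ≠ f) (F : Finset (V × V)) :
    N.IsFlow O i j F ↔ ∃ σ : Equiv.Perm (DirEdge O),
      (IsGood e f σ ∧ f ∈ σ.support) ∧ movedEdges σ = F := by
  constructor
  · rintro ⟨h1, h2, ⟨p, hpF, hp⟩, ⟨r, hrF, hr⟩, h5⟩
    have hpe : p = e.1 := by
      refine Prod.ext (hp.trans he.symm) (N.eq_of_adj_bdry (i := i) ?_ ?_)
      · have := hO.adj _ _ (h1 p hpF); rwa [hp] at this
      · have := hO.adj _ _ e.2; rwa [he] at this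
    have hrf : ∀ x : DirEdge O, x.1.2 = N.bdry j → x = f := by
      intro x hx
      refine Subtype.ext (Prod.ext (N.eq_of_adj_bdry (i := j) ?_ ?_) (hx.trans hf.symm))
      · have := (hO.adj _ _ x.2).symm; rwa [hx] at this
      · have := (hO.adj _ _ f.2).symm; rwa [hf] at this
    obtain ⟨σ, hσ, hs⟩ := exists_isGood hO he hf h2 h1 hef fun x hx => by
      rcases N.isInternal_or x.1.2 with h | ⟨l, hl⟩
      · exact Or.inl h
      · have := (h5 _ hx l).2 hl
        subst this
        exact Or.inr ⟨hrf x hl, hpe ▸ hpF⟩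
    refine ⟨σ, ⟨hσ, (hs f).2 ?_⟩, ?_⟩
    · have := hrf ⟨r, h1 r hrF⟩ hr
      rw [← this]; exact hrF
    · ext p
      rw [mem_movedEdges]
      exact ⟨fun ⟨h, h'⟩ => (hs _).1 h', fun h => ⟨h1 p h, (hs _).2 h⟩⟩
  · rintro ⟨σ, ⟨hσ, hfσ⟩, rfl⟩
    have hσf : σ f = e := by
      rcases hσ f hfσ with h | ⟨-, h⟩
      · exact absurd h (not_bdry_follows hO hf)
      · exact h
    have heσ : e ∈ σ.support := hσf ▸ Equiv.Perm.apply_mem_support.2 hfσ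
    refine ⟨fun p hp => (mem_movedEdges.1 hp).1, balanced_movedEdges he hf hσ,
      ⟨e.1, mem_movedEdges.2 ⟨e.2, heσ⟩, he⟩, ⟨f.1, mem_movedEdges.2 ⟨f.2, hfσ⟩, hf⟩, ?_⟩
    intro p hp l
    obtain ⟨hpO, hp⟩ := mem_movedEdges.1 hp
    set x : DirEdge O := ⟨p, hpO⟩
    constructor
    · intro hl
      have hy : σ⁻¹ x ∈ σ.support := Equiv.Perm.apply_mem_support.1 (by simpa using hp)
      rcases hσ _ hy with h | ⟨-, h⟩
      · rw [show σ (σ⁻¹ x) = x by simp] at h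
        exact absurd h (not_follows_bdry hO hl)
      · rw [show σ (σ⁻¹ x) = x by simp] at h
        exact N.bdry_injective (by rw [← hl, ← he, ← h])
    · intro hl
      rcases hσ _ hp with h | ⟨h, -⟩
      · exact absurd h (not_bdry_follows hO hl)
      · exact N.bdry_injective (by rw [← hl, ← hf, ← h])

open Classical in
theorem prod_abs_transfer_closed (hO : N.IsPerfect O) {i j : Fin n} {e f : DirEdge O}
    (hf : f.1.2 = N.bdry j) (σ : Equiv.Perm (DirEdge O)) :
    ∏ x ∈ σ.support, |(N.transfer ℓ O + Matrix.single f e (N.closingEntry ℓ O i j f)) x (σ x)| =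
      if IsGood e f σ then N.flowWeight (movedEdges σ) else 0 := by
  split_ifs with h
  · rw [flowWeight_movedEdges]
    refine Finset.prod_congr rfl fun x hx => ?_
    rcases h x hx with h' | ⟨rfl, h'⟩
    · rw [Matrix.add_apply, Matrix.single_apply, if_neg, add_zero, abs_transfer hO h']
      rintro ⟨rfl, -⟩; exact not_bdry_follows hO hf h'
    · rw [h', Matrix.add_apply, Matrix.single_apply_same,
        transfer_of_not_follows (not_bdry_follows hO hf), zero_add, abs_closingEntry hO]
  · unfold IsGood at h
    push Not at h
    obtain ⟨x, hx, hx'⟩ := h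
    refine Finset.prod_eq_zero hx ?_
    rw [Matrix.add_apply, Matrix.single_apply, if_neg, add_zero,
      transfer_of_not_follows fun h => hx' (Or.inl h), abs_zero]
    rintro ⟨rfl, h⟩; exact hx' (Or.inr ⟨rfl, h.symm⟩)

open Classical in
theorem prod_abs_transfer (hO : N.IsPerfect O) {j : Fin n} {e f : DirEdge O}
    (hf : f.1.2 = N.bdry j) (σ : Equiv.Perm (DirEdge O)) :
    ∏ x ∈ σ.support, |N.transfer ℓ O x (σ x)| =
      if IsGood e f σ ∧ ¬ f ∈ σ.support then N.flowWeight (movedEdges σ) else 0 := by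
  split_ifs with h
  · rw [flowWeight_movedEdges]
    refine Finset.prod_congr rfl fun x hx => ?_
    rcases h.1 x hx with h' | ⟨rfl, h'⟩
    · rw [abs_transfer hO h']
    · exact absurd hx h.2
  · by_cases hfσ : f ∈ σ.support
    · exact Finset.prod_eq_zero hfσ (by
        rw [transfer_of_not_follows (not_bdry_follows hO hf), abs_zero])
    · have h : ¬ IsGood e f σ := fun h' => h ⟨h', hfσ⟩
      unfold IsGood at h
      push Not at h
      obtain ⟨x, hx, hx'⟩ := h
      exact Finset.prod_eq_zero hx (by
        rw [transfer_of_not_follows fun h => hx' (Or.inl h), abs_zero])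

theorem measRow_eq [Fintype V] (hℓ : N.IsGaugeDirection ℓ) (hO : N.IsPerfect O) {i j : Fin n}
    {e f : DirEdge O} (he : e.1.1 = N.bdry i) (hf : f.1.2 = N.bdry j) {x : DirEdge O → ℝ}
    (hx : (1 - N.transfer ℓ O).mulVec x =
      Pi.single f (N.crossSign ℓ O f.1.1 f.1.2 * N.weight f.1.1 f.1.2)) :
    x e = N.measRow O i j := by
  classical
  have hj : j ∉ N.sources O := hO.notMem_sources_of_edge (hf ▸ f.2)
  have hef : e ≠ f := by
    rintro rfl
    have := hO.adj _ _ e.2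
    rw [he] at this
    exact N.not_isInternal_bdry j (hf ▸ N.isInternal_of_adj_bdry this)
  have hcol : ∀ y, N.transfer ℓ O y e = 0 := fun y =>
    transfer_of_not_follows (not_follows_bdry hO he)
  have hneg := negativeCycles_transfer hℓ hO (N := N)
  have hneg' := negativeCycles_transfer_closed hℓ hO he hf
  have hself := transfer_self hO (ℓ := ℓ)
  have hself' : ∀ y, (N.transfer ℓ O + Matrix.single f e (N.closingEntry ℓ O i j f)) y y = 0 := by
    intro y
    rw [Matrix.add_apply, hself, Matrix.single_apply, if_neg, add_zero]
    rintro ⟨rfl, h⟩; exact hef h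
  have key := solution_at_eq (s := N.closingEntry ℓ O i j f) hcol hneg hself hx
  have hdet := (det_one_sub_pos hneg hself).ne'
  have hw := (hO.weight_pos f).ne'
  have hD : (1 - N.transfer ℓ O).det =
      ∑ C : Finset (V × V) with N.IsConservativeFlow O C, N.flowWeight C := by
    rw [det_one_sub_eq_sum hneg hself, Finset.sum_congr rfl fun σ _ =>
      prod_abs_transfer hO (e := e) hf σ, ← Finset.sum_filter]
    refine Finset.sum_bij (fun σ _ => movedEdges σ) ?_ ?_ ?_ fun _ _ => rfl
    · intro σ hσ
      rw [Finset.mem_filter] at hσ ⊢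
      exact ⟨Finset.mem_univ _, (isConservativeFlow_iff hO he hf hef _).2 ⟨σ, hσ.2, rfl⟩⟩
    · intro σ hσ τ hτ h
      rw [Finset.mem_filter] at hσ hτ
      exact movedEdges_injOn hO he hf hσ.2.1 hτ.2.1 h
    · intro F hF
      obtain ⟨σ, hσ, rfl⟩ := (isConservativeFlow_iff hO he hf hef F).1 (Finset.mem_filter.1 hF).2
      exact ⟨σ, Finset.mem_filter.2 ⟨Finset.mem_univ _, hσ⟩, rfl⟩
  have hD' : (1 - (N.transfer ℓ O + Matrix.single f e (N.closingEntry ℓ O i j f))).det =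
      (1 - N.transfer ℓ O).det + ∑ F : Finset (V × V) with N.IsFlow O i j F, N.flowWeight F := by
    rw [det_one_sub_eq_sum hneg' hself', Finset.sum_congr rfl fun σ _ =>
      prod_abs_transfer_closed hO hf σ, ← Finset.sum_filter,
      ← Finset.sum_filter_add_sum_filter_not _ fun σ => f ∈ σ.support, Finset.filter_filter,
      Finset.filter_filter, add_comm]
    congr 1
    · rw [det_one_sub_eq_sum hneg hself, Finset.sum_congr rfl fun σ _ =>
        prod_abs_transfer hO (e := e) hf σ, ← Finset.sum_filter]
    · refine Finset.sum_bij (fun σ _ => movedEdges σ) ?_ ?_ ?_ fun _ _ => rfl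
      · intro σ hσ
        rw [Finset.mem_filter] at hσ ⊢
        exact ⟨Finset.mem_univ _, (isFlow_iff hO he hf hef _).2 ⟨σ, hσ.2, rfl⟩⟩
      · intro σ hσ τ hτ h
        rw [Finset.mem_filter] at hσ hτ
        exact movedEdges_injOn hO he hf hσ.2.1 hτ.2.1 h
      · intro F hF
        obtain ⟨σ, hσ, rfl⟩ := (isFlow_iff hO he hf hef F).1 (Finset.mem_filter.1 hF).2
        exact ⟨σ, Finset.mem_filter.2 ⟨Finset.mem_univ _, hσ⟩, rfl⟩
  have hmeas : N.measRow O i j = N.betweenSign O i j *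
      ((∑ F : Finset (V × V) with N.IsFlow O i j F, N.flowWeight F) /
        (1 - N.transfer ℓ O).det) := by
    rw [hD]; unfold measRow betweenSign; rw [if_neg hj]
  rw [hD'] at key
  rw [hmeas]
  have hε := betweenSign_mul_self (N := N) (O := O) i j
  have hc := crossSign_mul_self (N := N) (ℓ := ℓ) O f.1.1 f.1.2
  unfold closingEntry at key
  set Δ := (1 - N.transfer ℓ O).det
  set S := ∑ F : Finset (V × V) with N.IsFlow O i j F, N.flowWeight F
  set ε := N.betweenSign O i j
  set c := N.crossSign ℓ O f.1.1 f.1.2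
  set w := N.weight f.1.1 f.1.2
  have hc0 : c ≠ 0 := fun h => by rw [h] at hc; simp at hc
  have key2 : (c * w) * (Δ * x e) = (c * w) * (ε * S) := by
    linear_combination (-ε) * key - c * w * Δ * x e * hε
  have key3 := mul_left_cancel₀ (mul_ne_zero hc0 hw) key2
  field_simp
  linear_combination key3

end Flows

end PBDTPNetwork

namespace PBDTPNetwork

variable {V : Type*} {n : ℕ} {N : PBDTPNetwork V n} {ℓ : ℝ × ℝ} {O : V → V → Prop}

open Classical in
/-- The function on unoriented edges given by a function on the directed edges of `O`. -/
noncomputable def onSym2 {M : Type*} [Zero M] (x : DirEdge O → M) (s : Sym2 V) : M :=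
  if h : ∃ e : DirEdge O, s(e.1.1, e.1.2) = s then x h.choose else 0

theorem IsPerfect.dirEdge_ext (hO : N.IsPerfect O) {e f : DirEdge O}
    (h : s(e.1.1, e.1.2) = s(f.1.1, f.1.2)) : e = f := by
  rw [Sym2.eq_iff] at h
  rcases h with ⟨h1, h2⟩ | ⟨h1, h2⟩
  · exact Subtype.ext (Prod.ext h1 h2)
  · have := e.2
    rw [h1, h2] at this
    exact absurd this (hO.asymm _ _ f.2)

theorem onSym2_apply (hO : N.IsPerfect O) {M : Type*} [Zero M] (x : DirEdge O → M)
    (e : DirEdge O) : onSym2 x s(e.1.1, e.1.2) = x e := by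
  unfold onSym2
  have h : ∃ f : DirEdge O, s(f.1.1, f.1.2) = s(e.1.1, e.1.2) := ⟨e, rfl⟩
  rw [dif_pos h]
  exact congrArg x (hO.dirEdge_ext h.choose_spec)

open Classical in
/-- The contribution of the boundary vectors to the linear relation for the edge `e`. -/
noncomputable def sinkTerm (N : PBDTPNetwork V n) (ℓ : ℝ × ℝ) {M : Type*} [AddCommMonoid M]
    [Module ℝ M] (F : Fin n → M) (e : DirEdge O) : M :=
  ∑ j, if e.1.2 = N.bdry j then (N.crossSign ℓ O e.1.1 e.1.2 * N.weight e.1.1 e.1.2) • F j else 0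

theorem sinkTerm_of_bdry {M : Type*} [AddCommMonoid M] [Module ℝ M] (F : Fin n → M)
    {e : DirEdge O} {j : Fin n} (h : e.1.2 = N.bdry j) :
    N.sinkTerm ℓ F e = (N.crossSign ℓ O e.1.1 e.1.2 * N.weight e.1.1 e.1.2) • F j := by
  unfold sinkTerm
  rw [Finset.sum_eq_single j, if_pos h]
  · intro l _ hl
    rw [if_neg]; intro h'; exact hl (N.bdry_injective (h'.symm.trans h))
  · simp

theorem sinkTerm_of_isInternal {M : Type*} [AddCommMonoid M] [Module ℝ M] (F : Fin n → M)
    {e : DirEdge O} (h : N.IsInternal e.1.2) : N.sinkTerm ℓ F e = 0 := by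
  unfold sinkTerm
  refine Finset.sum_eq_zero fun l _ => if_neg fun h' => ?_
  rw [h'] at h; exact N.not_isInternal_bdry l h

open Classical in
theorem sum_transfer [Fintype V] [Fintype (DirEdge O)] {M : Type*} [AddCommMonoid M] [Module ℝ M] (e : DirEdge O) (E : Sym2 V → M) :
    ∑ f : DirEdge O, N.transfer ℓ O e f • E s(f.1.1, f.1.2) =
      ∑ x : V, if O e.1.2 x then
        (N.stepSign ℓ O e.1.1 e.1.2 x * N.weight e.1.1 e.1.2) • E s(e.1.2, x) else 0 := by
  have h1 : ∀ g : V × V → M, ∑ f : DirEdge O, g f.1 = ∑ p : V × V, if O p.1 p.2 then g p else 0 := by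
    intro g
    rw [← Finset.sum_filter]
    exact (Finset.sum_subtype _ (by simp) g).symm
  have h2 : ∀ f : DirEdge O, N.transfer ℓ O e f • E s(f.1.1, f.1.2) =
      (fun p : V × V => if e.1.2 = p.1 then
        (N.stepSign ℓ O e.1.1 e.1.2 p.2 * N.weight e.1.1 e.1.2) • E s(p.1, p.2) else 0) f.1 := by
    intro f
    by_cases h : e.1.2 = f.1.1
    · rw [transfer_of_follows h]; simp only [if_pos h]
    · rw [transfer_of_not_follows h]; simp only [if_neg h, zero_smul]
  rw [Finset.sum_congr rfl fun f _ => h2 f, h1 (fun p : V × V => if e.1.2 = p.1 then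
        (N.stepSign ℓ O e.1.1 e.1.2 p.2 * N.weight e.1.1 e.1.2) • E s(p.1, p.2) else 0), Fintype.sum_prod_type,
    Finset.sum_eq_single e.1.2]
  · simp
  · intro v _ hv
    refine Finset.sum_eq_zero fun x _ => ?_
    simp [Ne.symm hv]
  · simp

theorem isEdgeSystem_iff [Fintype V] [Fintype (DirEdge O)] (hℓ : N.IsGaugeDirection ℓ) (hO : N.IsPerfect O)
    (F : Fin n → Fin n → ℝ) (E : Sym2 V → Fin n → ℝ) :
    N.IsEdgeSystem ℓ O F E ↔ ∀ e : DirEdge O, E s(e.1.1, e.1.2) =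
      ∑ f : DirEdge O, N.transfer ℓ O e f • E s(f.1.1, f.1.2) + N.sinkTerm ℓ F e := by
  constructor
  · intro h e
    rcases N.isInternal_or e.1.2 with hv | ⟨j, hj⟩
    · rw [sinkTerm_of_isInternal F hv, add_zero, sum_transfer, h.internal _ _ e.2 hv]
      rfl
    · rw [sinkTerm_of_bdry F hj, Finset.sum_eq_zero, zero_add]
      · have := h.sink e.1.1 j (hj ▸ e.2)
        rw [hℓ.neg_one_zpow_crossings O (hj ▸ hO.adj _ _ e.2)] at this
        rw [hj, this]; rfl
      · intro f _
        rw [transfer_of_not_follows (not_bdry_follows hO hj), zero_smul]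
  · intro h
    constructor
    · intro u v huv hv
      have := h ⟨(u, v), huv⟩
      rw [sinkTerm_of_isInternal F hv, add_zero, sum_transfer] at this
      exact this
    · intro u j huj
      have := h ⟨(u, N.bdry j), huj⟩
      rw [sinkTerm_of_bdry F rfl, Finset.sum_eq_zero, zero_add] at this
      · rw [this, hℓ.neg_one_zpow_crossings O (hO.adj _ _ huj)]; rfl
      · intro f _
        rw [transfer_of_not_follows (not_bdry_follows hO rfl), zero_smul]

theorem solve_iff [Fintype (DirEdge O)] [DecidableEq (DirEdge O)] {x b : DirEdge O → ℝ} :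
    (1 - N.transfer ℓ O).mulVec x = b ↔ ∀ e, x e = ∑ f, N.transfer ℓ O e f * x f + b e := by
  rw [Matrix.sub_mulVec, Matrix.one_mulVec, funext_iff]
  refine forall_congr' fun e => ?_
  simp only [Pi.sub_apply, Matrix.mulVec, dotProduct]
  constructor <;> intro h <;> linarith

theorem exists_solution [Fintype (DirEdge O)] (hℓ : N.IsGaugeDirection ℓ) (hO : N.IsPerfect O) (b : DirEdge O → ℝ) :
    ∃ x : DirEdge O → ℝ, ∀ e, x e = ∑ f, N.transfer ℓ O e f * x f + b e := by
  classical
  have hdet := (det_one_sub_pos (negativeCycles_transfer hℓ hO) (transfer_self hO (ℓ := ℓ))).ne'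
  refine ⟨((1 - N.transfer ℓ O)⁻¹).mulVec b, solve_iff.1 ?_⟩
  rw [Matrix.mulVec_mulVec, Matrix.mul_nonsing_inv _ (isUnit_iff_ne_zero.2 hdet), Matrix.one_mulVec]

theorem solution_unique [Fintype (DirEdge O)] (hℓ : N.IsGaugeDirection ℓ) (hO : N.IsPerfect O) {x y b : DirEdge O → ℝ}
    (hx : ∀ e, x e = ∑ f, N.transfer ℓ O e f * x f + b e)
    (hy : ∀ e, y e = ∑ f, N.transfer ℓ O e f * y f + b e) : x = y := by
  classical
  exact one_sub_mulVec_unique (negativeCycles_transfer hℓ hO) (transfer_self hO (ℓ := ℓ))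
    ((solve_iff.2 hx).trans (solve_iff.2 hy).symm)

theorem sinkTerm_apply (F : Fin n → Fin n → ℝ) (e : DirEdge O) (a : Fin n) :
    N.sinkTerm ℓ F e a = N.sinkTerm ℓ (fun j => F j a) e := by
  rcases N.isInternal_or e.1.2 with hv | ⟨j, hj⟩
  · rw [sinkTerm_of_isInternal F hv, sinkTerm_of_isInternal _ hv]; rfl
  · rw [sinkTerm_of_bdry F hj, sinkTerm_of_bdry _ hj]; rfl

theorem IsEdgeSystem.apply_eq [Fintype V] [Fintype (DirEdge O)] (hℓ : N.IsGaugeDirection ℓ) (hO : N.IsPerfect O)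
    {F : Fin n → Fin n → ℝ} {E : Sym2 V → Fin n → ℝ} (hE : N.IsEdgeSystem ℓ O F E) (a : Fin n)
    (e : DirEdge O) : E s(e.1.1, e.1.2) a =
      ∑ f : DirEdge O, N.transfer ℓ O e f * E s(f.1.1, f.1.2) a +
        N.sinkTerm ℓ (fun j => F j a) e := by
  have := congrFun ((isEdgeSystem_iff hℓ hO F E).1 hE e) a
  rw [this, ← sinkTerm_apply]
  simp

theorem exists_isEdgeSystem [Fintype V] (hℓ : N.IsGaugeDirection ℓ) (hO : N.IsPerfect O)
    (F : Fin n → Fin n → ℝ) : ∃ E, N.IsEdgeSystem ℓ O F E := by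
  classical
  choose x hx using fun a => exists_solution hℓ hO (N.sinkTerm ℓ (O := O) fun j => F j a)
  refine ⟨onSym2 fun e a => x a e, (isEdgeSystem_iff hℓ hO F _).2 fun e => ?_⟩
  simp only [onSym2_apply hO]
  ext a
  rw [hx]
  simp [sinkTerm_apply]

theorem isEdgeSystem_unique [Fintype V] (hℓ : N.IsGaugeDirection ℓ) (hO : N.IsPerfect O)
    {F : Fin n → Fin n → ℝ} {E E' : Sym2 V → Fin n → ℝ} (hE : N.IsEdgeSystem ℓ O F E)
    (hE' : N.IsEdgeSystem ℓ O F E') : ∀ u v, O u v → E s(u, v) = E' s(u, v) := by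
  classical
  intro u v huv
  ext a
  exact congrFun (solution_unique hℓ hO (hE.apply_eq hℓ hO a) (hE'.apply_eq hℓ hO a)) ⟨(u, v), huv⟩

theorem IsPerfect.forall_edge (hO : N.IsPerfect O) {p : Sym2 V → Prop}
    (h : ∀ u v, O u v → p s(u, v)) : ∀ e ∈ N.graph.edgeSet, p e := by
  intro e he
  induction e with
  | _ u v =>
    rcases hO.total u v he with h' | h'
    · exact h u v h'
    · rw [Sym2.eq_swap]; exact h v u h'

/-- Changing the boundary vectors by multiples of `r` changes the edge vectors by multiples of
`r`. -/
theorem isEdgeSystem_perturb [Fintype V] (hℓ : N.IsGaugeDirection ℓ) (hO : N.IsPerfect O)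
    {F F' : Fin n → Fin n → ℝ} {E E' : Sym2 V → Fin n → ℝ} (hE : N.IsEdgeSystem ℓ O F E)
    (hE' : N.IsEdgeSystem ℓ O F' E') (r : Fin n → ℝ) (c : Fin n → ℝ)
    (hF : ∀ j, F' j = F j + c j • r) :
    ∀ e ∈ N.graph.edgeSet, ∃ t : ℝ, E' e = E e + t • r := by
  classical
  obtain ⟨y, hy⟩ := exists_solution hℓ hO (N.sinkTerm ℓ (O := O) c)
  refine hO.forall_edge (p := fun e => ∃ t : ℝ, E' e = E e + t • r) ?_
  intro u v huv
  refine ⟨y ⟨(u, v), huv⟩, ?_⟩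
  ext a
  refine congrFun (solution_unique (y := fun e => E s(e.1.1, e.1.2) a + y e * r a) hℓ hO
    (hE'.apply_eq hℓ hO a) fun e => ?_) ⟨(u, v), huv⟩
  have hs : N.sinkTerm ℓ (fun j => F' j a) e =
      N.sinkTerm ℓ (fun j => F j a) e + N.sinkTerm ℓ c e * r a := by
    rcases N.isInternal_or e.1.2 with hv | ⟨j, hj⟩
    · simp only [sinkTerm_of_isInternal _ hv]; ring
    · simp only [sinkTerm_of_bdry _ hj, hF]; simp; ring
  rw [hs]
  simp only [mul_add, Finset.sum_add_distrib]
  rw [hE.apply_eq hℓ hO a e, hy e, add_mul, Finset.sum_mul]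
  simp only [mul_assoc]
  ring

open Classical in
/-- The edge vector at a boundary source is a combination of the boundary vectors with the boundary
measurements as coefficients. -/
theorem IsEdgeSystem.source [Fintype V] (hℓ : N.IsGaugeDirection ℓ) (hO : N.IsPerfect O)
    {F : Fin n → Fin n → ℝ} {E : Sym2 V → Fin n → ℝ} (hE : N.IsEdgeSystem ℓ O F E) {i : Fin n}
    {v : V} (hv : O (N.bdry i) v) :
    E s(N.bdry i, v) = ∑ j, if j ∈ N.sources O then 0 else N.measRow O i j • F j := by
  have hsink : ∀ j, ∃ f : DirEdge O, j ∉ N.sources O → f.1.2 = N.bdry j := by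
    intro j
    by_cases hj : j ∈ N.sources O
    · exact ⟨⟨(N.bdry i, v), hv⟩, fun h => absurd hj h⟩
    · obtain ⟨u, hu⟩ := hO.exists_sink_edge hj
      exact ⟨⟨(u, N.bdry j), hu⟩, fun _ => rfl⟩
  choose f hf using hsink
  choose y hy using fun j => exists_solution hℓ hO
    (Pi.single (f j) (N.crossSign ℓ O (f j).1.1 (f j).1.2 * N.weight (f j).1.1 (f j).1.2))
  have hmeas : ∀ j ∉ N.sources O, y j ⟨(N.bdry i, v), hv⟩ = N.measRow O i j := fun j hj =>
    measRow_eq hℓ hO rfl (hf j hj) (solve_iff.2 (hy j))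
  ext a
  have := congrFun (solution_unique (y := fun e => ∑ j, if j ∈ N.sources O then 0 else
    y j e * F j a) hℓ hO (hE.apply_eq hℓ hO a) fun e => ?_) ⟨(N.bdry i, v), hv⟩
  · refine Eq.trans this ?_
    rw [Finset.sum_apply]
    refine Finset.sum_congr rfl fun j _ => ?_
    split_ifs with hj
    · rfl
    · rw [hmeas j hj]; rfl
  · have hs : N.sinkTerm ℓ (fun j => F j a) e = ∑ j, if j ∈ N.sources O then 0 else
        (Pi.single (f j) (N.crossSign ℓ O (f j).1.1 (f j).1.2 *
          N.weight (f j).1.1 (f j).1.2) : DirEdge O → ℝ) e * F j a := by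
      unfold sinkTerm
      refine Finset.sum_congr rfl fun j _ => ?_
      by_cases h : e.1.2 = N.bdry j
      · have hj : j ∉ N.sources O := hO.notMem_sources_of_edge (h ▸ e.2)
        have he : e = f j := by
          refine Subtype.ext (Prod.ext (N.eq_of_adj_bdry (i := j) ?_ ?_) (h.trans (hf j hj).symm))
          · have := (hO.adj _ _ e.2).symm; rwa [h] at this
          · have := (hO.adj _ _ (f j).2).symm; rwa [hf j hj] at this
        rw [if_pos h, if_neg hj, ← he, Pi.single_eq_same, smul_eq_mul]
      · rw [if_neg h]
        split_ifs with hj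
        · rfl
        · rw [Pi.single_eq_of_ne, zero_mul]
          intro he; exact h (he ▸ hf j hj)
    rw [hs]
    simp only [Finset.mul_sum]
    rw [Finset.sum_comm, ← Finset.sum_add_distrib]
    refine Finset.sum_congr rfl fun j _ => ?_
    split_ifs with hj
    · simp
    · conv_lhs => rw [hy j e]
      rw [add_mul, Finset.sum_mul]
      simp only [mul_assoc]

theorem IsEdgeSystem.source_std [Fintype V] (hℓ : N.IsGaugeDirection ℓ) (hO : N.IsPerfect O)
    {E : Sym2 V → Fin n → ℝ} (hE : N.IsEdgeSystem ℓ O (stdVec n) E) {i : Fin n}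
    {v : V} (hv : O (N.bdry i) v) :
    E s(N.bdry i, v) = N.measRow O i - stdVec n i := by
  classical
  have hi : i ∈ N.sources O := mem_sources.2 ⟨v, hv⟩
  rw [hE.source hℓ hO hv]
  ext a
  rw [Finset.sum_apply, Finset.sum_eq_single a]
  · by_cases ha : a ∈ N.sources O
    · rw [if_pos ha]
      simp only [Pi.zero_apply, Pi.sub_apply, measRow, if_pos ha, stdVec, Pi.single_apply]
      simp
    · have hai : a ≠ i := fun h => ha (h ▸ hi)
      rw [if_neg ha]
      simp [stdVec, hai]
  · intro j _ hj
    split_ifs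
    · rfl
    · simp [stdVec, Ne.symm hj]
  · simp

end PBDTPNetwork

theorem mem_segment_of_planeCross {ℓ c d z : ℝ × ℝ} (hcd : planeCross c ℓ < planeCross d ℓ)
    (hc : planeCross c ℓ ≤ planeCross z ℓ) (hd : planeCross z ℓ ≤ planeCross d ℓ)
    (h0 : planeCross (d - c) (z - c) = 0) : z ∈ segment ℝ c d := by
  have hne : planeCross d ℓ - planeCross c ℓ ≠ 0 := by linarith
  set t := (planeCross z ℓ - planeCross c ℓ) / (planeCross d ℓ - planeCross c ℓ) with ht
  have ht' : t * (planeCross d ℓ - planeCross c ℓ) = planeCross z ℓ - planeCross c ℓ := by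
    rw [ht]; field_simp
  refine exists_mem_segment_iff.2 ⟨t, div_nonneg (by linarith) (by linarith),
    by rw [ht, div_le_one (by linarith)]; linarith, ?_⟩
  unfold planeCross at *
  simp only [Prod.fst_sub, Prod.snd_sub] at h0
  ext
  · apply mul_left_cancel₀ hne
    simp only [Prod.fst_add, Prod.smul_fst, smul_eq_mul, Prod.fst_sub]
    linear_combination ℓ.1 * h0 - (d.1 - c.1) * ht'
  · apply mul_left_cancel₀ hne
    simp only [Prod.snd_add, Prod.smul_snd, smul_eq_mul, Prod.snd_sub]
    linear_combination ℓ.2 * h0 - (d.2 - c.2) * ht'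

/-- The segment from `c` to `d` passes above `z`, with respect to the upward direction `ℓ`; of the
two ends of the segment only the left one counts. -/
def PassesAbove (ℓ z c d : ℝ × ℝ) : Prop :=
  ((planeCross c ℓ ≤ planeCross z ℓ ∧ planeCross z ℓ < planeCross d ℓ) ∨
    (planeCross d ℓ ≤ planeCross z ℓ ∧ planeCross z ℓ < planeCross c ℓ)) ∧
  planeCross (d - c) ℓ * planeCross (d - c) (z - c) < 0

theorem passesAbove_comm {ℓ z c d : ℝ × ℝ} : PassesAbove ℓ z c d ↔ PassesAbove ℓ z d c := by
  unfold PassesAbove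
  have e : planeCross (d - c) ℓ * planeCross (d - c) (z - c) =
      planeCross (c - d) ℓ * planeCross (c - d) (z - d) := by
    unfold planeCross; simp only [Prod.fst_sub, Prod.snd_sub]; ring
  rw [e, or_comm]

/-- The change of the passing number at `z` that is caused by the end point `c`. -/
noncomputable def endChange (ℓ z₀ z c : ℝ × ℝ) : ZMod 2 :=
  parity (planeCross c ℓ = planeCross z₀ ℓ ∧ z₀.2 < c.2 ∧ planeCross z ℓ < planeCross c ℓ)

theorem continuous_planeCross_left (ℓ : ℝ × ℝ) : Continuous fun z => planeCross z ℓ := by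
  unfold planeCross; fun_prop

theorem continuous_planeCross_sub (a c : ℝ × ℝ) : Continuous fun z => planeCross a (z - c) := by
  unfold planeCross; fun_prop

open Filter in
theorem eventually_passesAbove {ℓ z₀ c d : ℝ × ℝ} (hℓ : 0 < ℓ.2)
    (hcd : planeCross (d - c) ℓ ≠ 0) (hz : z₀ ∉ segment ℝ c d) :
    ∀ᶠ z in 𝓝 z₀, parity (PassesAbove ℓ z c d) =
      parity (PassesAbove ℓ z₀ c d) + (endChange ℓ z₀ z c + endChange ℓ z₀ z d) := by
  rw [planeCross_sub_left] at hcd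
  wlog hlt : planeCross c ℓ < planeCross d ℓ generalizing c d
  · have := this (c := d) (d := c) (by intro h; apply hcd; linarith) (by rwa [segment_symm])
      (lt_of_le_of_ne (not_lt.1 hlt) (by intro h; apply hcd; linarith))
    filter_upwards [this] with z hz
    rw [parity_congr passesAbove_comm, hz, parity_congr (passesAbove_comm (c := d)),
      add_comm (endChange _ _ _ d)]
  have hcx := continuous_planeCross_left ℓ
  have hδ : Continuous fun z => planeCross (d - c) ℓ * planeCross (d - c) (z - c) :=
    continuous_const.mul (continuous_planeCross_sub _ _)
  have hpos : 0 < planeCross (d - c) ℓ := by rw [planeCross_sub_left]; linarith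
  have zero : ∀ z e : ℝ × ℝ, planeCross e ℓ ≠ planeCross z₀ ℓ → endChange ℓ z₀ z e = 0 :=
    fun z e h => parity_false fun h' => h h'.1
  have nc : ∀ z : ℝ × ℝ, ¬ (planeCross d ℓ ≤ planeCross z ℓ ∧ planeCross z ℓ < planeCross c ℓ) :=
    fun z h => by linarith [h.1, h.2]
  have hPA : ∀ z, PassesAbove ℓ z c d ↔
      (planeCross c ℓ ≤ planeCross z ℓ ∧ planeCross z ℓ < planeCross d ℓ) ∧
        planeCross (d - c) ℓ * planeCross (d - c) (z - c) < 0 := by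
    intro z; unfold PassesAbove; simp only [nc z, or_false]
  have vert : ∀ e : ℝ × ℝ, planeCross e ℓ = planeCross z₀ ℓ →
      ℓ.2 * planeCross (d - c) (z₀ - e) = (z₀.2 - e.2) * planeCross (d - c) ℓ := by
    intro e he
    unfold planeCross at he ⊢
    simp only [Prod.fst_sub, Prod.snd_sub]
    linear_combination (d.2 - c.2) * he
  have vertsign : ∀ e : ℝ × ℝ, planeCross e ℓ = planeCross z₀ ℓ →
      (z₀.2 < e.2 → planeCross (d - c) ℓ * planeCross (d - c) (z₀ - e) < 0) ∧
      (e.2 < z₀.2 → 0 < planeCross (d - c) ℓ * planeCross (d - c) (z₀ - e)) := by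
    intro e he
    have := vert e he
    constructor
    · intro h
      have h1 : ℓ.2 * planeCross (d - c) (z₀ - e) < 0 := by rw [this]; nlinarith
      have h2 : planeCross (d - c) (z₀ - e) < 0 := by by_contra! hh; nlinarith
      nlinarith
    · intro h
      have h1 : 0 < ℓ.2 * planeCross (d - c) (z₀ - e) := by rw [this]; nlinarith
      have h2 : 0 < planeCross (d - c) (z₀ - e) := by by_contra! hh; nlinarith
      positivity
  rcases lt_trichotomy (planeCross z₀ ℓ) (planeCross c ℓ) with h1 | h1 | h1
  · filter_upwards [hcx.continuousAt.eventually (gt_mem_nhds h1)] with z hz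
    rw [zero z c h1.ne', zero z d (by linarith : planeCross z₀ ℓ < planeCross d ℓ).ne',
      parity_false, parity_false]
    · simp
    · rw [hPA]; intro h; linarith [h.1.1]
    · rw [hPA]; intro h; linarith [h.1.1]
  · have hne : z₀.2 ≠ c.2 := by
      intro h2
      apply hz
      have : z₀ = c := by
        ext
        · unfold planeCross at h1
          rw [h2] at h1
          exact mul_right_cancel₀ hℓ.ne' (by linarith)
        · exact h2
      rw [this]; exact left_mem_segment ℝ c d
    have h2 : planeCross z₀ ℓ < planeCross d ℓ := by linarith
    rcases lt_or_gt_of_ne hne with h3 | h3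
    · filter_upwards [hcx.continuousAt.eventually (gt_mem_nhds h2),
        hδ.continuousAt.eventually (gt_mem_nhds ((vertsign c h1.symm).1 h3))] with z hz1 hz2
      rw [zero z d h2.ne', add_zero, parity_true ((hPA z₀).2 ⟨⟨h1.ge, h2⟩, (vertsign c h1.symm).1 h3⟩)]
      unfold endChange
      rw [← parity_not]
      apply parity_congr
      rw [hPA]
      simp only [h1, h3, hz1, hz2, true_and, and_true, not_lt]
    · filter_upwards [hδ.continuousAt.eventually (lt_mem_nhds ((vertsign c h1.symm).2 h3))]
        with z hz2
      rw [zero z d h2.ne', parity_false, parity_false, endChange, parity_false]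
      · simp
      · intro h; linarith [h.2.1]
      · rw [hPA]; intro h; linarith [h.2, (vertsign c h1.symm).2 h3]
      · rw [hPA]; intro h; linarith [h.2]
  · rcases lt_trichotomy (planeCross z₀ ℓ) (planeCross d ℓ) with h2 | h2 | h2
    · have hne : planeCross (d - c) ℓ * planeCross (d - c) (z₀ - c) ≠ 0 := fun h =>
        hz (mem_segment_of_planeCross hlt h1.le h2.le ((mul_eq_zero.1 h).resolve_left hpos.ne'))
      rcases lt_or_gt_of_ne hne with h3 | h3
      · filter_upwards [hcx.continuousAt.eventually (gt_mem_nhds h2),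
          hcx.continuousAt.eventually (lt_mem_nhds h1),
          hδ.continuousAt.eventually (gt_mem_nhds h3)] with z hz1 hz2 hz3
        rw [zero z c h1.ne, zero z d h2.ne', parity_true ((hPA z).2 ⟨⟨hz2.le, hz1⟩, hz3⟩),
          parity_true ((hPA z₀).2 ⟨⟨h1.le, h2⟩, h3⟩)]
        simp
      · filter_upwards [hδ.continuousAt.eventually (lt_mem_nhds h3)] with z hz3
        rw [zero z c h1.ne, zero z d h2.ne', parity_false, parity_false]
        · simp
        · rw [hPA]; intro h; linarith [h.2]
        · rw [hPA]; intro h; linarith [h.2]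
    · have hne : z₀.2 ≠ d.2 := by
        intro h3
        apply hz
        have : z₀ = d := by
          ext
          · unfold planeCross at h2
            rw [h3] at h2
            exact mul_right_cancel₀ hℓ.ne' (by linarith)
          · exact h3
        rw [this]; exact right_mem_segment ℝ c d
      have eδ : planeCross (d - c) (z₀ - c) = planeCross (d - c) (z₀ - d) := by
        unfold planeCross; simp only [Prod.fst_sub, Prod.snd_sub]; ring
      have vs := vertsign d h2.symm
      rw [← eδ] at vs
      have hz0 : parity (PassesAbove ℓ z₀ c d) = 0 :=
        parity_false fun h => by linarith [((hPA z₀).1 h).1.2]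
      rw [hz0]
      rcases lt_or_gt_of_ne hne with h3 | h3
      · filter_upwards [hcx.continuousAt.eventually (lt_mem_nhds h1),
          hδ.continuousAt.eventually (gt_mem_nhds (vs.1 h3))] with z hz1 hz2
        rw [zero z c h1.ne, zero_add, zero_add]
        apply parity_congr
        rw [hPA]
        simp only [h2, h3, hz1.le, hz2, true_and, and_true]
      · filter_upwards [hδ.continuousAt.eventually (lt_mem_nhds (vs.2 h3))] with z hz2
        rw [zero z c h1.ne, parity_false, endChange, parity_false]
        · simp
        · intro h; linarith [h.2.1]
        · rw [hPA]; intro h; linarith [h.2]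
    · filter_upwards [hcx.continuousAt.eventually (lt_mem_nhds h2)] with z hz
      rw [zero z c (by linarith : planeCross c ℓ < planeCross z₀ ℓ).ne, zero z d h2.ne,
        parity_false, parity_false]
      · simp
      · rw [hPA]; intro h; linarith [h.1.2]
      · rw [hPA]; intro h; linarith [h.1.2]

/-- The function `f` is locally constant in the open disk outside the set `K`. -/
def LocConstOff (K : Set (ℝ × ℝ)) (f : ℝ × ℝ → ZMod 2) : Prop :=
  ∀ z : ℝ × ℝ, 0 < z.2 → z ∉ K → ∀ᶠ z' in 𝓝 z, f z' = f z

namespace PBDTPNetwork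

variable {V : Type*} {n : ℕ} {N : PBDTPNetwork V n} {ℓ : ℝ × ℝ}

/-- The number modulo two of edges of the walk passing above `z`. -/
noncomputable def upCount (N : PBDTPNetwork V n) (ℓ : ℝ × ℝ) {a b : V} (P : N.graph.Walk a b)
    (z : ℝ × ℝ) : ZMod 2 :=
  (P.darts.map fun d => parity (PassesAbove ℓ z (N.pos d.fst) (N.pos d.snd))).sum

theorem walkSet_cons {a b c : V} (h : N.graph.Adj a b) (P : N.graph.Walk b c) :
    N.walkSet (SimpleGraph.Walk.cons h P) = segment ℝ (N.pos a) (N.pos b) ∪ N.walkSet P := by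
  ext z
  simp [walkSet]

open Filter in
theorem eventually_upCount (hℓ : N.IsGaugeDirection ℓ) {a b : V} (P : N.graph.Walk a b)
    {z₀ : ℝ × ℝ} (hz : z₀ ∉ N.walkSet P) :
    ∀ᶠ z in 𝓝 z₀, N.upCount ℓ P z = N.upCount ℓ P z₀ +
      (endChange ℓ z₀ z (N.pos a) + endChange ℓ z₀ z (N.pos b)) := by
  induction P with
  | nil => exact Eventually.of_forall fun z => by simp [upCount, add_self_zmod_two]
  | @cons a b c h P ih =>
    rw [walkSet_cons, Set.mem_union, not_or] at hz
    filter_upwards [ih hz.2, eventually_passesAbove hℓ.inside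
      (hℓ.not_parallel_of_adj h) hz.1] with z h1 h2
    have e : ∀ z, N.upCount ℓ (SimpleGraph.Walk.cons h P) z =
        parity (PassesAbove ℓ z (N.pos a) (N.pos b)) + N.upCount ℓ P z := by
      intro z; simp [upCount]
    rw [e, e, h1, h2]
    generalize endChange ℓ z₀ z (N.pos a) = x
    generalize endChange ℓ z₀ z (N.pos b) = y
    have := add_self_zmod_two y
    linear_combination this

theorem locConstOff_upCount (hℓ : N.IsGaugeDirection ℓ) {a b : V} (P : N.graph.Walk a b)
    (h : a = b ∨ ((N.pos a).2 = 0 ∧ (N.pos b).2 = 0)) :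
    LocConstOff (N.walkSet P) (N.upCount ℓ P) := by
  intro z hz hzP
  filter_upwards [eventually_upCount hℓ P hzP] with z' hz'
  rw [hz']
  rcases h with rfl | ⟨ha, hb⟩
  · rw [add_self_zmod_two, add_zero]
  · rw [endChange, endChange, parity_false, parity_false]
    · simp
    · intro h; linarith [h.2.1]
    · intro h; linarith [h.2.1]

end PBDTPNetwork

open Filter in
theorem IsPreconnected.eq_of_eventually_eq {X Y : Type*} [TopologicalSpace X] {s : Set X}
    (hs : IsPreconnected s) {f : X → Y} (hf : ∀ x ∈ s, ∀ᶠ y in 𝓝[s] x, f y = f x) {a b : X}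
    (ha : a ∈ s) (hb : b ∈ s) : f a = f b := by
  let _ : TopologicalSpace Y := ⊥
  have : DiscreteTopology Y := ⟨rfl⟩
  refine hs.constant (f := f) (fun x hx => ?_) ha hb
  rw [ContinuousWithinAt, nhds_discrete, tendsto_pure]
  exact hf x hx

/-- The value `y` is taken by `f` at the points close to `q` to the left of the line through `q`
in direction `e`. -/
def LeftAt (f : ℝ × ℝ → ZMod 2) (e q : ℝ × ℝ) (y : ZMod 2) : Prop :=
  ∀ᶠ z in 𝓝 q, 0 < planeCross e (z - q) → f z = y

/-- The value `y` is taken by `f` along the left side of the segment from `c` to `d`. -/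
def LeftVal (f : ℝ × ℝ → ZMod 2) (c d : ℝ × ℝ) (y : ZMod 2) : Prop :=
  ∀ q ∈ openSegment ℝ c d, LeftAt f (d - c) q y

/-- The vectors pointing to the left of a curve that arrives in direction `e` and leaves in
direction `g`. -/
def LeftCone (e g w : ℝ × ℝ) : Prop :=
  if 0 < planeCross e g then 0 < planeCross e w ∧ 0 < planeCross g w
  else 0 < planeCross e w ∨ 0 < planeCross g w

theorem planeCross_rotLeft (e : ℝ × ℝ) : planeCross e (rotLeft e) = e.1 ^ 2 + e.2 ^ 2 := by
  unfold planeCross rotLeft; ring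

theorem planeCross_rotLeft_pos {e : ℝ × ℝ} (he : e ≠ 0) : 0 < planeCross e (rotLeft e) := by
  rw [planeCross_rotLeft]
  by_contra! h
  have h1 : e.1 = 0 := by nlinarith [sq_nonneg e.1, sq_nonneg e.2]
  have h2 : e.2 = 0 := by nlinarith [sq_nonneg e.1, sq_nonneg e.2]
  exact he (Prod.ext h1 h2)

theorem convex_planeCross_pos (e q : ℝ × ℝ) : Convex ℝ {z : ℝ × ℝ | 0 < planeCross e (z - q)} := by
  intro x hx y hy a b ha hb hab
  simp only [Set.mem_ofPred_eq, planeCross_sub_right, planeCross_add_right,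
    planeCross_smul_right] at *
  have : a * planeCross e x + b * planeCross e y - planeCross e q =
      a * (planeCross e x - planeCross e q) + b * (planeCross e y - planeCross e q) := by
    linear_combination (planeCross e q) * hab
  rw [this]
  rcases ha.eq_or_lt with rfl | ha
  · have : b = 1 := by linarith
    subst this; simpa using hy
  · have := mul_pos ha hx
    have := mul_nonneg hb hy.le
    linarith

theorem tendsto_add_smul (q w : ℝ × ℝ) :
    Filter.Tendsto (fun t : ℝ => q + t • w) (𝓝[>] 0) (𝓝 q) := by
  have : Continuous fun t : ℝ => q + t • w := by fun_prop
  have h := this.tendsto 0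
  simp only [zero_smul, add_zero] at h
  exact h.mono_left nhdsWithin_le_nhds

theorem tendsto_sub_smul (q w : ℝ × ℝ) :
    Filter.Tendsto (fun t : ℝ => q - t • w) (𝓝[>] 0) (𝓝 q) := by
  have := tendsto_add_smul q (-w)
  simpa only [smul_neg, ← sub_eq_add_neg] using this

open Filter in
/-- A function is constant on the trace of a convex set in a neighbourhood of `q`. -/
theorem LocConstOff.exists_eventually {K : Set (ℝ × ℝ)} {f : ℝ × ℝ → ZMod 2} (hf : LocConstOff K f)
    {C : Set (ℝ × ℝ)} (hC : Convex ℝ C) {q : ℝ × ℝ}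
    (h : ∀ᶠ z in 𝓝 q, z ∈ C → 0 < z.2 ∧ z ∉ K) : ∃ y, ∀ᶠ z in 𝓝 q, z ∈ C → f z = y := by
  obtain ⟨r, hr, hb⟩ := Metric.eventually_nhds_iff_ball.1 h
  have hconv : Convex ℝ (C ∩ Metric.ball q r) := hC.inter (convex_ball q r)
  rcases (C ∩ Metric.ball q r).eq_empty_or_nonempty with h0 | ⟨z₀, hz₀⟩
  · refine ⟨0, ?_⟩
    filter_upwards [Metric.ball_mem_nhds q hr] with z hz hzC
    exact absurd (show z ∈ C ∩ Metric.ball q r from ⟨hzC, hz⟩) (by rw [h0]; simp)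
  · refine ⟨f z₀, ?_⟩
    filter_upwards [Metric.ball_mem_nhds q hr] with z hz hzC
    refine hconv.isPreconnected.eq_of_eventually_eq (fun x hx => ?_) ⟨hzC, hz⟩ hz₀
    have := hb x hx.2 hx.1
    exact (hf x this.1 this.2).filter_mono nhdsWithin_le_nhds

theorem LocConstOff.eq_of_isPreconnected {K : Set (ℝ × ℝ)} {f : ℝ × ℝ → ZMod 2}
    (hf : LocConstOff K f) {s : Set (ℝ × ℝ)} (hs : IsPreconnected s)
    (h : ∀ z ∈ s, 0 < z.2 ∧ z ∉ K) {a b : ℝ × ℝ} (ha : a ∈ s) (hb : b ∈ s) : f a = f b :=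
  hs.eq_of_eventually_eq (fun x hx => (hf x (h x hx).1 (h x hx).2).filter_mono
    nhdsWithin_le_nhds) ha hb

open Filter in
theorem LocConstOff.exists_leftAt {K : Set (ℝ × ℝ)} {f : ℝ × ℝ → ZMod 2} (hf : LocConstOff K f)
    {e q : ℝ × ℝ} (hq : 0 < q.2) (h : ∀ᶠ z in 𝓝 q, z ∈ K → planeCross e (z - q) = 0) :
    ∃ y, LeftAt f e q y := by
  refine hf.exists_eventually (convex_planeCross_pos e q) ?_
  filter_upwards [h, continuous_snd.continuousAt.eventually (lt_mem_nhds hq)] with z hz h2 hzC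
  exact ⟨h2, fun hK => hzC.ne' (hz hK)⟩

theorem eventually_planeCross_add_smul {e w : ℝ × ℝ} (q : ℝ × ℝ) (h : 0 < planeCross e w) :
    ∀ᶠ t in 𝓝[>] (0 : ℝ), 0 < planeCross e (q + t • w - q) := by
  filter_upwards [self_mem_nhdsWithin] with t ht
  rw [add_sub_cancel_left, planeCross_smul_right]
  exact mul_pos ht h

theorem LeftAt.eventually {f : ℝ × ℝ → ZMod 2} {e q w : ℝ × ℝ} {y : ZMod 2} (h : LeftAt f e q y)
    (hw : 0 < planeCross e w) : ∀ᶠ t in 𝓝[>] (0 : ℝ), f (q + t • w) = y := by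
  filter_upwards [(tendsto_add_smul q w).eventually h, eventually_planeCross_add_smul q hw]
    with t h1 h2
  exact h1 h2

theorem LeftAt.unique {f : ℝ × ℝ → ZMod 2} {e q : ℝ × ℝ} {y y' : ZMod 2} (he : e ≠ 0)
    (h : LeftAt f e q y) (h' : LeftAt f e q y') : y = y' := by
  obtain ⟨t, h1, h2⟩ := ((h.eventually (planeCross_rotLeft_pos he)).and
    (h'.eventually (planeCross_rotLeft_pos he))).exists
  rw [← h1, ← h2]

open Filter in
theorem LeftAt.eventually_leftAt {f : ℝ × ℝ → ZMod 2} {e q : ℝ × ℝ} {y : ZMod 2}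
    (h : LeftAt f e q y) : ∀ᶠ q' in 𝓝 q, planeCross e (q' - q) = 0 → LeftAt f e q' y := by
  filter_upwards [eventually_eventually_nhds.2 h] with q' hq' h0
  filter_upwards [hq'] with z hz hz'
  apply hz
  rw [planeCross_sub_right] at hz' h0 ⊢
  linarith

theorem planeCross_of_mem_segment {c d q : ℝ × ℝ} (hq : q ∈ segment ℝ c d) :
    planeCross (d - c) (q - c) = 0 := by
  obtain ⟨t, -, -, rfl⟩ := exists_mem_segment_iff.1 hq
  rw [add_sub_cancel_left, planeCross_smul_right, planeCross_self, mul_zero]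

theorem exists_leftVal {f : ℝ × ℝ → ZMod 2} {c d : ℝ × ℝ} (hcd : c ≠ d)
    (h : ∀ q ∈ openSegment ℝ c d, ∃ y, LeftAt f (d - c) q y) : ∃ y, LeftVal f c d y := by
  have hne : d - c ≠ 0 := sub_ne_zero.2 hcd.symm
  choose! Y hY using h
  have hmid : midpoint ℝ c d ∈ openSegment ℝ c d := midpoint_mem_openSegment c d
  refine ⟨Y (midpoint ℝ c d), fun q hq => ?_⟩
  have : Y (midpoint ℝ c d) = Y q := by
    refine (convex_openSegment c d).isPreconnected.eq_of_eventually_eq (fun x hx => ?_) hmid hq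
    filter_upwards [self_mem_nhdsWithin, (hY x hx).eventually_leftAt.filter_mono
      nhdsWithin_le_nhds] with z hz h1
    refine (hY z hz).unique hne (h1 ?_)
    have a := planeCross_of_mem_segment (openSegment_subset_segment ℝ _ _ hz)
    have b := planeCross_of_mem_segment (openSegment_subset_segment ℝ _ _ hx)
    rw [planeCross_sub_right] at a b ⊢
    linarith
  rw [this]
  exact hY q hq

theorem openSegment_eventually {c d : ℝ × ℝ} :
    ∀ᶠ t in 𝓝[>] (0 : ℝ), c + t • (d - c) ∈ openSegment ℝ c d := by
  filter_upwards [Ioo_mem_nhdsGT (zero_lt_one' ℝ)] with t ht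
  rw [openSegment_eq_image']
  exact ⟨t, ht, rfl⟩

theorem openSegment_eventually' {c d : ℝ × ℝ} :
    ∀ᶠ t in 𝓝[>] (0 : ℝ), d - t • (d - c) ∈ openSegment ℝ c d := by
  rw [openSegment_symm]
  filter_upwards [openSegment_eventually (c := d) (d := c)] with t ht
  convert ht using 1
  rw [← neg_sub d c, smul_neg, sub_eq_add_neg]

theorem LeftVal.unique {f : ℝ × ℝ → ZMod 2} {c d : ℝ × ℝ} {y y' : ZMod 2} (hcd : c ≠ d)
    (h : LeftVal f c d y) (h' : LeftVal f c d y') : y = y' := by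
  have hmid : midpoint ℝ c d ∈ openSegment ℝ c d := midpoint_mem_openSegment c d
  exact (h _ hmid).unique (sub_ne_zero.2 hcd.symm) (h' _ hmid)

open Filter in
/-- At a vertex `v` between `u` and `x`, a function that is locally constant off a curve through
`u`, `v`, `x` takes a single value on the left of the curve close to `v`. -/
theorem LocConstOff.exists_leftCone {K : Set (ℝ × ℝ)} {f : ℝ × ℝ → ZMod 2} (hf : LocConstOff K f)
    {u v x ℓ : ℝ × ℝ} (hv : 0 < v.2)
    (hpar : planeCross (v - u) (x - v) = 0 → 0 < planeCross (v - u) ℓ * planeCross (x - v) ℓ)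
    (hK : ∀ᶠ z in 𝓝 v, z ∈ K → z ∈ segment ℝ u v ∨ z ∈ segment ℝ v x) :
    ∃ y, ∀ᶠ z in 𝓝 v, LeftCone (v - u) (x - v) (z - v) → f z = y := by
  have hv2 := continuous_snd.continuousAt.eventually (lt_mem_nhds hv)
  have seg1 : ∀ z ∈ segment ℝ u v, ∃ t : ℝ, 0 ≤ t ∧ z - v = t • (u - v) := by
    intro z hz
    rw [segment_symm] at hz
    obtain ⟨t, h0, -, rfl⟩ := exists_mem_segment_iff.1 hz
    exact ⟨t, h0, by abel⟩
  have seg2 : ∀ z ∈ segment ℝ v x, ∃ t : ℝ, 0 ≤ t ∧ z - v = t • (x - v) := by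
    intro z hz
    obtain ⟨t, h0, -, rfl⟩ := exists_mem_segment_iff.1 hz
    exact ⟨t, h0, by abel⟩
  set e := v - u with he
  set g := x - v with hg
  have hue : u - v = -e := by rw [he]; abel
  rw [hue] at seg1
  have ge : planeCross g e = -planeCross e g := planeCross_swap _ _
  unfold LeftCone
  split_ifs with hpos
  · refine hf.exists_eventually (C := {z | 0 < planeCross e (z - v)} ∩ {z | 0 < planeCross g (z - v)})
      ((convex_planeCross_pos e v).inter (convex_planeCross_pos g v)) ?_
    filter_upwards [hK, hv2] with z hz h2 hzC
    refine ⟨h2, fun h => ?_⟩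
    rcases hz h with h | h
    · obtain ⟨t, h0, h1⟩ := seg1 z h
      have := hzC.1
      simp only [Set.mem_ofPred_eq, h1, planeCross_smul_right, planeCross_neg_right,
        planeCross_self] at this
      linarith
    · obtain ⟨t, h0, h1⟩ := seg2 z h
      have := hzC.2
      simp only [Set.mem_ofPred_eq, h1, planeCross_smul_right, planeCross_self] at this
      linarith
  · have hle := not_lt.1 hpos
    obtain ⟨y₁, h₁⟩ := hf.exists_eventually (convex_planeCross_pos e v) (by
      filter_upwards [hK, hv2] with z hz h2 hzC
      refine ⟨h2, fun h => ?_⟩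
      rcases hz h with h | h
      · obtain ⟨t, h0, h1⟩ := seg1 z h
        simp only [h1, planeCross_smul_right, planeCross_neg_right, planeCross_self] at hzC
        linarith
      · obtain ⟨t, h0, h1⟩ := seg2 z h
        simp only [h1, planeCross_smul_right] at hzC
        nlinarith)
    obtain ⟨y₂, h₂⟩ := hf.exists_eventually (convex_planeCross_pos g v) (by
      filter_upwards [hK, hv2] with z hz h2 hzC
      refine ⟨h2, fun h => ?_⟩
      rcases hz h with h | h
      · obtain ⟨t, h0, h1⟩ := seg1 z h
        simp only [h1, planeCross_smul_right, planeCross_neg_right, ge] at hzC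
        nlinarith
      · obtain ⟨t, h0, h1⟩ := seg2 z h
        simp only [h1, planeCross_smul_right, planeCross_self] at hzC
        linarith)
    obtain ⟨w, hw1, hw2⟩ : ∃ w, 0 < planeCross e w ∧ 0 < planeCross g w := by
      rcases hle.lt_or_eq with h | h
      · refine ⟨e - g, ?_, ?_⟩
        · rw [planeCross_sub_right, planeCross_self]; linarith
        · rw [planeCross_sub_right, planeCross_self, ge]; linarith
      · have hp := hpar h
        have hne : planeCross e ℓ ≠ 0 := by rintro h0; rw [h0] at hp; linarith
        refine ⟨planeCross e ℓ • ℓ, ?_, ?_⟩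
        · rw [planeCross_smul_right]; exact mul_self_pos.2 hne
        · rw [planeCross_smul_right]; exact hp
    have hy : y₁ = y₂ := by
      obtain ⟨t, a, b⟩ := ((LeftAt.eventually h₁ hw1).and (LeftAt.eventually h₂ hw2)).exists
      rw [← a, ← b]
    refine ⟨y₁, ?_⟩
    filter_upwards [h₁, h₂] with z a b h
    rcases h with h | h
    · exact a h
    · rw [hy]; exact b h

theorem leftCone_of_mem {e g : ℝ × ℝ} {a : ℝ} {w : ℝ × ℝ}
    (hw : 0 < planeCross e (w + a • e)) (hg : 0 < planeCross e g → 0 < planeCross g w) :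
    LeftCone e g w := by
  rw [planeCross_add_right, planeCross_smul_right, planeCross_self, mul_zero, add_zero] at hw
  unfold LeftCone
  split_ifs with h
  · exact ⟨hw, hg h⟩
  · exact Or.inl hw

open Filter in
theorem leftVal_eq_of_leftCone_in {f : ℝ × ℝ → ZMod 2} {u v x : ℝ × ℝ} {y y' : ZMod 2} (huv : u ≠ v)
    (h : ∀ᶠ z in 𝓝 v, LeftCone (v - u) (x - v) (z - v) → f z = y) (h' : LeftVal f u v y') :
    y' = y := by
  obtain ⟨a, ha, hq, hev⟩ := ((eventually_mem_nhdsWithin (a := (0 : ℝ)) (s := Set.Ioi 0)).and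
    ((openSegment_eventually' (c := u) (d := v)).and
    ((tendsto_sub_smul v (v - u)).eventually (eventually_eventually_nhds.2 h)))).exists
  refine (h' _ hq).unique (sub_ne_zero.2 huv.symm) ?_
  set e := v - u with he
  set g := x - v with hg
  by_cases hpos : 0 < planeCross e g
  · have : ∀ᶠ z in 𝓝 (v - a • e), 0 < planeCross g (z - v) := by
      refine (continuous_planeCross_sub g v).continuousAt.eventually (lt_mem_nhds ?_)
      have : v - a • e - v = -(a • e) := by abel
      simp only [this, planeCross_neg_right, planeCross_smul_right]
      rw [planeCross_swap]
      have := mul_pos (show (0 : ℝ) < a from ha) hpos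
      linarith
    filter_upwards [hev, this] with z hz h1 h2
    refine hz (leftCone_of_mem (a := a) ?_ fun _ => h1)
    have : z - v + a • e = z - (v - a • e) := by abel
    rwa [this]
  · filter_upwards [hev] with z hz h2
    refine hz (leftCone_of_mem (a := a) ?_ fun h => absurd h hpos)
    have : z - v + a • e = z - (v - a • e) := by abel
    rwa [this]

open Filter in
theorem leftVal_eq_of_leftCone_out {f : ℝ × ℝ → ZMod 2} {u v x : ℝ × ℝ} {y y' : ZMod 2}
    (hvx : v ≠ x)
    (h : ∀ᶠ z in 𝓝 v, LeftCone (v - u) (x - v) (z - v) → f z = y) (h' : LeftVal f v x y') :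
    y' = y := by
  obtain ⟨a, ha, hq, hev⟩ := ((eventually_mem_nhdsWithin (a := (0 : ℝ)) (s := Set.Ioi 0)).and
    ((openSegment_eventually (c := v) (d := x)).and
    ((tendsto_add_smul v (x - v)).eventually (eventually_eventually_nhds.2 h)))).exists
  refine (h' _ hq).unique (sub_ne_zero.2 hvx.symm) ?_
  set e := v - u with he
  set g := x - v with hg
  have key : ∀ z, 0 < planeCross g (z - (v + a • g)) → 0 < planeCross g (z - v) := by
    intro z hz
    have : z - v = z - (v + a • g) + a • g := by abel
    rw [this, planeCross_add_right, planeCross_smul_right, planeCross_self]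
    linarith
  by_cases hpos : 0 < planeCross e g
  · have : ∀ᶠ z in 𝓝 (v + a • g), 0 < planeCross e (z - v) := by
      refine (continuous_planeCross_sub e v).continuousAt.eventually (lt_mem_nhds ?_)
      simp only [add_sub_cancel_left, planeCross_smul_right]
      exact mul_pos ha hpos
    filter_upwards [hev, this] with z hz h1 h2
    refine hz ?_
    rw [LeftCone, if_pos hpos]
    exact ⟨h1, key z h2⟩
  · filter_upwards [hev] with z hz h2
    refine hz ?_
    rw [LeftCone, if_neg hpos]
    exact Or.inr (key z h2)

theorem isClosed_segment_prod (a b : ℝ × ℝ) : IsClosed (segment ℝ a b) := by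
  rw [segment_eq_image]
  exact (isCompact_Icc.image (by fun_prop)).isClosed

theorem right_notMem_openSegment {a b : ℝ × ℝ} (h : a ≠ b) : b ∉ openSegment ℝ a b :=
  fun hb => h (right_mem_openSegment_iff.1 hb)

theorem left_notMem_openSegment {a b : ℝ × ℝ} (h : a ≠ b) : a ∉ openSegment ℝ a b :=
  fun hb => h (left_mem_openSegment_iff.1 hb)

namespace PBDTPNetwork

variable {V : Type*} {n : ℕ} {N : PBDTPNetwork V n} {ℓ : ℝ × ℝ} {O : V → V → Prop}

theorem exists_adj (N : PBDTPNetwork V n) (v : V) : ∃ w, N.graph.Adj v w := by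
  obtain ⟨i, ⟨P⟩⟩ := N.connected v
  cases P with
  | nil =>
    obtain ⟨w, hw, -⟩ := N.bdry_edge i
    exact ⟨w, show w ∈ N.graph.neighborSet (N.bdry i) by rw [hw]; rfl⟩
  | cons h _ => exact ⟨_, h⟩

theorem eq_or_eq_of_pos_mem_segment {u v w : V} (h : N.graph.Adj u w)
    (hv : N.pos v ∈ segment ℝ (N.pos u) (N.pos w)) : v = u ∨ v = w := by
  obtain ⟨x, hx⟩ := N.exists_adj v
  by_cases hs : s(u, w) = s(v, x)
  · rw [Sym2.eq_iff] at hs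
    rcases hs with ⟨rfl, -⟩ | ⟨-, rfl⟩ <;> simp
  · obtain ⟨t, ht, -, h2⟩ := N.planar _ _ _ _ h hx hs _ ⟨hv, left_mem_segment ℝ _ _⟩
    rw [N.pos_injective h2]
    exact Sym2.mem_iff.1 ht

theorem snd_pos_of_mem_openSegment {u w : V} (h : N.graph.Adj u w) {q : ℝ × ℝ}
    (hq : q ∈ openSegment ℝ (N.pos u) (N.pos w)) : 0 < q.2 := by
  obtain ⟨a, b, ha, hb, hab, rfl⟩ := hq
  have hu := N.pos_snd_nonneg u
  have hw := N.pos_snd_nonneg w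
  simp only [Prod.snd_add, Prod.smul_snd, smul_eq_mul]
  rcases N.isInternal_or u with h1 | ⟨i, rfl⟩
  · have := N.internal_inside u h1
    have := mul_pos ha this
    have := mul_nonneg hb.le hw
    linarith
  · have := N.internal_inside w (N.isInternal_of_adj_bdry h)
    have := mul_pos hb this
    have := mul_nonneg ha.le hu
    linarith

/-- The union of the directed edges in `W`. -/
def curveSet (N : PBDTPNetwork V n) (W : V → V → Prop) : Set (ℝ × ℝ) :=
  {z | ∃ u v, W u v ∧ z ∈ segment ℝ (N.pos u) (N.pos v)}

/-- `W` consists of the edges of a simple directed curve that can only begin and end at the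
boundary. -/
structure IsCurve (N : PBDTPNetwork V n) (O W : V → V → Prop) : Prop where
  dir : ∀ u v, W u v → O u v
  out_unique : ∀ u v v', W u v → W u v' → v = v'
  in_unique : ∀ u u' v, W u v → W u' v → u = u'
  exists_out : ∀ u v, W u v → N.IsInternal v → ∃ x, W v x
  exists_in : ∀ v x, W v x → N.IsInternal v → ∃ u, W u v
  chain : ∀ p : V → V → Prop, (∀ u v x, W u v → W v x → (p u v ↔ p v x)) →
    ∀ u v u' v', W u v → W u' v' → p u v → p u' v'

theorem eventually_mem_segment [Finite V] (N : PBDTPNetwork V n) (q : ℝ × ℝ) :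
    ∀ᶠ z in 𝓝 q, ∀ u w, z ∈ segment ℝ (N.pos u) (N.pos w) → q ∈ segment ℝ (N.pos u) (N.pos w) := by
  rw [Filter.eventually_all]
  intro u
  rw [Filter.eventually_all]
  intro w
  by_cases h : q ∈ segment ℝ (N.pos u) (N.pos w)
  · exact Filter.Eventually.of_forall fun _ _ => h
  · filter_upwards [(isClosed_segment_prod (N.pos u) (N.pos w)).isOpen_compl.mem_nhds h]
      with z hz hz'
    exact absurd hz' hz

theorem isClosed_curveSet [Finite V] (N : PBDTPNetwork V n) (W : V → V → Prop) :
    IsClosed (N.curveSet W) := by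
  rw [← isOpen_compl_iff, isOpen_iff_mem_nhds]
  intro q hq
  filter_upwards [N.eventually_mem_segment q] with z hz
  rintro ⟨u, v, h, h'⟩
  exact hq ⟨u, v, h, hz _ _ h'⟩

namespace IsCurve

variable {W : V → V → Prop}

theorem adj (hO : N.IsPerfect O) (hW : N.IsCurve O W) {u v : V} (h : W u v) : N.graph.Adj u v :=
  hO.adj _ _ (hW.dir _ _ h)

theorem pos_ne (hO : N.IsPerfect O) (hW : N.IsCurve O W) {u v : V} (h : W u v) :
    N.pos u ≠ N.pos v := fun h' => (hW.adj hO h).ne (N.pos_injective h')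

theorem isInternal (hO : N.IsPerfect O) (hW : N.IsCurve O W) {u v x : V} (h : W u v) (h' : W v x) :
    N.IsInternal v := hO.isInternal_of_in_out (hW.dir _ _ h) (hW.dir _ _ h')

theorem ne (hO : N.IsPerfect O) (hW : N.IsCurve O W) {u v x : V} (h : W u v) (h' : W v x) :
    u ≠ x := by
  rintro rfl
  exact hO.asymm _ _ (hW.dir _ _ h) (hW.dir _ _ h')

theorem eventually_vertex [Finite V] (hO : N.IsPerfect O) (hW : N.IsCurve O W) (v : V) :
    ∀ᶠ z in 𝓝 (N.pos v), z ∈ N.curveSet W →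
      (∃ u, W u v ∧ z ∈ segment ℝ (N.pos u) (N.pos v)) ∨
      (∃ x, W v x ∧ z ∈ segment ℝ (N.pos v) (N.pos x)) := by
  filter_upwards [N.eventually_mem_segment (N.pos v)] with z hz
  rintro ⟨u, w, h, h'⟩
  rcases N.eq_or_eq_of_pos_mem_segment (hW.adj hO h) (hz u w h') with rfl | rfl
  · exact Or.inr ⟨w, h, h'⟩
  · exact Or.inl ⟨u, h, h'⟩

theorem eventually_openSegment [Finite V] (hO : N.IsPerfect O) (hW : N.IsCurve O W) {u v : V}
    (h : W u v) {q : ℝ × ℝ} (hq : q ∈ openSegment ℝ (N.pos u) (N.pos v)) :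
    ∀ᶠ z in 𝓝 q, z ∈ N.curveSet W → z ∈ segment ℝ (N.pos u) (N.pos v) := by
  filter_upwards [N.eventually_mem_segment q] with z hz
  rintro ⟨x, y, h', hz'⟩
  have hq' := hz x y hz'
  by_cases hs : s(u, v) = s(x, y)
  · rw [Sym2.eq_iff] at hs
    rcases hs with ⟨rfl, rfl⟩ | ⟨rfl, rfl⟩
    · exact hz'
    · exact absurd (hW.dir _ _ h) (hO.asymm _ _ (hW.dir _ _ h'))
  · obtain ⟨t, ht, -, rfl⟩ := N.planar _ _ _ _ (hW.adj hO h) (hW.adj hO h') hs q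
      ⟨openSegment_subset_segment ℝ _ _ hq, hq'⟩
    rcases Sym2.mem_iff.1 ht with rfl | rfl
    · exact absurd hq (left_notMem_openSegment (hW.pos_ne hO h))
    · exact absurd hq (right_notMem_openSegment (hW.pos_ne hO h))

theorem exists_leftAt [Finite V] (hO : N.IsPerfect O) (hW : N.IsCurve O W) {f : ℝ × ℝ → ZMod 2}
    (hf : LocConstOff (N.curveSet W) f) {u v : V} (h : W u v) :
    (∃ y, LeftVal f (N.pos u) (N.pos v) y) ∧ ∃ y, LeftVal f (N.pos v) (N.pos u) y := by
  constructor
  · refine exists_leftVal (hW.pos_ne hO h) fun q hq => ?_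
    refine hf.exists_leftAt (N.snd_pos_of_mem_openSegment (hW.adj hO h) hq) ?_
    filter_upwards [hW.eventually_openSegment hO h hq] with z hz hz'
    have a := planeCross_of_mem_segment (hz hz')
    have b := planeCross_of_mem_segment (openSegment_subset_segment ℝ _ _ hq)
    rw [planeCross_sub_right] at a b ⊢
    linarith
  · refine exists_leftVal (hW.pos_ne hO h).symm fun q hq => ?_
    rw [openSegment_symm] at hq
    refine hf.exists_leftAt (N.snd_pos_of_mem_openSegment (hW.adj hO h) hq) ?_
    filter_upwards [hW.eventually_openSegment hO h hq] with z hz hz'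
    have a := planeCross_of_mem_segment ((segment_symm ℝ _ _).subset (hz hz'))
    have b := planeCross_of_mem_segment
      ((segment_symm ℝ _ _).subset (openSegment_subset_segment ℝ _ _ hq))
    rw [planeCross_sub_right] at a b ⊢
    linarith

theorem pos_mul_of_parallel (hℓ : N.IsGaugeDirection ℓ) (hO : N.IsPerfect O) (hW : N.IsCurve O W)
    {u v x : V} (h : W u v) (h' : W v x)
    (h0 : planeCross (N.pos v - N.pos u) (N.pos x - N.pos v) = 0) :
    0 < planeCross (N.pos v - N.pos u) ℓ * planeCross (N.pos x - N.pos v) ℓ := by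
  by_contra hc
  refine N.planeCross_ne_zero_of_turn (ℓ := ℓ) (hW.adj hO h) (hW.adj hO h') (hW.ne hO h h') ?_ h0
  exact lt_of_le_of_ne (not_lt.1 hc) (mul_ne_zero (hℓ.not_parallel_of_adj (hW.adj hO h))
    (hℓ.not_parallel_of_adj (hW.adj hO h')))

theorem eventually_leftCone [Finite V] (hℓ : N.IsGaugeDirection ℓ) (hO : N.IsPerfect O)
    (hW : N.IsCurve O W) {f : ℝ × ℝ → ZMod 2} (hf : LocConstOff (N.curveSet W) f) {u v x : V}
    (h : W u v) (h' : W v x) {y : ZMod 2} (hy : LeftVal f (N.pos u) (N.pos v) y) :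
    ∀ᶠ z in 𝓝 (N.pos v), LeftCone (N.edgeDir u v) (N.edgeDir v x) (z - N.pos v) → f z = y := by
  obtain ⟨y', hy'⟩ := hf.exists_leftCone (u := N.pos u) (v := N.pos v) (x := N.pos x) (ℓ := ℓ)
    (N.internal_inside v (hW.isInternal hO h h')) (hW.pos_mul_of_parallel hℓ hO h h') (by
      filter_upwards [hW.eventually_vertex hO v] with z hz hz'
      rcases hz hz' with ⟨u', h1, h2⟩ | ⟨x', h1, h2⟩
      · rw [hW.in_unique _ _ _ h h1]; exact Or.inl h2
      · rw [hW.out_unique _ _ _ h' h1]; exact Or.inr h2)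
  rw [leftVal_eq_of_leftCone_in (hW.pos_ne hO h) hy' hy]
  exact hy'

theorem eventually_rightCone [Finite V] (hℓ : N.IsGaugeDirection ℓ) (hO : N.IsPerfect O)
    (hW : N.IsCurve O W) {f : ℝ × ℝ → ZMod 2} (hf : LocConstOff (N.curveSet W) f) {u v x : V}
    (h : W u v) (h' : W v x) {y : ZMod 2} (hy : LeftVal f (N.pos v) (N.pos u) y) :
    ∀ᶠ z in 𝓝 (N.pos v), LeftCone (N.edgeDir x v) (N.edgeDir v u) (z - N.pos v) → f z = y := by
  obtain ⟨y', hy'⟩ := hf.exists_leftCone (u := N.pos x) (v := N.pos v) (x := N.pos u) (ℓ := ℓ)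
    (N.internal_inside v (hW.isInternal hO h h')) (by
      intro h0
      have e1 : N.pos v - N.pos x = -(N.pos x - N.pos v) := by abel
      have e2 : N.pos u - N.pos v = -(N.pos v - N.pos u) := by abel
      rw [e1, e2, planeCross_neg_left, planeCross_neg_right, neg_neg, planeCross_swap,
        neg_eq_zero] at h0
      have := hW.pos_mul_of_parallel hℓ hO h h' h0
      rw [e1, e2, planeCross_neg_left, planeCross_neg_left, neg_mul_neg, mul_comm]
      exact this) (by
      filter_upwards [hW.eventually_vertex hO v] with z hz hz'
      rcases hz hz' with ⟨u', h1, h2⟩ | ⟨x', h1, h2⟩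
      · rw [hW.in_unique _ _ _ h h1, segment_symm ℝ (N.pos v)]; exact Or.inr h2
      · rw [hW.out_unique _ _ _ h' h1, segment_symm ℝ _ (N.pos v)]; exact Or.inl h2)
  rw [leftVal_eq_of_leftCone_out (hW.pos_ne hO h).symm hy' hy]
  exact hy'

theorem leftVal_of_leftVal [Finite V] (hℓ : N.IsGaugeDirection ℓ) (hO : N.IsPerfect O)
    (hW : N.IsCurve O W) {f : ℝ × ℝ → ZMod 2} (hf : LocConstOff (N.curveSet W) f) {u v u' v' : V}
    (h : W u v) (h' : W u' v') {y : ZMod 2} (hy : LeftVal f (N.pos u) (N.pos v) y) :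
    LeftVal f (N.pos u') (N.pos v') y := by
  refine hW.chain (fun u v => LeftVal f (N.pos u) (N.pos v) y) (fun u v x h1 h2 => ?_) u v u' v'
    h h' hy
  obtain ⟨⟨y₁, hy₁⟩, -⟩ := hW.exists_leftAt hO hf h1
  obtain ⟨⟨y₂, hy₂⟩, -⟩ := hW.exists_leftAt hO hf h2
  have := leftVal_eq_of_leftCone_out (hW.pos_ne hO h2) (hW.eventually_leftCone hℓ hO hf h1 h2 hy₁) hy₂
  subst this
  exact ⟨fun h3 => h3.unique (hW.pos_ne hO h1) hy₁ ▸ hy₂,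
    fun h3 => h3.unique (hW.pos_ne hO h2) hy₂ ▸ hy₁⟩

theorem rightVal_of_rightVal [Finite V] (hℓ : N.IsGaugeDirection ℓ) (hO : N.IsPerfect O)
    (hW : N.IsCurve O W) {f : ℝ × ℝ → ZMod 2} (hf : LocConstOff (N.curveSet W) f) {u v u' v' : V}
    (h : W u v) (h' : W u' v') {y : ZMod 2} (hy : LeftVal f (N.pos v) (N.pos u) y) :
    LeftVal f (N.pos v') (N.pos u') y := by
  refine hW.chain (fun u v => LeftVal f (N.pos v) (N.pos u) y) (fun u v x h1 h2 => ?_) u v u' v'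
    h h' hy
  obtain ⟨-, y₁, hy₁⟩ := hW.exists_leftAt hO hf h1
  obtain ⟨-, y₂, hy₂⟩ := hW.exists_leftAt hO hf h2
  have := leftVal_eq_of_leftCone_in (hW.pos_ne hO h2).symm
    (hW.eventually_rightCone hℓ hO hf h1 h2 hy₁) hy₂
  subst this
  exact ⟨fun h3 => h3.unique (hW.pos_ne hO h1).symm hy₁ ▸ hy₂,
    fun h3 => h3.unique (hW.pos_ne hO h2).symm hy₂ ▸ hy₁⟩

open Filter in
/-- Close to the boundary source where the curve begins, the values on both sides of the curve are
taken in whole sectors. -/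
theorem eventually_start [Finite V] (hO : N.IsPerfect O) (hW : N.IsCurve O W)
    {f : ℝ × ℝ → ZMod 2} (hf : LocConstOff (N.curveSet W) f) {i : Fin n} {x : V}
    (h : W (N.bdry i) x) {y : ZMod 2} :
    (LeftVal f (N.pos (N.bdry i)) (N.pos x) y → ∀ᶠ z in 𝓝 (N.pos (N.bdry i)),
      0 < z.2 → 0 < planeCross (N.edgeDir (N.bdry i) x) (z - N.pos (N.bdry i)) → f z = y) ∧
    (LeftVal f (N.pos x) (N.pos (N.bdry i)) y → ∀ᶠ z in 𝓝 (N.pos (N.bdry i)),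
      0 < z.2 → planeCross (N.edgeDir (N.bdry i) x) (z - N.pos (N.bdry i)) < 0 → f z = y) := by
  set b := N.pos (N.bdry i) with hb
  have hadj := hW.adj hO h
  have hne : b ≠ N.pos x := hW.pos_ne hO h
  have up : Convex ℝ {z : ℝ × ℝ | 0 < z.2} := by
    have := convex_planeCross_pos (1, 0) 0
    simpa [planeCross] using this
  have near : ∀ᶠ z in 𝓝 b, z ∈ N.curveSet W → planeCross (N.edgeDir (N.bdry i) x) (z - b) = 0 := by
    filter_upwards [hW.eventually_vertex hO (N.bdry i)] with z hz hz'
    rcases hz hz' with ⟨u, h1, -⟩ | ⟨x', h1, h2⟩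
    · exact absurd (hW.isInternal hO h1 h) (N.not_isInternal_bdry i)
    · rw [← hW.out_unique _ _ _ h h1] at h2
      exact planeCross_of_mem_segment h2
  have hmem : ∀ᶠ t in 𝓝[>] (0 : ℝ), b + t • (N.pos x - b) ∈ openSegment ℝ b (N.pos x) :=
    openSegment_eventually
  constructor
  · intro hy
    obtain ⟨y', hy'⟩ := hf.exists_eventually (q := b)
      (up.inter (convex_planeCross_pos (N.edgeDir (N.bdry i) x) b)) (by
        filter_upwards [near] with z hz hzC
        exact ⟨hzC.1, fun hK => hzC.2.ne' (hz hK)⟩)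
    obtain ⟨t, ht, hev⟩ := (hmem.and ((tendsto_add_smul b (N.pos x - b)).eventually
      (eventually_eventually_nhds.2 hy'))).exists
    have : y = y' := by
      refine (hy _ ht).unique (sub_ne_zero.2 hne.symm) ?_
      filter_upwards [hev, continuous_snd.continuousAt.eventually
        (lt_mem_nhds (N.snd_pos_of_mem_openSegment hadj ht))] with z hz h2 h3
      refine hz ⟨h2, ?_⟩
      have e : z - b = z - (b + t • (N.pos x - b)) + t • (N.pos x - b) := by abel
      simp only [Set.mem_ofPred_eq]
      rw [e, planeCross_add_right, planeCross_smul_right, edgeDir, planeCross_self]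
      linarith
    rw [this]
    filter_upwards [hy'] with z hz h1 h2 using hz ⟨h1, h2⟩
  · intro hy
    have neg : ∀ z, planeCross (N.edgeDir x (N.bdry i)) z = -planeCross (N.edgeDir (N.bdry i) x) z :=
      fun z => by rw [edgeDir_swap, planeCross_neg_left]
    obtain ⟨y', hy'⟩ := hf.exists_eventually (q := b)
      (up.inter (convex_planeCross_pos (N.edgeDir x (N.bdry i)) b)) (by
        filter_upwards [near] with z hz hzC
        refine ⟨hzC.1, fun hK => (show 0 < planeCross (N.edgeDir x (N.bdry i)) (z - b) from
          hzC.2).ne' ?_⟩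
        rw [neg, hz hK, neg_zero])
    obtain ⟨t, ht, hev⟩ := (hmem.and ((tendsto_add_smul b (N.pos x - b)).eventually
      (eventually_eventually_nhds.2 hy'))).exists
    have : y = y' := by
      refine (hy _ ((openSegment_symm ℝ _ _).subset ht)).unique (sub_ne_zero.2 hne) ?_
      filter_upwards [hev, continuous_snd.continuousAt.eventually
        (lt_mem_nhds (N.snd_pos_of_mem_openSegment hadj ht))] with z hz h2 h3
      refine hz ⟨h2, ?_⟩
      have e : z - b = z - (b + t • (N.pos x - b)) - t • (b - N.pos x) := by
        rw [← neg_sub (N.pos x) b, smul_neg]; abel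
      simp only [Set.mem_ofPred_eq]
      rw [e, planeCross_sub_right, planeCross_smul_right, edgeDir, planeCross_self]
      linarith
    rw [this]
    filter_upwards [hy'] with z hz h1 h2
    refine hz ⟨h1, ?_⟩
    simp only [Set.mem_ofPred_eq]
    rw [neg]; linarith

end IsCurve

end PBDTPNetwork

namespace PBDTPNetwork

variable {V : Type*} {n : ℕ} {N : PBDTPNetwork V n} {ℓ : ℝ × ℝ} {O : V → V → Prop}

/-- The directed edges of a walk. -/
def dartRel {G : SimpleGraph V} {a b : V} (P : G.Walk a b) (u v : V) : Prop :=
  ∃ d ∈ P.darts, d.fst = u ∧ d.snd = v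

theorem curveSet_dartRel {a b : V} (P : N.graph.Walk a b) :
    N.curveSet (dartRel P) = N.walkSet P := by
  ext z
  constructor
  · rintro ⟨_, _, ⟨d, hd, rfl, rfl⟩, hz⟩; exact ⟨d, hd, hz⟩
  · rintro ⟨d, hd, hz⟩; exact ⟨_, _, ⟨d, hd, rfl, rfl⟩, hz⟩

theorem dart_chain {G : SimpleGraph V} {W p : V → V → Prop}
    (hp : ∀ u v x, W u v → W v x → (p u v ↔ p v x)) {a b c : V} (h : G.Adj a b) (P : G.Walk b c)
    (hW : ∀ d ∈ (SimpleGraph.Walk.cons h P).darts, W d.fst d.snd) :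
    ∀ d ∈ (SimpleGraph.Walk.cons h P).darts, p d.fst d.snd ↔ p a b := by
  induction P generalizing a with
  | nil => intro d hd; simp at hd; subst hd; rfl
  | @cons b x c h' P ih =>
    intro d hd
    rw [SimpleGraph.Walk.darts_cons, List.mem_cons] at hd
    rcases hd with rfl | hd
    · rfl
    · rw [ih h' (fun d hd => hW d (by rw [SimpleGraph.Walk.darts_cons]; exact List.mem_cons_of_mem _ hd)) d hd]
      refine (hp a b x (hW ⟨(a, b), h⟩ (by simp)) (hW ⟨(b, x), h'⟩ (by simp))).symm

theorem chain_dartRel {G : SimpleGraph V} {a b : V} (P : G.Walk a b) (p : V → V → Prop)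
    (hp : ∀ u v x, dartRel P u v → dartRel P v x → (p u v ↔ p v x)) (u v u' v' : V)
    (h : dartRel P u v) (h' : dartRel P u' v') (hpu : p u v) : p u' v' := by
  cases P with
  | nil => obtain ⟨d, hd, -⟩ := h; simp at hd
  | cons e P =>
    have key := dart_chain hp e P (fun d hd => ⟨d, hd, rfl, rfl⟩)
    obtain ⟨d, hd, rfl, rfl⟩ := h
    obtain ⟨d', hd', rfl, rfl⟩ := h'
    exact (key d' hd').2 ((key d hd).1 hpu)

theorem dartRel_out_iff {G : SimpleGraph V} {a b : V} (P : G.Walk a b) (v : V) :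
    (∃ x, dartRel P v x) ↔ v ∈ P.support.dropLast := by
  rw [← SimpleGraph.Walk.map_fst_darts, List.mem_map]
  constructor
  · rintro ⟨x, d, hd, h, -⟩; exact ⟨d, hd, h⟩
  · rintro ⟨d, hd, h⟩; exact ⟨_, d, hd, h, rfl⟩

theorem dartRel_in_iff {G : SimpleGraph V} {a b : V} (P : G.Walk a b) (v : V) :
    (∃ u, dartRel P u v) ↔ v ∈ P.support.tail := by
  rw [← SimpleGraph.Walk.map_snd_darts, List.mem_map]
  constructor
  · rintro ⟨x, d, hd, -, h⟩; exact ⟨d, hd, h⟩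
  · rintro ⟨d, hd, h⟩; exact ⟨_, d, hd, rfl, h⟩

theorem dartRel_out_unique {G : SimpleGraph V} {a b : V} {P : G.Walk a b}
    (h : P.support.dropLast.Nodup) {u v v' : V} (h1 : dartRel P u v) (h2 : dartRel P u v') :
    v = v' := by
  rw [← SimpleGraph.Walk.map_fst_darts] at h
  obtain ⟨d, hd, rfl, rfl⟩ := h1
  obtain ⟨d', hd', he, rfl⟩ := h2
  rw [List.inj_on_of_nodup_map h hd hd' he.symm]

theorem dartRel_in_unique {G : SimpleGraph V} {a b : V} {P : G.Walk a b}
    (h : P.support.tail.Nodup) {u u' v : V} (h1 : dartRel P u v) (h2 : dartRel P u' v) :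
    u = u' := by
  rw [← SimpleGraph.Walk.map_snd_darts] at h
  obtain ⟨d, hd, rfl, rfl⟩ := h1
  obtain ⟨d', hd', rfl, he⟩ := h2
  rw [List.inj_on_of_nodup_map h hd hd' he.symm]

theorem mem_dropLast_or {G : SimpleGraph V} {a b : V} (P : G.Walk a b) {v : V}
    (h : v ∈ P.support) : v ∈ P.support.dropLast ∨ v = b := by
  rwa [← P.dropLast_support_concat, List.mem_append, List.mem_singleton] at h

theorem isCurve_path {i₀ j₀ : Fin n}
    {P : N.graph.Walk (N.bdry i₀) (N.bdry j₀)} (hP : P.IsPath) (hPO : ∀ d ∈ P.darts, O d.fst d.snd) :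
    N.IsCurve O (dartRel P) := by
  have hnd := hP.support_nodup
  refine ⟨?_, fun u v v' => dartRel_out_unique (hnd.sublist (List.dropLast_sublist _)),
    fun u u' v => dartRel_in_unique hnd.tail, ?_, ?_, chain_dartRel P⟩
  · rintro _ _ ⟨d, hd, rfl, rfl⟩; exact hPO d hd
  · intro u v h hv
    rw [dartRel_out_iff]
    rcases mem_dropLast_or P (List.mem_of_mem_tail ((dartRel_in_iff P v).1 ⟨u, h⟩)) with h' | rfl
    · exact h'
    · exact absurd hv (N.not_isInternal_bdry _)
  · intro v x h hv
    rw [dartRel_in_iff]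
    have := List.mem_of_mem_dropLast ((dartRel_out_iff P v).1 ⟨x, h⟩)
    rw [← P.cons_tail_support, List.mem_cons] at this
    rcases this with rfl | h'
    · exact absurd hv (N.not_isInternal_bdry _)
    · exact h'

theorem isCurve_cycle {v₀ : V} {Q : N.graph.Walk v₀ v₀} (hQ : Q.IsCycle)
    (hQO : ∀ d ∈ Q.darts, O d.fst d.snd) : N.IsCurve O (dartRel Q) := by
  have hnd := hQ.support_nodup
  have hperm := Q.tail_support_perm_dropLast_support
  refine ⟨?_, fun u v v' => dartRel_out_unique (hperm.nodup_iff.1 hnd),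
    fun u u' v => dartRel_in_unique hnd, ?_, ?_, chain_dartRel Q⟩
  · rintro _ _ ⟨d, hd, rfl, rfl⟩; exact hQO d hd
  · intro u v h _
    rw [dartRel_out_iff, ← hperm.mem_iff, ← dartRel_in_iff]
    exact ⟨u, h⟩
  · intro v x h _
    rw [dartRel_in_iff, hperm.mem_iff, ← dartRel_out_iff]
    exact ⟨x, h⟩

theorem mem_edges_iff (hO : N.IsPerfect O) {a b : V} {P : N.graph.Walk a b}
    (hPO : ∀ d ∈ P.darts, O d.fst d.snd) {u v : V} (h : O u v) :
    s(u, v) ∈ P.edges ↔ dartRel P u v := by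
  rw [SimpleGraph.Walk.edges, List.mem_map]
  constructor
  · rintro ⟨d, hd, he⟩
    have he' : s(d.fst, d.snd) = s(u, v) := he
    rw [Sym2.eq_iff] at he'
    rcases he' with ⟨h1, h2⟩ | ⟨h1, h2⟩
    · exact ⟨d, hd, h1, h2⟩
    · have := hPO d hd
      rw [h1, h2] at this
      exact absurd h (hO.asymm _ _ this)
  · rintro ⟨d, hd, rfl, rfl⟩
    exact ⟨d, hd, rfl⟩

end PBDTPNetwork

/-- The vertical line through `z` meets the segment from `c` to `d`, of whose ends only the left
one counts. -/
def Straddles (ℓ z c d : ℝ × ℝ) : Prop :=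
  (planeCross c ℓ ≤ planeCross z ℓ ∧ planeCross z ℓ < planeCross d ℓ) ∨
    (planeCross d ℓ ≤ planeCross z ℓ ∧ planeCross z ℓ < planeCross c ℓ)

theorem PassesAbove.straddles {ℓ z c d : ℝ × ℝ} (h : PassesAbove ℓ z c d) : Straddles ℓ z c d := h.1

theorem parity_straddles (ℓ z c d : ℝ × ℝ) : parity (Straddles ℓ z c d) =
    parity (planeCross c ℓ ≤ planeCross z ℓ) + parity (planeCross d ℓ ≤ planeCross z ℓ) := by
  unfold Straddles
  by_cases h1 : planeCross c ℓ ≤ planeCross z ℓ <;> by_cases h2 : planeCross d ℓ ≤ planeCross z ℓ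
  · rw [parity_true h1, parity_true h2, parity_false, add_self_zmod_two]
    rintro (h | h) <;> linarith [h.2]
  · rw [parity_true h1, parity_false h2, parity_true, add_zero]
    exact Or.inl ⟨h1, not_le.1 h2⟩
  · rw [parity_false h1, parity_true h2, parity_true, zero_add]
    exact Or.inr ⟨h2, not_le.1 h1⟩
  · rw [parity_false h1, parity_false h2, parity_false, add_zero]
    rintro (h | h)
    · exact h1 h.1
    · exact h2 h.1

theorem planeCross_add_smul_up (ℓ z : ℝ × ℝ) (t : ℝ) :
    planeCross (z + t • ℓ) ℓ = planeCross z ℓ := by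
  rw [planeCross_add_left, planeCross_smul_left, planeCross_self, mul_zero, add_zero]

theorem Straddles.exists_mem {ℓ z c d : ℝ × ℝ} (h : Straddles ℓ z c d) :
    ∃ t : ℝ, z + t • ℓ ∈ segment ℝ c d ∧ (PassesAbove ℓ z c d ↔ 0 < t) := by
  have hp : planeCross (d - c) ℓ ≠ 0 := by
    rw [planeCross_sub_left]
    rcases h with h | h
    · exact (by linarith [h.1, h.2] : 0 < planeCross d ℓ - planeCross c ℓ).ne'
    · exact (by linarith [h.1, h.2] : planeCross d ℓ - planeCross c ℓ < 0).ne
  set p := planeCross (d - c) ℓ with hpdef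
  set a := planeCross (d - c) (z - c) with ha
  refine ⟨-a / p, ?_, ?_⟩
  · have h0 : planeCross (d - c) (z + (-a / p) • ℓ - c) = 0 := by
      have : z + (-a / p) • ℓ - c = (z - c) + (-a / p) • ℓ := by abel
      rw [this, planeCross_add_right, planeCross_smul_right, ← hpdef, ← ha]
      field_simp; ring
    rcases h with h | h
    · exact mem_segment_of_planeCross (ℓ := ℓ) (by linarith [h.1, h.2])
        (by rw [planeCross_add_smul_up]; exact h.1) (by rw [planeCross_add_smul_up]; exact h.2.le) h0
    · rw [segment_symm]
      refine mem_segment_of_planeCross (ℓ := ℓ) (by linarith [h.1, h.2])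
        (by rw [planeCross_add_smul_up]; exact h.1) (by rw [planeCross_add_smul_up]; exact h.2.le) ?_
      rw [← neg_eq_zero, ← h0]
      unfold planeCross
      simp only [Prod.fst_sub, Prod.snd_sub]
      ring
  · have : PassesAbove ℓ z c d ↔ p * a < 0 := ⟨fun h' => h'.2, fun h' => ⟨h, h'⟩⟩
    rw [this, div_pos_iff, mul_neg_iff]
    constructor
    · rintro (⟨h1, h2⟩ | ⟨h1, h2⟩)
      · exact Or.inl ⟨by linarith, h1⟩
      · exact Or.inr ⟨by linarith, h1⟩
    · rintro (⟨h1, h2⟩ | ⟨h1, h2⟩)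
      · exact Or.inl ⟨h2, by linarith⟩
      · exact Or.inr ⟨h2, by linarith⟩

theorem straddles_of_mem_openSegment {ℓ c d q : ℝ × ℝ} (hp : planeCross (d - c) ℓ ≠ 0)
    (hq : q ∈ openSegment ℝ c d) : Straddles ℓ q c d := by
  rw [openSegment_eq_image'] at hq
  obtain ⟨t, ⟨h0, h1⟩, rfl⟩ := hq
  unfold Straddles
  simp only [planeCross_add_left, planeCross_smul_left]
  rw [planeCross_sub_left] at hp ⊢
  rcases lt_or_gt_of_ne hp with h | h
  · right; constructor <;> nlinarith
  · left; constructor <;> nlinarith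

theorem passesAbove_sub_smul {ℓ c d q : ℝ × ℝ} (hp : planeCross (d - c) ℓ ≠ 0)
    (hq : q ∈ openSegment ℝ c d) {t : ℝ} : PassesAbove ℓ (q - t • ℓ) c d ↔ 0 < t := by
  have hs := straddles_of_mem_openSegment hp hq
  have e : q - t • ℓ = q + (-t) • ℓ := by rw [neg_smul, sub_eq_add_neg]
  have hs' : Straddles ℓ (q - t • ℓ) c d := by
    unfold Straddles
    rw [e, planeCross_add_smul_up]; exact hs
  have h2 : planeCross (d - c) (q - t • ℓ - c) = -(t * planeCross (d - c) ℓ) := by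
    have : q - t • ℓ - c = (q - c) - t • ℓ := by abel
    rw [this, planeCross_sub_right, planeCross_smul_right,
      planeCross_of_mem_segment (openSegment_subset_segment ℝ _ _ hq)]
    ring
  unfold PassesAbove
  rw [h2]
  have h3 : 0 < planeCross (d - c) ℓ ^ 2 := by positivity
  constructor
  · intro h
    have := h.2
    by_contra! hc
    nlinarith
  · intro h
    exact ⟨hs', by nlinarith⟩

namespace PBDTPNetwork

variable {V : Type*} {n : ℕ} {N : PBDTPNetwork V n} {ℓ : ℝ × ℝ} {O : V → V → Prop}

theorem sum_straddles (N : PBDTPNetwork V n) (ℓ : ℝ × ℝ) {a b : V} (P : N.graph.Walk a b)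
    (z : ℝ × ℝ) :
    (P.darts.map fun d => parity (Straddles ℓ z (N.pos d.fst) (N.pos d.snd))).sum =
      parity (planeCross (N.pos a) ℓ ≤ planeCross z ℓ) +
        parity (planeCross (N.pos b) ℓ ≤ planeCross z ℓ) := by
  induction P with
  | nil => simp [add_self_zmod_two]
  | @cons a b c h P ih =>
    rw [SimpleGraph.Walk.darts_cons, List.map_cons, List.sum_cons, ih, parity_straddles]
    generalize parity (planeCross (N.pos a) ℓ ≤ planeCross z ℓ) = x
    generalize parity (planeCross (N.pos c) ℓ ≤ planeCross z ℓ) = y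
    simp only
    generalize parity (planeCross (N.pos b) ℓ ≤ planeCross z ℓ) = w
    linear_combination add_self_zmod_two w

theorem upCount_eq_of_forall {a b : V} (P : N.graph.Walk a b) {z : ℝ × ℝ}
    (h : ∀ d ∈ P.darts, Straddles ℓ z (N.pos d.fst) (N.pos d.snd) →
      PassesAbove ℓ z (N.pos d.fst) (N.pos d.snd)) :
    N.upCount ℓ P z = parity (planeCross (N.pos a) ℓ ≤ planeCross z ℓ) +
        parity (planeCross (N.pos b) ℓ ≤ planeCross z ℓ) := by
  rw [← sum_straddles, upCount]
  congr 1
  refine List.map_congr_left fun d hd => parity_congr ⟨fun h' => h'.straddles, h d hd⟩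

theorem upCount_axis {a b : V} (P : N.graph.Walk a b) {z : ℝ × ℝ} (hℓ : 0 < ℓ.2) (hz : z.2 = 0)
    (hzP : z ∉ N.walkSet P) :
    N.upCount ℓ P z = parity (planeCross (N.pos a) ℓ ≤ planeCross z ℓ) +
        parity (planeCross (N.pos b) ℓ ≤ planeCross z ℓ) := by
  refine upCount_eq_of_forall P fun d hd hs => ?_
  obtain ⟨t, ht, hiff⟩ := hs.exists_mem
  rw [hiff]
  have h2 : 0 ≤ (z + t • ℓ).2 := by
    obtain ⟨x, y, hx, hy, -, he⟩ := ht
    rw [← he]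
    have := mul_nonneg hx (N.pos_snd_nonneg d.fst)
    have := mul_nonneg hy (N.pos_snd_nonneg d.snd)
    simp only [Prod.snd_add, Prod.smul_snd, smul_eq_mul]
    linarith
  simp only [Prod.snd_add, hz, Prod.smul_snd, smul_eq_mul, zero_add] at h2
  rcases (nonneg_of_mul_nonneg_left h2 hℓ).eq_or_lt with h0 | h0
  · rw [← h0, zero_smul, add_zero] at ht
    exact absurd ⟨d, hd, ht⟩ hzP
  · exact h0

theorem exists_above_of_upCount_ne_zero {a b : V} {P : N.graph.Walk a b} {z : ℝ × ℝ}
    (h : N.upCount ℓ P z ≠ 0) : ∃ t : ℝ, 0 < t ∧ z + t • ℓ ∈ N.walkSet P := by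
  by_contra hc
  apply h
  rw [upCount]
  apply List.sum_eq_zero
  intro x hx
  rw [List.mem_map] at hx
  obtain ⟨d, hd, rfl⟩ := hx
  apply parity_false
  intro hpa
  obtain ⟨t, ht, hiff⟩ := hpa.straddles.exists_mem
  exact hc ⟨t, hiff.1 hpa, d, hd, ht⟩

theorem exists_vertical_of_upCount {a b : V} {P : N.graph.Walk a b} {z : ℝ × ℝ}
    (hz : z ∉ N.walkSet P)
    (h : N.upCount ℓ P z + (parity (planeCross (N.pos a) ℓ ≤ planeCross z ℓ) +
        parity (planeCross (N.pos b) ℓ ≤ planeCross z ℓ)) ≠ 0) :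
    ∃ w : ℝ × ℝ, (w = ℓ ∨ w = -ℓ) ∧ ∃ t : ℝ, 0 < t ∧ z + t • w ∈ N.walkSet P := by
  by_contra hc
  apply h
  rw [upCount_eq_of_forall P, add_self_zmod_two]
  intro d hd hs
  obtain ⟨t, ht, hiff⟩ := hs.exists_mem
  rw [hiff]
  by_contra h0
  rcases (not_lt.1 h0).lt_or_eq with h1 | rfl
  · exact hc ⟨-ℓ, Or.inr rfl, -t, by linarith, d, hd, by simpa using ht⟩
  · exact hz ⟨d, hd, by simpa using ht⟩

theorem upCount_flip (hℓ : N.IsGaugeDirection ℓ) {a b : V} {P : N.graph.Walk a b}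
    (hnd : P.edges.Nodup) {c d : V} (hcd : dartRel P c d) {q : ℝ × ℝ}
    (hq : q ∈ openSegment ℝ (N.pos c) (N.pos d)) (hgen : ∀ v, planeCross q ℓ ≠ planeCross (N.pos v) ℓ) :
    ∀ᶠ t in 𝓝[>] (0 : ℝ), N.upCount ℓ P (q + t • ℓ) + N.upCount ℓ P (q - t • ℓ) = 1 := by
  obtain ⟨e, he, rfl, rfl⟩ := hcd
  have hp := hℓ.not_parallel_of_adj e.adj
  have key : ∀ l : List N.graph.Dart, (∀ d ∈ l, d.edge ≠ e.edge) →
      ∀ᶠ z in 𝓝 q, (l.map fun d => parity (PassesAbove ℓ z (N.pos d.fst) (N.pos d.snd))).sum =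
        (l.map fun d => parity (PassesAbove ℓ q (N.pos d.fst) (N.pos d.snd))).sum := by
    intro l
    induction l with
    | nil => intro _; exact Filter.Eventually.of_forall fun _ => rfl
    | cons d l ih =>
      intro hl
      have hqd : q ∉ segment ℝ (N.pos d.fst) (N.pos d.snd) := by
        intro hqd
        obtain ⟨w, hw, -, hqw⟩ := N.planar _ _ _ _ d.adj e.adj (hl d (by simp)) q
          ⟨hqd, openSegment_subset_segment ℝ _ _ hq⟩
        exact hgen w (by rw [hqw])
      filter_upwards [ih fun d' hd' => hl d' (List.mem_cons_of_mem _ hd'),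
        eventually_passesAbove hℓ.inside (hℓ.not_parallel_of_adj d.adj) hqd] with z h1 h2
      rw [List.map_cons, List.sum_cons, List.map_cons, List.sum_cons, h1, h2]
      have h0 : ∀ v, endChange ℓ q z (N.pos v) = 0 := fun v =>
        parity_false fun h => hgen v h.1.symm
      rw [h0, h0, add_zero, add_zero]
  obtain ⟨l₁, l₂, hl⟩ := List.append_of_mem he
  rw [SimpleGraph.Walk.edges, hl, List.map_append, List.map_cons, List.nodup_append] at hnd
  have h1 : ∀ d ∈ l₁, d.edge ≠ e.edge := fun d hd =>
    hnd.2.2 _ (List.mem_map_of_mem hd) _ (by simp)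
  have h2 : ∀ d ∈ l₂, d.edge ≠ e.edge := fun d hd h =>
    (List.nodup_cons.1 hnd.2.1).1 (h ▸ List.mem_map_of_mem hd)
  filter_upwards [(tendsto_add_smul q ℓ).eventually (key l₁ h1),
    (tendsto_add_smul q ℓ).eventually (key l₂ h2), (tendsto_sub_smul q ℓ).eventually (key l₁ h1),
    (tendsto_sub_smul q ℓ).eventually (key l₂ h2), self_mem_nhdsWithin] with t a1 a2 a3 a4 ht
  have b1 : parity (PassesAbove ℓ (q - t • ℓ) (N.pos e.fst) (N.pos e.snd)) = 1 :=
    parity_true ((passesAbove_sub_smul hp hq).2 ht)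
  have b2 : parity (PassesAbove ℓ (q + t • ℓ) (N.pos e.fst) (N.pos e.snd)) = 0 := by
    apply parity_false
    have : q + t • ℓ = q - (-t) • ℓ := by rw [neg_smul, sub_neg_eq_add]
    rw [this, passesAbove_sub_smul hp hq]
    have : (0 : ℝ) < t := ht
    linarith
  rw [upCount, upCount, hl]
  simp only [List.map_append, List.map_cons, List.sum_append, List.sum_cons, a1, a2, a3, a4, b1, b2]
  generalize (l₁.map fun d => parity (PassesAbove ℓ q (N.pos d.fst) (N.pos d.snd))).sum = x
  generalize (l₂.map fun d => parity (PassesAbove ℓ q (N.pos d.fst) (N.pos d.snd))).sum = y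
  linear_combination add_self_zmod_two x + add_self_zmod_two y

end PBDTPNetwork

/-- The points on the vertical lines whose coordinates belong to `X`. -/
def verticals (ℓ : ℝ × ℝ) (X : Set ℝ) : Set (ℝ × ℝ) := {z | planeCross z ℓ ∈ X}

theorem isClosed_verticals (ℓ : ℝ × ℝ) {X : Set ℝ} (hX : X.Finite) : IsClosed (verticals ℓ X) :=
  hX.isClosed.preimage (continuous_planeCross_left ℓ)

/-- The open disk without the closed set `K`. -/
def diskOff (K : Set (ℝ × ℝ)) : Set (ℝ × ℝ) := {z | 0 < z.2} \ K

theorem isOpen_diskOff {K : Set (ℝ × ℝ)} (hK : IsClosed K) : IsOpen (diskOff K) :=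
  (isOpen_lt continuous_const continuous_snd).sdiff hK

/-- The indicator function of a region. -/
noncomputable def regionInd (K : Set (ℝ × ℝ)) (z w : ℝ × ℝ) : ZMod 2 :=
  parity (w ∈ connectedComponentIn (diskOff K) z)

theorem regionInd_eq_one {K : Set (ℝ × ℝ)} {z w : ℝ × ℝ} :
    regionInd K z w = 1 ↔ w ∈ connectedComponentIn (diskOff K) z := by
  unfold regionInd
  by_cases h : w ∈ connectedComponentIn (diskOff K) z
  · rw [parity_true h]; exact ⟨fun _ => h, fun _ => rfl⟩
  · rw [parity_false h]; exact ⟨fun h' => absurd h' zero_ne_one, fun h' => absurd h' h⟩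

theorem locConstOff_regionInd {K : Set (ℝ × ℝ)} (hK : IsClosed K) (z : ℝ × ℝ) :
    LocConstOff K (regionInd K z) := by
  intro w hw hwK
  have hwD : w ∈ diskOff K := ⟨hw, hwK⟩
  have hopen : IsOpen (connectedComponentIn (diskOff K) w) := (isOpen_diskOff hK).connectedComponentIn
  filter_upwards [hopen.mem_nhds (mem_connectedComponentIn hwD)] with w' hw'
  have e := connectedComponentIn_eq hw'
  apply parity_congr
  have hw'D := connectedComponentIn_subset _ _ hw'
  constructor
  · intro h
    rw [connectedComponentIn_eq h, ← e]
    exact mem_connectedComponentIn hwD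
  · intro h
    rw [connectedComponentIn_eq h, e]
    exact mem_connectedComponentIn hw'D

theorem LocConstOff.eq_of_mem_region {K : Set (ℝ × ℝ)} {f : ℝ × ℝ → ZMod 2} (hf : LocConstOff K f)
    {z w : ℝ × ℝ} (hw : w ∈ connectedComponentIn (diskOff K) z) : f w = f z := by
  have hz : z ∈ diskOff K := by
    by_contra h
    rw [connectedComponentIn_eq_empty h] at hw
    exact hw
  exact hf.eq_of_isPreconnected isPreconnected_connectedComponentIn
    (fun x hx => (connectedComponentIn_subset (diskOff K) z hx : x ∈ diskOff K)) hw (mem_connectedComponentIn hz)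

theorem LocConstOff.mono {K K' : Set (ℝ × ℝ)} {f : ℝ × ℝ → ZMod 2} (hf : LocConstOff K f)
    (h : K ⊆ K') : LocConstOff K' f := fun z hz hzK => hf z hz fun h' => hzK (h h')

theorem eventually_planeCross_ne {ℓ z w : ℝ × ℝ} (hw : planeCross w ℓ ≠ 0) (c : ℝ) :
    ∀ᶠ s in 𝓝[>] (0 : ℝ), planeCross (z + s • w) ℓ ≠ c := by
  by_cases h : planeCross z ℓ = c
  · filter_upwards [self_mem_nhdsWithin] with s hs h2
    rw [planeCross_add_left, planeCross_smul_left, h] at h2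
    have : s * planeCross w ℓ ≠ 0 := mul_ne_zero (show (0 : ℝ) < s from hs).ne' hw
    exact this (by linarith)
  · exact (tendsto_add_smul z w).eventually
      ((continuous_planeCross_left ℓ).continuousAt.eventually_ne h)

namespace PBDTPNetwork

variable {V : Type*} {n : ℕ} {N : PBDTPNetwork V n} {ℓ : ℝ × ℝ} {O W : V → V → Prop}

theorem eventually_generic [Finite V] (N : PBDTPNetwork V n) {z w : ℝ × ℝ}
    (hw : planeCross w ℓ ≠ 0) :
    ∀ᶠ s in 𝓝[>] (0 : ℝ), ∀ v, planeCross (z + s • w) ℓ ≠ planeCross (N.pos v) ℓ := by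
  rw [Filter.eventually_all]
  exact fun v => eventually_planeCross_ne hw _

theorem exists_generic [Finite V] (hℓ : N.IsGaugeDirection ℓ) {K : Set (ℝ × ℝ)} (hK : IsClosed K)
    {z : ℝ × ℝ} (hz : z ∈ diskOff K) : ∃ z' ∈ connectedComponentIn (diskOff K) z,
      ∀ v, planeCross z' ℓ ≠ planeCross (N.pos v) ℓ := by
  have hopen : IsOpen (connectedComponentIn (diskOff K) z) := (isOpen_diskOff hK).connectedComponentIn
  have hw : planeCross (1, 0) ℓ ≠ 0 := by
    have := hℓ.inside
    simp [planeCross, this.ne']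
  obtain ⟨s, h1, h2⟩ := (((tendsto_add_smul z (1, 0)).eventually
    (hopen.mem_nhds (mem_connectedComponentIn hz))).and (N.eventually_generic hw)).exists
  exact ⟨_, h1, h2⟩

namespace IsCurve

theorem eventually_side [Finite V] (hO : N.IsPerfect O) (hW : N.IsCurve O W) {X : Set ℝ}
    (hX : X.Finite) {u v : V} (h : W u v) {q : ℝ × ℝ}
    (hq : q ∈ openSegment ℝ (N.pos u) (N.pos v)) (hqX : planeCross q ℓ ∉ X) :
    ∀ᶠ z in 𝓝 q, z ∈ N.curveSet W ∪ verticals ℓ X → planeCross (N.pos v - N.pos u) (z - q) = 0 := by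
  filter_upwards [hW.eventually_openSegment hO h hq,
    (isClosed_verticals ℓ hX).isOpen_compl.mem_nhds (show q ∉ verticals ℓ X from hqX)]
    with z hz hz2 hzK
  rcases hzK with hzK | hzK
  · have a := planeCross_of_mem_segment (hz hzK)
    have b := planeCross_of_mem_segment (openSegment_subset_segment ℝ _ _ hq)
    rw [planeCross_sub_right] at a b ⊢
    linarith
  · exact absurd hzK hz2

open Filter in
theorem leftAt_of_eventually [Finite V] (hO : N.IsPerfect O) (hW : N.IsCurve O W) {X : Set ℝ}
    (hX : X.Finite) {u v : V} (h : W u v) {q w : ℝ × ℝ}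
    (hq : q ∈ openSegment ℝ (N.pos u) (N.pos v)) (hqX : planeCross q ℓ ∉ X)
    {f : ℝ × ℝ → ZMod 2} (hf : LocConstOff (N.curveSet W ∪ verticals ℓ X) f) {y : ZMod 2}
    (hw : planeCross (N.pos v - N.pos u) w ≠ 0) (hR : ∃ᶠ s in 𝓝[>] (0 : ℝ), f (q + s • w) = y) :
    (0 < planeCross (N.pos v - N.pos u) w ∧ LeftAt f (N.pos v - N.pos u) q y) ∨
      (0 < planeCross (N.pos u - N.pos v) w ∧ LeftAt f (N.pos u - N.pos v) q y) := by
  have hpos := N.snd_pos_of_mem_openSegment (hW.adj hO h) hq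
  have near := hW.eventually_side hO hX h hq hqX
  have key : ∀ e : ℝ × ℝ, 0 < planeCross e w → (∀ᶠ z in 𝓝 q,
      z ∈ N.curveSet W ∪ verticals ℓ X → planeCross e (z - q) = 0) → LeftAt f e q y := by
    intro e he hn
    obtain ⟨y', hy'⟩ := hf.exists_leftAt hpos hn
    obtain ⟨s, h1, h2⟩ := (hR.and_eventually (hy'.eventually he)).exists
    rw [← h1, h2]
    exact hy'
  have e2 : N.pos u - N.pos v = -(N.pos v - N.pos u) := by abel
  rcases lt_or_gt_of_ne hw with h1 | h1
  · have h1' : 0 < planeCross (N.pos u - N.pos v) w := by rw [e2, planeCross_neg_left]; linarith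
    refine Or.inr ⟨h1', key _ h1' ?_⟩
    filter_upwards [near] with z hz hzK
    rw [e2, planeCross_neg_left, hz hzK, neg_zero]
  · exact Or.inl ⟨h1, key _ h1 near⟩

/-- The region with indicator function `f` lies on the left or on the right side of some edge of the
curve `W`. -/
def Touches (N : PBDTPNetwork V n) (W : V → V → Prop) (f : ℝ × ℝ → ZMod 2) : Prop :=
  ∃ u v, W u v ∧ ∃ q ∈ openSegment ℝ (N.pos u) (N.pos v),
    LeftAt f (N.pos v - N.pos u) q 1 ∨ LeftAt f (N.pos u - N.pos v) q 1

theorem exists_hit [Finite V] (hℓ : N.IsGaugeDirection ℓ) (hO : N.IsPerfect O)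
    (hW : N.IsCurve O W) {z w : ℝ × ℝ} (hw : w = ℓ ∨ w = -ℓ)
    (hgen : ∀ v, planeCross z ℓ ≠ planeCross (N.pos v) ℓ) {t : ℝ}
    (ht : z + t • w ∈ N.curveSet W) : ∃ u v, W u v ∧ z + t • w ∈ openSegment ℝ (N.pos u) (N.pos v) ∧
      planeCross (N.pos v - N.pos u) w ≠ 0 := by
  have hx : planeCross (z + t • w) ℓ = planeCross z ℓ := by
    rcases hw with rfl | rfl
    · exact planeCross_add_smul_up _ _ _
    · rw [smul_neg, ← neg_smul]; exact planeCross_add_smul_up _ _ _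
  obtain ⟨u, v, h, hseg⟩ := ht
  refine ⟨u, v, h, mem_openSegment_of_ne_left_right ?_ ?_ hseg, ?_⟩
  · intro he; exact hgen u (by rw [he, hx])
  · intro he; exact hgen v (by rw [he, hx])
  · have := hℓ.not_parallel_of_adj (hW.adj hO h)
    rcases hw with rfl | rfl
    · exact this
    · rw [planeCross_neg_right]; exact neg_ne_zero.2 this

theorem touches_of_hit [Finite V] (hℓ : N.IsGaugeDirection ℓ) (hO : N.IsPerfect O)
    (hW : N.IsCurve O W) {X : Set ℝ} (hX : X.Finite) {z z₀ w : ℝ × ℝ}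
    (hz : z ∈ connectedComponentIn (diskOff (N.curveSet W ∪ verticals ℓ X)) z₀)
    (hw : w = ℓ ∨ w = -ℓ) (hgen : ∀ v, planeCross z ℓ ≠ planeCross (N.pos v) ℓ)
    (hit : ∃ t : ℝ, 0 < t ∧ z + t • w ∈ N.curveSet W) :
    Touches N W (regionInd (N.curveSet W ∪ verticals ℓ X) z₀) := by
  have hx : ∀ t : ℝ, planeCross (z + t • w) ℓ = planeCross z ℓ := by
    intro t
    rcases hw with rfl | rfl
    · exact planeCross_add_smul_up _ _ _
    · rw [smul_neg, ← neg_smul]; exact planeCross_add_smul_up _ _ _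
  have hzD := connectedComponentIn_subset _ _ hz
  have hKcl := N.isClosed_curveSet W
  set K := N.curveSet W ∪ verticals ℓ X with hK
  have hclosed : IsClosed K := hKcl.union (isClosed_verticals ℓ hX)
  set T : Set ℝ := {t | 0 ≤ t ∧ z + t • w ∈ N.curveSet W} with hT
  have hTcl : IsClosed T := by
    apply IsClosed.inter isClosed_Ici
    exact hKcl.preimage (by fun_prop : Continuous fun t : ℝ => z + t • w)
  obtain ⟨t₁, ht₁, hit₁⟩ := hit
  have hbdd : BddBelow T := ⟨0, fun t ht => ht.1⟩
  have hmem : sInf T ∈ T := hTcl.csInf_mem ⟨t₁, ht₁.le, hit₁⟩ hbdd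
  set t₀ := sInf T with ht₀
  have hbelow : ∀ t, 0 ≤ t → t < t₀ → z + t • w ∉ N.curveSet W := fun t h0 h1 h2 =>
    absurd (csInf_le hbdd (show t ∈ T from ⟨h0, h2⟩)) (not_le.2 h1)
  have hpos : 0 < t₀ := by
    rcases hmem.1.lt_or_eq with h | h
    · exact h
    · have := hmem.2
      rw [← h, zero_smul, add_zero] at this
      exact absurd (Or.inl this) hzD.2
  obtain ⟨u, v, h, hseg, hne⟩ := hW.exists_hit hℓ hO hw hgen hmem.2
  have hq2 := N.snd_pos_of_mem_openSegment (hW.adj hO h) hseg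
  have hxX : planeCross z ℓ ∉ X := fun h' => hzD.2 (Or.inr h')
  have hpath : ∀ t ∈ Set.Ico 0 t₀, z + t • w ∈ connectedComponentIn (diskOff K) z₀ := by
    intro t ht
    rw [connectedComponentIn_eq hz]
    have hpre : IsPreconnected ((fun t : ℝ => z + t • w) '' Set.Ico 0 t₀) :=
      isPreconnected_Ico.image _ (by fun_prop)
    refine hpre.subset_connectedComponentIn ⟨0, ⟨le_rfl, hpos⟩, by simp⟩ ?_ ⟨t, ht, rfl⟩
    rintro _ ⟨s, hs, rfl⟩
    refine ⟨?_, ?_⟩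
    · have h1 : 0 < z.2 := hzD.1
      simp only [Set.mem_ofPred_eq, Prod.snd_add, Prod.smul_snd, smul_eq_mul] at hq2 ⊢
      rcases le_or_gt 0 w.2 with h2 | h2
      · have := mul_nonneg hs.1 h2; linarith
      · have := mul_lt_mul_of_neg_right hs.2 h2; linarith
    · rintro (h' | h')
      · exact hbelow s hs.1 hs.2 h'
      · exact hxX (by rw [← hx s]; exact h')
  have hev : ∀ᶠ s in 𝓝[>] (0 : ℝ), regionInd K z₀ (z + t₀ • w + s • (-w)) = 1 := by
    filter_upwards [Ioo_mem_nhdsGT hpos] with s hs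
    rw [regionInd_eq_one]
    have : z + t₀ • w + s • (-w) = z + (t₀ - s) • w := by
      rw [sub_smul, smul_neg]; abel
    rw [this]
    exact hpath _ ⟨by linarith [hs.2], by linarith [hs.1]⟩
  rcases hW.leftAt_of_eventually hO hX h hseg (by rw [hx]; exact hxX)
    (locConstOff_regionInd hclosed z₀) (by rw [planeCross_neg_right]; exact neg_ne_zero.2 hne)
    hev.frequently with h' | h'
  · exact ⟨u, v, h, _, hseg, Or.inl h'.2⟩
  · exact ⟨u, v, h, _, hseg, Or.inr h'.2⟩

end IsCurve

end PBDTPNetwork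

theorem eventually_le_planeCross {ℓ q w : ℝ × ℝ} {c : ℝ}
    (h : c < planeCross q ℓ ∨ (c = planeCross q ℓ ∧ 0 < planeCross w ℓ)) :
    ∀ᶠ s in 𝓝[>] (0 : ℝ), c ≤ planeCross (q + s • w) ℓ := by
  rcases h with h | ⟨rfl, h⟩
  · filter_upwards [(tendsto_add_smul q w).eventually
      ((continuous_planeCross_left ℓ).continuousAt.eventually (lt_mem_nhds h))] with s hs using hs.le
  · filter_upwards [self_mem_nhdsWithin] with s hs
    rw [planeCross_add_left, planeCross_smul_left]
    have := mul_pos (show (0 : ℝ) < s from hs) h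
    linarith

theorem eventually_planeCross_lt {ℓ q w : ℝ × ℝ} {c : ℝ}
    (h : planeCross q ℓ < c ∨ (c = planeCross q ℓ ∧ planeCross w ℓ < 0)) :
    ∀ᶠ s in 𝓝[>] (0 : ℝ), planeCross (q + s • w) ℓ < c := by
  rcases h with h | ⟨rfl, h⟩
  · exact (tendsto_add_smul q w).eventually
      ((continuous_planeCross_left ℓ).continuousAt.eventually (gt_mem_nhds h))
  · filter_upwards [self_mem_nhdsWithin] with s hs
    rw [planeCross_add_left, planeCross_smul_left]
    have := mul_pos_of_neg_of_neg h (neg_neg_of_pos (show (0 : ℝ) < s from hs))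
    nlinarith

theorem planeCross_rotLeft_self (w ℓ : ℝ × ℝ) :
    planeCross (rotLeft w) ℓ = -(w.1 * ℓ.1 + w.2 * ℓ.2) := by
  unfold planeCross rotLeft; ring

theorem locConst_parity_le (ℓ : ℝ × ℝ) {c : ℝ} {z : ℝ × ℝ} (h : planeCross z ℓ ≠ c) :
    ∀ᶠ z' in 𝓝 z, parity (c ≤ planeCross z' ℓ) = parity (c ≤ planeCross z ℓ) := by
  rcases lt_or_gt_of_ne h with h | h
  · filter_upwards [(continuous_planeCross_left ℓ).continuousAt.eventually (gt_mem_nhds h)] with z' h'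
    rw [parity_false (not_le.2 h), parity_false (not_le.2 h')]
  · filter_upwards [(continuous_planeCross_left ℓ).continuousAt.eventually (lt_mem_nhds h)] with z' h'
    rw [parity_true h.le, parity_true (le_of_lt h')]

namespace PBDTPNetwork

variable {V : Type*} {n : ℕ} {N : PBDTPNetwork V n} {ℓ : ℝ × ℝ} {O W : V → V → Prop}

/-- The horizontal coordinate of a boundary vertex. -/
noncomputable def bx (N : PBDTPNetwork V n) (ℓ : ℝ × ℝ) (i : Fin n) : ℝ :=
  planeCross (N.pos (N.bdry i)) ℓ

theorem bx_eq (i : Fin n) : N.bx ℓ i = (N.pos (N.bdry i)).1 * ℓ.2 := by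
  unfold bx planeCross; rw [N.bdry_on_axis]; ring

theorem bx_lt_iff (hℓ : 0 < ℓ.2) {i j : Fin n} :
    N.bx ℓ i < N.bx ℓ j ↔ (N.pos (N.bdry i)).1 < (N.pos (N.bdry j)).1 := by
  rw [bx_eq, bx_eq, mul_lt_mul_iff_left₀ hℓ]

/-- `1` between the vertical lines through `b_i` and `b_j`, and `0` outside. -/
noncomputable def between (N : PBDTPNetwork V n) (ℓ : ℝ × ℝ) (i j : Fin n) (z : ℝ × ℝ) : ZMod 2 :=
  parity (N.bx ℓ i ≤ planeCross z ℓ) + parity (N.bx ℓ j ≤ planeCross z ℓ)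

theorem eventually_between {i j : Fin n} {z : ℝ × ℝ} (hi : planeCross z ℓ ≠ N.bx ℓ i)
    (hj : planeCross z ℓ ≠ N.bx ℓ j) :
    ∀ᶠ z' in 𝓝 z, N.between ℓ i j z' = N.between ℓ i j z := by
  filter_upwards [locConst_parity_le ℓ hi, locConst_parity_le ℓ hj] with z' h1 h2
  unfold between
  rw [h1, h2]

/-- The lines of the gauge rays at `b_i` and `b_j`. -/
def twoLines (N : PBDTPNetwork V n) (ℓ : ℝ × ℝ) (i j : Fin n) : Set ℝ := {N.bx ℓ i, N.bx ℓ j}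

theorem finite_twoLines (i j : Fin n) : (N.twoLines ℓ i j).Finite := by
  unfold twoLines; exact Set.toFinite _

theorem locConstOff_between (i j : Fin n) :
    LocConstOff (verticals ℓ (N.twoLines ℓ i j)) (N.between ℓ i j) := fun _ _ hz =>
  eventually_between (fun h => hz (Or.inl h)) (fun h => hz (Or.inr h))

theorem pathRegion_eq (hℓ : N.IsGaugeDirection ℓ) {i₀ j₀ : Fin n}
    (P : N.graph.Walk (N.bdry i₀) (N.bdry j₀)) (z : ℝ × ℝ) :
    N.pathRegion ℓ P z = connectedComponentIn
      (diskOff (N.curveSet (dartRel P) ∪ verticals ℓ (N.twoLines ℓ i₀ j₀))) z := by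
  unfold pathRegion
  congr 1
  have ray : ∀ i (w : ℝ × ℝ), 0 < w.2 →
      (w ∈ openRay (N.pos (N.bdry i)) ℓ ↔ planeCross w ℓ = N.bx ℓ i) := by
    intro i w hw
    constructor
    · intro h
      have := IsGaugeDirection.planeCross_of_mem_openRay h
      rw [planeCross_sub_left] at this
      unfold bx; linarith
    · intro h
      refine hℓ.mem_openRay_of_planeCross_eq_zero hw ?_
      rw [planeCross_sub_left, h]
      unfold bx; ring
  rw [curveSet_dartRel]
  ext w
  simp only [diskOff, Set.mem_sdiff, Set.mem_union, Set.mem_ofPred_eq, verticals, twoLines,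
    Set.mem_insert_iff, Set.mem_singleton_iff]
  constructor
  · rintro ⟨h1, h2⟩
    rw [ray i₀ w h1, ray j₀ w h1] at h2
    exact ⟨h1, by tauto⟩
  · rintro ⟨h1, h2⟩
    rw [ray i₀ w h1, ray j₀ w h1]
    exact ⟨h1, by tauto⟩

open Filter in
/-- The values on the two sides of a curve beginning at a boundary source are found just above the
boundary, on the two sides of this source. -/
theorem IsCurve.eventually_axis [Finite V] (hO : N.IsPerfect O) (hW : N.IsCurve O W)
    {f : ℝ × ℝ → ZMod 2} (hf : LocConstOff (N.curveSet W) f) {i : Fin n} {x : V}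
    (h : W (N.bdry i) x) {y : ZMod 2} :
    (LeftVal f (N.pos (N.bdry i)) (N.pos x) y → ∀ᶠ s in 𝓝[>] (0 : ℝ),
      ∀ᶠ z in 𝓝 (N.pos (N.bdry i) + s • ((-1, 0) : ℝ × ℝ)), 0 < z.2 → f z = y) ∧
    (LeftVal f (N.pos x) (N.pos (N.bdry i)) y → ∀ᶠ s in 𝓝[>] (0 : ℝ),
      ∀ᶠ z in 𝓝 (N.pos (N.bdry i) + s • ((1, 0) : ℝ × ℝ)), 0 < z.2 → f z = y) := by
  have hx := N.internal_inside x (N.isInternal_of_adj_bdry (hW.adj hO h))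
  obtain ⟨h1, h2⟩ := hW.eventually_start hO hf h (y := y)
  set b := N.pos (N.bdry i) with hb
  have hb2 : b.2 = 0 := N.bdry_on_axis i
  have hg : (N.edgeDir (N.bdry i) x).2 = (N.pos x).2 := by
    unfold edgeDir; rw [Prod.snd_sub, ← hb, hb2, sub_zero]
  have cr : ∀ c s : ℝ, planeCross (N.edgeDir (N.bdry i) x) (b + s • ((c, 0) : ℝ × ℝ) - b) =
      -(s * c * (N.pos x).2) := by
    intro c s
    rw [add_sub_cancel_left, planeCross_smul_right, ← hg]
    unfold planeCross; simp only; ring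
  constructor
  · intro hy
    filter_upwards [(tendsto_add_smul b (-1, 0)).eventually (eventually_eventually_nhds.2 (h1 hy)),
      self_mem_nhdsWithin] with s hs hs0
    have hs0 : (0 : ℝ) < s := hs0
    have := (continuous_planeCross_sub (N.edgeDir (N.bdry i) x) b).continuousAt.eventually
      (lt_mem_nhds (show (0 : ℝ) < planeCross (N.edgeDir (N.bdry i) x)
        (b + s • ((-1, 0) : ℝ × ℝ) - b) by
          rw [cr]; have := mul_pos hs0 hx; linarith))
    filter_upwards [hs, this] with z a1 a2 a3 using a1 a3 a2
  · intro hy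
    filter_upwards [(tendsto_add_smul b (1, 0)).eventually (eventually_eventually_nhds.2 (h2 hy)),
      self_mem_nhdsWithin] with s hs hs0
    have hs0 : (0 : ℝ) < s := hs0
    have := (continuous_planeCross_sub (N.edgeDir (N.bdry i) x) b).continuousAt.eventually
      (gt_mem_nhds (show planeCross (N.edgeDir (N.bdry i) x)
        (b + s • ((1, 0) : ℝ × ℝ) - b) < 0 by
          rw [cr]; have := mul_pos hs0 hx; linarith))
    filter_upwards [hs, this] with z a1 a2 a3 using a1 a3 a2

theorem exists_above_axis {q : ℝ × ℝ} (hq : q.2 = 0) {p : ℝ × ℝ → Prop} (h : ∀ᶠ z in 𝓝 q, p z) :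
    ∃ z, 0 < z.2 ∧ p z := by
  obtain ⟨t, ht, hp⟩ := ((eventually_mem_nhdsWithin (a := (0 : ℝ)) (s := Set.Ioi 0)).and
    ((tendsto_add_smul q (0, 1)).eventually h)).exists
  have ht : (0 : ℝ) < t := ht
  exact ⟨_, by simp [hq, ht], hp⟩

section Path

variable {i₀ j₀ : Fin n} {P : N.graph.Walk (N.bdry i₀) (N.bdry j₀)}

theorem exists_first (h : i₀ ≠ j₀) : ∃ x, dartRel P (N.bdry i₀) x := by
  have key : ∀ {a b : V} (P : N.graph.Walk a b), a ≠ b → ∃ x, dartRel P a x := by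
    intro a b P hab
    cases P with
    | nil => exact absurd rfl hab
    | cons e Q => exact ⟨_, ⟨(_, _), e⟩, by simp, rfl, rfl⟩
  exact key P fun h' => h (N.bdry_injective h')

/-- The value of the passing number on the left of the path. -/
noncomputable def leftCount (N : PBDTPNetwork V n) (ℓ : ℝ × ℝ) (i₀ j₀ : Fin n) : ZMod 2 :=
  parity (N.bx ℓ j₀ < N.bx ℓ i₀)

theorem eventually_between_west (hℓ : N.IsGaugeDirection ℓ) (h : i₀ ≠ j₀) :
    ∀ᶠ s in 𝓝[>] (0 : ℝ), ∀ᶠ z in 𝓝 (N.pos (N.bdry i₀) + s • ((-1, 0) : ℝ × ℝ)),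
      N.between ℓ i₀ j₀ z = N.leftCount ℓ i₀ j₀ := by
  have hα : planeCross (-1, 0) ℓ < 0 := by have := hℓ.inside; simp [planeCross, this]
  have hne : N.bx ℓ j₀ ≠ N.bx ℓ i₀ := by
    rw [bx_eq, bx_eq]
    exact fun h' => N.bdry_fst_ne h (mul_right_cancel₀ hℓ.inside.ne' h').symm
  filter_upwards [eventually_planeCross_lt (q := N.pos (N.bdry i₀)) (c := N.bx ℓ i₀)
    (Or.inr ⟨rfl, hα⟩), eventually_planeCross_ne (ℓ := ℓ) (z := N.pos (N.bdry i₀)) hα.ne (N.bx ℓ j₀),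
    (tendsto_add_smul (N.pos (N.bdry i₀)) (-1, 0)).eventually (locConst_parity_le ℓ hne.symm)]
    with s h1 h2 h3
  filter_upwards [eventually_between h1.ne h2] with z hz
  rw [hz, between, h3, parity_false (not_le.2 h1), zero_add]
  exact parity_congr ⟨fun h => lt_of_le_of_ne h hne, fun h => h.le⟩

theorem eventually_between_east (hℓ : N.IsGaugeDirection ℓ) (h : i₀ ≠ j₀) :
    ∀ᶠ s in 𝓝[>] (0 : ℝ), ∀ᶠ z in 𝓝 (N.pos (N.bdry i₀) + s • ((1, 0) : ℝ × ℝ)),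
      N.between ℓ i₀ j₀ z = N.leftCount ℓ i₀ j₀ + 1 := by
  have hα : 0 < planeCross (1, 0) ℓ := by have := hℓ.inside; simp [planeCross, this]
  have hne : N.bx ℓ j₀ ≠ N.bx ℓ i₀ := by
    rw [bx_eq, bx_eq]
    exact fun h' => N.bdry_fst_ne h (mul_right_cancel₀ hℓ.inside.ne' h').symm
  filter_upwards [eventually_le_planeCross (q := N.pos (N.bdry i₀)) (c := N.bx ℓ i₀)
    (Or.inr ⟨rfl, hα⟩), eventually_planeCross_ne (ℓ := ℓ) (z := N.pos (N.bdry i₀)) hα.ne' (N.bx ℓ j₀),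
    eventually_planeCross_ne (ℓ := ℓ) (z := N.pos (N.bdry i₀)) hα.ne' (N.bx ℓ i₀),
    (tendsto_add_smul (N.pos (N.bdry i₀)) (1, 0)).eventually (locConst_parity_le ℓ hne.symm)]
    with s h1 h2 h2' h3
  filter_upwards [eventually_between h2' h2] with z hz
  rw [hz, between, h3, parity_true h1, add_comm]
  congr 1
  exact parity_congr ⟨fun h => lt_of_le_of_ne h hne, fun h => h.le⟩

open Filter in
theorem upCount_near_start [Finite V] (hℓ : N.IsGaugeDirection ℓ) (hO : N.IsPerfect O)
    (hW : N.IsCurve O (dartRel P)) (hne : i₀ ≠ j₀) {c : ℝ} (hc : c ≠ 0) :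
    ∀ᶠ s in 𝓝[>] (0 : ℝ), ∀ᶠ z in 𝓝 (N.pos (N.bdry i₀) + s • ((c, 0) : ℝ × ℝ)),
      N.upCount ℓ P z = N.between ℓ i₀ j₀ (N.pos (N.bdry i₀) + s • ((c, 0) : ℝ × ℝ)) := by
  obtain ⟨x, hx⟩ := exists_first (P := P) hne
  have hx2 := N.internal_inside x (N.isInternal_of_adj_bdry (hW.adj hO hx))
  filter_upwards [(tendsto_add_smul (N.pos (N.bdry i₀)) (c, 0)).eventually
    (hW.eventually_vertex hO (N.bdry i₀)), self_mem_nhdsWithin] with s hs hs0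
  have hs0 : (0 : ℝ) < s := hs0
  have hb := N.bdry_on_axis i₀
  set b := N.pos (N.bdry i₀) with hbdef
  set q := b + s • ((c, 0) : ℝ × ℝ) with hq
  have hq2 : q.2 = 0 := by rw [hq]; simp [hb]
  have hqK : q ∉ N.walkSet P := by
    rw [← curveSet_dartRel]
    intro h
    rcases hs h with ⟨u, h1, -⟩ | ⟨x', h1, h2⟩
    · exact absurd (hW.isInternal hO h1 hx) (N.not_isInternal_bdry _)
    · rw [← hW.out_unique _ _ _ hx h1] at h2
      have := planeCross_of_mem_segment h2
      rw [hq, add_sub_cancel_left, planeCross_smul_right] at this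
      have h3 : planeCross (N.pos x - b) (c, 0) ≠ 0 := by
        unfold planeCross
        simp only [Prod.snd_sub, hb]
        rw [mul_zero, zero_sub, sub_zero]
        exact neg_ne_zero.2 (mul_ne_zero hx2.ne' hc)
      exact mul_ne_zero hs0.ne' h3 this
  filter_upwards [eventually_upCount hℓ P hqK] with z hz
  have h0 : ∀ i, endChange ℓ q z (N.pos (N.bdry i)) = 0 := by
    intro i
    apply parity_false
    rintro ⟨-, h, -⟩
    rw [hq2, N.bdry_on_axis] at h
    exact lt_irrefl _ h
  rw [hz, upCount_axis P hℓ.inside hq2 hqK, h0, h0, add_zero, add_zero]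
  rfl

theorem leftVal_upCount [Finite V] (hℓ : N.IsGaugeDirection ℓ) (hO : N.IsPerfect O)
    (hW : N.IsCurve O (dartRel P)) (hne : i₀ ≠ j₀) {u v : V} (h : dartRel P u v) :
    LeftVal (N.upCount ℓ P) (N.pos u) (N.pos v) (N.leftCount ℓ i₀ j₀) ∧
      LeftVal (N.upCount ℓ P) (N.pos v) (N.pos u) (N.leftCount ℓ i₀ j₀ + 1) := by
  obtain ⟨x, hx⟩ := exists_first (P := P) hne
  have hf : LocConstOff (N.curveSet (dartRel P)) (N.upCount ℓ P) := by
    rw [curveSet_dartRel]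
    exact locConstOff_upCount hℓ P (Or.inr ⟨N.bdry_on_axis _, N.bdry_on_axis _⟩)
  obtain ⟨⟨y₁, hy₁⟩, y₂, hy₂⟩ := hW.exists_leftAt hO hf hx
  have e := hW.eventually_axis hO hf hx (y := y₁)
  have e' := hW.eventually_axis hO hf hx (y := y₂)
  have ax : ∀ c s : ℝ, (N.pos (N.bdry i₀) + s • ((c, 0) : ℝ × ℝ)).2 = 0 := by
    intro c s; simp [N.bdry_on_axis]
  have h1 : y₁ = N.leftCount ℓ i₀ j₀ := by
    obtain ⟨s, a1, a2, a3⟩ := ((e.1 hy₁).and ((upCount_near_start hℓ hO hW hne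
      (by norm_num : (-1 : ℝ) ≠ 0)).and (eventually_between_west hℓ hne))).exists
    obtain ⟨z, hz, b1, b2⟩ := exists_above_axis (ax _ _) (a1.and a2)
    rw [← b1 hz, b2, a3.self_of_nhds]
  have h2 : y₂ = N.leftCount ℓ i₀ j₀ + 1 := by
    obtain ⟨s, a1, a2, a3⟩ := ((e'.2 hy₂).and ((upCount_near_start hℓ hO hW hne
      (by norm_num : (1 : ℝ) ≠ 0)).and (eventually_between_east hℓ hne))).exists
    obtain ⟨z, hz, b1, b2⟩ := exists_above_axis (ax _ _) (a1.and a2)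
    rw [← b1 hz, b2, a3.self_of_nhds]
  rw [← h2, ← h1]
  exact ⟨hW.leftVal_of_leftVal hℓ hO hf hx h hy₁, hW.rightVal_of_rightVal hℓ hO hf hx h hy₂⟩

end Path

end PBDTPNetwork

theorem zmod_two_eq_zero_or (x : ZMod 2) : x = 0 ∨ x = 1 := by
  revert x; decide

namespace PBDTPNetwork

variable {V : Type*} {n : ℕ} {N : PBDTPNetwork V n} {ℓ : ℝ × ℝ} {O W : V → V → Prop}
  {i₀ j₀ : Fin n} {P : N.graph.Walk (N.bdry i₀) (N.bdry j₀)}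

theorem bx_lt_or (hℓ : 0 < ℓ.2) (hne : i₀ ≠ j₀) :
    (N.bx ℓ j₀ < N.bx ℓ i₀ ∧ (N.pos (N.bdry j₀)).1 < (N.pos (N.bdry i₀)).1 ∧
      N.leftCount ℓ i₀ j₀ = 1) ∨
    (N.bx ℓ i₀ < N.bx ℓ j₀ ∧ (N.pos (N.bdry i₀)).1 < (N.pos (N.bdry j₀)).1 ∧
      N.leftCount ℓ i₀ j₀ = 0) := by
  rcases lt_or_gt_of_ne (N.bdry_fst_ne hne) with h | h
  · have h' := (bx_lt_iff (N := N) hℓ).2 h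
    exact Or.inr ⟨h', h, parity_false h'.not_gt⟩
  · have h' := (bx_lt_iff (N := N) hℓ).2 h
    exact Or.inl ⟨h', h, parity_true h'⟩

theorem between_of_le_of_le {q w : ℝ × ℝ}
    (hi : ∀ᶠ s in 𝓝[>] (0 : ℝ), N.bx ℓ i₀ ≤ planeCross (q + s • w) ℓ)
    (hj : ∀ᶠ s in 𝓝[>] (0 : ℝ), N.bx ℓ j₀ ≤ planeCross (q + s • w) ℓ) :
    ∀ᶠ s in 𝓝[>] (0 : ℝ), N.between ℓ i₀ j₀ (q + s • w) = 0 := by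
  filter_upwards [hi, hj] with s h1 h2
  rw [between, parity_true h1, parity_true h2]; rfl

theorem between_of_le_of_lt {q w : ℝ × ℝ}
    (hi : ∀ᶠ s in 𝓝[>] (0 : ℝ), N.bx ℓ i₀ ≤ planeCross (q + s • w) ℓ)
    (hj : ∀ᶠ s in 𝓝[>] (0 : ℝ), planeCross (q + s • w) ℓ < N.bx ℓ j₀) :
    ∀ᶠ s in 𝓝[>] (0 : ℝ), N.between ℓ i₀ j₀ (q + s • w) = 1 := by
  filter_upwards [hi, hj] with s h1 h2
  rw [between, parity_true h1, parity_false (not_le.2 h2)]; rfl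

theorem between_of_lt_of_le {q w : ℝ × ℝ}
    (hi : ∀ᶠ s in 𝓝[>] (0 : ℝ), planeCross (q + s • w) ℓ < N.bx ℓ i₀)
    (hj : ∀ᶠ s in 𝓝[>] (0 : ℝ), N.bx ℓ j₀ ≤ planeCross (q + s • w) ℓ) :
    ∀ᶠ s in 𝓝[>] (0 : ℝ), N.between ℓ i₀ j₀ (q + s • w) = 1 := by
  filter_upwards [hi, hj] with s h1 h2
  rw [between, parity_true h2, parity_false (not_le.2 h1)]; rfl

theorem between_of_lt_of_lt {q w : ℝ × ℝ}
    (hi : ∀ᶠ s in 𝓝[>] (0 : ℝ), planeCross (q + s • w) ℓ < N.bx ℓ i₀)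
    (hj : ∀ᶠ s in 𝓝[>] (0 : ℝ), planeCross (q + s • w) ℓ < N.bx ℓ j₀) :
    ∀ᶠ s in 𝓝[>] (0 : ℝ), N.between ℓ i₀ j₀ (q + s • w) = 0 := by
  filter_upwards [hi, hj] with s h1 h2
  rw [between, parity_false (not_le.2 h1), parity_false (not_le.2 h2)]; rfl

theorem planeCross_of_mem_openRay_bdry {i : Fin n} {q : ℝ × ℝ}
    (hq : q ∈ openRay (N.pos (N.bdry i)) ℓ) : planeCross q ℓ = N.bx ℓ i := by
  have := IsGaugeDirection.planeCross_of_mem_openRay hq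
  rw [planeCross_sub_left] at this
  unfold bx; linarith

/-- The mark to the left of the ray at `b_i`. -/
theorem between_ray_left (hℓ : N.IsGaugeDirection ℓ) (hne : i₀ ≠ j₀) {q w : ℝ × ℝ} {c : ZMod 2}
    (h : (planeCross q ℓ = N.bx ℓ i₀ ∧ (planeCross w ℓ < 0 ∧ c = 0 ∨ 0 < planeCross w ℓ ∧ c = 1)) ∨
      (planeCross q ℓ = N.bx ℓ j₀ ∧ (0 < planeCross w ℓ ∧ c = 0 ∨ planeCross w ℓ < 0 ∧ c = 1))) :
    ∀ᶠ s in 𝓝[>] (0 : ℝ), N.between ℓ i₀ j₀ (q + s • w) = N.leftCount ℓ i₀ j₀ + c := by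
  rcases bx_lt_or (N := N) hℓ.inside hne with ⟨h1, -, h2⟩ | ⟨h1, -, h2⟩ <;> rw [h2] <;>
    rcases h with ⟨hq, ⟨hw, rfl⟩ | ⟨hw, rfl⟩⟩ | ⟨hq, ⟨hw, rfl⟩ | ⟨hw, rfl⟩⟩
  · exact between_of_lt_of_le (eventually_planeCross_lt (Or.inr ⟨hq.symm, hw⟩))
      (eventually_le_planeCross (Or.inl (by rw [hq]; exact h1)))
  · exact between_of_le_of_le (eventually_le_planeCross (Or.inr ⟨hq.symm, hw⟩))
      (eventually_le_planeCross (Or.inl (by rw [hq]; exact h1)))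
  · exact between_of_lt_of_le (eventually_planeCross_lt (Or.inl (by rw [hq]; exact h1)))
      (eventually_le_planeCross (Or.inr ⟨hq.symm, hw⟩))
  · exact between_of_lt_of_lt (eventually_planeCross_lt (Or.inl (by rw [hq]; exact h1)))
      (eventually_planeCross_lt (Or.inr ⟨hq.symm, hw⟩))
  · exact between_of_lt_of_lt (eventually_planeCross_lt (Or.inr ⟨hq.symm, hw⟩))
      (eventually_planeCross_lt (Or.inl (by rw [hq]; exact h1)))
  · exact between_of_le_of_lt (eventually_le_planeCross (Or.inr ⟨hq.symm, hw⟩))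
      (eventually_planeCross_lt (Or.inl (by rw [hq]; exact h1)))
  · exact between_of_le_of_le (eventually_le_planeCross (Or.inl (by rw [hq]; exact h1)))
      (eventually_le_planeCross (Or.inr ⟨hq.symm, hw⟩))
  · exact between_of_le_of_lt (eventually_le_planeCross (Or.inl (by rw [hq]; exact h1)))
      (eventually_planeCross_lt (Or.inr ⟨hq.symm, hw⟩))

theorem planeCross_axis {p : ℝ × ℝ} (h : p.2 = 0) : planeCross p ℓ = p.1 * ℓ.2 := by
  unfold planeCross; rw [h]; ring

theorem openRay_bdry {q : ℝ × ℝ} {i j l : Fin n}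
    (hq : q ∈ openRay (N.pos (N.bdry l)) (N.edgeDir (N.bdry i) (N.bdry j))) :
    ∃ t : ℝ, 0 < t ∧ q.2 = 0 ∧
      q.1 = (N.pos (N.bdry l)).1 + t * ((N.pos (N.bdry j)).1 - (N.pos (N.bdry i)).1) := by
  obtain ⟨t, ht, rfl⟩ := hq
  exact ⟨t, ht, by simp [edgeDir, N.bdry_on_axis], by simp [edgeDir]⟩

/-- If a region touches a piece from the left (`c = 0`) or from the right (`c = 1`), then one of its
two marks is known. -/
theorem mark_of_piece [Finite V] (hℓ : N.IsGaugeDirection ℓ) (hO : N.IsPerfect O)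
    (hW : N.IsCurve O (dartRel P)) (hne : i₀ ≠ j₀) {p : Set (ℝ × ℝ) × (ℝ × ℝ)}
    (hp : p ∈ N.pathPieces ℓ P) {q : ℝ × ℝ} (hq : q ∈ p.1) {σ : ℝ} {c : ZMod 2}
    (hσ : σ = 1 ∧ c = 0 ∨ σ = -1 ∧ c = 1) :
    (∀ᶠ t in 𝓝[>] (0 : ℝ), 0 < (q + t • (σ • rotLeft p.2)).2 →
      N.between ℓ i₀ j₀ (q + t • (σ • rotLeft p.2)) = N.leftCount ℓ i₀ j₀ + c) ∨
    (∀ᶠ t in 𝓝[>] (0 : ℝ),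
      N.upCount ℓ P (q + t • (σ • rotLeft p.2)) = N.leftCount ℓ i₀ j₀ + c) := by
  have h2 := hℓ.inside
  have hrot : planeCross (rotLeft ℓ) ℓ < 0 := by
    rw [planeCross_rotLeft_self]; nlinarith [sq_nonneg ℓ.1]
  have hsnd : ∀ (i j : Fin n), (rotLeft (N.edgeDir (N.bdry i) (N.bdry j))).2 =
      (N.pos (N.bdry j)).1 - (N.pos (N.bdry i)).1 := fun i j => by simp [rotLeft, edgeDir]
  have axis : ∀ (i j : Fin n), q.2 = 0 →
      (σ * ((N.pos (N.bdry j)).1 - (N.pos (N.bdry i)).1) < 0 ∨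
        planeCross q ℓ ≠ N.bx ℓ i₀ ∧ planeCross q ℓ ≠ N.bx ℓ j₀ ∧
        N.between ℓ i₀ j₀ q = N.leftCount ℓ i₀ j₀ + c) →
      ∀ᶠ t in 𝓝[>] (0 : ℝ), 0 < (q + t • (σ • rotLeft (N.edgeDir (N.bdry i) (N.bdry j)))).2 →
      N.between ℓ i₀ j₀ (q + t • (σ • rotLeft (N.edgeDir (N.bdry i) (N.bdry j)))) =
        N.leftCount ℓ i₀ j₀ + c := by
    intro i j hq2 h
    rcases h with h | ⟨ha, hb, hc⟩
    · filter_upwards [self_mem_nhdsWithin] with t ht hpos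
      have ht : (0 : ℝ) < t := ht
      simp only [Prod.snd_add, hq2, Prod.smul_snd, smul_eq_mul, hsnd, zero_add] at hpos
      nlinarith
    · filter_upwards [(tendsto_add_smul q _).eventually (eventually_between ha hb)] with t ht _
      rw [ht, hc]
  have xq : q.2 = 0 → planeCross q ℓ = q.1 * ℓ.2 := planeCross_axis
  rcases hp with (rfl | rfl | rfl | rfl | rfl) | ⟨d, hd, rfl⟩
  · left
    have hqx := planeCross_of_mem_openRay_bdry hq
    refine (between_ray_left hℓ hne (Or.inl ⟨hqx, ?_⟩)).mono fun t ht _ => ht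
    simp only [planeCross_smul_left]
    rcases hσ with ⟨rfl, rfl⟩ | ⟨rfl, rfl⟩
    · left; exact ⟨by linarith, rfl⟩
    · right; exact ⟨by linarith, rfl⟩
  · left
    have hqx := planeCross_of_mem_openRay_bdry hq
    refine (between_ray_left hℓ hne (Or.inr ⟨hqx, ?_⟩)).mono fun t ht _ => ht
    have : rotLeft (-ℓ) = -rotLeft ℓ := by unfold rotLeft; simp
    simp only [planeCross_smul_left, this, planeCross_neg_left]
    rcases hσ with ⟨rfl, rfl⟩ | ⟨rfl, rfl⟩
    · left; exact ⟨by linarith, rfl⟩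
    · right; exact ⟨by linarith, rfl⟩
  · left
    have hq : q ∈ openSegment ℝ (N.pos (N.bdry j₀)) (N.pos (N.bdry i₀)) := hq
    rw [openSegment_eq_image'] at hq
    obtain ⟨t, ⟨ht0, ht1⟩, hqt⟩ := hq
    have hq1 : q.1 = (N.pos (N.bdry j₀)).1 +
        t * ((N.pos (N.bdry i₀)).1 - (N.pos (N.bdry j₀)).1) := by rw [← hqt]; simp
    have hq2 : q.2 = 0 := by rw [← hqt]; simp [N.bdry_on_axis]
    refine axis _ _ hq2 ?_
    rcases bx_lt_or (N := N) h2 hne with ⟨-, h1, h3⟩ | ⟨-, h1, h3⟩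
    · rcases hσ with ⟨rfl, rfl⟩ | ⟨rfl, rfl⟩
      · right
        rw [h3]
        have a1 : planeCross q ℓ < N.bx ℓ i₀ := by
          rw [xq hq2, bx_eq]; exact mul_lt_mul_of_pos_right (by nlinarith) h2
        have a2 : N.bx ℓ j₀ < planeCross q ℓ := by
          rw [xq hq2, bx_eq]; exact mul_lt_mul_of_pos_right (by nlinarith) h2
        refine ⟨a1.ne, a2.ne', ?_⟩
        rw [between, parity_false (not_le.2 a1), parity_true a2.le]; rfl
      · left; linarith
    · rcases hσ with ⟨rfl, rfl⟩ | ⟨rfl, rfl⟩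
      · left; linarith
      · right
        rw [h3]
        have a1 : planeCross q ℓ < N.bx ℓ j₀ := by
          rw [xq hq2, bx_eq]; exact mul_lt_mul_of_pos_right (by nlinarith) h2
        have a2 : N.bx ℓ i₀ < planeCross q ℓ := by
          rw [xq hq2, bx_eq]; exact mul_lt_mul_of_pos_right (by nlinarith) h2
        refine ⟨a2.ne', a1.ne, ?_⟩
        rw [between, parity_false (not_le.2 a1), parity_true a2.le]; rfl
  · left
    obtain ⟨t, ht0, hq2, hq1⟩ := openRay_bdry hq
    refine axis _ _ hq2 ?_
    rcases bx_lt_or (N := N) h2 hne with ⟨h0, h1, h3⟩ | ⟨h0, h1, h3⟩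
    · rcases hσ with ⟨rfl, rfl⟩ | ⟨rfl, rfl⟩
      · left; linarith
      · right
        rw [h3]
        have a1 : planeCross q ℓ < N.bx ℓ j₀ := by
          rw [xq hq2, bx_eq]; exact mul_lt_mul_of_pos_right (by nlinarith) h2
        have a2 : planeCross q ℓ < N.bx ℓ i₀ := a1.trans h0
        refine ⟨a2.ne, a1.ne, ?_⟩
        rw [between, parity_false (not_le.2 a1), parity_false (not_le.2 a2)]; rfl
    · rcases hσ with ⟨rfl, rfl⟩ | ⟨rfl, rfl⟩
      · right
        rw [h3]
        have a1 : N.bx ℓ j₀ < planeCross q ℓ := by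
          rw [xq hq2, bx_eq]; exact mul_lt_mul_of_pos_right (by nlinarith) h2
        have a2 : N.bx ℓ i₀ < planeCross q ℓ := h0.trans a1
        refine ⟨a2.ne', a1.ne', ?_⟩
        rw [between, parity_true a1.le, parity_true a2.le]; rfl
      · left; linarith
  · left
    obtain ⟨t, ht0, hq2, hq1⟩ := openRay_bdry hq
    refine axis _ _ hq2 ?_
    rcases bx_lt_or (N := N) h2 hne with ⟨h0, h1, h3⟩ | ⟨h0, h1, h3⟩
    · rcases hσ with ⟨rfl, rfl⟩ | ⟨rfl, rfl⟩
      · left; linarith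
      · right
        rw [h3]
        have a2 : N.bx ℓ i₀ < planeCross q ℓ := by
          rw [xq hq2, bx_eq]; exact mul_lt_mul_of_pos_right (by nlinarith) h2
        have a1 : N.bx ℓ j₀ < planeCross q ℓ := h0.trans a2
        refine ⟨a2.ne', a1.ne', ?_⟩
        rw [between, parity_true a1.le, parity_true a2.le]
    · rcases hσ with ⟨rfl, rfl⟩ | ⟨rfl, rfl⟩
      · right
        rw [h3]
        have a2 : planeCross q ℓ < N.bx ℓ i₀ := by
          rw [xq hq2, bx_eq]; exact mul_lt_mul_of_pos_right (by nlinarith) h2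
        have a1 : planeCross q ℓ < N.bx ℓ j₀ := a2.trans h0
        refine ⟨a2.ne, a1.ne, ?_⟩
        rw [between, parity_false (not_le.2 a1), parity_false (not_le.2 a2)]
      · left; linarith
  · right
    have hW' : dartRel P d.fst d.snd := ⟨d, hd, rfl, rfl⟩
    obtain ⟨hl, hr⟩ := leftVal_upCount hℓ hO hW hne hW'
    have hpos := hW.pos_ne hO hW'
    rcases hσ with ⟨rfl, rfl⟩ | ⟨rfl, rfl⟩
    · rw [add_zero]
      refine (hl q hq).eventually ?_
      rw [one_smul]
      exact planeCross_rotLeft_pos (sub_ne_zero.2 hpos.symm)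
    · refine (hr q ((openSegment_symm ℝ _ _).subset hq)).eventually ?_
      have : N.pos d.fst - N.pos d.snd = -(N.pos d.snd - N.pos d.fst) := by abel
      rw [this, planeCross_neg_left, planeCross_smul_right, edgeDir]
      have := planeCross_rotLeft_pos (sub_ne_zero.2 hpos.symm)
      linarith

end PBDTPNetwork

namespace PBDTPNetwork

variable {V : Type*} {n : ℕ} {N : PBDTPNetwork V n} {ℓ : ℝ × ℝ} {O W : V → V → Prop}
  {i₀ j₀ : Fin n} {P : N.graph.Walk (N.bdry i₀) (N.bdry j₀)}

theorem LeftAt.sub_smul {f : ℝ × ℝ → ZMod 2} {q w : ℝ × ℝ} {y : ZMod 2} (h : LeftAt f (-w) q y)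
    (hw : w ≠ 0) : ∀ᶠ t in 𝓝[>] (0 : ℝ), f (q - t • rotLeft w) = y := by
  have := h.eventually (w := -rotLeft w) (by
    rw [planeCross_neg_left, planeCross_neg_right, neg_neg]; exact planeCross_rotLeft_pos hw)
  simpa only [smul_neg, ← sub_eq_add_neg] using this

theorem LeftAt.add_smul {f : ℝ × ℝ → ZMod 2} {q w : ℝ × ℝ} {y : ZMod 2} (h : LeftAt f w q y)
    (hw : w ≠ 0) : ∀ᶠ t in 𝓝[>] (0 : ℝ), f (q + t • rotLeft w) = y :=
  h.eventually (planeCross_rotLeft_pos hw)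

open Filter in
/-- If the indicator function of a region is not locally constant off the curve, then the region
touches one of the two vertical lines. -/
theorem exists_line_touch [Finite V] (hℓ : N.IsGaugeDirection ℓ)
    {z₀ : ℝ × ℝ} (hf : ¬ LocConstOff (N.curveSet W)
      (regionInd (N.curveSet W ∪ verticals ℓ (N.twoLines ℓ i₀ j₀)) z₀)) :
    ∃ i, (i = i₀ ∨ i = j₀) ∧ ∃ q ∈ openRay (N.pos (N.bdry i)) ℓ,
      LeftAt (regionInd (N.curveSet W ∪ verticals ℓ (N.twoLines ℓ i₀ j₀)) z₀) ℓ q 1 ∨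
      LeftAt (regionInd (N.curveSet W ∪ verticals ℓ (N.twoLines ℓ i₀ j₀)) z₀) (-ℓ) q 1 := by
  have hKcl := N.isClosed_curveSet W
  set K := N.curveSet W ∪ verticals ℓ (N.twoLines ℓ i₀ j₀) with hK
  have hclosed : IsClosed K := hKcl.union (isClosed_verticals ℓ (finite_twoLines _ _))
  have hf0 := locConstOff_regionInd hclosed z₀
  by_contra hc
  apply hf
  intro q hq hqK
  by_cases hqv : q ∈ verticals ℓ (N.twoLines ℓ i₀ j₀)
  swap
  · exact hf0 q hq (by rintro (h | h); exacts [hqK h, hqv h])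
  have hqi : ∃ i, (i = i₀ ∨ i = j₀) ∧ planeCross q ℓ = N.bx ℓ i := by
    rcases hqv with h | h
    · exact ⟨i₀, Or.inl rfl, h⟩
    · exact ⟨j₀, Or.inr rfl, h⟩
  obtain ⟨i, hi, hqi⟩ := hqi
  have hray : q ∈ openRay (N.pos (N.bdry i)) ℓ := by
    refine hℓ.mem_openRay_of_planeCross_eq_zero hq ?_
    rw [planeCross_sub_left, hqi]
    unfold bx; ring
  have near : ∀ᶠ z in 𝓝 q, z ∈ K → planeCross ℓ (z - q) = 0 := by
    have hfin : (N.twoLines ℓ i₀ j₀ \ {planeCross q ℓ}).Finite := (finite_twoLines _ _).sdiff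
    filter_upwards [hKcl.isOpen_compl.mem_nhds hqK,
      (isClosed_verticals ℓ hfin).isOpen_compl.mem_nhds (fun h => h.2 rfl)] with z h1 h2 h3
    rcases h3 with h3 | h3
    · exact absurd h3 h1
    · have : planeCross z ℓ = planeCross q ℓ := by
        by_contra hne
        exact h2 ⟨h3, hne⟩
      rw [planeCross_sub_right, planeCross_swap z ℓ, planeCross_swap q ℓ, this, sub_self]
  have near' : ∀ᶠ z in 𝓝 q, z ∈ K → planeCross (-ℓ) (z - q) = 0 := by
    filter_upwards [near] with z hz hzK
    rw [planeCross_neg_left, hz hzK, neg_zero]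
  obtain ⟨y₁, hy₁⟩ := hf0.exists_leftAt hq near
  obtain ⟨y₂, hy₂⟩ := hf0.exists_leftAt hq near'
  have e₁ : y₁ = 0 := by
    rcases zmod_two_eq_zero_or y₁ with h | rfl
    · exact h
    · exact absurd ⟨i, hi, q, hray, Or.inl hy₁⟩ hc
  have e₂ : y₂ = 0 := by
    rcases zmod_two_eq_zero_or y₂ with h | rfl
    · exact h
    · exact absurd ⟨i, hi, q, hray, Or.inr hy₂⟩ hc
  subst e₁ e₂
  have line : ∀ z, planeCross z ℓ = planeCross q ℓ → regionInd K z₀ z = 0 := by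
    intro z hz
    apply parity_false
    intro h
    have := (connectedComponentIn_subset _ _ h).2
    apply this
    right
    show planeCross z ℓ ∈ N.twoLines ℓ i₀ j₀
    rw [hz]; exact hqv
  filter_upwards [hy₁, hy₂] with z h1 h2
  rw [line q rfl]
  rcases lt_trichotomy (planeCross ℓ (z - q)) 0 with h | h | h
  · exact h2 (by rw [planeCross_neg_left]; linarith)
  · apply line
    rw [planeCross_sub_right, planeCross_swap z ℓ, planeCross_swap q ℓ] at h
    linarith
  · exact h1 h

open Filter in
/-- The regions marked `+` by a path, in terms of its passing number. -/
theorem pathPlus_iff [Finite V] (hℓ : N.IsGaugeDirection ℓ) (hO : N.IsPerfect O)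
    (hW : N.IsCurve O (dartRel P)) (hne : i₀ ≠ j₀) {z : ℝ × ℝ} (hz : 0 < z.2)
    (hzP : z ∉ N.walkSet P) (hzi : planeCross z ℓ ≠ N.bx ℓ i₀) (hzj : planeCross z ℓ ≠ N.bx ℓ j₀) :
    N.PathPlus ℓ P z ↔ N.upCount ℓ P z = N.between ℓ i₀ j₀ z := by
  have hU : LocConstOff (N.curveSet (dartRel P)) (N.upCount ℓ P) := by
    rw [curveSet_dartRel]
    exact locConstOff_upCount hℓ P (Or.inr ⟨N.bdry_on_axis _, N.bdry_on_axis _⟩)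
  have hB : LocConstOff _ (N.between ℓ i₀ j₀) := locConstOff_between i₀ j₀
  have hKcl := N.isClosed_curveSet (dartRel P)
  have hR := N.pathRegion_eq hℓ P z
  have hzD : z ∈ diskOff (N.curveSet (dartRel P) ∪ verticals ℓ (N.twoLines ℓ i₀ j₀)) := by
    refine ⟨hz, ?_⟩
    rintro (h | h | h)
    · rw [curveSet_dartRel] at h; exact hzP h
    · exact hzi h
    · exact hzj h
  set K := N.curveSet (dartRel P) ∪ verticals ℓ (N.twoLines ℓ i₀ j₀) with hK
  have hclosed : IsClosed K := hKcl.union (isClosed_verticals ℓ (finite_twoLines _ _))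
  have hUc : ∀ w ∈ N.pathRegion ℓ P z, N.upCount ℓ P w = N.upCount ℓ P z := by
    intro w hw
    rw [hR] at hw
    exact (hU.mono Set.subset_union_left).eq_of_mem_region hw
  have hBc : ∀ w ∈ N.pathRegion ℓ P z, N.between ℓ i₀ j₀ w = N.between ℓ i₀ j₀ z := by
    intro w hw
    rw [hR] at hw
    exact (hB.mono Set.subset_union_right).eq_of_mem_region hw
  have hpos : ∀ w ∈ N.pathRegion ℓ P z, 0 < w.2 := by
    intro w hw
    rw [hR] at hw
    exact (connectedComponentIn_subset _ _ hw).1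
  unfold PathPlus
  constructor
  · intro hplus
    by_contra hcon
    have hcon1 : N.upCount ℓ P z + N.between ℓ i₀ j₀ z ≠ 0 := by
      intro h
      apply hcon
      linear_combination h - add_self_zmod_two (N.between ℓ i₀ j₀ z)
    have hf := locConstOff_regionInd hclosed z
    obtain ⟨z', hz', hgen⟩ := exists_generic hℓ hclosed hzD
    have hz'D := connectedComponentIn_subset _ _ hz'
    rw [← hR] at hz'
    have hz'P : z' ∉ N.walkSet P := fun h => hz'D.2 (Or.inl (by rwa [curveSet_dartRel]))
    obtain ⟨w, hw, hit⟩ := exists_vertical_of_upCount (ℓ := ℓ) hz'P (by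
      rw [hUc z' hz']
      have := hBc z' hz'
      unfold between bx at this
      rw [this]
      exact hcon1)
    rw [← curveSet_dartRel] at hit
    rw [hR] at hz'
    obtain ⟨u, v, huv, q, hq, htouch⟩ :=
      hW.touches_of_hit hℓ hO (finite_twoLines _ _) hz' hw hgen hit
    rw [← hK] at htouch
    have huvne := hW.pos_ne hO huv
    have hind : ∀ y, regionInd K z y = 1 ↔ y ∈ N.pathRegion ℓ P z := fun y => by
      rw [hR, regionInd_eq_one]
    have hLeft := leftVal_upCount hℓ hO hW hne huv
    have hℓ0 : ℓ ≠ 0 := fun h => by have := hℓ.inside; rw [h] at this; exact lt_irrefl _ this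
    have axis_snd : ∀ c s : ℝ, (N.pos (N.bdry i₀) + s • ((c, 0) : ℝ × ℝ)).2 = 0 := by
      intro c s; simp [N.bdry_on_axis]
    obtain ⟨x, hx⟩ := exists_first (P := P) hne
    have hdart : (openSegment ℝ (N.pos u) (N.pos v), N.edgeDir u v) ∈ N.pathPieces ℓ P := by
      right
      obtain ⟨d, hd, rfl, rfl⟩ := huv
      exact ⟨d, hd, rfl⟩
    have hvu : N.pos u - N.pos v = -N.edgeDir u v := by unfold edgeDir; abel
    have hedge : N.edgeDir u v ≠ 0 := sub_ne_zero.2 huvne.symm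
    have hrot : planeCross (rotLeft ℓ) ℓ < 0 := by
      have := hℓ.inside
      rw [planeCross_rotLeft_self]; nlinarith [sq_nonneg ℓ.1]
    have raymark : ∀ (i : Fin n), (i = i₀ ∨ i = j₀) → ∀ q ∈ openRay (N.pos (N.bdry i)) ℓ, ∀ σ c,
        (σ = (1 : ℝ) ∧ (i = i₀ ∧ c = 0 ∨ i = j₀ ∧ c = 1) ∨
          σ = -1 ∧ (i = i₀ ∧ c = 1 ∨ i = j₀ ∧ c = 0)) →
        (∀ᶠ t in 𝓝[>] (0 : ℝ), q + t • (σ • rotLeft ℓ) ∈ N.pathRegion ℓ P z) →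
        N.between ℓ i₀ j₀ z = N.leftCount ℓ i₀ j₀ + c := by
      intro i hi q hq σ c hσ hev
      have hqx := planeCross_of_mem_openRay_bdry hq
      have hb : ∀ᶠ s in 𝓝[>] (0 : ℝ), N.between ℓ i₀ j₀ (q + s • (σ • rotLeft ℓ)) =
          N.leftCount ℓ i₀ j₀ + c := by
        apply between_ray_left hℓ hne
        rw [planeCross_smul_left]
        rcases hσ with ⟨rfl, ⟨rfl, rfl⟩ | ⟨rfl, rfl⟩⟩ | ⟨rfl, ⟨rfl, rfl⟩ | ⟨rfl, rfl⟩⟩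
        · exact Or.inl ⟨hqx, Or.inl ⟨by linarith, rfl⟩⟩
        · exact Or.inr ⟨hqx, Or.inr ⟨by linarith, rfl⟩⟩
        · exact Or.inl ⟨hqx, Or.inr ⟨by linarith, rfl⟩⟩
        · exact Or.inr ⟨hqx, Or.inl ⟨by linarith, rfl⟩⟩
      obtain ⟨s, h1, h2⟩ := (hev.and hb).exists
      rw [← hBc _ h1, h2]
    have ray : ∀ (i : Fin n), (i = i₀ ∨ i = j₀) → ∀ q ∈ openRay (N.pos (N.bdry i)) ℓ,
        (LeftAt (regionInd K z) ℓ q 1 ∨ LeftAt (regionInd K z) (-ℓ) q 1) →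
        (N.between ℓ i₀ j₀ z = N.leftCount ℓ i₀ j₀ ∧
          ∃ p ∈ N.pathPieces ℓ P, ∃ q ∈ p.1,
            ∀ᶠ t in 𝓝[>] (0 : ℝ), q + t • rotLeft p.2 ∈ N.pathRegion ℓ P z) ∨
        (N.between ℓ i₀ j₀ z = N.leftCount ℓ i₀ j₀ + 1 ∧
          ∃ p ∈ N.pathPieces ℓ P, ∃ q ∈ p.1,
            ∀ᶠ t in 𝓝[>] (0 : ℝ), q - t • rotLeft p.2 ∈ N.pathRegion ℓ P z) := by
      intro i hi q hq htouch
      have hneg : rotLeft (-ℓ) = -rotLeft ℓ := by unfold rotLeft; simp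
      have hplus1 : ∀ t : ℝ, q + t • ((1 : ℝ) • rotLeft ℓ) = q + t • rotLeft ℓ := by
        intro t; rw [one_smul]
      have hminus1 : ∀ t : ℝ, q + t • ((-1 : ℝ) • rotLeft ℓ) = q - t • rotLeft ℓ := by
        intro t; rw [neg_one_smul, smul_neg, ← sub_eq_add_neg]
      rcases htouch with h | h
      · have h1 := (LeftAt.add_smul h hℓ0).mono fun t ht => (hind _).1 ht
        have h2 := raymark i hi q hq 1
        simp only [hplus1] at h2
        rcases hi with rfl | rfl
        · left
          have := h2 0 (by simp) h1
          rw [add_zero] at this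
          exact ⟨this, _, Or.inl (Or.inl rfl), q, hq, h1⟩
        · right
          refine ⟨h2 1 (by simp) h1, _, Or.inl (Or.inr (Or.inl rfl)), q, hq, ?_⟩
          simpa only [hneg, smul_neg, sub_neg_eq_add] using h1
      · have h1 := (LeftAt.sub_smul h hℓ0).mono fun t ht => (hind _).1 ht
        have h2 := raymark i hi q hq (-1)
        simp only [hminus1] at h2
        rcases hi with rfl | rfl
        · right
          exact ⟨h2 1 (by simp) h1, _, Or.inl (Or.inl rfl), q, hq, h1⟩
        · left
          have := h2 0 (by simp) h1
          rw [add_zero] at this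
          refine ⟨this, _, Or.inl (Or.inr (Or.inl rfl)), q, hq, ?_⟩
          simpa only [hneg, smul_neg, ← sub_eq_add_neg] using h1
    rcases htouch with htouch | htouch
    · have ht1 : ∀ᶠ t in 𝓝[>] (0 : ℝ), q + t • rotLeft (N.edgeDir u v) ∈ N.pathRegion ℓ P z :=
        (LeftAt.add_smul htouch hedge).mono fun t ht => (hind _).1 ht
      have hUz : N.upCount ℓ P z = N.leftCount ℓ i₀ j₀ := by
        obtain ⟨t, a1, a2⟩ := (ht1.and (LeftAt.add_smul (hLeft.1 q hq) hedge)).exists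
        rw [← hUc _ a1, ← a2]; rfl
      have hnl : ¬ LocConstOff (N.curveSet (dartRel P)) (regionInd K z) := by
        intro hl
        obtain ⟨⟨y, hy⟩, -⟩ := hW.exists_leftAt hO hl huv
        rw [(hy q hq).unique hedge htouch] at hy
        have hy' := hW.leftVal_of_leftVal hℓ hO hl huv hx hy
        obtain ⟨s, a1, a2⟩ := (((hW.eventually_axis hO hl hx (y := 1)).1 hy').and
          (eventually_between_west hℓ hne)).exists
        obtain ⟨y, hy2, b1, b2⟩ := exists_above_axis (axis_snd _ _) (a1.and a2)
        rw [hBc y ((hind _).1 (b1 hy2))] at b2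
        exact hcon (hUz.trans b2.symm)
      obtain ⟨i, hi, q', hq', h'⟩ := exists_line_touch hℓ hnl
      rcases ray i hi q' hq' h' with ⟨h1, -⟩ | ⟨-, p, hp, q'', hq'', h2⟩
      · exact hcon (hUz.trans h1.symm)
      · rcases hplus with h | h
        · exact h _ hdart ⟨q, hq, ht1⟩
        · exact h p hp ⟨q'', hq'', h2⟩
    · rw [hvu] at htouch
      have ht1 : ∀ᶠ t in 𝓝[>] (0 : ℝ), q - t • rotLeft (N.edgeDir u v) ∈ N.pathRegion ℓ P z :=
        (LeftAt.sub_smul htouch hedge).mono fun t ht => (hind _).1 ht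
      have hq2 := (openSegment_symm ℝ _ _).subset hq
      have hUz : N.upCount ℓ P z = N.leftCount ℓ i₀ j₀ + 1 := by
        have hr := hLeft.2 q hq2
        rw [hvu] at hr
        obtain ⟨t, a1, a2⟩ := (ht1.and (LeftAt.sub_smul hr hedge)).exists
        rw [← hUc _ a1, ← a2]
      have hnl : ¬ LocConstOff (N.curveSet (dartRel P)) (regionInd K z) := by
        intro hl
        obtain ⟨-, y, hy⟩ := hW.exists_leftAt hO hl huv
        have hyq := hy q hq2
        rw [hvu] at hyq
        rw [hyq.unique (neg_ne_zero.2 hedge) htouch] at hy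
        have hy' := hW.rightVal_of_rightVal hℓ hO hl huv hx hy
        obtain ⟨s, a1, a2⟩ := (((hW.eventually_axis hO hl hx (y := 1)).2 hy').and
          (eventually_between_east hℓ hne)).exists
        obtain ⟨y, hy2, b1, b2⟩ := exists_above_axis (axis_snd _ _) (a1.and a2)
        rw [hBc y ((hind _).1 (b1 hy2))] at b2
        exact hcon (hUz.trans b2.symm)
      obtain ⟨i, hi, q', hq', h'⟩ := exists_line_touch hℓ hnl
      rcases ray i hi q' hq' h' with ⟨-, p, hp, q'', hq'', h2⟩ | ⟨h1, -⟩
      · rcases hplus with h | h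
        · exact h p hp ⟨q'', hq'', h2⟩
        · exact h _ hdart ⟨q, hq, ht1⟩
      · exact hcon (hUz.trans h1.symm)
  · intro heq
    have piece : ∀ p ∈ N.pathPieces ℓ P, ∀ q ∈ p.1, ∀ (σ : ℝ) (c : ZMod 2),
        (σ = 1 ∧ c = 0 ∨ σ = -1 ∧ c = 1) →
        (∀ᶠ t in 𝓝[>] (0 : ℝ), q + t • (σ • rotLeft p.2) ∈ N.pathRegion ℓ P z) →
        N.upCount ℓ P z = N.leftCount ℓ i₀ j₀ + c := by
      intro p hp q hq σ c hσ hev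
      rcases mark_of_piece hℓ hO hW hne hp hq hσ with h | h
      · obtain ⟨t, h1, h2⟩ := (hev.and h).exists
        rw [heq, ← hBc _ h1, h2 (hpos _ h1)]
      · obtain ⟨t, h1, h2⟩ := (hev.and h).exists
        rw [← hUc _ h1, h2]
    by_cases hl : N.upCount ℓ P z = N.leftCount ℓ i₀ j₀
    · right
      rintro p hp ⟨q, hq, hev⟩
      have := piece p hp q hq (-1) 1 (by simp) (by
        simpa only [neg_one_smul, smul_neg, ← sub_eq_add_neg] using hev)
      rw [hl] at this
      exact one_ne_zero (left_eq_add.1 this)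
    · left
      rintro p hp ⟨q, hq, hev⟩
      have := piece p hp q hq 1 0 (by simp) (by simpa only [one_smul] using hev)
      rw [add_zero] at this
      exact hl this

end PBDTPNetwork

namespace PBDTPNetwork

variable {V : Type*} {n : ℕ} {N : PBDTPNetwork V n} {ℓ : ℝ × ℝ} {O : V → V → Prop}
  {v₀ : V} {Q : N.graph.Walk v₀ v₀}

theorem locConstOff_upCount_cycle (hℓ : N.IsGaugeDirection ℓ) :
    LocConstOff (N.curveSet (dartRel Q)) (N.upCount ℓ Q) := by
  rw [curveSet_dartRel]
  exact locConstOff_upCount hℓ Q (Or.inl rfl)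

theorem exists_leftVal_upCount_cycle [Finite V] (hℓ : N.IsGaugeDirection ℓ) (hO : N.IsPerfect O)
    (hW : N.IsCurve O (dartRel Q)) (hnd : Q.edges.Nodup) :
    ∃ y, ∀ u v, dartRel Q u v → LeftVal (N.upCount ℓ Q) (N.pos u) (N.pos v) y ∧
      LeftVal (N.upCount ℓ Q) (N.pos v) (N.pos u) (y + 1) := by
  by_cases hex : ∃ u v, dartRel Q u v
  swap
  · exact ⟨0, fun u v h => absurd ⟨u, v, h⟩ hex⟩
  obtain ⟨u, v, h⟩ := hex
  have hU := locConstOff_upCount_cycle (Q := Q) hℓ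
  obtain ⟨⟨y, hy⟩, y', hy'⟩ := hW.exists_leftAt hO hU h
  have hκ := hℓ.not_parallel_of_adj (hW.adj hO h)
  obtain ⟨s, hq, hgen⟩ := ((openSegment_eventually (c := N.pos u) (d := N.pos v)).and
    (N.eventually_generic (z := N.pos u) hκ)).exists
  set q := N.pos u + s • (N.pos v - N.pos u) with hqdef
  have flip := upCount_flip hℓ hnd h hq hgen
  have hq' := (openSegment_symm ℝ _ _).subset hq
  have hvu : N.pos u - N.pos v = -N.edgeDir u v := by unfold edgeDir; abel
  have e : y' = y + 1 := by
    rcases lt_or_gt_of_ne hκ with hk | hk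
    · have h1 := (hy q hq).eventually (w := -ℓ) (by
        rw [planeCross_neg_right]; unfold edgeDir at hk; linarith)
      have h2 := (hy' q hq').eventually (w := ℓ) (by rw [hvu, planeCross_neg_left]; linarith)
      obtain ⟨t, a1, a2, a3⟩ := (flip.and (h1.and h2)).exists
      rw [smul_neg, ← sub_eq_add_neg] at a2
      rw [a2, a3] at a1
      linear_combination a1 - add_self_zmod_two y
    · have h1 := (hy q hq).eventually (w := ℓ) hk
      have h2 := (hy' q hq').eventually (w := -ℓ) (by
        rw [hvu, planeCross_neg_left, planeCross_neg_right]; linarith)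
      obtain ⟨t, a1, a2, a3⟩ := (flip.and (h1.and h2)).exists
      rw [smul_neg, ← sub_eq_add_neg] at a3
      rw [a2, a3] at a1
      linear_combination a1 - add_self_zmod_two y
  refine ⟨y, fun u' v' h' => ⟨hW.leftVal_of_leftVal hℓ hO hU h h' hy, ?_⟩⟩
  rw [← e]
  exact hW.rightVal_of_rightVal hℓ hO hU h h' hy'

theorem isCompact_curveSet [Finite V] (N : PBDTPNetwork V n) (W : V → V → Prop) :
    IsCompact (N.curveSet W) := by
  have : N.curveSet W = ⋃ p ∈ {p : V × V | W p.1 p.2}, segment ℝ (N.pos p.1) (N.pos p.2) := by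
    ext z
    simp [curveSet]
  rw [this]
  refine Set.Finite.isCompact_biUnion (Set.toFinite _) fun p _ => ?_
  rw [segment_eq_image]
  exact isCompact_Icc.image (by fun_prop)

theorem not_isBounded_of_ray (hℓ : N.IsGaugeDirection ℓ) {K : Set (ℝ × ℝ)} {z w : ℝ × ℝ}
    (hw : w ∈ connectedComponentIn (diskOff K) z) (h : ∀ t : ℝ, 0 < t → w + t • ℓ ∉ K) :
    ¬ Bornology.IsBounded (connectedComponentIn (diskOff K) z) := by
  intro hb
  have hwD := connectedComponentIn_subset _ _ hw
  have hw2 : 0 < w.2 := hwD.1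
  have h2 := hℓ.inside
  have hmem : ∀ t : ℝ, 0 ≤ t → w + t • ℓ ∈ connectedComponentIn (diskOff K) z := by
    intro t ht
    rw [connectedComponentIn_eq hw]
    have hpre : IsPreconnected ((fun t : ℝ => w + t • ℓ) '' Set.Ici 0) :=
      isPreconnected_Ici.image _ (by fun_prop)
    refine hpre.subset_connectedComponentIn ⟨0, Set.self_mem_Ici, by simp⟩ ?_ ⟨t, ht, rfl⟩
    rintro _ ⟨s, hs, rfl⟩
    have hs : (0 : ℝ) ≤ s := hs
    refine ⟨?_, ?_⟩
    · simp only [Set.mem_ofPred_eq, Prod.snd_add, Prod.smul_snd, smul_eq_mul]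
      positivity
    · rcases hs.eq_or_lt with rfl | hs
      · simpa using hwD.2
      · exact h s hs
  obtain ⟨M, hM⟩ := hb.exists_norm_le
  have hM0 : 0 ≤ M := (norm_nonneg _).trans (hM _ hw)
  have := hM _ (hmem ((M + 1) / ℓ.2) (by positivity))
  have h3 := (norm_snd_le (w + ((M + 1) / ℓ.2) • ℓ)).trans this
  simp only [Prod.snd_add, Prod.smul_snd, smul_eq_mul] at h3
  rw [div_mul_cancel₀ _ h2.ne', Real.norm_eq_abs] at h3
  have := (le_abs_self _).trans h3
  linarith

/-- The regions marked `+` by a cycle, in terms of its passing number. -/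
theorem cyclePlus_iff [Finite V] (hℓ : N.IsGaugeDirection ℓ) (hO : N.IsPerfect O)
    (hW : N.IsCurve O (dartRel Q)) (hnd : Q.edges.Nodup) {z : ℝ × ℝ} (hz : 0 < z.2)
    (hzQ : z ∉ N.walkSet Q) : N.CyclePlus Q z ↔ N.upCount ℓ Q z = 0 := by
  have hU := locConstOff_upCount_cycle (Q := Q) hℓ
  have hKcl := N.isClosed_curveSet (dartRel Q)
  obtain ⟨M, hM⟩ := (N.isCompact_curveSet (dartRel Q)).isBounded.exists_norm_le
  have hzD : z ∈ diskOff (N.curveSet (dartRel Q)) := ⟨hz, by rwa [curveSet_dartRel]⟩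
  have h2 := hℓ.inside
  have hregion : connectedComponentIn ({z : ℝ × ℝ | 0 < z.2} \ N.walkSet Q) z =
      connectedComponentIn (diskOff (N.curveSet (dartRel Q))) z := by
    rw [curveSet_dartRel]; rfl
  unfold CyclePlus
  rw [hregion]
  have hUc : ∀ w ∈ connectedComponentIn (diskOff (N.curveSet (dartRel Q))) z,
      N.upCount ℓ Q w = N.upCount ℓ Q z := fun w hw => hU.eq_of_mem_region hw
  have hM2 : ∀ w ∈ N.curveSet (dartRel Q), w.2 ≤ M := fun w hw =>
    (le_abs_self _).trans ((norm_snd_le w).trans (hM w hw))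
  constructor
  · intro hb
    by_contra hne
    apply hb
    refine (Metric.isBounded_closedBall (x := (0 : ℝ × ℝ)) (r := M + M / ℓ.2 * ‖ℓ‖)).subset ?_
    intro w hw
    rw [mem_closedBall_zero_iff]
    have hw2 : 0 < w.2 := (connectedComponentIn_subset _ _ hw).1
    obtain ⟨t, ht, hK⟩ := exists_above_of_upCount_ne_zero (ℓ := ℓ) (by rw [hUc w hw]; exact hne)
    rw [← curveSet_dartRel] at hK
    have h3 := hM2 _ hK
    simp only [Prod.snd_add, Prod.smul_snd, smul_eq_mul] at h3
    have h4 : t ≤ M / ℓ.2 := by rw [le_div_iff₀ h2]; linarith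
    have h5 : w = (w + t • ℓ) - t • ℓ := by abel
    rw [h5]
    refine (norm_sub_le _ _).trans (add_le_add (hM _ hK) ?_)
    rw [norm_smul, Real.norm_eq_abs, abs_of_pos ht]
    exact mul_le_mul_of_nonneg_right h4 (norm_nonneg _)
  · intro hU0 hb
    have hf := locConstOff_regionInd hKcl z
    obtain ⟨z', hz', hgen⟩ := exists_generic hℓ hKcl hzD
    have hz'D := connectedComponentIn_subset _ _ hz'
    have hit : ∃ t : ℝ, 0 < t ∧ z' + t • ℓ ∈ N.curveSet (dartRel Q) := by
      by_contra hc
      push Not at hc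
      exact not_isBounded_of_ray hℓ hz' hc hb
    have hve : N.curveSet (dartRel Q) ∪ verticals ℓ ∅ = N.curveSet (dartRel Q) := by
      have : verticals ℓ ∅ = ∅ := by ext; simp [verticals]
      rw [this, Set.union_empty]
    have htouch := hW.touches_of_hit hℓ hO (X := ∅) Set.finite_empty (z₀ := z)
      (by rw [hve]; exact hz') (Or.inl rfl) hgen hit
    rw [hve] at htouch
    set T : Set ℝ := {t | 0 ≤ t ∧ z' + t • ℓ ∈ N.curveSet (dartRel Q)} with hT
    have hTcl : IsClosed T := by
      apply IsClosed.inter isClosed_Ici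
      exact hKcl.preimage (by fun_prop : Continuous fun t : ℝ => z' + t • ℓ)
    have hbdd : BddAbove T := by
      refine ⟨M / ℓ.2, fun t ht => ?_⟩
      have h3 := hM2 _ ht.2
      have h4 : 0 < z'.2 := hz'D.1
      simp only [Prod.snd_add, Prod.smul_snd, smul_eq_mul] at h3
      rw [le_div_iff₀ h2]; linarith
    obtain ⟨t, ht, hitt⟩ := hit
    have hmem : sSup T ∈ T := hTcl.csSup_mem ⟨t, ht.le, hitt⟩ hbdd
    set t₁ := sSup T with ht₁
    set q := z' + t₁ • ℓ with hq
    have habove : ∀ t : ℝ, 0 < t → q + t • ℓ ∉ N.curveSet (dartRel Q) := by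
      intro t ht hK
      have hmem' : t₁ + t ∈ T := by
        refine ⟨by linarith [hmem.1], ?_⟩
        rw [add_smul, ← add_assoc]; exact hK
      linarith [le_csSup hbdd hmem']
    have hU1 : ∀ t : ℝ, 0 < t → N.upCount ℓ Q (q + t • ℓ) = 0 := by
      intro t ht
      by_contra hne
      obtain ⟨s, hs, hK⟩ := exists_above_of_upCount_ne_zero (ℓ := ℓ) hne
      rw [← curveSet_dartRel, add_assoc, ← add_smul] at hK
      exact habove _ (by linarith) hK
    obtain ⟨u', v', h', hq', hκ⟩ := hW.exists_hit hℓ hO (Or.inl rfl) hgen hmem.2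
    have hgq : ∀ v, planeCross q ℓ ≠ planeCross (N.pos v) ℓ := by
      intro v; rw [hq, planeCross_add_smul_up]; exact hgen v
    have flip := upCount_flip hℓ hnd h' hq' hgq
    have final : ∀ e : ℝ × ℝ, planeCross e ℓ ≠ 0 → LeftAt (N.upCount ℓ Q) e q 0 →
        LeftAt (regionInd (N.curveSet (dartRel Q)) z) e q 1 → False := by
      intro e he h3 h4
      rcases lt_or_gt_of_ne he with hk | hk
      · have h5 := h3.eventually (w := -ℓ) (by rw [planeCross_neg_right]; linarith)
        obtain ⟨t, a1, a2, a3⟩ := ((eventually_mem_nhdsWithin (a := (0 : ℝ)) (s := Set.Ioi 0)).and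
          (flip.and h5)).exists
        rw [smul_neg, ← sub_eq_add_neg] at a3
        rw [a3, hU1 t a1] at a2
        exact zero_ne_one a2
      · obtain ⟨t, a1, a2⟩ := ((eventually_mem_nhdsWithin (a := (0 : ℝ)) (s := Set.Ioi 0)).and
          (h4.eventually hk)).exists
        rw [regionInd_eq_one] at a2
        refine not_isBounded_of_ray hℓ a2 (fun s hs => ?_) hb
        rw [add_assoc, ← add_smul]
        exact habove _ (add_pos a1 hs)
    have common : ∀ e q' : ℝ × ℝ, e ≠ 0 → ∀ y, LeftAt (N.upCount ℓ Q) e q' y →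
        LeftAt (regionInd (N.curveSet (dartRel Q)) z) e q' 1 → y = 0 := by
      intro e q' he y h3 h4
      obtain ⟨t, a1, a2⟩ := ((h3.eventually (planeCross_rotLeft_pos he)).and
        (h4.eventually (planeCross_rotLeft_pos he))).exists
      rw [regionInd_eq_one] at a2
      rw [← a1, hUc _ a2, hU0]
    obtain ⟨u, v, huv, q₀, hq₀, h3 | h3⟩ := htouch
    · obtain ⟨⟨y, hy⟩, -⟩ := hW.exists_leftAt hO hU huv
      obtain ⟨⟨x, hx⟩, -⟩ := hW.exists_leftAt hO hf huv
      have hne := sub_ne_zero.2 (hW.pos_ne hO huv).symm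
      rw [common _ q₀ hne y (hy q₀ hq₀) h3] at hy
      rw [(hx q₀ hq₀).unique hne h3] at hx
      exact final _ hκ (hW.leftVal_of_leftVal hℓ hO hU huv h' hy q hq')
        (hW.leftVal_of_leftVal hℓ hO hf huv h' hx q hq')
    · obtain ⟨-, y, hy⟩ := hW.exists_leftAt hO hU huv
      obtain ⟨-, x, hx⟩ := hW.exists_leftAt hO hf huv
      have hne := sub_ne_zero.2 (hW.pos_ne hO huv)
      have hq₀' := (openSegment_symm ℝ _ _).subset hq₀
      have hqs := (openSegment_symm ℝ _ _).subset hq'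
      rw [common _ q₀ hne y (hy q₀ hq₀') h3] at hy
      rw [(hx q₀ hq₀').unique hne h3] at hx
      refine final (N.pos u' - N.pos v') ?_ (hW.rightVal_of_rightVal hℓ hO hU huv h' hy q hqs)
        (hW.rightVal_of_rightVal hℓ hO hf huv h' hx q hqs)
      rw [← neg_sub, planeCross_neg_left]
      exact neg_ne_zero.2 hκ

end PBDTPNetwork

theorem planeCross_pluecker (e f g ℓ : ℝ × ℝ) :
    planeCross e ℓ * planeCross f g - planeCross f ℓ * planeCross e g +
      planeCross g ℓ * planeCross e f = 0 := by
  unfold planeCross; ring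

/-- `1` if `g` points to the left of a curve arriving in direction `e` and leaving in direction `f`,
and `-1` otherwise. -/
noncomputable def coneSign (e f g : ℝ × ℝ) : ℝ :=
  open Classical in if LeftCone e f g then 1 else -1

theorem turnSign_neg_neg_mul {ℓ e f : ℝ × ℝ} (he : planeCross e ℓ ≠ 0) (hf : planeCross f ℓ ≠ 0)
    (hef : planeCross e ℓ * planeCross f ℓ < 0 → planeCross e f ≠ 0) :
    sgn (planeCross f ℓ) = turnSign ℓ (-f) (-e) * turnSign ℓ e f * sgn (planeCross e ℓ) := by
  have hfe : planeCross f e = -planeCross e f := planeCross_swap _ _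
  unfold turnSign
  simp only [planeCross_neg_left, planeCross_neg_right, neg_neg, neg_mul_neg, hfe]
  generalize planeCross e f = c at *
  generalize planeCross e ℓ = a at *
  generalize planeCross f ℓ = b at *
  rcases lt_or_gt_of_ne he with h1 | h1 <;> rcases lt_or_gt_of_ne hf with h2 | h2
  · rw [if_neg (by rintro ⟨h, -⟩; nlinarith), if_neg (by rintro ⟨h, -⟩; nlinarith),
      sgn_of_neg h1, sgn_of_neg h2]; norm_num
  · rw [sgn_of_neg h1, sgn_of_nonneg h2.le]
    have hab : a * b < 0 := mul_neg_of_neg_of_pos h1 h2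
    rcases lt_or_gt_of_ne (hef hab) with h3 | h3
    · rw [if_neg (by rintro ⟨-, h⟩; nlinarith), if_pos ⟨hab, by nlinarith⟩]; norm_num
    · rw [if_pos ⟨by linarith, by nlinarith⟩, if_neg (by rintro ⟨-, h⟩; nlinarith)]; norm_num
  · rw [sgn_of_neg h2, sgn_of_nonneg h1.le]
    have hab : a * b < 0 := mul_neg_of_pos_of_neg h1 h2
    rcases lt_or_gt_of_ne (hef hab) with h3 | h3
    · rw [if_pos ⟨by linarith, by nlinarith⟩, if_neg (by rintro ⟨-, h⟩; nlinarith)]; norm_num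
    · rw [if_neg (by rintro ⟨-, h⟩; nlinarith), if_pos ⟨hab, by nlinarith⟩]; norm_num
  · rw [if_neg (by rintro ⟨h, -⟩; nlinarith), if_neg (by rintro ⟨h, -⟩; nlinarith),
      sgn_of_nonneg h1.le, sgn_of_nonneg h2.le]; norm_num

theorem coneSign_white {ℓ e f g : ℝ × ℝ} (he : planeCross e ℓ ≠ 0) (hf : planeCross f ℓ ≠ 0)
    (hg : planeCross g ℓ ≠ 0) (hef : planeCross e ℓ * planeCross f ℓ < 0 → planeCross e f ≠ 0)
    (heg : planeCross e ℓ * planeCross g ℓ < 0 → planeCross e g ≠ 0)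
    (hfg : 0 < planeCross f ℓ * planeCross g ℓ → planeCross f g ≠ 0) :
    coneSign e f g = -(sgn (planeCross e ℓ) * turnSign ℓ (-f) (-e) * turnSign ℓ e g *
      turnSign ℓ (-f) g) := by
  have hfe : planeCross f e = -planeCross e f := planeCross_swap _ _
  have hp := planeCross_pluecker e f g ℓ
  unfold turnSign coneSign LeftCone
  simp only [planeCross_neg_left, planeCross_neg_right, neg_neg, hfe, neg_mul, mul_neg,
    Left.neg_neg_iff]
  clear hfe
  generalize planeCross e f = x at *
  generalize planeCross e g = y at *
  generalize planeCross f g = z at *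
  generalize planeCross e ℓ = a at *
  generalize planeCross f ℓ = b at *
  generalize planeCross g ℓ = c at *
  have pos : ∀ s t : ℝ, 0 < s → ((0 < t ↔ 0 < s * t) ∧ (t < 0 ↔ s * t < 0)) := fun s t h =>
    ⟨(mul_pos_iff_of_pos_left h).symm, by rw [mul_neg_iff]; simp [h, h.not_gt]⟩
  have neg : ∀ s t : ℝ, s < 0 → ((0 < t ↔ s * t < 0) ∧ (t < 0 ↔ 0 < s * t)) := fun s t h =>
    ⟨by rw [mul_neg_iff]; simp [h, h.not_gt], by rw [mul_pos_iff]; simp [h, h.not_gt]⟩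
  have hx : (0 < c ∧ (0 < x ↔ 0 < c * x) ∧ (x < 0 ↔ c * x < 0)) ∨
      (c < 0 ∧ (0 < x ↔ c * x < 0) ∧ (x < 0 ↔ 0 < c * x)) :=
    (lt_or_gt_of_ne hg).elim (fun h => Or.inr ⟨h, neg _ _ h⟩) fun h => Or.inl ⟨h, pos _ _ h⟩
  have hy : (0 < b ∧ (0 < y ↔ 0 < b * y) ∧ (y < 0 ↔ b * y < 0)) ∨
      (b < 0 ∧ (0 < y ↔ b * y < 0) ∧ (y < 0 ↔ 0 < b * y)) :=
    (lt_or_gt_of_ne hf).elim (fun h => Or.inr ⟨h, neg _ _ h⟩) fun h => Or.inl ⟨h, pos _ _ h⟩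
  have hz : (0 < a ∧ (0 < z ↔ 0 < a * z) ∧ (z < 0 ↔ a * z < 0)) ∨
      (a < 0 ∧ (0 < z ↔ a * z < 0) ∧ (z < 0 ↔ 0 < a * z)) :=
    (lt_or_gt_of_ne he).elim (fun h => Or.inr ⟨h, neg _ _ h⟩) fun h => Or.inl ⟨h, pos _ _ h⟩
  have hx0 := lt_trichotomy x 0
  have hy0 := lt_trichotomy y 0
  have hz0 := lt_trichotomy z 0
  generalize c * x = x' at *
  generalize b * y = y' at *
  generalize a * z = z' at *
  rcases hz with ⟨h1, a1, a2⟩ | ⟨h1, a1, a2⟩ <;> rcases hy with ⟨h2, b1, b2⟩ | ⟨h2, b1, b2⟩ <;>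
    rcases hx with ⟨h3, c1, c2⟩ | ⟨h3, c1, c2⟩
  all_goals
    simp only [mul_pos_iff, mul_neg_iff, h1, h2, h3, h1.not_gt, h2.not_gt, h3.not_gt, true_and,
      false_and, and_true, and_false, or_false, false_or, or_self, and_self, sgn, if_true, if_false,
      forall_true_left, false_imp_iff, ne_eq] at *
    clear h1 h2 h3 pos neg he hf hg
    grind

theorem coneSign_black {ℓ e f h : ℝ × ℝ} (he : planeCross e ℓ ≠ 0) (hf : planeCross f ℓ ≠ 0)
    (hh : planeCross h ℓ ≠ 0) (hef : planeCross e ℓ * planeCross f ℓ < 0 → planeCross e f ≠ 0)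
    (heh : 0 < planeCross e ℓ * planeCross h ℓ → planeCross e h ≠ 0)
    (hfh : planeCross f ℓ * planeCross h ℓ < 0 → planeCross f h ≠ 0) :
    coneSign e f (-h) = sgn (planeCross e ℓ) * turnSign ℓ h f * turnSign ℓ h (-e) *
      turnSign ℓ e f := by
  have hh' : planeCross (-h) ℓ ≠ 0 := by rw [planeCross_neg_left]; exact neg_ne_zero.2 hh
  have hf' : planeCross (-f) ℓ ≠ 0 := by rw [planeCross_neg_left]; exact neg_ne_zero.2 hf
  have heh' : planeCross e ℓ * planeCross (-h) ℓ < 0 → planeCross e (-h) ≠ 0 := by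
    rw [planeCross_neg_left, planeCross_neg_right, mul_neg, Left.neg_neg_iff]
    exact fun h => neg_ne_zero.2 (heh h)
  have h1 := turnSign_neg_neg_mul he hf hef
  have h2 := turnSign_neg_neg_mul he hh' heh'
  have h3 := turnSign_neg_neg_mul (e := -f) (f := -h) (ℓ := ℓ) hf' hh' (by
    rw [planeCross_neg_left, planeCross_neg_left, planeCross_neg_left, planeCross_neg_right,
      neg_mul_neg, neg_neg]
    exact hfh)
  rw [coneSign_white (ℓ := ℓ) he hf hh' hef heh' (by
    rw [planeCross_neg_left, planeCross_neg_right, mul_neg, Left.neg_pos_iff]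
    exact fun h => neg_ne_zero.2 (hfh h))]
  rw [planeCross_neg_left, sgn_neg hh] at h2 h3
  rw [planeCross_neg_left, sgn_neg hf] at h3
  simp only [neg_neg] at h1 h2 h3
  have i1 := turnSign_mul_self ℓ e f
  have i2 := turnSign_mul_self ℓ e (-h)
  have i3 := turnSign_mul_self ℓ (-f) (-h)
  have k1 := sgn_mul_self (planeCross e ℓ)
  have k2 := sgn_mul_self (planeCross f ℓ)
  have k3 := sgn_mul_self (planeCross h ℓ)
  generalize sgn (planeCross e ℓ) = a at *
  generalize sgn (planeCross f ℓ) = b at *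
  generalize sgn (planeCross h ℓ) = c at *
  generalize turnSign ℓ e f = x at *
  generalize turnSign ℓ e (-h) = y at *
  generalize turnSign ℓ (-f) (-h) = z at *
  have e1 : turnSign ℓ (-f) (-e) = a * b * x := by
    linear_combination (-(turnSign ℓ (-f) (-e))) * (a ^ 2 * i1 + k1) - a * x * h1
  have e2 : turnSign ℓ h (-e) = -(a * c * y) := by
    linear_combination (-(turnSign ℓ h (-e))) * (a ^ 2 * i2 + k1) - a * y * h2
  have e3 : turnSign ℓ h f = b * c * z := by
    linear_combination (-(turnSign ℓ h f)) * (b ^ 2 * i3 + k2) + b * z * h3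
  rw [e1, e2, e3]
  linear_combination (a ^ 2 * b * x * y * z) * k3

theorem leftCone_neg_of_not {ℓ e f g : ℝ × ℝ} (he : planeCross e ℓ ≠ 0) (hf : planeCross f ℓ ≠ 0)
    (hg : planeCross g ℓ ≠ 0) (hef : planeCross e ℓ * planeCross f ℓ < 0 → planeCross e f ≠ 0)
    (heg : planeCross e ℓ * planeCross g ℓ < 0 → planeCross e g ≠ 0)
    (hfg : 0 < planeCross f ℓ * planeCross g ℓ → planeCross f g ≠ 0)
    (h : ¬ LeftCone e f g) : LeftCone (-f) (-e) g := by
  have hfe : planeCross f e = -planeCross e f := planeCross_swap _ _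
  have hp := planeCross_pluecker e f g ℓ
  unfold LeftCone at *
  simp only [planeCross_neg_left, planeCross_neg_right, neg_neg, hfe, Left.neg_pos_iff] at *
  generalize planeCross e f = x at *
  generalize planeCross e g = y at *
  generalize planeCross f g = z at *
  generalize planeCross e ℓ = a at *
  generalize planeCross f ℓ = b at *
  generalize planeCross g ℓ = c at *
  have hef' : x = 0 → 0 < a * b := fun h0 => lt_of_le_of_ne
    (not_lt.1 fun h => hef h h0) (mul_ne_zero he hf).symm
  have heg' : y = 0 → 0 < a * c := fun h0 => lt_of_le_of_ne
    (not_lt.1 fun h => heg h h0) (mul_ne_zero he hg).symm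
  have hfg' : z = 0 → b * c < 0 := fun h0 => lt_of_le_of_ne
    (not_lt.1 fun h => hfg h h0) (mul_ne_zero hf hg)
  have hy0 : y = 0 → (0 < x → z < 0) ∧ (x < 0 → 0 < z) := by
    intro h0
    have h1 := heg' h0
    have h2 : a ^ 2 * z = -(a * c * x) := by rw [h0] at hp; linear_combination a * hp
    have h3 : 0 < a ^ 2 := by positivity
    constructor <;> intro h4 <;> by_contra! h5 <;> nlinarith
  have hz0 : z = 0 → (0 < x → y < 0) ∧ (x < 0 → 0 < y) := by
    intro h0
    have h1 := hfg' h0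
    have h2 : b ^ 2 * y = b * c * x := by rw [h0] at hp; linear_combination -b * hp
    have h3 : 0 < b ^ 2 := by positivity
    constructor <;> intro h4 <;> by_contra! h5 <;> nlinarith
  have hxyz : x = 0 → y = 0 → z = 0 → False := by
    intro h1 h2 h3
    have i1 := hef' h1
    have i2 := heg' h2
    have i3 := hfg' h3
    have := mul_pos i1 i2
    have h4 : a * b * (a * c) = a ^ 2 * (b * c) := by ring
    rw [h4] at this
    nlinarith [sq_nonneg a]
  have hx := lt_trichotomy x 0
  have hy := lt_trichotomy y 0
  have hz := lt_trichotomy z 0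
  clear hef' heg' hfg' hef heg hfg hp hfe he hf hg
  rcases hx with h1 | h1 | h1
  · rw [if_neg h1.not_gt] at h
    rw [if_pos h1]
    push Not at h
    constructor
    · rcases hz with h2 | h2 | h2
      · exact h2
      · exact absurd ((hz0 h2).2 h1) (not_lt.2 h.1)
      · exact absurd h2 (not_lt.2 h.2)
    · rcases hy with h2 | h2 | h2
      · exact h2
      · exact absurd ((hy0 h2).2 h1) (not_lt.2 h.2)
      · exact absurd h2 (not_lt.2 h.1)
  · rw [if_neg (by rw [h1]; exact lt_irrefl _)] at h ⊢
    push Not at h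
    by_contra! hc
    exact hxyz h1 (le_antisymm h.1 hc.2) (le_antisymm h.2 hc.1)
  · rw [if_pos h1] at h
    rw [if_neg h1.not_gt]
    rcases hy with h2 | h2 | h2
    · exact Or.inr h2
    · exact Or.inl ((hy0 h2).1 h1)
    · rcases hz with h3 | h3 | h3
      · exact Or.inl h3
      · exact Or.inr ((hz0 h3).1 h1)
      · exact absurd ⟨h2, h3⟩ h

/-- The sign belonging to an element of `ZMod 2`. -/
noncomputable def zsign (x : ZMod 2) : ℝ := if x = 0 then 1 else -1

theorem zsign_zero : zsign 0 = 1 := if_pos rfl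

theorem zsign_one : zsign 1 = -1 := if_neg one_ne_zero

theorem zsign_add (x y : ZMod 2) : zsign (x + y) = zsign x * zsign y := by
  rcases zmod_two_eq_zero_or x with rfl | rfl <;> rcases zmod_two_eq_zero_or y with rfl | rfl
  · rw [add_zero, zsign_zero, mul_one]
  · rw [zero_add, zsign_zero, one_mul]
  · rw [add_zero, zsign_zero, mul_one]
  · rw [add_self_zmod_two, zsign_zero, zsign_one]; norm_num

theorem zsign_mul_self (x : ZMod 2) : zsign x * zsign x = 1 := by
  rw [← zsign_add, add_self_zmod_two, zsign_zero]

theorem zsign_parity_le (a b : ℝ) : zsign (parity (a ≤ b)) = -sgn (b - a) := by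
  by_cases h : a ≤ b
  · rw [parity_true h, zsign_one, sgn_of_nonneg (by linarith)]
  · rw [parity_false h, zsign_zero, sgn_of_neg (by linarith)]; norm_num

namespace PBDTPNetwork

variable {V : Type*} {n : ℕ} {N : PBDTPNetwork V n} {ℓ : ℝ × ℝ} {O W : V → V → Prop}
  {Plus : ℝ × ℝ → Prop}

/-- The sign of an edge off the curve. -/
noncomputable def offSign (N : PBDTPNetwork V n) (Plus : ℝ × ℝ → Prop) (u v : V) : ℝ :=
  (-1 : ℝ) ^ N.indexOff Plus u v

open Classical in
/-- The sign of the region to the left of an edge of the curve near its end point. -/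
noncomputable def onSign (N : PBDTPNetwork V n) (Plus : ℝ × ℝ → Prop) (u v : V) : ℝ :=
  (-1 : ℝ) ^ (if ∀ᶠ a in 𝓝[>] (0 : ℝ), ∀ᶠ t in 𝓝[>] (0 : ℝ),
      Plus (N.pos v - a • N.edgeDir u v + t • rotLeft (N.edgeDir u v)) then (0 : ℤ) else 1)

theorem offSign_eq {u v : V} {m : ZMod 2}
    (h : ∀ᶠ t in 𝓝[>] (0 : ℝ), (Plus (N.pos u + t • N.edgeDir u v) ↔ m = 0)) :
    N.offSign Plus u v = zsign m := by
  have : (∀ᶠ t in 𝓝[>] (0 : ℝ), Plus (N.pos u + t • N.edgeDir u v)) ↔ m = 0 := by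
    rw [Filter.eventually_congr h]
    exact Filter.eventually_const
  unfold offSign indexOff zsign
  simp only [this]
  split_ifs <;> norm_num

theorem onSign_eq {u v : V} {m : ZMod 2}
    (h : ∀ᶠ a in 𝓝[>] (0 : ℝ), ∀ᶠ t in 𝓝[>] (0 : ℝ),
      (Plus (N.pos v - a • N.edgeDir u v + t • rotLeft (N.edgeDir u v)) ↔ m = 0)) :
    N.onSign Plus u v = zsign m := by
  have : (∀ᶠ a in 𝓝[>] (0 : ℝ), ∀ᶠ t in 𝓝[>] (0 : ℝ),
      Plus (N.pos v - a • N.edgeDir u v + t • rotLeft (N.edgeDir u v))) ↔ m = 0 := by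
    rw [Filter.eventually_congr (h.mono fun a ha => (Filter.eventually_congr ha).trans
      Filter.eventually_const)]
    exact Filter.eventually_const
  unfold onSign zsign
  simp only [this]
  split_ifs <;> norm_num

theorem neg_one_zpow_half (hℓ : N.IsGaugeDirection ℓ) {u v : V} (h : N.graph.Adj u v) :
    (-1 : ℝ) ^ ((1 - orientSign (N.edgeDir u v) ℓ) / 2) = sgn (planeCross (N.edgeDir u v) ℓ) := by
  rcases lt_or_gt_of_ne (hℓ.not_parallel_of_adj h) with h' | h'
  · rw [orientSign_eq_neg_one.2 h', sgn_of_neg h']; norm_num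
  · rw [orientSign_eq_one.2 h', sgn_of_nonneg (le_of_lt h')]; norm_num

theorem neg_one_zpow_crossings (hℓ : N.IsGaugeDirection ℓ) (O : V → V → Prop) {u v : V}
    (h : N.graph.Adj u v) : (-1 : ℝ) ^ N.crossings ℓ O u v = N.crossSign ℓ O u v :=
  hℓ.neg_one_zpow_crossings O h

open Classical in
theorem changeFactor_eq (hℓ : N.IsGaugeDirection ℓ) {S : Set (Sym2 V)} {u v : V}
    (h : N.graph.Adj u v) : N.changeFactor ℓ O S Plus u v =
      if s(u, v) ∈ S then N.onSign Plus u v * sgn (planeCross (N.edgeDir u v) ℓ) *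
        N.crossSign ℓ O u v / N.weight u v
      else N.offSign Plus u v := by
  unfold changeFactor indexOn onSign offSign
  split_ifs <;> first
    | rfl
    | rw [zpow_add₀ (by norm_num), zpow_add₀ (by norm_num), neg_one_zpow_half hℓ h,
        neg_one_zpow_crossings hℓ O h]

/-- The boundary vertex `b_l` is an end of the curve. -/
def IsEnd (N : PBDTPNetwork V n) (W : V → V → Prop) (v : V) : Prop :=
  ∃ l, v = N.bdry l ∧ ((∃ x, W v x) ∨ ∃ u, W u v)

/-- The signs attached to the regions cut out by a curve `W`: `U` is the passing number of the
curve, and `B` takes the additional vertical lines into account. -/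
structure MarkedCurve (N : PBDTPNetwork V n) (ℓ : ℝ × ℝ) (O W : V → V → Prop)
    (Plus : ℝ × ℝ → Prop) (U B : ℝ × ℝ → ZMod 2) (c : ZMod 2) (X : V → V → ℝ) : Prop where
  curve : N.IsCurve O W
  locConst : LocConstOff (N.curveSet W) U
  left : ∀ u v, W u v → LeftVal U (N.pos u) (N.pos v) c
  right : ∀ u v, W u v → LeftVal U (N.pos v) (N.pos u) (c + 1)
  plus : ∀ z : ℝ × ℝ, 0 < z.2 → z ∉ N.curveSet W → (∀ l, planeCross z ℓ ≠ N.bx ℓ l) →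
    (Plus z ↔ U z = B z)
  locConst_B : ∀ v, ¬ N.IsEnd W v → ∀ᶠ z in 𝓝 (N.pos v), B z = B (N.pos v)
  axis : ∀ l, ¬ N.IsEnd W (N.bdry l) →
    ∀ᶠ z in 𝓝 (N.pos (N.bdry l)), U z = B (N.pos (N.bdry l))
  cross_off : ∀ u v, N.graph.Adj u v → ¬ N.IsEnd W u → ¬ N.IsEnd W v →
    X u v = zsign (B (N.pos u)) * zsign (B (N.pos v))
  cross_first : ∀ i v, W (N.bdry i) v →
    zsign c * zsign (B (N.pos v)) * sgn (planeCross (N.edgeDir (N.bdry i) v) ℓ) = -X (N.bdry i) v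
  cross_last : ∀ u j, W u (N.bdry j) → ∃ b,
    (∀ᶠ a in 𝓝[>] (0 : ℝ), ∀ᶠ z in 𝓝 (N.pos (N.bdry j) - a • N.edgeDir u (N.bdry j)), B z = b) ∧
    X u (N.bdry j) = zsign (B (N.pos u)) * zsign b ∧
    zsign c * zsign b * sgn (planeCross (N.edgeDir u (N.bdry j)) ℓ) = -1

theorem not_isEnd_of_isInternal {v : V} (h : N.IsInternal v) : ¬ N.IsEnd W v := by
  rintro ⟨l, rfl, -⟩; exact N.not_isInternal_bdry l h

theorem eventually_bx_ne (N : PBDTPNetwork V n) {z w : ℝ × ℝ} (hw : planeCross w ℓ ≠ 0) :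
    ∀ᶠ s in 𝓝[>] (0 : ℝ), ∀ l, planeCross (z + s • w) ℓ ≠ N.bx ℓ l := by
  rw [Filter.eventually_all]
  exact fun l => eventually_planeCross_ne hw _

theorem notMem_curveSet_of_mem_openSegment (hO : N.IsPerfect O) (hW : N.IsCurve O W) {u v : V}
    (h : N.graph.Adj u v) (h1 : ¬ W u v) (h2 : ¬ W v u) {z : ℝ × ℝ}
    (hz : z ∈ openSegment ℝ (N.pos u) (N.pos v)) : z ∉ N.curveSet W := by
  rintro ⟨x, y, hxy, hzx⟩
  have hs : s(u, v) ≠ s(x, y) := by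
    rw [Ne, Sym2.eq_iff]
    rintro (⟨rfl, rfl⟩ | ⟨rfl, rfl⟩)
    · exact h1 hxy
    · exact h2 hxy
  obtain ⟨w, hw, -, rfl⟩ := N.planar _ _ _ _ h (hW.adj hO hxy) hs z
    ⟨openSegment_subset_segment ℝ _ _ hz, hzx⟩
  have hne : N.pos u ≠ N.pos v := fun h' => h.ne (N.pos_injective h')
  rcases Sym2.mem_iff.1 hw with rfl | rfl
  · exact left_notMem_openSegment hne hz
  · exact right_notMem_openSegment hne hz

theorem bdry_isEnd_out (hO : N.IsPerfect O) (hW : N.IsCurve O W) {u v : V} (h : O u v)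
    (h' : ¬ W u v) : ¬ N.IsEnd W u := by
  rintro ⟨l, rfl, ⟨x, hx⟩ | ⟨x, hx⟩⟩
  · rw [N.eq_of_adj_bdry (hO.adj _ _ h) (hW.adj hO hx)] at h'
    exact h' hx
  · have := N.eq_of_adj_bdry (hO.adj _ _ h) (hW.adj hO hx).symm
    rw [this] at h
    exact hO.asymm _ _ h (hW.dir _ _ hx)

theorem bdry_isEnd_in (hO : N.IsPerfect O) (hW : N.IsCurve O W) {u v : V} (h : O u v)
    (h' : ¬ W u v) : ¬ N.IsEnd W v := by
  rintro ⟨l, rfl, ⟨x, hx⟩ | ⟨x, hx⟩⟩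
  · have := N.eq_of_adj_bdry (hO.adj _ _ h).symm (hW.adj hO hx)
    rw [this] at h
    exact hO.asymm _ _ h (hW.dir _ _ hx)
  · rw [N.eq_of_adj_bdry (hO.adj _ _ h).symm (hW.adj hO hx).symm] at h'
    exact h' hx

theorem coneSign_eq_one {e f g : ℝ × ℝ} (h : LeftCone e f g) : coneSign e f g = 1 := if_pos h

theorem coneSign_eq_neg_one {e f g : ℝ × ℝ} (h : ¬ LeftCone e f g) : coneSign e f g = -1 := if_neg h

/-- Edges at a vertex do not overlap. -/
theorem planeCross_ne_zero_out {v x y : V} (hx : N.graph.Adj v x) (hy : N.graph.Adj v y)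
    (hxy : x ≠ y)
    (h : 0 < planeCross (N.edgeDir v x) ℓ * planeCross (N.edgeDir v y) ℓ) :
    planeCross (N.edgeDir v x) (N.edgeDir v y) ≠ 0 := by
  have := N.planeCross_ne_zero_of_turn (ℓ := ℓ) hx.symm hy hxy (by
    rw [edgeDir_swap, planeCross_neg_left]; linarith)
  rw [edgeDir_swap, planeCross_neg_left] at this
  exact neg_ne_zero.1 this

namespace MarkedCurve

variable {U B : ℝ × ℝ → ZMod 2} {c : ZMod 2} {X : V → V → ℝ}

theorem exists_edge_value (hO : N.IsPerfect O) (hM : MarkedCurve N ℓ O W Plus U B c X) {u v : V}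
    (h : O u v) (h' : ¬ W u v) : ∃ y, ∀ z ∈ openSegment ℝ (N.pos u) (N.pos v), U z = y := by
  have hadj := hO.adj _ _ h
  have hvu : ¬ W v u := fun hw => hO.asymm _ _ h (hM.curve.dir _ _ hw)
  refine ⟨U (midpoint ℝ (N.pos u) (N.pos v)), fun z hz => ?_⟩
  exact hM.locConst.eq_of_isPreconnected (convex_openSegment _ _).isPreconnected
    (fun x hx => ⟨N.snd_pos_of_mem_openSegment hadj hx,
      notMem_curveSet_of_mem_openSegment hO hM.curve hadj h' hvu hx⟩) hz
    (midpoint_mem_openSegment _ _)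

theorem offSign_eq (hℓ : N.IsGaugeDirection ℓ) (hO : N.IsPerfect O)
    (hM : MarkedCurve N ℓ O W Plus U B c X) {u v : V} (h : O u v) (h' : ¬ W u v) {y : ZMod 2}
    (hy : ∀ z ∈ openSegment ℝ (N.pos u) (N.pos v), U z = y) :
    N.offSign Plus u v = zsign y * zsign (B (N.pos u)) := by
  rw [← zsign_add]
  apply PBDTPNetwork.offSign_eq
  have hadj := hO.adj _ _ h
  have hvu : ¬ W v u := fun hw => hO.asymm _ _ h (hM.curve.dir _ _ hw)
  filter_upwards [openSegment_eventually (c := N.pos u) (d := N.pos v),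
    N.eventually_bx_ne (z := N.pos u) (hℓ.not_parallel_of_adj hadj),
    (tendsto_add_smul (N.pos u) (N.edgeDir u v)).eventually
      (hM.locConst_B u (bdry_isEnd_out hO hM.curve h h'))] with t h1 h2 h3
  have h1' : N.pos u + t • N.edgeDir u v ∈ openSegment ℝ (N.pos u) (N.pos v) := h1
  rw [hM.plus _ (N.snd_pos_of_mem_openSegment hadj h1')
    (notMem_curveSet_of_mem_openSegment hO hM.curve hadj h' hvu h1') h2, hy _ h1', h3]
  constructor
  · intro h4; rw [h4, add_self_zmod_two]
  · intro h4; linear_combination h4 - add_self_zmod_two (B (N.pos u))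

theorem onSign_eq [Finite V] (hℓ : N.IsGaugeDirection ℓ) (hO : N.IsPerfect O)
    (hM : MarkedCurve N ℓ O W Plus U B c X) {u v : V} (h : W u v) {b : ZMod 2}
    (hb : ∀ᶠ a in 𝓝[>] (0 : ℝ), ∀ᶠ z in 𝓝 (N.pos v - a • N.edgeDir u v), B z = b) :
    N.onSign Plus u v = zsign c * zsign b := by
  rw [← zsign_add]
  apply PBDTPNetwork.onSign_eq
  have hadj := hM.curve.adj hO h
  have hne := hM.curve.pos_ne hO h
  have hκ := hℓ.not_parallel_of_adj hadj
  have hgen : ∀ᶠ a in 𝓝[>] (0 : ℝ), ∀ l, planeCross (N.pos v - a • N.edgeDir u v) ℓ ≠ N.bx ℓ l := by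
    have := N.eventually_bx_ne (z := N.pos v) (w := -N.edgeDir u v)
      (by rw [planeCross_neg_left]; exact neg_ne_zero.2 hκ)
    simpa only [smul_neg, ← sub_eq_add_neg] using this
  filter_upwards [hb, openSegment_eventually' (c := N.pos u) (d := N.pos v), hgen] with a h1 h2 h3
  have h2' : N.pos v - a • N.edgeDir u v ∈ openSegment ℝ (N.pos u) (N.pos v) := h2
  set q := N.pos v - a • N.edgeDir u v with hq
  have hrot := planeCross_rotLeft_pos (sub_ne_zero.2 hne.symm)
  have hgen' : ∀ᶠ z in 𝓝 q, ∀ l, planeCross z ℓ ≠ N.bx ℓ l := by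
    rw [Filter.eventually_all]
    exact fun l => (continuous_planeCross_left ℓ).continuousAt.eventually_ne (h3 l)
  filter_upwards [(tendsto_add_smul q (rotLeft (N.edgeDir u v))).eventually h1,
    (hM.left u v h q h2').eventually hrot,
    (tendsto_add_smul q (rotLeft (N.edgeDir u v))).eventually hgen',
    (tendsto_add_smul q (rotLeft (N.edgeDir u v))).eventually
      (hM.curve.eventually_openSegment hO h h2'),
    (tendsto_add_smul q (rotLeft (N.edgeDir u v))).eventually
      (continuous_snd.continuousAt.eventually
        (lt_mem_nhds (N.snd_pos_of_mem_openSegment hadj h2'))),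
    eventually_planeCross_add_smul q hrot] with t i1 i2 i3 i4 i5 i6
  have hK : q + t • rotLeft (N.edgeDir u v) ∉ N.curveSet W := by
    intro hK
    have j1 := planeCross_of_mem_segment (i4 hK)
    have j2 := planeCross_of_mem_segment (openSegment_subset_segment ℝ _ _ h2')
    unfold edgeDir at *
    rw [planeCross_sub_right] at j1 j2 i6
    linarith
  rw [hM.plus _ i5 hK i3, i1]
  have i2' : U (q + t • rotLeft (N.edgeDir u v)) = c := i2
  rw [i2']
  constructor
  · intro h4; rw [h4, add_self_zmod_two]
  · intro h4; linear_combination h4 - add_self_zmod_two b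

theorem onSign_eq_of_isInternal [Finite V] (hℓ : N.IsGaugeDirection ℓ) (hO : N.IsPerfect O)
    (hM : MarkedCurve N ℓ O W Plus U B c X) {u v : V} (h : W u v) (hv : N.IsInternal v) :
    N.onSign Plus u v = zsign c * zsign (B (N.pos v)) :=
  hM.onSign_eq hℓ hO h ((tendsto_sub_smul _ _).eventually
    (eventually_eventually_nhds.2 (hM.locConst_B v (not_isEnd_of_isInternal hv))))

theorem off_vertex [Finite V] (hℓ : N.IsGaugeDirection ℓ) (hO : N.IsPerfect O)
    (hM : MarkedCurve N ℓ O W Plus U B c X) {a v x : V} (h : O a v) (h' : O v x)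
    (hin : ∀ u, ¬ W u v) (hout : ∀ x, ¬ W v x) :
    N.offSign Plus a v = X a v * N.offSign Plus v x := by
  have hv := hO.isInternal_of_in_out h h'
  obtain ⟨y, hy⟩ := hM.exists_edge_value hO h (hin a)
  obtain ⟨y', hy'⟩ := hM.exists_edge_value hO h' (hout x)
  have hK : N.pos v ∉ N.curveSet W := by
    rintro ⟨u, w, huw, hz⟩
    rcases N.eq_or_eq_of_pos_mem_segment (hM.curve.adj hO huw) hz with rfl | rfl
    · exact hout _ huw
    · exact hin _ huw
  have hU := hM.locConst _ (N.internal_inside v hv) hK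
  obtain ⟨t, h1, h2⟩ := ((openSegment_eventually' (c := N.pos a) (d := N.pos v)).and
    ((tendsto_sub_smul _ _).eventually hU)).exists
  obtain ⟨t', h1', h2'⟩ := ((openSegment_eventually (c := N.pos v) (d := N.pos x)).and
    ((tendsto_add_smul _ _).eventually hU)).exists
  rw [hM.offSign_eq hℓ hO h (hin a) hy, hM.offSign_eq hℓ hO h' (hout x) hy', ← hy _ h1, h2,
    ← hy' _ h1', h2', hM.cross_off a v (hO.adj _ _ h) (bdry_isEnd_out hO hM.curve h (hin a))
      (bdry_isEnd_in hO hM.curve h (hin a))]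
  linear_combination (-(zsign (U (N.pos v)) * zsign (B (N.pos a)))) *
    zsign_mul_self (B (N.pos v))

theorem on_vertex [Finite V] (hℓ : N.IsGaugeDirection ℓ) (hO : N.IsPerfect O)
    (hM : MarkedCurve N ℓ O W Plus U B c X) {p v s : V} (h : W p v) (h' : W v s) :
    N.onSign Plus v s = X v s * N.onSign Plus p v := by
  have hv := hM.curve.isInternal hO h h'
  rw [hM.onSign_eq_of_isInternal hℓ hO h hv]
  rcases N.isInternal_or s with hs | ⟨j, rfl⟩
  · rw [hM.onSign_eq_of_isInternal hℓ hO h' hs, hM.cross_off v s (hM.curve.adj hO h')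
      (not_isEnd_of_isInternal hv) (not_isEnd_of_isInternal hs)]
    linear_combination (-(zsign c * zsign (B (N.pos s)))) * zsign_mul_self (B (N.pos v))
  · obtain ⟨b, hb, hX, -⟩ := hM.cross_last v j h'
    rw [hM.onSign_eq hℓ hO h' hb, hX]
    linear_combination (-(zsign c * zsign b)) * zsign_mul_self (B (N.pos v))

theorem edge_value_near [Finite V] (hℓ : N.IsGaugeDirection ℓ) (hO : N.IsPerfect O)
    (hM : MarkedCurve N ℓ O W Plus U B c X) {p v s x : V} (h : W p v) (h' : W v s)
    (hx : N.graph.Adj v x) (hxs : x ≠ s) (hxp : x ≠ p) {y : ZMod 2}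
    (hy : ∀ z ∈ openSegment ℝ (N.pos v) (N.pos x), U z = y) :
    zsign y = zsign c * coneSign (N.edgeDir p v) (N.edgeDir v s) (N.edgeDir v x) := by
  have hpv := hM.curve.adj hO h
  have hvs := hM.curve.adj hO h'
  have near : ∀ᶠ t in 𝓝[>] (0 : ℝ), N.pos v + t • N.edgeDir v x ∈ openSegment ℝ (N.pos v) (N.pos x) :=
    openSegment_eventually
  have cone : ∀ e f : ℝ × ℝ, LeftCone e f (N.edgeDir v x) → ∀ t : ℝ, 0 < t →
      LeftCone e f (N.pos v + t • N.edgeDir v x - N.pos v) := by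
    intro e f hc t ht
    unfold LeftCone at *
    simp only [add_sub_cancel_left, planeCross_smul_right, mul_pos_iff_of_pos_left ht]
    exact hc
  by_cases hc : LeftCone (N.edgeDir p v) (N.edgeDir v s) (N.edgeDir v x)
  · obtain ⟨t, h1, h2, h3⟩ := (near.and ((eventually_mem_nhdsWithin (a := (0 : ℝ))
      (s := Set.Ioi 0)).and ((tendsto_add_smul (N.pos v) (N.edgeDir v x)).eventually
      (hM.curve.eventually_leftCone hℓ hO hM.locConst h h' (hM.left p v h))))).exists
    rw [coneSign_eq_one hc, ← hy _ h1, h3 (cone _ _ hc t h2), mul_one]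
  · have hc' : LeftCone (N.edgeDir s v) (N.edgeDir v p) (N.edgeDir v x) := by
      have := leftCone_neg_of_not (ℓ := ℓ) (hℓ.not_parallel_of_adj hpv)
        (hℓ.not_parallel_of_adj hvs) (hℓ.not_parallel_of_adj hx)
        (N.planeCross_ne_zero_of_turn hpv hvs (hM.curve.ne hO h h'))
        (N.planeCross_ne_zero_of_turn hpv hx hxp.symm)
        (planeCross_ne_zero_out hvs hx hxs.symm) hc
      rwa [← edgeDir_swap, ← edgeDir_swap] at this
    obtain ⟨t, h1, h2, h3⟩ := (near.and ((eventually_mem_nhdsWithin (a := (0 : ℝ))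
      (s := Set.Ioi 0)).and ((tendsto_add_smul (N.pos v) (N.edgeDir v x)).eventually
      (hM.curve.eventually_rightCone hℓ hO hM.locConst h h' (hM.right p v h))))).exists
    rw [coneSign_eq_neg_one hc, ← hy _ h1, h3 (cone _ _ hc' t h2), zsign_add, zsign_one]

theorem off_out [Finite V] (hℓ : N.IsGaugeDirection ℓ) (hO : N.IsPerfect O)
    (hM : MarkedCurve N ℓ O W Plus U B c X) {p v s x : V} (h : W p v) (h' : W v s) (hx : O v x)
    (hxs : x ≠ s) : N.offSign Plus v x = N.onSign Plus p v *
      coneSign (N.edgeDir p v) (N.edgeDir v s) (N.edgeDir v x) := by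
  have hxp : x ≠ p := by rintro rfl; exact hO.asymm _ _ hx (hM.curve.dir _ _ h)
  have hnW : ¬ W v x := fun hw => hxs (hM.curve.out_unique _ _ _ hw h')
  obtain ⟨y, hy⟩ := hM.exists_edge_value hO hx hnW
  rw [hM.offSign_eq hℓ hO hx hnW hy, hM.edge_value_near hℓ hO h h' (hO.adj _ _ hx) hxs hxp hy,
    hM.onSign_eq_of_isInternal hℓ hO h (hM.curve.isInternal hO h h')]
  ring

theorem off_in [Finite V] (hℓ : N.IsGaugeDirection ℓ) (hO : N.IsPerfect O)
    (hM : MarkedCurve N ℓ O W Plus U B c X) {p v s y : V} (h : W p v) (h' : W v s) (hy : O y v)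
    (hyp : y ≠ p) : N.offSign Plus y v = X y v * N.onSign Plus p v *
      coneSign (N.edgeDir p v) (N.edgeDir v s) (-N.edgeDir y v) := by
  have hys : y ≠ s := by rintro rfl; exact hO.asymm _ _ hy (hM.curve.dir _ _ h')
  have hnW : ¬ W y v := fun hw => hyp (hM.curve.in_unique _ _ _ hw h)
  obtain ⟨u, hu⟩ := hM.exists_edge_value hO hy hnW
  rw [hM.offSign_eq hℓ hO hy hnW hu, hM.edge_value_near hℓ hO h h' (hO.adj _ _ hy).symm hys hyp
      (fun z hz => hu z ((openSegment_symm ℝ _ _).subset hz)),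
    hM.onSign_eq_of_isInternal hℓ hO h (hM.curve.isInternal hO h h'),
    hM.cross_off y v (hO.adj _ _ hy) (bdry_isEnd_out hO hM.curve hy hnW)
      (bdry_isEnd_in hO hM.curve hy hnW), ← edgeDir_swap]
  linear_combination (-(zsign c * zsign (B (N.pos y)) *
    coneSign (N.edgeDir p v) (N.edgeDir v s) (N.edgeDir v y))) * zsign_mul_self (B (N.pos v))

theorem off_sink (hℓ : N.IsGaugeDirection ℓ) (hO : N.IsPerfect O)
    (hM : MarkedCurve N ℓ O W Plus U B c X) {u : V} {j : Fin n} (h : O u (N.bdry j))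
    (h' : ¬ W u (N.bdry j)) : N.offSign Plus u (N.bdry j) = X u (N.bdry j) := by
  obtain ⟨y, hy⟩ := hM.exists_edge_value hO h h'
  have hend := bdry_isEnd_in hO hM.curve h h'
  obtain ⟨t, h1, h2⟩ := ((openSegment_eventually' (c := N.pos u) (d := N.pos (N.bdry j))).and
    ((tendsto_sub_smul _ _).eventually (hM.axis j hend))).exists
  rw [hM.offSign_eq hℓ hO h h' hy, ← hy _ h1, h2, hM.cross_off u _ (hO.adj _ _ h)
    (bdry_isEnd_out hO hM.curve h h') hend, mul_comm]

theorem off_source (hℓ : N.IsGaugeDirection ℓ) (hO : N.IsPerfect O)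
    (hM : MarkedCurve N ℓ O W Plus U B c X) {v : V} {i : Fin n} (h : O (N.bdry i) v)
    (h' : ¬ W (N.bdry i) v) : N.offSign Plus (N.bdry i) v = 1 := by
  obtain ⟨y, hy⟩ := hM.exists_edge_value hO h h'
  have hend := bdry_isEnd_out hO hM.curve h h'
  obtain ⟨t, h1, h2⟩ := ((openSegment_eventually (c := N.pos (N.bdry i)) (d := N.pos v)).and
    ((tendsto_add_smul _ _).eventually (hM.axis i hend))).exists
  rw [hM.offSign_eq hℓ hO h h' hy, ← hy _ h1, h2, zsign_mul_self]

theorem on_first [Finite V] (hℓ : N.IsGaugeDirection ℓ) (hO : N.IsPerfect O)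
    (hM : MarkedCurve N ℓ O W Plus U B c X) {i : Fin n} {v : V} (h : W (N.bdry i) v) :
    N.onSign Plus (N.bdry i) v * sgn (planeCross (N.edgeDir (N.bdry i) v) ℓ) =
      -X (N.bdry i) v := by
  rw [hM.onSign_eq_of_isInternal hℓ hO h (N.isInternal_of_adj_bdry (hM.curve.adj hO h)),
    hM.cross_first i v h]

theorem on_last [Finite V] (hℓ : N.IsGaugeDirection ℓ) (hO : N.IsPerfect O)
    (hM : MarkedCurve N ℓ O W Plus U B c X) {u : V} {j : Fin n} (h : W u (N.bdry j)) :
    N.onSign Plus u (N.bdry j) * sgn (planeCross (N.edgeDir u (N.bdry j)) ℓ) = -1 := by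
  obtain ⟨b, hb, -, h1⟩ := hM.cross_last u j h
  rw [hM.onSign_eq hℓ hO h hb, h1]

end MarkedCurve

end PBDTPNetwork

namespace PBDTPNetwork

variable {V : Type*} {n : ℕ} {N : PBDTPNetwork V n} {ℓ : ℝ × ℝ} {O W : V → V → Prop}

section Cycle

variable {v₀ : V} {Q : N.graph.Walk v₀ v₀}

theorem not_isEnd_cycle (hO : N.IsPerfect O) (hQ : Q.IsCycle) (hQO : ∀ d ∈ Q.darts, O d.fst d.snd)
    (v : V) : ¬ N.IsEnd (dartRel Q) v := by
  have hW := isCurve_cycle hQ hQO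
  have hperm := Q.tail_support_perm_dropLast_support
  rintro ⟨l, rfl, h⟩
  have h1 : N.bdry l ∈ Q.support.tail := by
    rcases h with h | h
    · exact hperm.mem_iff.2 ((dartRel_out_iff Q _).1 h)
    · exact (dartRel_in_iff Q _).1 h
  obtain ⟨u, hu⟩ := (dartRel_in_iff Q _).2 h1
  obtain ⟨x, hx⟩ := (dartRel_out_iff Q _).2 (hperm.mem_iff.1 h1)
  exact N.not_isInternal_bdry l (hW.isInternal hO hu hx)

theorem exists_markedCurve_cycle [Finite V] (hℓ : N.IsGaugeDirection ℓ) (hO : N.IsPerfect O)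
    (hQ : Q.IsCycle) (hQO : ∀ d ∈ Q.darts, O d.fst d.snd) :
    ∃ c, MarkedCurve N ℓ O (dartRel Q) (N.CyclePlus Q) (N.upCount ℓ Q) (fun _ => 0) c
      (fun _ _ => 1) := by
  have hW := isCurve_cycle hQ hQO
  have hend := not_isEnd_cycle hO hQ hQO
  obtain ⟨c, hc⟩ := exists_leftVal_upCount_cycle hℓ hO hW hQ.edges_nodup
  refine ⟨c, hW, locConstOff_upCount_cycle hℓ, fun u v h => (hc u v h).1, fun u v h => (hc u v h).2,
    fun z hz hzQ _ => ?_, fun _ _ => Filter.Eventually.of_forall fun _ => rfl, fun l _ => ?_,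
    fun _ _ _ _ _ => ?_, fun i v h => ?_, fun u j h => ?_⟩
  · rw [curveSet_dartRel] at hzQ
    exact cyclePlus_iff hℓ hO hW hQ.edges_nodup hz hzQ
  · have hzQ : N.pos (N.bdry l) ∉ N.walkSet Q := by
      rw [← curveSet_dartRel]
      rintro ⟨u, w, huw, hz⟩
      rcases N.eq_or_eq_of_pos_mem_segment (hW.adj hO huw) hz with h | h
      · exact hend _ ⟨l, rfl, Or.inl ⟨w, h ▸ huw⟩⟩
      · exact hend _ ⟨l, rfl, Or.inr ⟨u, h ▸ huw⟩⟩
    filter_upwards [eventually_upCount hℓ Q hzQ] with z hz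
    rw [hz, upCount_axis Q hℓ.inside (N.bdry_on_axis l) hzQ, add_self_zmod_two, add_self_zmod_two,
      add_zero]
  · rw [zsign_zero, mul_one]
  · exact absurd ⟨i, rfl, Or.inl ⟨v, h⟩⟩ (hend _)
  · exact absurd ⟨j, rfl, Or.inr ⟨u, h⟩⟩ (hend _)

end Cycle

section Path

variable {i₀ j₀ : Fin n} {P : N.graph.Walk (N.bdry i₀) (N.bdry j₀)}

theorem exists_last (h : i₀ ≠ j₀) : ∃ u, dartRel P u (N.bdry j₀) := by
  rw [dartRel_in_iff]
  have := P.end_mem_support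
  rw [← P.cons_tail_support, List.mem_cons] at this
  exact this.resolve_left fun h' => h (N.bdry_injective h').symm

theorem eq_of_dartRel_bdry_left (hO : N.IsPerfect O) (hPO : ∀ d ∈ P.darts, O d.fst d.snd)
    {l : Fin n} {x : V} (h : dartRel P (N.bdry l) x) : l = i₀ := by
  have hm := List.mem_of_mem_dropLast ((dartRel_out_iff P _).1 ⟨x, h⟩)
  rw [← P.cons_tail_support, List.mem_cons] at hm
  rcases hm with h' | h'
  · exact N.bdry_injective h'
  · obtain ⟨u, d, hd, rfl, hd'⟩ := (dartRel_in_iff P _).2 h'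
    obtain ⟨e, he, he', rfl⟩ := h
    have h1 := hPO d hd
    have h2 := hPO e he
    rw [hd'] at h1
    rw [he'] at h2
    exact absurd (hO.isInternal_of_in_out h1 h2) (N.not_isInternal_bdry l)

theorem eq_of_dartRel_bdry_right (hO : N.IsPerfect O) (hPO : ∀ d ∈ P.darts, O d.fst d.snd)
    {l : Fin n} {u : V} (h : dartRel P u (N.bdry l)) : l = j₀ := by
  rcases mem_dropLast_or P (List.mem_of_mem_tail ((dartRel_in_iff P _).1 ⟨u, h⟩)) with h' | h'
  · obtain ⟨x, d, hd, hd', rfl⟩ := (dartRel_out_iff P _).2 h'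
    obtain ⟨e, he, rfl, he'⟩ := h
    have h1 := hPO d hd
    have h2 := hPO e he
    rw [hd'] at h1
    rw [he'] at h2
    exact absurd (hO.isInternal_of_in_out h2 h1) (N.not_isInternal_bdry l)
  · exact N.bdry_injective h'

/-- The change of the crossing signs that is caused by replacing the source `i` by `j`. -/
noncomputable def swapSign (N : PBDTPNetwork V n) (ℓ : ℝ × ℝ) (i j : Fin n) (u v : V) : ℝ :=
  sgn (N.side ℓ i u * N.side ℓ i v) * sgn (N.side ℓ j u * N.side ℓ j v)

theorem side_eq (l : Fin n) (v : V) : N.side ℓ l v = planeCross (N.pos v) ℓ - N.bx ℓ l :=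
  planeCross_sub_left _ _ _

theorem zsign_between (i j : Fin n) (v : V) :
    zsign (N.between ℓ i j (N.pos v)) = sgn (N.side ℓ i v) * sgn (N.side ℓ j v) := by
  unfold between
  rw [zsign_add, zsign_parity_le, zsign_parity_le, side_eq, side_eq, neg_mul_neg]

theorem zsign_leftCount (hℓ : N.IsGaugeDirection ℓ) {i j : Fin n} (h : i ≠ j) :
    zsign (N.leftCount ℓ i j) = -sgn (N.side ℓ j (N.bdry i)) := by
  have hne := hℓ.side_ne_zero (l := j) (v := N.bdry i) fun h' => h (N.bdry_injective h')
  rw [side_eq] at hne ⊢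
  have hb : N.bx ℓ j ≠ N.bx ℓ i := fun h' => hne (by unfold bx at h' ⊢; linarith)
  unfold leftCount
  rw [parity_congr (lt_iff_le_and_ne.trans (and_iff_left hb)), zsign_parity_le]
  rfl

theorem markedCurve_path [Finite V] (hℓ : N.IsGaugeDirection ℓ) (hO : N.IsPerfect O)
    (hne : i₀ ≠ j₀) (hP : P.IsPath) (hPO : ∀ d ∈ P.darts, O d.fst d.snd) :
    MarkedCurve N ℓ O (dartRel P) (N.PathPlus ℓ P) (N.upCount ℓ P) (N.between ℓ i₀ j₀)
      (N.leftCount ℓ i₀ j₀) (N.swapSign ℓ i₀ j₀) := by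
  have hW := isCurve_path hP hPO
  have end₁ : ∀ v, ¬ N.IsEnd (dartRel P) v → v ≠ N.bdry i₀ := by
    rintro v hv rfl
    exact hv ⟨i₀, rfl, Or.inl (exists_first hne)⟩
  have end₂ : ∀ v, ¬ N.IsEnd (dartRel P) v → v ≠ N.bdry j₀ := by
    rintro v hv rfl
    exact hv ⟨j₀, rfl, Or.inr (exists_last hne)⟩
  have loc : ∀ v, ¬ N.IsEnd (dartRel P) v → ∀ᶠ z in 𝓝 (N.pos v),
      N.between ℓ i₀ j₀ z = N.between ℓ i₀ j₀ (N.pos v) := by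
    intro v hv
    have h1 := hℓ.side_ne_zero (end₁ v hv)
    have h2 := hℓ.side_ne_zero (end₂ v hv)
    rw [side_eq, sub_ne_zero] at h1 h2
    exact eventually_between h1 h2
  have hc := zsign_leftCount hℓ hne
  refine ⟨hW, ?_, fun u v h => (leftVal_upCount hℓ hO hW hne h).1,
    fun u v h => (leftVal_upCount hℓ hO hW hne h).2, fun z hz hzP hzl => ?_, loc, fun l hl => ?_,
    fun u v _ hu hv => ?_, fun i v h => ?_, fun u j h => ?_⟩
  · rw [curveSet_dartRel]
    exact locConstOff_upCount hℓ P (Or.inr ⟨N.bdry_on_axis _, N.bdry_on_axis _⟩)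
  · rw [curveSet_dartRel] at hzP
    exact pathPlus_iff hℓ hO hW hne hz hzP (hzl _) (hzl _)
  · have hzP : N.pos (N.bdry l) ∉ N.walkSet P := by
      rw [← curveSet_dartRel]
      rintro ⟨u, w, huw, hz⟩
      rcases N.eq_or_eq_of_pos_mem_segment (hW.adj hO huw) hz with h | h
      · exact hl ⟨l, rfl, Or.inl ⟨w, h ▸ huw⟩⟩
      · exact hl ⟨l, rfl, Or.inr ⟨u, h ▸ huw⟩⟩
    have h0 : ∀ (z : ℝ × ℝ) (i : Fin n),
        endChange ℓ (N.pos (N.bdry l)) z (N.pos (N.bdry i)) = 0 := by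
      intro z i
      refine parity_false ?_
      rintro ⟨-, h, -⟩
      rw [N.bdry_on_axis, N.bdry_on_axis] at h
      exact lt_irrefl _ h
    filter_upwards [eventually_upCount hℓ P hzP] with z hz
    rw [hz, upCount_axis P hℓ.inside (N.bdry_on_axis l) hzP, h0, h0, add_zero, add_zero]
    rfl
  · rw [zsign_between, zsign_between]
    unfold swapSign
    rw [sgn_mul (hℓ.side_ne_zero (end₁ u hu)) (hℓ.side_ne_zero (end₁ v hv)),
      sgn_mul (hℓ.side_ne_zero (end₂ u hu)) (hℓ.side_ne_zero (end₂ v hv))]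
    ring
  · obtain rfl := eq_of_dartRel_bdry_left hO hPO h
    have hv := N.isInternal_of_adj_bdry (hW.adj hO h)
    have hvj : v ≠ N.bdry j₀ := by rintro rfl; exact N.not_isInternal_bdry _ hv
    rw [hc, zsign_between, ← N.side_sub_side (ℓ := ℓ) i, side_self, sub_zero]
    unfold swapSign
    rw [side_self, zero_mul, sgn_of_nonneg le_rfl, one_mul,
      sgn_mul (hℓ.side_ne_zero fun h' => hne (N.bdry_injective h')) (hℓ.side_ne_zero hvj)]
    linear_combination (-(sgn (N.side ℓ j₀ (N.bdry i)) * sgn (N.side ℓ j₀ v))) *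
      sgn_mul_self (N.side ℓ i v)
  · obtain rfl := eq_of_dartRel_bdry_right hO hPO h
    have hu := N.isInternal_of_adj_bdry (hW.adj hO h).symm
    have hui : u ≠ N.bdry i₀ := by rintro rfl; exact N.not_isInternal_bdry _ hu
    have huj : u ≠ N.bdry j := by rintro rfl; exact N.not_isInternal_bdry _ hu
    have su := hℓ.side_ne_zero huj
    have sb : N.side ℓ i₀ (N.bdry j) ≠ 0 := hℓ.side_ne_zero fun h' => hne (N.bdry_injective h').symm
    have hκ : planeCross (N.edgeDir u (N.bdry j)) ℓ = -N.side ℓ j u := by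
      rw [← N.side_sub_side j, side_self, zero_sub]
    have hx : ∀ a : ℝ, planeCross (N.pos (N.bdry j) - a • N.edgeDir u (N.bdry j)) ℓ =
        N.bx ℓ j + a * N.side ℓ j u := by
      intro a
      rw [planeCross_sub_left, planeCross_smul_left, hκ]
      unfold bx; ring
    have hz : zsign (parity (N.bx ℓ i₀ ≤ N.bx ℓ j) + parity (0 ≤ N.side ℓ j u)) =
        sgn (N.side ℓ i₀ (N.bdry j)) * sgn (N.side ℓ j u) := by
      rw [zsign_add, zsign_parity_le, zsign_parity_le, side_eq i₀, sub_zero, neg_mul_neg]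
      rfl
    refine ⟨parity (N.bx ℓ i₀ ≤ N.bx ℓ j) + parity (0 ≤ N.side ℓ j u), ?_, ?_, ?_⟩
    · have hij : planeCross (N.pos (N.bdry j)) ℓ ≠ N.bx ℓ i₀ := by
        rw [side_eq, sub_ne_zero] at sb; exact sb
      filter_upwards [(tendsto_sub_smul (N.pos (N.bdry j)) (N.edgeDir u (N.bdry j))).eventually
          (locConst_parity_le ℓ hij),
        (tendsto_sub_smul (N.pos (N.bdry j)) (N.edgeDir u (N.bdry j))).eventually
          ((continuous_planeCross_left ℓ).continuousAt.eventually_ne hij),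
        self_mem_nhdsWithin] with a h1 h2 h3
      have h3 : (0 : ℝ) < a := h3
      have h4 : planeCross (N.pos (N.bdry j) - a • N.edgeDir u (N.bdry j)) ℓ ≠ N.bx ℓ j := by
        rw [hx]
        have := mul_ne_zero h3.ne' su
        intro h5; apply this; linarith
      filter_upwards [eventually_between h2 h4] with z h5
      rw [h5]
      unfold between
      rw [h1]
      congr 1
      refine parity_congr ?_
      rw [hx, le_add_iff_nonneg_right, mul_nonneg_iff_of_pos_left h3]
    · rw [hz, zsign_between]
      unfold swapSign
      rw [side_self, mul_zero, sgn_of_nonneg le_rfl, mul_one, sgn_mul (hℓ.side_ne_zero hui) sb]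
      linear_combination (-(sgn (N.side ℓ i₀ u) * sgn (N.side ℓ i₀ (N.bdry j)))) *
        sgn_mul_self (N.side ℓ j u)
    · have hopp : N.side ℓ j (N.bdry i₀) = -N.side ℓ i₀ (N.bdry j) := by
        rw [side_bdry, side_bdry]; ring
      rw [hz, hc, hκ, sgn_neg su, hopp, sgn_neg sb]
      linear_combination (-(sgn (N.side ℓ i₀ (N.bdry j)) * sgn (N.side ℓ i₀ (N.bdry j)))) *
        sgn_mul_self (N.side ℓ j u) - sgn_mul_self (N.side ℓ i₀ (N.bdry j))

end Path

end PBDTPNetwork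

namespace PBDTPNetwork

variable {V : Type*} {n : ℕ} {N : PBDTPNetwork V n} {ℓ : ℝ × ℝ} {O W : V → V → Prop}
  {Plus : ℝ × ℝ → Prop} {S : Set (Sym2 V)}

theorem reorient_iff (hW : N.IsCurve O W)
    (hS : ∀ u v, O u v → (s(u, v) ∈ S ↔ W u v)) {u v : V} :
    reorient O S u v ↔ W v u ∨ (O u v ∧ ¬ W u v) := by
  unfold reorient
  constructor
  · rintro (⟨h1, h2⟩ | ⟨h1, h2⟩)
    · rw [Sym2.eq_swap] at h1
      exact Or.inl ((hS _ _ h2).1 h1)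
    · exact Or.inr ⟨h2, fun h => h1 ((hS _ _ h2).2 h)⟩
  · rintro (h | ⟨h1, h2⟩)
    · have hvu := hW.dir _ _ h
      refine Or.inl ⟨?_, hvu⟩
      rw [Sym2.eq_swap]
      exact (hS _ _ hvu).2 h
    · exact Or.inr ⟨fun h => h2 ((hS _ _ h1).1 h), h1⟩

theorem isPerfect_reorient (hO : N.IsPerfect O) (hW : N.IsCurve O W)
    (hS : ∀ u v, O u v → (s(u, v) ∈ S ↔ W u v)) : N.IsPerfect (reorient O S) := by
  have hR := @reorient_iff _ _ _ _ _ _ hW hS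
  refine ⟨fun u v h => ?_, fun u v h => ?_, fun u v h h' => ?_, fun v hv hc => ?_, fun v hv hc => ?_⟩
  · rcases hR.1 h with h | h
    · exact (hW.adj hO h).symm
    · exact hO.adj _ _ h.1
  · simp only [hR]
    rcases hO.total u v h with h | h
    · by_cases hw : W u v
      · exact Or.inr (Or.inl hw)
      · exact Or.inl (Or.inr ⟨h, hw⟩)
    · by_cases hw : W v u
      · exact Or.inl (Or.inl hw)
      · exact Or.inr (Or.inr ⟨h, hw⟩)
  · rw [hR] at h h'
    have := hO.asymm u v
    have := hW.dir u v
    have := hW.dir v u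
    tauto
  · obtain ⟨u, hu, huniq⟩ := hO.white v hv hc
    by_cases hw : ∃ x, W v x
    · obtain ⟨x, hx⟩ := hw
      obtain ⟨p, hp⟩ := hW.exists_in v x hx hv
      refine ⟨x, hR.2 (Or.inl hx), fun y hy => ?_⟩
      rcases hR.1 hy with h | ⟨h, h'⟩
      · exact hW.out_unique _ _ _ h hx
      · rw [huniq y h, ← huniq p (hW.dir _ _ hp)] at h'
        exact absurd hp h'
    · have hw' : ¬ W u v := fun h => hw (hW.exists_out _ _ h hv)
      refine ⟨u, hR.2 (Or.inr ⟨hu, hw'⟩), fun y hy => ?_⟩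
      rcases hR.1 hy with h | ⟨h, -⟩
      · exact absurd ⟨y, h⟩ hw
      · exact huniq y h
  · obtain ⟨u, hu, huniq⟩ := hO.black v hv hc
    by_cases hw : ∃ x, W x v
    · obtain ⟨x, hx⟩ := hw
      obtain ⟨p, hp⟩ := hW.exists_out x v hx hv
      refine ⟨x, hR.2 (Or.inl hx), fun y hy => ?_⟩
      rcases hR.1 hy with h | ⟨h, h'⟩
      · exact hW.in_unique _ _ _ h hx
      · rw [huniq y h, ← huniq p (hW.dir _ _ hp)] at h'
        exact absurd hp h'
    · have hw' : ¬ W v u := fun h => hw (hW.exists_in _ _ h hv)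
      refine ⟨u, hR.2 (Or.inr ⟨hu, hw'⟩), fun y hy => ?_⟩
      rcases hR.1 hy with h | ⟨h, -⟩
      · exact absurd ⟨y, h⟩ hw
      · exact huniq y h

open Classical in
theorem sum_out_split {V M : Type*} [Fintype V] [AddCommMonoid M] {R R' : V → Prop} {s : V}
    (h : ∀ x, R x ↔ x = s ∨ R' x) (hs : ¬ R' s) (g : V → M) :
    (∑ x, if R x then g x else 0) = g s + ∑ x, if R' x then g x else 0 := by
  have : g s = ∑ x, if x = s then g x else 0 := by simp
  rw [this, ← Finset.sum_add_distrib]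
  refine Finset.sum_congr rfl fun x _ => ?_
  by_cases hx : x = s
  · subst hx
    rw [if_pos ((h x).2 (Or.inl rfl)), if_pos rfl, if_neg hs, add_zero]
  · rw [if_neg hx, zero_add]
    exact if_congr ((h x).trans (or_iff_right hx)) rfl rfl

open Classical in
/-- The linear relations in terms of the signs of crossings and turns. -/
theorem IsEdgeSystem.internal_eq [Fintype V] (hℓ : N.IsGaugeDirection ℓ) (hO : N.IsPerfect O)
    {F : Fin n → Fin n → ℝ} {E : Sym2 V → Fin n → ℝ} (hE : N.IsEdgeSystem ℓ O F E) {u v : V}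
    (h : O u v) (hv : N.IsInternal v) : E s(u, v) = (N.crossSign ℓ O u v * N.weight u v) •
      ∑ x, if O v x then turnSign ℓ (N.edgeDir u v) (N.edgeDir v x) • E s(v, x) else 0 := by
  rw [hE.internal u v h hv, Finset.smul_sum]
  refine Finset.sum_congr rfl fun x _ => ?_
  split_ifs
  · have := stepSign_eq hℓ O (x := x) (hO.adj _ _ h)
    unfold stepSign at this
    rw [this, smul_smul]
    congr 1; ring
  · rw [smul_zero]

open Classical in
theorem isEdgeSystem_of_eq [Fintype V] (hℓ : N.IsGaugeDirection ℓ) (hO : N.IsPerfect O)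
    {F : Fin n → Fin n → ℝ} {E : Sym2 V → Fin n → ℝ}
    (h : ∀ u v, O u v → N.IsInternal v → E s(u, v) = (N.crossSign ℓ O u v * N.weight u v) •
      ∑ x, if O v x then turnSign ℓ (N.edgeDir u v) (N.edgeDir v x) • E s(v, x) else 0)
    (h' : ∀ u j, O u (N.bdry j) → E s(u, N.bdry j) =
      (N.crossSign ℓ O u (N.bdry j) * N.weight u (N.bdry j)) • F j) :
    N.IsEdgeSystem ℓ O F E := by
  refine ⟨fun u v huv hv => ?_, fun u j huj => ?_⟩
  · rw [h u v huv hv, Finset.smul_sum]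
    refine Finset.sum_congr rfl fun x _ => ?_
    split_ifs
    · have := stepSign_eq hℓ O (x := x) (hO.adj _ _ huv)
      unfold stepSign at this
      rw [this, smul_smul]
      congr 1; ring
    · rw [smul_zero]
  · rw [h' u j huj, neg_one_zpow_crossings hℓ O (hO.adj _ _ huj)]

theorem sink_eq [Fintype V] (hℓ : N.IsGaugeDirection ℓ) (hO : N.IsPerfect O)
    {F : Fin n → Fin n → ℝ} {E : Sym2 V → Fin n → ℝ} (hE : N.IsEdgeSystem ℓ O F E) {u : V}
    {j : Fin n} (h : O u (N.bdry j)) : E s(u, N.bdry j) =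
      (N.crossSign ℓ O u (N.bdry j) * N.weight u (N.bdry j)) • F j := by
  rw [hE.sink u j h, neg_one_zpow_crossings hℓ O (hO.adj _ _ h)]

namespace MarkedCurve

variable {U B : ℝ × ℝ → ZMod 2} {c : ZMod 2} {X : V → V → ℝ}
  {F F' : Fin n → Fin n → ℝ} {E Eh : Sym2 V → Fin n → ℝ}

/-- The relations at the vertices that are not on the curve. -/
theorem reorient_off [Fintype V] (hℓ : N.IsGaugeDirection ℓ) (hO : N.IsPerfect O)
    (hM : MarkedCurve N ℓ O W Plus U B c X) (hS : ∀ u v, O u v → (s(u, v) ∈ S ↔ W u v))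
    (hX : ∀ u v, N.crossSign ℓ (reorient O S) u v = X u v * N.crossSign ℓ O u v)
    (hE : N.IsEdgeSystem ℓ O F E)
    (hoff : ∀ u v, O u v → ¬ W u v → Eh s(u, v) = N.offSign Plus u v • E s(u, v)) {u v : V}
    (h : O u v) (hv : N.IsInternal v) (hin : ∀ u, ¬ W u v) (hout : ∀ x, ¬ W v x) :
    Eh s(u, v) = (N.crossSign ℓ (reorient O S) u v * N.weight u v) •
      ∑ x, open Classical in if reorient O S v x then
        turnSign ℓ (N.edgeDir u v) (N.edgeDir v x) • Eh s(v, x) else 0 := by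
  classical
  rw [hoff u v h (hin u), hE.internal_eq hℓ hO h hv, smul_smul, Finset.smul_sum, Finset.smul_sum]
  refine Finset.sum_congr rfl fun x _ => ?_
  have hR : reorient O S v x ↔ O v x := by
    rw [reorient_iff hM.curve hS]
    have := hin x
    have := hout x
    tauto
  by_cases hx : O v x
  · rw [if_pos hx, if_pos (hR.2 hx), hoff v x hx (hout x), hX, hM.off_vertex hℓ hO h hx hin hout,
      smul_smul, smul_smul, smul_smul]
    congr 1; ring
  · rw [if_neg hx, if_neg (mt hR.1 hx), smul_zero, smul_zero]

end MarkedCurve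

end PBDTPNetwork

namespace PBDTPNetwork

variable {V : Type*} {n : ℕ} {N : PBDTPNetwork V n} {ℓ : ℝ × ℝ} {O W : V → V → Prop}
  {Plus : ℝ × ℝ → Prop} {S : Set (Sym2 V)}

theorem planeCross_ne_zero_in {v x y : V} (hx : N.graph.Adj x v) (hy : N.graph.Adj y v)
    (hxy : x ≠ y)
    (h : 0 < planeCross (N.edgeDir x v) ℓ * planeCross (N.edgeDir y v) ℓ) :
    planeCross (N.edgeDir x v) (N.edgeDir y v) ≠ 0 := by
  have := planeCross_ne_zero_out (ℓ := ℓ) hx.symm hy.symm hxy (by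
    rw [N.edgeDir_swap x v, N.edgeDir_swap y v, planeCross_neg_left, planeCross_neg_left, neg_mul_neg]
    exact h)
  rwa [N.edgeDir_swap x v, N.edgeDir_swap y v, planeCross_neg_left, planeCross_neg_right,
    neg_neg] at this

open Classical in
theorem sum_out_single {V M : Type*} [Fintype V] [AddCommMonoid M] {R : V → Prop} {s : V}
    (h : ∀ x, R x ↔ x = s) (g : V → M) : (∑ x, if R x then g x else 0) = g s := by
  simp only [h]
  simp

namespace MarkedCurve

variable {U B : ℝ × ℝ → ZMod 2} {c : ZMod 2} {X : V → V → ℝ}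
  {F F' : Fin n → Fin n → ℝ} {E Eh : Sym2 V → Fin n → ℝ}

theorem reorient_out_iff (hW : N.IsCurve O W)
    (hS : ∀ u v, O u v → (s(u, v) ∈ S ↔ W u v)) {p v : V} (hp : W p v) (x : V) :
    reorient O S v x ↔ x = p ∨ (O v x ∧ ¬ W v x) := by
  rw [reorient_iff hW hS]
  refine or_congr_left ⟨fun h => hW.in_unique _ _ _ h hp, ?_⟩
  rintro rfl; exact hp

/-- The relations for the reversed edges of the curve. -/
theorem reorient_on [Fintype V] (hℓ : N.IsGaugeDirection ℓ) (hO : N.IsPerfect O)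
    (hM : MarkedCurve N ℓ O W Plus U B c X) (hS : ∀ u v, O u v → (s(u, v) ∈ S ↔ W u v))
    (hX : ∀ u v, N.crossSign ℓ (reorient O S) u v = X u v * N.crossSign ℓ O u v)
    (hE : N.IsEdgeSystem ℓ O F E)
    (hoff : ∀ u v, O u v → ¬ W u v → Eh s(u, v) = N.offSign Plus u v • E s(u, v))
    (hon : ∀ u v, W u v → Eh s(u, v) = (N.onSign Plus u v *
      sgn (planeCross (N.edgeDir u v) ℓ) * N.crossSign ℓ O u v / N.weight u v) • E s(u, v))
    {p v s : V} (hp : W p v) (hs : W v s) :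
    Eh s(s, v) = (N.crossSign ℓ (reorient O S) s v * N.weight s v) •
      ∑ x, open Classical in if reorient O S v x then
        turnSign ℓ (N.edgeDir s v) (N.edgeDir v x) • Eh s(v, x) else 0 := by
  classical
  have hW := hM.curve
  have hv := hW.isInternal hO hp hs
  have hpO := hW.dir _ _ hp
  have hpA := hW.adj hO hp
  have hsA := hW.adj hO hs
  have hps := hW.ne hO hp hs
  have κe := hℓ.not_parallel_of_adj hpA
  have κf := hℓ.not_parallel_of_adj hsA
  have hef := N.planeCross_ne_zero_of_turn (ℓ := ℓ) hpA hsA hps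
  have hw0 := (N.weight_pos _ _ hpA).ne'
  obtain ⟨R', hR'⟩ : ∃ R' : V → Prop, ∀ x, R' x ↔ O v x ∧ ¬ W v x := ⟨_, fun _ => Iff.rfl⟩
  have hR := reorient_out_iff hW hS hp
  simp only [← hR'] at hR
  have hOs : ∀ x, O v x ↔ x = s ∨ R' x := by
    intro x
    rw [hR']
    by_cases hx : W v x
    · exact ⟨fun _ => Or.inl (hW.out_unique _ _ _ hx hs), fun _ => hW.dir _ _ hx⟩
    · constructor
      · exact fun h => Or.inr ⟨h, hx⟩
      · rintro (rfl | h)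
        · exact absurd hs hx
        · exact h.1
  have hsum : (∑ x, if R' x then
        turnSign ℓ (N.edgeDir s v) (N.edgeDir v x) • Eh s(v, x) else 0) =
      -((N.onSign Plus p v * sgn (planeCross (N.edgeDir p v) ℓ) *
        turnSign ℓ (N.edgeDir s v) (N.edgeDir v p)) •
        ∑ x, if R' x then
          turnSign ℓ (N.edgeDir p v) (N.edgeDir v x) • E s(v, x) else 0) := by
    rw [Finset.smul_sum, ← Finset.sum_neg_distrib]
    refine Finset.sum_congr rfl fun x _ => ?_
    split_ifs with hx
    · rw [hR'] at hx
      have hxA := hO.adj _ _ hx.1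
      have hxs : x ≠ s := by rintro rfl; exact hx.2 hs
      have hxp : x ≠ p := by rintro rfl; exact hO.asymm _ _ hx.1 hpO
      rw [hoff v x hx.1 hx.2, hM.off_out hℓ hO hp hs hx.1 hxs,
        coneSign_white (ℓ := ℓ) κe κf (hℓ.not_parallel_of_adj hxA) hef
          (N.planeCross_ne_zero_of_turn hpA hxA hxp.symm)
          (planeCross_ne_zero_out hsA hxA hxs.symm), N.edgeDir_swap v s, N.edgeDir_swap p v,
        smul_smul, smul_smul, ← neg_smul]
      congr 1
      linear_combination (-(N.onSign Plus p v * sgn (planeCross (N.edgeDir p v) ℓ) *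
        turnSign ℓ (-N.edgeDir v s) (-N.edgeDir p v) *
        turnSign ℓ (N.edgeDir p v) (N.edgeDir v x))) *
        turnSign_mul_self ℓ (-N.edgeDir v s) (N.edgeDir v x)
    · rw [smul_zero, neg_zero]
  have hEe := hE.internal_eq hℓ hO hpO hv
  rw [sum_out_split hOs (fun h => ((hR' s).1 h).2 hs)] at hEe
  have hEhe : Eh s(v, p) = (N.onSign Plus p v * sgn (planeCross (N.edgeDir p v) ℓ)) •
      (turnSign ℓ (N.edgeDir p v) (N.edgeDir v s) • E s(v, s) +
        ∑ x, if R' x then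
          turnSign ℓ (N.edgeDir p v) (N.edgeDir v x) • E s(v, x) else 0) := by
    rw [Sym2.eq_swap, hon p v hp, hEe, smul_smul]
    congr 1
    field_simp
    linear_combination (N.onSign Plus p v * sgn (planeCross (N.edgeDir p v) ℓ)) *
      crossSign_mul_self (N := N) (ℓ := ℓ) O p v
  rw [sum_out_split hR (fun h => hO.asymm _ _ ((hR' p).1 h).1 hpO), hsum, hEhe]
  rw [Sym2.eq_swap, hon v s hs, hM.on_vertex hℓ hO hp hs, hX,
    N.weight_symm v s hsA, crossSign_comm O s v, turnSign_neg_neg_mul κe κf hef,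
    ← edgeDir_swap, ← edgeDir_swap]
  have hXs : X s v * N.crossSign ℓ O v s = X v s * N.crossSign ℓ O v s := by
    rw [← hX, crossSign_comm O v s, ← hX, crossSign_comm]
  rw [hXs]
  module

/-- The relations for the edges that end on the curve. -/
theorem reorient_in [Fintype V] (hℓ : N.IsGaugeDirection ℓ) (hO : N.IsPerfect O)
    (hM : MarkedCurve N ℓ O W Plus U B c X) (hS : ∀ u v, O u v → (s(u, v) ∈ S ↔ W u v))
    (hX : ∀ u v, N.crossSign ℓ (reorient O S) u v = X u v * N.crossSign ℓ O u v)
    (hE : N.IsEdgeSystem ℓ O F E)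
    (hoff : ∀ u v, O u v → ¬ W u v → Eh s(u, v) = N.offSign Plus u v • E s(u, v))
    (hon : ∀ u v, W u v → Eh s(u, v) = (N.onSign Plus u v *
      sgn (planeCross (N.edgeDir u v) ℓ) * N.crossSign ℓ O u v / N.weight u v) • E s(u, v))
    {p v s y : V} (hp : W p v) (hs : W v s) (hy : O y v) (hyW : ¬ W y v) :
    Eh s(y, v) = (N.crossSign ℓ (reorient O S) y v * N.weight y v) •
      ∑ x, open Classical in if reorient O S v x then
        turnSign ℓ (N.edgeDir y v) (N.edgeDir v x) • Eh s(v, x) else 0 := by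
  classical
  have hW := hM.curve
  have hv := hW.isInternal hO hp hs
  have hpO := hW.dir _ _ hp
  have hsO := hW.dir _ _ hs
  have hpA := hW.adj hO hp
  have hsA := hW.adj hO hs
  have hyA := hO.adj _ _ hy
  have hyp : y ≠ p := by rintro rfl; exact hyW hp
  have hys : y ≠ s := by rintro rfl; exact hO.asymm _ _ hy hsO
  have κe := hℓ.not_parallel_of_adj hpA
  have κf := hℓ.not_parallel_of_adj hsA
  have κh := hℓ.not_parallel_of_adj hyA
  have hef := N.planeCross_ne_zero_of_turn (ℓ := ℓ) hpA hsA (hW.ne hO hp hs)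
  have hw0 := (N.weight_pos _ _ hpA).ne'
  have hout : ∀ x, O v x ↔ x = s := by
    intro x
    constructor
    · intro hx
      exact (hO.in_or_out_unique hy hpO hx hsO).resolve_left hyp
    · rintro rfl; exact hsO
  have hR : ∀ x, reorient O S v x ↔ x = p := by
    intro x
    rw [reorient_out_iff hW hS hp]
    refine or_iff_left fun h => ?_
    have := (hout x).1 h.1
    subst this
    exact h.2 hs
  have hEy := hE.internal_eq hℓ hO hy hv
  have hEp := hE.internal_eq hℓ hO hpO hv
  rw [sum_out_single hout] at hEy hEp
  have hfh : planeCross (N.edgeDir v s) ℓ * planeCross (N.edgeDir y v) ℓ < 0 →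
      planeCross (N.edgeDir v s) (N.edgeDir y v) ≠ 0 := by
    intro h
    rw [planeCross_swap, neg_ne_zero]
    exact N.planeCross_ne_zero_of_turn hyA hsA hys (by rwa [mul_comm])
  rw [sum_out_single hR, hoff y v hy hyW, hM.off_in hℓ hO hp hs hy hyp, hEy,
    coneSign_black (ℓ := ℓ) κe κf κh hef (planeCross_ne_zero_in hpA hyA hyp.symm) hfh,
    Sym2.eq_swap (a := v) (b := p), hon p v hp, hEp, hX, ← N.edgeDir_swap p v]
  simp only [smul_smul]
  congr 1
  field_simp
  have h1 := turnSign_mul_self ℓ (N.edgeDir y v) (N.edgeDir v s)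
  have h2 := crossSign_mul_self (N := N) (ℓ := ℓ) O p v
  generalize turnSign ℓ (N.edgeDir y v) (N.edgeDir v s) = t at *
  generalize N.crossSign ℓ O p v = d at *
  linear_combination (X y v * N.onSign Plus p v * sgn (planeCross (N.edgeDir p v) ℓ) * turnSign ℓ (N.edgeDir y v) (N.edgeDir v p) *
    turnSign ℓ (N.edgeDir p v) (N.edgeDir v s) * N.crossSign ℓ O y v * N.weight y v) * (h1 - h2)

theorem isEdgeSystem_reorient [Fintype V] (hℓ : N.IsGaugeDirection ℓ) (hO : N.IsPerfect O)
    (hM : MarkedCurve N ℓ O W Plus U B c X) (hS : ∀ u v, O u v → (s(u, v) ∈ S ↔ W u v))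
    (hX : ∀ u v, N.crossSign ℓ (reorient O S) u v = X u v * N.crossSign ℓ O u v)
    (hE : N.IsEdgeSystem ℓ O F E)
    (hEh : ∀ u v, O u v → Eh s(u, v) = N.changeFactor ℓ O S Plus u v • E s(u, v))
    (hF : ∀ u j, O u (N.bdry j) → ¬ W u (N.bdry j) → F' j = F j)
    (hF' : ∀ i v, W (N.bdry i) v → E s(N.bdry i, v) = -F' i) :
    N.IsEdgeSystem ℓ (reorient O S) F' Eh := by
  have hW := hM.curve
  have hoff : ∀ u v, O u v → ¬ W u v → Eh s(u, v) = N.offSign Plus u v • E s(u, v) := by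
    intro u v h h'
    rw [hEh u v h, changeFactor_eq hℓ (hO.adj _ _ h), if_neg fun h'' => h' ((hS u v h).1 h'')]
  have hon : ∀ u v, W u v → Eh s(u, v) = (N.onSign Plus u v *
      sgn (planeCross (N.edgeDir u v) ℓ) * N.crossSign ℓ O u v / N.weight u v) • E s(u, v) := by
    intro u v h
    have h' := hW.dir _ _ h
    rw [hEh u v h', changeFactor_eq hℓ (hO.adj _ _ h'), if_pos ((hS u v h').2 h)]
  refine isEdgeSystem_of_eq hℓ (isPerfect_reorient hO hW hS) (fun u v h hv => ?_) fun u j h => ?_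
  · rcases (reorient_iff hW hS).1 h with h | ⟨h, h'⟩
    · obtain ⟨p, hp⟩ := hW.exists_in v u h hv
      exact hM.reorient_on hℓ hO hS hX hE hoff hon hp h
    · by_cases hin : ∃ p, W p v
      · obtain ⟨p, hp⟩ := hin
        obtain ⟨s, hs⟩ := hW.exists_out p v hp hv
        exact hM.reorient_in hℓ hO hS hX hE hoff hon hp hs h h'
      · refine hM.reorient_off hℓ hO hS hX hE hoff h hv (fun u hu => hin ⟨u, hu⟩) fun x hx => ?_
        exact hin (hW.exists_in v x hx hv)
  · rcases (reorient_iff hW hS).1 h with h | ⟨h, h'⟩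
    · have hX' : X u (N.bdry j) * N.crossSign ℓ O u (N.bdry j) =
          X (N.bdry j) u * N.crossSign ℓ O u (N.bdry j) := by
        rw [← hX, crossSign_comm O u, ← hX, crossSign_comm]
      rw [Sym2.eq_swap, hon _ _ h, hF' _ _ h, hM.on_first hℓ hO h, hX, hX',
        N.weight_symm _ _ (hW.adj hO h), crossSign_comm O u]
      module
    · rw [hoff u _ h h', hM.off_sink hℓ hO h h', sink_eq hℓ hO hE h, hF u j h h', hX, smul_smul,
        mul_assoc]

end MarkedCurve

end PBDTPNetwork

namespace PBDTPNetwork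

variable {V : Type*} {n : ℕ} {N : PBDTPNetwork V n} {ℓ : ℝ × ℝ} {O W : V → V → Prop}

theorem flowWeight_pos (hO : N.IsPerfect O) {F : Finset (V × V)} (hF : ∀ e ∈ F, O e.1 e.2) :
    0 < N.flowWeight F :=
  Finset.prod_pos fun e he => N.weight_pos _ _ (hO.adj _ _ (hF e he))

theorem measRow_ne_zero [Fintype V] (hO : N.IsPerfect O) {i j : Fin n} (hj : j ∉ N.sources O)
    {F : Finset (V × V)} (hF : N.IsFlow O i j F) : N.measRow O i j ≠ 0 := by
  classical
  unfold measRow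
  rw [if_neg hj]
  refine mul_ne_zero (pow_ne_zero _ (by norm_num)) (div_pos ?_ ?_).ne'
  · refine Finset.sum_pos (fun F hF => ?_) ⟨F, by simpa using hF⟩
    exact flowWeight_pos hO (Finset.mem_filter.1 hF).2.1
  · refine Finset.sum_pos (fun F hF => ?_) ⟨∅, ?_⟩
    · exact flowWeight_pos hO (Finset.mem_filter.1 hF).2.1
    · rw [Finset.mem_filter]
      exact ⟨Finset.mem_univ _, by simp, fun v _ => by simp, by simp⟩

section Cycle

variable {v₀ : V} {Q : N.graph.Walk v₀ v₀}

theorem sources_reorient_cycle (hO : N.IsPerfect O) (hQ : Q.IsCycle)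
    (hQO : ∀ d ∈ Q.darts, O d.fst d.snd) :
    N.sources (reorient O {e | e ∈ Q.edges}) = N.sources O := by
  have hW := isCurve_cycle hQ hQO
  have hend := not_isEnd_cycle hO hQ hQO
  ext i
  rw [mem_sources, mem_sources]
  refine exists_congr fun v => ?_
  rw [reorient_iff hW fun u v h => mem_edges_iff hO hQO h]
  have h1 : ¬ dartRel Q v (N.bdry i) := fun h => hend _ ⟨i, rfl, Or.inr ⟨v, h⟩⟩
  have h2 : ¬ dartRel Q (N.bdry i) v := fun h => hend _ ⟨i, rfl, Or.inl ⟨v, h⟩⟩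
  tauto

theorem isEdgeSystem_reorient_cycle [Fintype V] (hℓ : N.IsGaugeDirection ℓ) (hO : N.IsPerfect O)
    (hQ : Q.IsCycle) (hQO : ∀ d ∈ Q.darts, O d.fst d.snd) {F : Fin n → Fin n → ℝ}
    {E Eh : Sym2 V → Fin n → ℝ} (hE : N.IsEdgeSystem ℓ O F E)
    (hEh : ∀ u v, O u v → Eh s(u, v) =
      N.changeFactor ℓ O {e | e ∈ Q.edges} (N.CyclePlus Q) u v • E s(u, v)) :
    N.IsEdgeSystem ℓ (reorient O {e | e ∈ Q.edges}) F Eh := by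
  obtain ⟨c, hM⟩ := exists_markedCurve_cycle hℓ hO hQ hQO
  refine hM.isEdgeSystem_reorient hℓ hO (fun u v h => mem_edges_iff hO hQO h) (fun u v => ?_) hE
    hEh (fun _ _ _ _ => rfl) fun i v h => ?_
  · unfold crossSign
    rw [sources_reorient_cycle hO hQ hQO, one_mul]
  · exact absurd ⟨i, rfl, Or.inl ⟨v, h⟩⟩ (not_isEnd_cycle hO hQ hQO _)

end Cycle

section Path

variable {i₀ j₀ : Fin n} {P : N.graph.Walk (N.bdry i₀) (N.bdry j₀)}

theorem isFlow_path [Fintype V] (hO : N.IsPerfect O) (hne : i₀ ≠ j₀) (hP : P.IsPath)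
    (hPO : ∀ d ∈ P.darts, O d.fst d.snd) : ∃ F : Finset (V × V), N.IsFlow O i₀ j₀ F := by
  classical
  have hW := isCurve_path hP hPO
  refine ⟨Finset.univ.filter fun e : V × V => dartRel P e.1 e.2, fun e he => ?_, fun v hv => ?_,
    ?_, ?_, fun e he l => ?_⟩
  · exact hW.dir _ _ (Finset.mem_filter.1 he).2
  · have key : (∃ p s, dartRel P p v ∧ dartRel P v s) ∨
        ((∀ p, ¬ dartRel P p v) ∧ ∀ s, ¬ dartRel P v s) := by
      by_cases h : ∃ p, dartRel P p v
      · obtain ⟨p, hp⟩ := h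
        obtain ⟨s, hs⟩ := hW.exists_out p v hp hv
        exact Or.inl ⟨p, s, hp, hs⟩
      · push Not at h
        refine Or.inr ⟨h, fun s hs => ?_⟩
        obtain ⟨p, hp⟩ := hW.exists_in v s hs hv
        exact h p hp
    rcases key with ⟨p, s, hp, hs⟩ | ⟨h1, h2⟩
    · have e1 : (Finset.univ.filter fun e : V × V => dartRel P e.1 e.2).filter
          (fun e => e.2 = v) = {(p, v)} := by
        ext ⟨a, b⟩
        simp only [Finset.mem_filter, Finset.mem_univ, true_and, Finset.mem_singleton,
          Prod.mk.injEq]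
        constructor
        · rintro ⟨h, rfl⟩; exact ⟨hW.in_unique _ _ _ h hp, rfl⟩
        · rintro ⟨rfl, rfl⟩; exact ⟨hp, rfl⟩
      have e2 : (Finset.univ.filter fun e : V × V => dartRel P e.1 e.2).filter
          (fun e => e.1 = v) = {(v, s)} := by
        ext ⟨a, b⟩
        simp only [Finset.mem_filter, Finset.mem_univ, true_and, Finset.mem_singleton,
          Prod.mk.injEq]
        constructor
        · rintro ⟨h, rfl⟩; exact ⟨rfl, hW.out_unique _ _ _ h hs⟩
        · rintro ⟨rfl, rfl⟩; exact ⟨hs, rfl⟩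
      calc _ = 1 := by rw [← Finset.card_singleton (p, v)]; convert congrArg Finset.card e1
        _ = _ := by symm; rw [← Finset.card_singleton (v, s)]; convert congrArg Finset.card e2
    · rw [Finset.filter_false_of_mem, Finset.filter_false_of_mem]
      · rintro ⟨a, b⟩ he rfl
        exact h2 _ (Finset.mem_filter.1 he).2
      · rintro ⟨a, b⟩ he rfl
        exact h1 _ (Finset.mem_filter.1 he).2
  · obtain ⟨x, hx⟩ := exists_first (P := P) hne
    exact ⟨(N.bdry i₀, x), by simpa using hx, rfl⟩
  · obtain ⟨x, hx⟩ := exists_last (P := P) hne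
    exact ⟨(x, N.bdry j₀), by simpa using hx, rfl⟩
  · have he' := (Finset.mem_filter.1 he).2
    constructor
    · intro h
      rw [h] at he'
      exact eq_of_dartRel_bdry_left hO hPO he'
    · intro h
      rw [h] at he'
      exact eq_of_dartRel_bdry_right hO hPO he'

open Classical in
theorem sources_reorient_path (hO : N.IsPerfect O) (hne : i₀ ≠ j₀) (hP : P.IsPath)
    (hPO : ∀ d ∈ P.darts, O d.fst d.snd) :
    N.sources (reorient O {e | e ∈ P.edges}) = insert j₀ ((N.sources O).erase i₀) := by
  have hW := isCurve_path hP hPO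
  ext i
  rw [Finset.mem_insert, Finset.mem_erase, mem_sources, mem_sources]
  have hS : ∀ u v, O u v → (s(u, v) ∈ {e | e ∈ P.edges} ↔ dartRel P u v) :=
    fun u v h => mem_edges_iff hO hPO h
  simp only [reorient_iff hW hS]
  constructor
  · rintro ⟨v, h | ⟨h, h'⟩⟩
    · exact Or.inl (eq_of_dartRel_bdry_right hO hPO h)
    · refine Or.inr ⟨?_, v, h⟩
      rintro rfl
      obtain ⟨x, hx⟩ := exists_first (P := P) hne
      rw [N.eq_of_adj_bdry (hO.adj _ _ h) (hW.adj hO hx)] at h'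
      exact h' hx
  · rintro (rfl | ⟨h, v, hv⟩)
    · obtain ⟨u, hu⟩ := exists_last (P := P) hne
      exact ⟨u, Or.inl hu⟩
    · exact ⟨v, Or.inr ⟨hv, fun h' => h (eq_of_dartRel_bdry_left hO hPO h')⟩⟩

theorem crossSign_reorient_path (hO : N.IsPerfect O) (hi : i₀ ∈ N.sources O)
    (hj : j₀ ∉ N.sources O) (hP : P.IsPath) (hPO : ∀ d ∈ P.darts, O d.fst d.snd) (u v : V) :
    N.crossSign ℓ (reorient O {e | e ∈ P.edges}) u v =
      N.swapSign ℓ i₀ j₀ u v * N.crossSign ℓ O u v := by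
  classical
  have hne : i₀ ≠ j₀ := by rintro rfl; exact hj hi
  unfold crossSign swapSign
  rw [sources_reorient_path hO hne hP hPO,
    Finset.prod_insert fun h => hj (Finset.mem_of_mem_erase h), ← Finset.mul_prod_erase _ _ hi]
  linear_combination (-(sgn (N.side ℓ j₀ u * N.side ℓ j₀ v) *
    ∏ l ∈ (N.sources O).erase i₀, sgn (N.side ℓ l u * N.side ℓ l v))) *
    sgn_mul_self (N.side ℓ i₀ u * N.side ℓ i₀ v)

/-- The boundary vectors of the system that is proportional to the standard system after the
reversal of a path from `b_i` to `b_j`. -/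
noncomputable def modifiedVec [Fintype V] (N : PBDTPNetwork V n) (O : V → V → Prop) (i₀ j₀ : Fin n)
    (j : Fin n) : Fin n → ℝ :=
  if j = j₀ then stdVec n j₀ - (1 / N.measRow O i₀ j₀) • N.measRow O i₀ else stdVec n j

theorem measRow_path_ne_zero [Fintype V] (hO : N.IsPerfect O) (hi : i₀ ∈ N.sources O)
    (hj : j₀ ∉ N.sources O) (hP : P.IsPath) (hPO : ∀ d ∈ P.darts, O d.fst d.snd) :
    N.measRow O i₀ j₀ ≠ 0 := by
  obtain ⟨F, hF⟩ := isFlow_path hO (by rintro rfl; exact hj hi) hP hPO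
  exact measRow_ne_zero hO hj hF

theorem modified_eq_add [Fintype V] (hℓ : N.IsGaugeDirection ℓ) (hO : N.IsPerfect O)
    {E Et : Sym2 V → Fin n → ℝ} (hE : N.IsEdgeSystem ℓ O (stdVec n) E)
    (hEt : N.IsEdgeSystem ℓ O (N.modifiedVec O i₀ j₀) Et) :
    ∀ e ∈ N.graph.edgeSet, ∃ c : ℝ, Et e = E e + c • N.measRow O i₀ := by
  refine isEdgeSystem_perturb hℓ hO hE hEt (N.measRow O i₀)
    (fun j => if j = j₀ then -(1 / N.measRow O i₀ j₀) else 0) fun j => ?_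
  unfold modifiedVec
  split_ifs with h
  · rw [h, neg_smul, sub_eq_add_neg]
  · rw [zero_smul, add_zero]

theorem modified_source [Fintype V] (hℓ : N.IsGaugeDirection ℓ) (hO : N.IsPerfect O)
    (hj : j₀ ∉ N.sources O) (ha : N.measRow O i₀ j₀ ≠ 0)
    {Et : Sym2 V → Fin n → ℝ} (hEt : N.IsEdgeSystem ℓ O (N.modifiedVec O i₀ j₀) Et) {v : V}
    (hv : O (N.bdry i₀) v) : Et s(N.bdry i₀, v) = -stdVec n i₀ := by
  classical
  obtain ⟨E, hE⟩ := exists_isEdgeSystem hℓ hO (stdVec n)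
  have h1 := hE.source hℓ hO hv
  rw [hE.source_std hℓ hO hv] at h1
  have h2 : (∑ j, if j ∈ N.sources O then 0 else N.measRow O i₀ j • N.modifiedVec O i₀ j₀ j) =
      (∑ j, if j ∈ N.sources O then 0 else N.measRow O i₀ j • stdVec n j) +
        ∑ j, if j = j₀ then -N.measRow O i₀ else 0 := by
    rw [← Finset.sum_add_distrib]
    refine Finset.sum_congr rfl fun j _ => ?_
    unfold modifiedVec
    by_cases h : j = j₀
    · subst h
      rw [if_neg hj, if_neg hj, if_pos rfl, if_pos rfl, smul_sub, smul_smul, mul_one_div_cancel ha,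
        one_smul, sub_eq_add_neg]
    · rw [if_neg h, if_neg h, add_zero]
  rw [hEt.source hℓ hO hv, h2, ← h1, Finset.sum_ite_eq' Finset.univ j₀, if_pos (Finset.mem_univ _)]
  abel

theorem isEdgeSystem_reorient_path [Fintype V] (hℓ : N.IsGaugeDirection ℓ) (hO : N.IsPerfect O)
    (hi : i₀ ∈ N.sources O) (hj : j₀ ∉ N.sources O) (hP : P.IsPath)
    (hPO : ∀ d ∈ P.darts, O d.fst d.snd) {Et Eh : Sym2 V → Fin n → ℝ}
    (hEt : N.IsEdgeSystem ℓ O (N.modifiedVec O i₀ j₀) Et)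
    (hEh : ∀ u v, O u v → Eh s(u, v) =
      N.changeFactor ℓ O {e | e ∈ P.edges} (N.PathPlus ℓ P) u v • Et s(u, v)) :
    N.IsEdgeSystem ℓ (reorient O {e | e ∈ P.edges}) (stdVec n) Eh := by
  have hne : i₀ ≠ j₀ := by rintro rfl; exact hj hi
  have hW := isCurve_path hP hPO
  have hM := markedCurve_path hℓ hO hne hP hPO
  refine hM.isEdgeSystem_reorient hℓ hO (fun u v h => mem_edges_iff hO hPO h)
    (crossSign_reorient_path hO hi hj hP hPO) hEt hEh (fun u j h h' => ?_) fun i v h => ?_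
  · unfold modifiedVec
    rw [if_neg]
    rintro rfl
    obtain ⟨x, hx⟩ := exists_last (P := P) hne
    rw [N.eq_of_adj_bdry (hO.adj _ _ h).symm (hW.adj hO hx).symm] at h'
    exact h' hx
  · obtain rfl := eq_of_dartRel_bdry_left hO hPO h
    exact modified_source hℓ hO hj (measRow_path_ne_zero hO hi hj hP hPO) hEt (hW.dir _ _ h)

end Path

end PBDTPNetwork

namespace PBDTPNetwork

variable {V : Type*} {n : ℕ} {N : PBDTPNetwork V n} {ℓ : ℝ × ℝ} {O O' D : V → V → Prop}

/-- The space spanned by the rows of the boundary measurement matrix. -/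
noncomputable def rowSpace [Fintype V] (N : PBDTPNetwork V n) (O : V → V → Prop) :
    Submodule ℝ (Fin n → ℝ) :=
  Submodule.span ℝ (N.measRow O '' N.sources O)

theorem measRow_mem_rowSpace [Fintype V] {i : Fin n} (h : i ∈ N.sources O) :
    N.measRow O i ∈ N.rowSpace O := Submodule.subset_span ⟨i, h, rfl⟩

/-- The standard systems of `O'` and `O` are proportional modulo the row space of `O`. -/
structure Proportional [Fintype V] (N : PBDTPNetwork V n) (ℓ : ℝ × ℝ) (O O' : V → V → Prop) :
    Prop where
  rowSpace_le : N.rowSpace O' ≤ N.rowSpace O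
  vectors : ∀ E E' : Sym2 V → Fin n → ℝ, N.IsEdgeSystem ℓ O (stdVec n) E →
    N.IsEdgeSystem ℓ O' (stdVec n) E' → ∀ e ∈ N.graph.edgeSet,
      ∃ α : ℝ, ∃ r ∈ N.rowSpace O, α ≠ 0 ∧ E' e = α • E e + r

theorem proportional_refl [Fintype V] (hℓ : N.IsGaugeDirection ℓ) (hO : N.IsPerfect O) :
    N.Proportional ℓ O O := by
  refine ⟨le_rfl, fun E E' hE hE' => hO.forall_edge fun u v h => ?_⟩
  exact ⟨1, 0, Submodule.zero_mem _, one_ne_zero, by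
    rw [one_smul, add_zero, isEdgeSystem_unique hℓ hO hE' hE u v h]⟩

theorem Proportional.trans [Fintype V] (hℓ : N.IsGaugeDirection ℓ) {O₁ O₂ O₃ : V → V → Prop}
    (hO₂ : N.IsPerfect O₂) (h : N.Proportional ℓ O₁ O₂) (h' : N.Proportional ℓ O₂ O₃) :
    N.Proportional ℓ O₁ O₃ := by
  refine ⟨h'.rowSpace_le.trans h.rowSpace_le, fun E E' hE hE' e he => ?_⟩
  obtain ⟨E₂, hE₂⟩ := exists_isEdgeSystem hℓ hO₂ (stdVec n)
  obtain ⟨α, r, hr, hα, h1⟩ := h.vectors E E₂ hE hE₂ e he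
  obtain ⟨α', r', hr', hα', h2⟩ := h'.vectors E₂ E' hE₂ hE' e he
  refine ⟨α' * α, α' • r + r', Submodule.add_mem _ (Submodule.smul_mem _ _ hr)
    (h.rowSpace_le hr'), mul_ne_zero hα' hα, ?_⟩
  rw [h2, h1]
  module

theorem changeFactor_ne_zero (hO : N.IsPerfect O) (S : Set (Sym2 V)) (Plus : ℝ × ℝ → Prop)
    {u v : V} (h : O u v) : N.changeFactor ℓ O S Plus u v ≠ 0 := by
  unfold changeFactor
  have := (N.weight_pos _ _ (hO.adj _ _ h)).ne'
  split_ifs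
  · exact div_ne_zero (zpow_ne_zero _ (by norm_num)) this
  · exact zpow_ne_zero _ (by norm_num)

/-- Prescribed multiples of a family indexed by the edges. -/
theorem exists_rescaled (hO : N.IsPerfect O) (E : Sym2 V → Fin n → ℝ) (g : V → V → ℝ) :
    ∃ Eh : Sym2 V → Fin n → ℝ, ∀ u v, O u v → Eh s(u, v) = g u v • E s(u, v) :=
  ⟨onSym2 fun e : DirEdge O => g e.1.1 e.1.2 • E s(e.1.1, e.1.2),
    fun u v h => onSym2_apply hO _ ⟨(u, v), h⟩⟩

theorem proportional_cycle [Fintype V] (hℓ : N.IsGaugeDirection ℓ) (hO : N.IsPerfect O)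
    {v₀ : V} {Q : N.graph.Walk v₀ v₀} (hQ : Q.IsCycle) (hQO : ∀ d ∈ Q.darts, O d.fst d.snd) :
    N.Proportional ℓ O (reorient O {e | e ∈ Q.edges}) := by
  have hW := isCurve_cycle hQ hQO
  have hS : ∀ u v, O u v → (s(u, v) ∈ {e | e ∈ Q.edges} ↔ dartRel Q u v) :=
    fun u v h => mem_edges_iff hO hQO h
  have hO' := isPerfect_reorient hO hW hS
  have hsys : ∀ E : Sym2 V → Fin n → ℝ, N.IsEdgeSystem ℓ O (stdVec n) E →
      ∃ Eh, N.IsEdgeSystem ℓ (reorient O {e | e ∈ Q.edges}) (stdVec n) Eh ∧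
        ∀ u v, O u v → Eh s(u, v) =
          N.changeFactor ℓ O {e | e ∈ Q.edges} (N.CyclePlus Q) u v • E s(u, v) := by
    intro E hE
    obtain ⟨Eh, hEh⟩ := exists_rescaled hO E
      (N.changeFactor ℓ O {e | e ∈ Q.edges} (N.CyclePlus Q))
    exact ⟨Eh, isEdgeSystem_reorient_cycle hℓ hO hQ hQO hE hEh, hEh⟩
  refine ⟨?_, fun E E' hE hE' => hO.forall_edge fun u v h => ?_⟩
  · refine Submodule.span_le.2 ?_
    rintro _ ⟨i, hi, rfl⟩
    obtain ⟨c, hM⟩ := exists_markedCurve_cycle hℓ hO hQ hQO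
    obtain ⟨E, hE⟩ := exists_isEdgeSystem hℓ hO (stdVec n)
    obtain ⟨Eh, hEh, hEh'⟩ := hsys E hE
    obtain ⟨v, hv⟩ := mem_sources.1 hi
    have hiO := hi
    rw [sources_reorient_cycle hO hQ hQO] at hiO
    obtain ⟨v', hv'⟩ := mem_sources.1 hiO
    obtain rfl := N.eq_of_adj_bdry (hO'.adj _ _ hv) (hO.adj _ _ hv')
    have hnW : ¬ dartRel Q (N.bdry i) v :=
      fun h => not_isEnd_cycle hO hQ hQO _ ⟨i, rfl, Or.inl ⟨v, h⟩⟩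
    have h1 := hEh.source_std hℓ hO' hv
    rw [hEh' _ _ hv', changeFactor_eq hℓ (hO.adj _ _ hv'),
      if_neg fun h => hnW ((hS _ _ hv').1 h), hM.off_source hℓ hO hv' hnW, one_smul,
      hE.source_std hℓ hO hv', sub_left_inj] at h1
    rw [← h1]
    exact measRow_mem_rowSpace hiO
  · obtain ⟨Eh, hEh, hEh'⟩ := hsys E hE
    refine ⟨_, 0, Submodule.zero_mem _, changeFactor_ne_zero (ℓ := ℓ) hO {e | e ∈ Q.edges} (N.CyclePlus Q) h,
      ?_⟩
    rw [add_zero, ← hEh' u v h]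
    exact hO'.forall_edge (p := fun e => E' e = Eh e)
      (isEdgeSystem_unique hℓ hO' hE' hEh) _ (hO.adj _ _ h)

theorem proportional_path [Fintype V] (hℓ : N.IsGaugeDirection ℓ) (hO : N.IsPerfect O)
    {i₀ j₀ : Fin n} {P : N.graph.Walk (N.bdry i₀) (N.bdry j₀)} (hi : i₀ ∈ N.sources O)
    (hj : j₀ ∉ N.sources O) (hP : P.IsPath) (hPO : ∀ d ∈ P.darts, O d.fst d.snd) :
    N.Proportional ℓ O (reorient O {e | e ∈ P.edges}) := by
  classical
  have hne : i₀ ≠ j₀ := by rintro rfl; exact hj hi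
  have hW := isCurve_path hP hPO
  have hS : ∀ u v, O u v → (s(u, v) ∈ {e | e ∈ P.edges} ↔ dartRel P u v) :=
    fun u v h => mem_edges_iff hO hPO h
  have hO' := isPerfect_reorient hO hW hS
  have hM := markedCurve_path hℓ hO hne hP hPO
  have hA₀ := measRow_mem_rowSpace hi
  obtain ⟨Et, hEt⟩ := exists_isEdgeSystem hℓ hO (N.modifiedVec O i₀ j₀)
  obtain ⟨Eh, hEh'⟩ := exists_rescaled hO Et
    (N.changeFactor ℓ O {e | e ∈ P.edges} (N.PathPlus ℓ P))
  have hEh := isEdgeSystem_reorient_path hℓ hO hi hj hP hPO hEt hEh'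
  refine ⟨?_, fun E E' hE hE' => hO.forall_edge fun u v h => ?_⟩
  · refine Submodule.span_le.2 ?_
    rintro _ ⟨i, hi', rfl⟩
    obtain ⟨E, hE⟩ := exists_isEdgeSystem hℓ hO (stdVec n)
    obtain ⟨v, hv⟩ := mem_sources.1 hi'
    have h1 := hEh.source_std hℓ hO' hv
    rcases (reorient_iff hW hS).1 hv with hw | ⟨hvO, hnW⟩
    · obtain rfl := eq_of_dartRel_bdry_right hO hPO hw
      have hvO := hW.dir _ _ hw
      have hw0 := (N.weight_pos _ _ (hO.adj _ _ hvO)).ne'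
      have h2 : Eh s(N.bdry i, v) = -N.modifiedVec O i₀ i i := by
        rw [Sym2.eq_swap, hEh' _ _ hvO, changeFactor_eq hℓ (hO.adj _ _ hvO),
          if_pos ((hS _ _ hvO).2 hw), hM.on_last hℓ hO hw, sink_eq hℓ hO hEt hvO, smul_smul,
          ← neg_one_smul ℝ (N.modifiedVec O i₀ i i)]
        congr 1
        field_simp
        linear_combination -crossSign_mul_self (N := N) (ℓ := ℓ) O v (N.bdry i)
      rw [h2] at h1
      have h3 : N.measRow (reorient O {e | e ∈ P.edges}) i =
          (1 / N.measRow O i₀ i) • N.measRow O i₀ := by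
        unfold modifiedVec at h1
        rw [if_pos rfl, neg_sub, sub_left_inj] at h1
        exact h1.symm
      rw [h3]
      exact Submodule.smul_mem _ _ hA₀
    · obtain ⟨c, hc⟩ := modified_eq_add hℓ hO hE hEt s(N.bdry i, v) (hO.adj _ _ hvO)
      rw [hEh' _ _ hvO, changeFactor_eq hℓ (hO.adj _ _ hvO),
        if_neg fun h => hnW ((hS _ _ hvO).1 h), hM.off_source hℓ hO hvO hnW, one_smul, hc,
        hE.source_std hℓ hO hvO] at h1
      have h3 : N.measRow (reorient O {e | e ∈ P.edges}) i =
          N.measRow O i + c • N.measRow O i₀ := by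
        linear_combination (exp := 1) -h1
      rw [h3]
      exact Submodule.add_mem _ (measRow_mem_rowSpace (mem_sources.2 ⟨v, hvO⟩))
        (Submodule.smul_mem _ _ hA₀)
  · obtain ⟨c, hc⟩ := modified_eq_add hℓ hO hE hEt s(u, v) (hO.adj _ _ h)
    have h1 : E' s(u, v) = Eh s(u, v) := hO'.forall_edge (p := fun e => E' e = Eh e)
      (isEdgeSystem_unique hℓ hO' hE' hEh) _ (hO.adj _ _ h)
    refine ⟨_, _, Submodule.smul_mem _ (N.changeFactor ℓ O {e | e ∈ P.edges} (N.PathPlus ℓ P) u v * c)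
      hA₀, changeFactor_ne_zero (ℓ := ℓ) hO {e | e ∈ P.edges} (N.PathPlus ℓ P) h, ?_⟩
    rw [h1, hEh' u v h, hc, smul_add, smul_smul]

/-- The edges of `O` with the opposite direction in `O'`. -/
def opposite (O O' : V → V → Prop) (u v : V) : Prop := O u v ∧ O' v u

theorem opposite_exists_out (hO : N.IsPerfect O) (hO' : N.IsPerfect O') {u v : V}
    (h : opposite O O' u v) (hv : N.IsInternal v) : ∃ x, opposite O O' v x := by
  by_cases hc : N.white v
  · obtain ⟨x, hx, -⟩ := hO'.white v hv hc
    refine ⟨x, (hO'.total _ _ (hO'.adj _ _ hx)).elim (fun _ => ?_) fun h' => ?_, hx⟩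
    · refine (hO.total _ _ (hO'.adj _ _ hx)).resolve_left fun hxv => ?_
      rw [(hO.white v hv hc).unique hxv h.1] at hx
      exact hO'.asymm _ _ hx h.2
    · exact absurd h' (hO'.asymm _ _ hx)
  · obtain ⟨x, hx, -⟩ := hO.black v hv hc
    refine ⟨x, hx, (hO'.total _ _ (hO.adj _ _ hx)).resolve_left fun hvx => ?_⟩
    rw [(hO'.black v hv hc).unique hvx h.2] at hx
    exact hO.asymm _ _ hx h.1

theorem opposite_exists_in (hO : N.IsPerfect O) (hO' : N.IsPerfect O') {v x : V}
    (h : opposite O O' v x) (hv : N.IsInternal v) : ∃ u, opposite O O' u v := by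
  by_cases hc : N.white v
  · obtain ⟨u, hu, -⟩ := hO.white v hv hc
    refine ⟨u, hu, (hO'.total _ _ (hO.adj _ _ hu)).resolve_left fun hvx => ?_⟩
    rw [(hO'.white v hv hc).unique hvx h.2] at hu
    exact hO.asymm _ _ hu h.1
  · obtain ⟨u, hu, -⟩ := hO'.black v hv hc
    refine ⟨u, (hO.total _ _ (hO'.adj _ _ hu)).resolve_left fun hvu => ?_, hu⟩
    rw [(hO.black v hv hc).unique hvu h.1] at hu
    exact hO'.asymm _ _ hu h.2

theorem isCycle_cons {G : SimpleGraph V} {a y : V} (hD : ∀ u v, D u v → ¬ D v u) (h : G.Adj y a)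
    (hya : D y a) {P : G.Walk a y} (hP : P.IsPath) (hPD : ∀ d ∈ P.darts, D d.fst d.snd) :
    (SimpleGraph.Walk.cons h P).IsCycle := by
  rw [SimpleGraph.Walk.cons_isCycle_iff]
  refine ⟨hP, fun he => ?_⟩
  rw [SimpleGraph.Walk.edges, List.mem_map] at he
  obtain ⟨d, hd, he⟩ := he
  have he' : s(d.fst, d.snd) = s(y, a) := he
  rw [Sym2.eq_iff] at he'
  rcases he' with ⟨h1, h2⟩ | ⟨h1, h2⟩
  · have h3 := (dartRel_out_iff P y).1 ⟨a, d, hd, h1, h2⟩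
    have hnd := hP.support_nodup
    rw [← P.dropLast_support_concat, List.nodup_append] at hnd
    exact hnd.2.2 _ h3 _ (List.mem_singleton_self _) rfl
  · have := hPD d hd
    rw [h1, h2] at this
    exact hD _ _ hya this

/-- The edges with opposite directions contain a directed cycle or a directed path from a source to
a sink. -/
theorem exists_cycle_or_path [Fintype V] (hO : N.IsPerfect O) (hO' : N.IsPerfect O') {u₀ w₀ : V}
    (h₀ : opposite O O' u₀ w₀) :
    (∃ (v : V) (Q : N.graph.Walk v v), Q.IsCycle ∧ ∀ d ∈ Q.darts, opposite O O' d.fst d.snd) ∨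
    ∃ (i j : Fin n) (P : N.graph.Walk (N.bdry i) (N.bdry j)), P.IsPath ∧
      (∀ d ∈ P.darts, opposite O O' d.fst d.snd) ∧ i ∈ N.sources O ∧ j ∉ N.sources O := by
  classical
  by_cases hcyc : ∃ (v : V) (Q : N.graph.Walk v v), Q.IsCycle ∧
      ∀ d ∈ Q.darts, opposite O O' d.fst d.snd
  · exact Or.inl hcyc
  refine Or.inr ?_
  have hadj : ∀ u v, opposite O O' u v → N.graph.Adj u v := fun u v h => hO.adj _ _ h.1
  have hasym : ∀ u v, opposite O O' u v → ¬ opposite O O' v u := fun u v h h' =>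
    hO.asymm _ _ h.1 h'.1
  set L : Set ℕ := {k | ∃ (a b : V) (P : N.graph.Walk a b), P.IsPath ∧
    (∀ d ∈ P.darts, opposite O O' d.fst d.snd) ∧ P.length = k} with hL
  have hmem1 : 1 ∈ L := by
    refine ⟨u₀, w₀, SimpleGraph.Walk.cons (hadj _ _ h₀) SimpleGraph.Walk.nil, ?_, ?_, rfl⟩
    · simp [(hadj _ _ h₀).ne]
    · intro d hd
      simp only [SimpleGraph.Walk.darts_cons, SimpleGraph.Walk.darts_nil, List.mem_singleton] at hd
      subst hd
      exact h₀
  have hbdd : BddAbove L := by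
    refine ⟨Fintype.card V, ?_⟩
    rintro _ ⟨a, b, P, hP, -, rfl⟩
    exact hP.length_lt.le
  obtain ⟨a, b, P, hP, hPD, hlen⟩ := Nat.sSup_mem ⟨1, hmem1⟩ hbdd
  have hmax : ∀ k ∈ L, k ≤ P.length := fun k hk => hlen ▸ le_csSup hbdd hk
  have hpos := hmax 1 hmem1
  have hab : (∃ x, dartRel P a x) ∧ ∃ u, dartRel P u b := by
    rw [dartRel_out_iff, dartRel_in_iff]
    cases P with
    | nil => simp at hpos
    | cons h P => simp [List.dropLast_cons_of_ne_nil]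
  obtain ⟨⟨x, dx, hdx, hx1, hx2⟩, y, dy, hdy, hy1, hy2⟩ := hab
  have hax := hPD dx hdx
  rw [hx1, hx2] at hax
  have hyb := hPD dy hdy
  rw [hy1, hy2] at hyb
  rcases N.isInternal_or a with ha | ⟨i, rfl⟩
  · exfalso
    obtain ⟨z, hz⟩ := opposite_exists_in hO hO' hax ha
    by_cases hzP : z ∈ P.support
    · exact hcyc ⟨_, _, isCycle_cons hasym (hadj _ _ hz) hz (hP.takeUntil hzP)
        fun d hd => hPD d (P.darts_takeUntil_subset_darts hzP hd), fun d hd => by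
          rw [SimpleGraph.Walk.darts_cons, List.mem_cons] at hd
          rcases hd with rfl | hd
          · exact hz
          · exact hPD d (P.darts_takeUntil_subset_darts hzP hd)⟩
    · have := hmax (P.length + 1) ⟨z, b, SimpleGraph.Walk.cons (hadj _ _ hz) P, hP.cons hzP, fun d hd => by
        rw [SimpleGraph.Walk.darts_cons, List.mem_cons] at hd
        rcases hd with rfl | hd
        · exact hz
        · exact hPD d hd, SimpleGraph.Walk.length_cons _ _⟩
      omega
  rcases N.isInternal_or b with hb | ⟨j, rfl⟩
  · exfalso
    obtain ⟨z, hz⟩ := opposite_exists_out hO hO' hyb hb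
    by_cases hzP : z ∈ P.support
    · exact hcyc ⟨_, _, isCycle_cons hasym (hadj _ _ hz) hz (hP.dropUntil hzP)
        fun d hd => hPD d (P.darts_dropUntil_subset_darts hzP hd), fun d hd => by
          rw [SimpleGraph.Walk.darts_cons, List.mem_cons] at hd
          rcases hd with rfl | hd
          · exact hz
          · exact hPD d (P.darts_dropUntil_subset_darts hzP hd)⟩
    · have := hmax (P.length + 1) ⟨_, z, P.concat (hadj _ _ hz), hP.concat hzP _, fun d hd => by
        rw [SimpleGraph.Walk.darts_concat, List.concat_eq_append, List.mem_append,
          List.mem_singleton] at hd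
        rcases hd with hd | rfl
        · exact hPD d hd
        · exact hz, SimpleGraph.Walk.length_concat _ _⟩
      omega
  exact ⟨i, j, P, hP, hPD, mem_sources.2 ⟨x, hax.1⟩, hO.notMem_sources_of_edge hyb.1⟩

theorem proportional [Fintype V] (hℓ : N.IsGaugeDirection ℓ) (hO : N.IsPerfect O)
    (hO' : N.IsPerfect O') : N.Proportional ℓ O O' := by
  classical
  induction hk : (Finset.univ.filter fun e : V × V => opposite O O' e.1 e.2).card
    using Nat.strong_induction_on generalizing O with
  | _ k ih =>
  subst hk
  by_cases h : ∃ u v, opposite O O' u v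
  swap
  · have : O = O' := by
      funext u v
      refine propext ⟨fun huv => ?_, fun huv => ?_⟩
      · exact (hO'.total _ _ (hO.adj _ _ huv)).resolve_right fun h' => h ⟨u, v, huv, h'⟩
      · exact (hO.total _ _ (hO'.adj _ _ huv)).resolve_right fun h' => h ⟨v, u, h', huv⟩
    subst this
    exact proportional_refl hℓ hO
  have step : ∀ {a b : V} {P : N.graph.Walk a b}, N.IsCurve O (dartRel P) →
      (∀ d ∈ P.darts, opposite O O' d.fst d.snd) → (∃ u v, dartRel P u v) →
      N.Proportional ℓ O (reorient O {e | e ∈ P.edges}) → N.Proportional ℓ O O' := by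
    intro a b P hW hPD ⟨u, v, huv⟩ hprop
    have hS : ∀ u v, O u v → (s(u, v) ∈ {e | e ∈ P.edges} ↔ dartRel P u v) :=
      fun u v h => mem_edges_iff hO (fun d hd => (hPD d hd).1) h
    have hR := isPerfect_reorient hO hW hS
    refine hprop.trans hℓ hR (ih _ (Finset.card_lt_card ?_) hR rfl)
    have hWD : ∀ u v, dartRel P u v → opposite O O' u v := by
      rintro _ _ ⟨d, hd, rfl, rfl⟩; exact hPD d hd
    rw [Finset.ssubset_iff_of_subset]
    · refine ⟨(u, v), by simpa using hWD _ _ huv, fun hmem => ?_⟩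
      have h1 := (Finset.mem_filter.1 hmem).2.1
      rcases (reorient_iff hW hS).1 h1 with h2 | h2
      · exact hO.asymm _ _ (hW.dir _ _ huv) (hW.dir _ _ h2)
      · exact h2.2 huv
    · rintro ⟨x, y⟩ hmem
      obtain ⟨-, h1, h2⟩ := Finset.mem_filter.1 hmem
      rw [Finset.mem_filter]
      refine ⟨Finset.mem_univ _, ?_⟩
      rcases (reorient_iff hW hS).1 h1 with h3 | h3
      · exact absurd h2 (hO'.asymm _ _ (hWD _ _ h3).2)
      · exact ⟨h3.1, h2⟩
  obtain ⟨u, v, huv⟩ := h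
  rcases exists_cycle_or_path hO hO' huv with ⟨v, Q, hQ, hQD⟩ | ⟨i, j, P, hP, hPD, hi, hj⟩
  · have hQO : ∀ d ∈ Q.darts, O d.fst d.snd := fun d hd => (hQD d hd).1
    refine step (isCurve_cycle hQ hQO) hQD ?_ (proportional_cycle hℓ hO hQ hQO)
    cases Q with
    | nil => exact absurd hQ SimpleGraph.Walk.not_isCycle_nil
    | cons h Q => exact ⟨_, _, ⟨(_, _), h⟩, by simp, rfl, rfl⟩
  · have hPO : ∀ d ∈ P.darts, O d.fst d.snd := fun d hd => (hPD d hd).1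
    have hne : i ≠ j := by rintro rfl; exact hj hi
    exact step (isCurve_path hP hPO) hPD ⟨_, exists_first hne⟩ (proportional_path hℓ hO hi hj hP hPO)

theorem Represents.rowSpace_le [Fintype V] {k : ℕ} {A : Matrix (Fin k) (Fin n) ℝ}
    (hA : N.Represents O A) : N.rowSpace O ≤ Submodule.span ℝ (Set.range A) := by
  obtain ⟨hk, g, hg, hA⟩ := hA
  refine Submodule.span_le.2 ?_
  rintro _ ⟨i, hi, rfl⟩
  obtain ⟨r, rfl⟩ : ∃ r, (N.sources O).orderEmbOfFin hk r = i := by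
    have : i ∈ Set.range ((N.sources O).orderEmbOfFin hk) := by
      rw [Finset.range_orderEmbOfFin]; exact hi
    exact this
  set M := Matrix.of fun r j => N.measRow O ((N.sources O).orderEmbOfFin hk r) j with hM
  have h1 : g⁻¹ * A = M := by
    rw [hA, ← Matrix.mul_assoc, Matrix.nonsing_inv_mul _ (isUnit_iff_ne_zero.2 hg.ne'),
      Matrix.one_mul]
  have h2 : N.measRow O ((N.sources O).orderEmbOfFin hk r) = ∑ s, g⁻¹ r s • A s := by
    funext j
    have : M r j = (g⁻¹ * A) r j := by rw [h1]
    rw [Matrix.mul_apply] at this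
    rw [Finset.sum_apply]
    exact this
  rw [h2]
  exact Submodule.sum_mem _ fun s _ => Submodule.smul_mem _ _ (Submodule.subset_span ⟨s, rfl⟩)

end PBDTPNetwork

theorem mainTheorem7 {V : Type*} [Fintype V] {n k : ℕ} (N : PBDTPNetwork V n) (ℓ : ℝ × ℝ)
    (hℓ : N.IsGaugeDirection ℓ) (O : V → V → Prop) (hO : N.IsPerfect O)
    (A : Matrix (Fin k) (Fin n) ℝ) (hA : N.Represents O A) :
    -- for any perfect orientation and any boundary vectors there is a unique system of edge vectors
    (∀ O' : V → V → Prop, N.IsPerfect O' → ∀ F : Fin n → Fin n → ℝ,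
      (∃ E, N.IsEdgeSystem ℓ O' F E) ∧
      ∀ E E', N.IsEdgeSystem ℓ O' F E → N.IsEdgeSystem ℓ O' F E' →
        ∀ e ∈ N.graph.edgeSet, E e = E' e) ∧
    -- dependence on the orientation
    (∀ O' : V → V → Prop, N.IsPerfect O' → ∀ E E' : Sym2 V → Fin n → ℝ,
      N.IsEdgeSystem ℓ O (PBDTPNetwork.stdVec n) E →
      N.IsEdgeSystem ℓ O' (PBDTPNetwork.stdVec n) E' →
      ∀ e ∈ N.graph.edgeSet, ∃ (α : ℝ) (c : Fin k → ℝ), α ≠ 0 ∧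
        E' e = α • E e + ∑ r, c r • A r) ∧
    -- change of orientation along a simple path from a boundary source to a boundary sink
    (∀ (i₀ j₀ : Fin n) (P : N.graph.Walk (N.bdry i₀) (N.bdry j₀)),
      i₀ ∈ N.sources O → j₀ ∉ N.sources O → P.IsPath → (∀ d ∈ P.darts, O d.fst d.snd) →
      N.IsPerfect (reorient O {e | e ∈ P.edges}) ∧ N.measRow O i₀ j₀ ≠ 0 ∧
      ∀ E Et Eh : Sym2 V → Fin n → ℝ,
        N.IsEdgeSystem ℓ O (PBDTPNetwork.stdVec n) E →
        N.IsEdgeSystem ℓ O (fun j => if j = j₀ then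
            PBDTPNetwork.stdVec n j₀ - (1 / N.measRow O i₀ j₀) • N.measRow O i₀
          else PBDTPNetwork.stdVec n j) Et →
        (∀ u v, O u v → Eh s(u, v) =
          N.changeFactor ℓ O {e | e ∈ P.edges} (N.PathPlus ℓ P) u v • Et s(u, v)) →
        (∀ e ∈ N.graph.edgeSet, ∃ c : ℝ, Et e = E e + c • N.measRow O i₀) ∧
        N.IsEdgeSystem ℓ (reorient O {e | e ∈ P.edges}) (PBDTPNetwork.stdVec n) Eh) ∧
    -- change of orientation along a simple closed cycle
    (∀ (v₀ : V) (Q : N.graph.Walk v₀ v₀), Q.IsCycle → (∀ d ∈ Q.darts, O d.fst d.snd) →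
      N.IsPerfect (reorient O {e | e ∈ Q.edges}) ∧
      ∀ E Eh : Sym2 V → Fin n → ℝ,
        N.IsEdgeSystem ℓ O (PBDTPNetwork.stdVec n) E →
        (∀ u v, O u v → Eh s(u, v) =
          N.changeFactor ℓ O {e | e ∈ Q.edges} (N.CyclePlus Q) u v • E s(u, v)) →
        N.IsEdgeSystem ℓ (reorient O {e | e ∈ Q.edges}) (PBDTPNetwork.stdVec n) Eh) := by
  refine ⟨fun O' hO' F => ⟨PBDTPNetwork.exists_isEdgeSystem hℓ hO' F, fun E E' hE hE' =>
    hO'.forall_edge (PBDTPNetwork.isEdgeSystem_unique hℓ hO' hE hE')⟩,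
    fun O' hO' E E' hE hE' e he => ?_, fun i₀ j₀ P hi hj hP hPO => ?_, fun v₀ Q hQ hQO => ?_⟩
  · obtain ⟨α, r, hr, hα, h⟩ := (PBDTPNetwork.proportional hℓ hO hO').vectors E E' hE hE' e he
    obtain ⟨c, hc⟩ := (Submodule.mem_span_range_iff_exists_fun ℝ).1 (hA.rowSpace_le hr)
    exact ⟨α, c, hα, by rw [h, hc]⟩
  · exact ⟨PBDTPNetwork.isPerfect_reorient hO (PBDTPNetwork.isCurve_path hP hPO)
        fun u v h => PBDTPNetwork.mem_edges_iff hO hPO h,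
      PBDTPNetwork.measRow_path_ne_zero hO hi hj hP hPO, fun E Et Eh hE hEt hEh =>
        ⟨PBDTPNetwork.modified_eq_add hℓ hO hE hEt,
          PBDTPNetwork.isEdgeSystem_reorient_path hℓ hO hi hj hP hPO hEt hEh⟩⟩
  · exact ⟨PBDTPNetwork.isPerfect_reorient hO (PBDTPNetwork.isCurve_cycle hQ hQO)
        fun u v h => PBDTPNetwork.mem_edges_iff hO hQO h,
      fun E Eh hE hEh => PBDTPNetwork.isEdgeSystem_reorient_cycle hℓ hO hQ hQO hE hEh⟩
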